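/- **Setting.** Let $M=\mathbb R^{1,s'}$, $s'\ge 1$, be Minkowski space with forward cone $V_+$, and let $O\mapsto\mathcal A(O)$ map the double cones $O=(V_++x)\cap(V_-+y)$, $y-x\in V_+$, to von Neumann algebras on a separable Hilbert space $\mathcal H$ such that: $\mathcal A(O_1)\subset\mathcal A(O_2)$ if $O_1\subset O_2$; Haag duality $\mathcal A(O)=\mathcal A(O')'$ holds, where $O'$ is the causal complement and $\mathcal A(O')$ is generated by the $\mathcal A(O_1)$ of the double cones $O_1\subset O'$; there is a strongly continuous unitary representation $U(a)=e^{iP\cdot a}$ of the translations with $U(a)\mathcal A(O)U(a)^*=\mathcal A(O+a)$ and with spectrum of $P$ in $\overline{V_+}$; there is a $U$-invariant unit vector $\Omega$ that is cyclic for $\bigcup_O\mathcal A(O)$; and weak additivity $\{\bigcup_a\mathcal A(O+a)\}''=\{\bigcup_{O_1}\mathcal A(O_1)\}''$ holds for every $O$. Let $\mathcal A$ be the norm closure of $\bigcup_O\mathcal A(O)$. A unital $*$-endomorphism $\rho$ of $\mathcal A$ is *localized in $O$* if $\rho(A)=A$ for all $A\in\mathcal A(O')$. A *localized endomorphism* is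 one that is localized in some double cone and such that for every double cone $\tilde O$ there is a unitary $u\in\mathcal A$ for which $\mathrm{Ad}\,u\circ\rho$ is localized in $\tilde O$. It is *irreducible* if $\rho(\mathcal A)'\cap\mathcal A=\mathbb C1$. Its *statistics operator* is $\varepsilon_\rho=\rho(U_1^*)U_2^*U_1\rho(U_2)$, where $U_1,U_2\in\mathcal A$ are unitaries such that $\mathrm{Ad}\,U_i\circ\rho$ is localized in $O_i$ and $O_2<O_1$: every point of $O_1$ lies in the right wedge (along the first spatial axis) with apex at any given point of $O_2$; if $s'=1$, this says that $O_1,O_2$ are causally disjoint and $O_2$ is to the left of $O_1$. A *left inverse* of $\rho$ is a positive unital linear map $\phi:\mathcal A\to\mathcal A$ with $\phi(A\rho(B))=\phi(A)B$. **Ocneanu–Wenzl representation.** Let $q,d\in\mathbb N\cup\{\infty\}$ with $d\ge2$ and $d+2\le q$, let $\theta=\pi/q$ ($\theta=0$ if $q=\infty$) and $t\in\{e^{2i\theta},e^{-2i\theta}\}$. A $(d,q)$-tableau with $n$ boxes is a sequence $\emptyset=Y_0\subset Y_1\subset\dots\subset Y_n$ of Young diagrams, growing by one box in each step, with at most $d$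 rows and, if $q<\infty$, with (length of row $1$) $-$ (length of row $d$) $\le q-d$ for each $Y_j$. On the finite-dimensional Hilbert space with an orthonormal basis $(v_r)$ indexed by these tableaux (all shapes), $1\le k\le n-1$, put $e_kv_r=a_mv_r+\sqrt{a_m(1-a_m)}\,v_{r'}$, where $m=c(k)-c(k+1)$ is the difference of the contents (column minus row) of the $k$-th and $(k+1)$-st box of $r$, $a_m=\frac{\sin (m+1)\theta}{2\cos\theta\,\sin m\theta}$ ($a_m=\frac{m+1}{2m}$ if $q=\infty$), and $r'$ is $r$ with these two boxes exchanged (the second term vanishes if $r'$ is not a $(d,q)$-tableau). The Ocneanu–Wenzl representation $\pi$ of the braid group $B_n$ with data $(q,d,t)$ is the unitary representation with $\sigma_k\mapsto t-(1+t)e_k$. **Theorem.** Let $\rho$ be an irreducible localized endomorphism such that $\rho^2$ is, as a representation on $\mathcal H$, the direct sum of exactly two irreducible subrepresentations. Let $\phi$ be a left inverse of $\rho$ and $\varepsilon_\rho$ the statistics operator. Then there are $q,d\in\mathbb N\cup\{\infty\}$ with $q\ge4$, $d\ge 2$, $d+2\le q$ (where $d=\infty$ is possible only if $q=\infty$) such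 that the following holds. 1. $\varepsilon_\rho$ has exactly two different eigenvalues. They can be labelled $\lambda_1,\lambda_2$ so that (1)–(3) hold: $(\varepsilon_\rho-\lambda_1)(\varepsilon_\rho-\lambda_2)=0$ and $\lambda_1/\lambda_2=-e^{2\pi i/q}$ or $\lambda_1/\lambda_2=-e^{-2\pi i/q}$ (which is $-1$ if $q=\infty$). 2. The statistics parameter $\lambda_\rho=\phi(\varepsilon_\rho)$ is a scalar, and $|\lambda_\rho|=\frac{\sin(\pi/q)}{\sin(d\pi/q)}$ if $q<\infty$, $|\lambda_\rho|=\frac1d$ if $q=\infty$, $d<\infty$, and $\lambda_\rho=0$ if $q=d=\infty$. 3. For every $n$ there is a representation $\varepsilon_\rho^{(n)}$ of $B_n$ by unitaries in $\mathcal A$ with $\sigma_k\mapsto\rho^{k-1}(\varepsilon_\rho)$, $k=1,\dots,n-1$. On $\mathcal H$ it is unitarily equivalent to the direct sum of countably infinitely many copies of $\chi\otimes\pi$, where $\pi$ is the Ocneanu–Wenzl representation of $B_n$ with data $(q,d,-\lambda_1/\lambda_2)$ and $\chi$ is the one-dimensional representation $\sigma_k\mapsto-\lambda_2$. With the spectral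 projections $E_1,E_2$ of $\varepsilon_\rho$ for $\lambda_1,\lambda_2$ and $E_i^{(m)}=E_i\wedge\rho(E_i)\wedge\dots\wedge\rho^{m-2}(E_i)$ one has $E_2^{(m)}=0$ for all $m>d$ and $E_1^{(m)}=0$ for all $m>q-d$ (the latter being void if $q=\infty$). 4. The iterated left inverse defines a Markov trace: $\phi^n(\varepsilon_\rho^{(n)}(b))=\mathrm{tr}(b)1$ for $b\in B_n$, where the functions $\mathrm{tr}:B_n\to\mathbb C$ extend to tracial states of the group algebras, are compatible with the inclusions $B_n\subset B_{n+1}$, and satisfy $\mathrm{tr}(b\sigma_n)=\lambda_\rho\,\mathrm{tr}(b)$ for $b\in B_n$, $n\ge1$, $\sigma_n\in B_{n+1}$. -/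

import Mathlib

open scoped ComplexConjugate

noncomputable section

namespace LQP

/-! ### Minkowski space -/

/-- Minkowski space with `s + 1` spatial dimensions; a point is `(time, space)`. -/
abbrev Minkowski (s : ℕ) : Type := ℝ × EuclideanSpace ℝ (Fin (s + 1))

/-- The open forward light cone `V₊`. -/
def forwardCone (s : ℕ) : Set (Minkowski s) := {x | ‖x.2‖ < x.1}

/-- The closed forward light cone. -/
def closedForwardCone (s : ℕ) : Set (Minkowski s) := {x | ‖x.2‖ ≤ x.1}

/-- The Minkowski product `p · a`. -/
def minkowskiProduct {s : ℕ} (p a : Minkowski s) : ℝ := p.1 * a.1 - inner ℝ p.2 a.2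

/-- A double cone `(V₊ + past) ∩ (V₋ + future)` with `future - past ∈ V₊`. -/
structure DoubleCone (s : ℕ) where
  past : Minkowski s
  future : Minkowski s
  mem_cone : future - past ∈ forwardCone s

namespace DoubleCone

variable {s : ℕ}

/-- The set of points of a double cone. -/
def region (O : DoubleCone s) : Set (Minkowski s) :=
  {z | z - O.past ∈ forwardCone s ∧ O.future - z ∈ forwardCone s}

/-- The translate `O + a`. -/
def translate (O : DoubleCone s) (a : Minkowski s) : DoubleCone s where
  past := O.past + a
  future := O.future + a
  mem_cone := by simpa using O.mem_cone

/-- Two double cones are causally disjoint: any two of their points are spacelike separated.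
Equivalently, the one is contained in the causal complement of the other. -/
def CausallyDisjoint (O₁ O₂ : DoubleCone s) : Prop :=
  ∀ x ∈ O₁.region, ∀ y ∈ O₂.region, |y.1 - x.1| < ‖y.2 - x.2‖

/-- The spacelike order `O₂ < O₁`: every point of `O₁` lies in the right wedge (along the first
spatial axis) of every point of `O₂`. In `1 + 1` dimensions this says precisely that the two
double cones are causally disjoint and that `O₂` is to the left of `O₁`. In higher dimensions,
where all causally disjoint configurations are connected to each other, it is a particular
causally disjoint configuration. -/
def Precedes (O₂ O₁ : DoubleCone s) : Prop :=
  ∀ x ∈ O₂.region, ∀ y ∈ O₁.region, |y.1 - x.1| < y.2 0 - x.2 0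

end DoubleCone

/-! ### Nets of observables -/

section Net

variable {s : ℕ} {H : Type*} [NormedAddCommGroup H] [InnerProductSpace ℂ H] [CompleteSpace H]

/-- A Haag-Kastler net of von Neumann algebras over the double cones of Minkowski space, in its
vacuum representation: isotony, Haag duality, translation covariance with positive energy, a
cyclic invariant vacuum vector, and weak additivity. -/
structure HaagKastlerNet (s : ℕ) (H : Type*) [NormedAddCommGroup H] [InnerProductSpace ℂ H]
    [CompleteSpace H] where
  /-- The local algebras `𝒜(O)`. -/
  alg : DoubleCone s → VonNeumannAlgebra H
  isotony : ∀ O₁ O₂ : DoubleCone s, O₁.region ⊆ O₂.region → alg O₁ ≤ alg O₂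
  /-- `𝒜(O) = 𝒜(O')'`, where `𝒜(O')` is generated by the `𝒜(O₁)` with `O₁ ⊆ O'`. -/
  haag_duality : ∀ O : DoubleCone s, (alg O : Set (H →L[ℂ] H)) =
    Set.centralizer (⋃ (O₁ : DoubleCone s) (_ : O.CausallyDisjoint O₁),
      (alg O₁ : Set (H →L[ℂ] H)))
  /-- The unitary representation of the translations. -/
  U : Multiplicative (Minkowski s) →* unitary (H →L[ℂ] H)
  continuous_U : ∀ ψ : H,
    Continuous fun a : Minkowski s => (U (Multiplicative.ofAdd a) : H →L[ℂ] H) ψ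
  covariance : ∀ (a : Minkowski s) (O : DoubleCone s),
    (fun A : H →L[ℂ] H => (U (Multiplicative.ofAdd a) : H →L[ℂ] H) * A *
      star (U (Multiplicative.ofAdd a) : H →L[ℂ] H)) '' (alg O : Set (H →L[ℂ] H)) =
    (alg (O.translate a) : Set (H →L[ℂ] H))
  /-- Positivity of the energy: with `U a = exp (i P · a)`, the spectral measures of `P` are
  supported in the closed forward cone. -/
  spectrum_condition : ∀ ψ : H, ∃ μ : MeasureTheory.Measure (Minkowski s),
    MeasureTheory.IsFiniteMeasure μ ∧ μ (closedForwardCone s)ᶜ = 0 ∧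
    ∀ a : Minkowski s, inner ℂ ψ ((U (Multiplicative.ofAdd a) : H →L[ℂ] H) ψ) =
      ∫ p, Complex.exp (Complex.I * (minkowskiProduct p a : ℂ)) ∂μ
  /-- The vacuum vector. -/
  Ω : H
  norm_Ω : ‖Ω‖ = 1
  U_Ω : ∀ a : Minkowski s, (U (Multiplicative.ofAdd a) : H →L[ℂ] H) Ω = Ω
  cyclic_Ω : Dense {ψ : H | ∃ (O : DoubleCone s), ∃ A ∈ alg O, A Ω = ψ}
  weak_additivity : ∀ O : DoubleCone s,
    Set.centralizer (Set.centralizer (⋃ a : Minkowski s,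
      (alg (O.translate a) : Set (H →L[ℂ] H)))) =
    Set.centralizer (Set.centralizer (⋃ O₁ : DoubleCone s, (alg O₁ : Set (H →L[ℂ] H))))

namespace HaagKastlerNet

variable (N : HaagKastlerNet s H)

/-- The quasilocal algebra: the norm closure of the star algebra generated by (equivalently, of
the directed union of) the local algebras. -/
def quasilocal : StarSubalgebra ℂ (H →L[ℂ] H) :=
  (StarAlgebra.adjoin ℂ
    (⋃ O : DoubleCone s, (N.alg O : Set (H →L[ℂ] H)))).topologicalClosure

variable {N}

/-- `ρ` is localized in `O`: it acts trivially on `𝒜(O')`. -/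
def IsLocalizedIn (ρ : N.quasilocal →⋆ₐ[ℂ] N.quasilocal) (O : DoubleCone s) : Prop :=
  ∀ O₁ : DoubleCone s, O.CausallyDisjoint O₁ →
    ∀ A : N.quasilocal, (A : H →L[ℂ] H) ∈ N.alg O₁ → ρ A = A

/-- The inner equivalent endomorphism `Ad u ∘ ρ`, `A ↦ u ρ(A) u⋆`. -/
def adComp (u : unitary N.quasilocal) (ρ : N.quasilocal →⋆ₐ[ℂ] N.quasilocal) :
    N.quasilocal →⋆ₐ[ℂ] N.quasilocal :=
  ((Unitary.conjStarAlgAut ℂ N.quasilocal u : N.quasilocal ≃⋆ₐ[ℂ] N.quasilocal) :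
    N.quasilocal →⋆ₐ[ℂ] N.quasilocal).comp ρ

/-- A localized endomorphism in the sense of Doplicher, Haag and Roberts: localized in some
double cone, and transportable into any other one by a unitary of the quasilocal algebra. -/
def IsLocalizedEndomorphism (ρ : N.quasilocal →⋆ₐ[ℂ] N.quasilocal) : Prop :=
  (∃ O : DoubleCone s, IsLocalizedIn ρ O) ∧
  ∀ O : DoubleCone s, ∃ u : unitary N.quasilocal, IsLocalizedIn (adComp u ρ) O

/-- `ρ(𝒜)' ∩ 𝒜 = ℂ 1`. -/
def IsIrreducibleEndomorphism (ρ : N.quasilocal →⋆ₐ[ℂ] N.quasilocal) : Prop :=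
  ∀ T : N.quasilocal, (∀ A : N.quasilocal, T * ρ A = ρ A * T) → ∃ c : ℂ, T = c • 1

/-- `p` is the orthogonal projection onto a subrepresentation of the representation `σ` of the
quasilocal algebra on the vacuum Hilbert space. -/
def IsSubrepresentation (σ : N.quasilocal →⋆ₐ[ℂ] N.quasilocal) (p : H →L[ℂ] H) : Prop :=
  IsStarProjection p ∧ ∀ A : N.quasilocal, p * (σ A : H →L[ℂ] H) = (σ A : H →L[ℂ] H) * p

/-- The subrepresentation with projection `p` is nonzero and has no proper nonzero
subrepresentation. -/
def IsIrreducibleSubrepresentation (σ : N.quasilocal →⋆ₐ[ℂ] N.quasilocal)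
    (p : H →L[ℂ] H) : Prop :=
  IsSubrepresentation σ p ∧ p ≠ 0 ∧
    ∀ r : H →L[ℂ] H, IsSubrepresentation σ r → p * r = r → r = 0 ∨ r = p

/-- `σ ≃ ρ₁ ⊕ ρ₂` with `ρ₁` and `ρ₂` irreducible. -/
def HasTwoIrreducibleComponents (σ : N.quasilocal →⋆ₐ[ℂ] N.quasilocal) : Prop :=
  ∃ p : H →L[ℂ] H, IsIrreducibleSubrepresentation σ p ∧ IsIrreducibleSubrepresentation σ (1 - p)

/-- `ε` is the statistics operator `ε(ρ, ρ) = ρ(U₁⋆) U₂⋆ U₁ ρ(U₂)`, formed with charge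
transporters `U₁`, `U₂` that shift the localization of `ρ` into double cones `O₂ < O₁`. -/
def IsStatisticsOperator (ρ : N.quasilocal →⋆ₐ[ℂ] N.quasilocal) (ε : N.quasilocal) : Prop :=
  ∃ (O₁ O₂ : DoubleCone s) (u₁ u₂ : unitary N.quasilocal),
    O₂.Precedes O₁ ∧ IsLocalizedIn (adComp u₁ ρ) O₁ ∧ IsLocalizedIn (adComp u₂ ρ) O₂ ∧
    ε = ρ (star (u₁ : N.quasilocal)) * star (u₂ : N.quasilocal) * (u₁ : N.quasilocal) *
      ρ (u₂ : N.quasilocal)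

/-- `φ` is a left inverse of `ρ`: a positive unital linear map with `φ(A ρ(B)) = φ(A) B`. -/
structure IsLeftInverse (ρ : N.quasilocal →⋆ₐ[ℂ] N.quasilocal)
    (φ : N.quasilocal →ₗ[ℂ] N.quasilocal) : Prop where
  positive : ∀ A : N.quasilocal, (φ (star A * A) : H →L[ℂ] H).IsPositive
  map_one : φ 1 = 1
  map_mul : ∀ A B : N.quasilocal, φ (A * ρ B) = φ A * B

/-- The spectral projection `(l - l')⁻¹ (ε - l')` of an operator `ε` with eigenvalues `l`, `l'`,
for the eigenvalue `l`. -/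
def eigenprojection (ε : N.quasilocal) (l l' : ℂ) : N.quasilocal :=
  (l - l')⁻¹ • (ε - l' • 1)

/-- The projection `E^(m) = E ∧ ρ(E) ∧ ... ∧ ρ^(m-2)(E)` onto the intersection of the ranges
(which are closed, so that the closure is there only to have the projection defined for
arbitrary `E`). -/
def meetProjection (ρ : N.quasilocal →⋆ₐ[ℂ] N.quasilocal) (E : N.quasilocal) (m : ℕ) :
    H →L[ℂ] H :=
  (⨅ k : Fin (m - 1),
    LinearMap.range (((⇑ρ)^[(k : ℕ)] E : H →L[ℂ] H) : H →ₗ[ℂ] H)).topologicalClosure.starProjection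

end HaagKastlerNet

end Net

/-! ### Braid groups and Markov traces -/

/-- The Artin relations between `n - 1` generators; the generator with index `k : Fin (n - 1)` is
`σ_{k+1}`. -/
def braidRelations (n : ℕ) : Set (FreeGroup (Fin (n - 1))) :=
  {r | ∃ i j : Fin (n - 1),
    ((j : ℕ) = i + 1 ∧ r = FreeGroup.of i * FreeGroup.of j * FreeGroup.of i *
      (FreeGroup.of j * FreeGroup.of i * FreeGroup.of j)⁻¹) ∨
    ((i : ℕ) + 2 ≤ j ∧ r = FreeGroup.of i * FreeGroup.of j *
      (FreeGroup.of j * FreeGroup.of i)⁻¹)}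

/-- The braid group `B_n` on `n` strands. -/
abbrev BraidGroup (n : ℕ) : Type := PresentedGroup (braidRelations n)

/-- The Artin generator `σ_{k+1}` of `B_n`. -/
def braidGen (n : ℕ) (k : Fin (n - 1)) : BraidGroup n := PresentedGroup.of k

/-- The natural map `B_n → B_{n+1}`, `σ_k ↦ σ_k`. -/
def braidInclusion (n : ℕ) : BraidGroup n →* BraidGroup (n + 1) :=
  PresentedGroup.toGroup (f := fun k => braidGen (n + 1) (Fin.castLE (by omega) k)) (by
    rintro r ⟨i, j, ⟨h, rfl⟩ | ⟨h, rfl⟩⟩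
    · have := PresentedGroup.one_of_mem (rels := braidRelations (n + 1))
        (x := _) ⟨Fin.castLE (by omega) i, Fin.castLE (by omega) j, Or.inl ⟨by simpa using h, rfl⟩⟩
      simpa [braidGen, PresentedGroup.of] using this
    · have := PresentedGroup.one_of_mem (rels := braidRelations (n + 1))
        (x := _) ⟨Fin.castLE (by omega) i, Fin.castLE (by omega) j, Or.inr ⟨by simpa using h, rfl⟩⟩
      simpa [braidGen, PresentedGroup.of] using this)

/-- A Markov trace on the braid groups with parameter `c`: a tracial state (given by its values
on group elements) on the group algebras of all `B_n`, compatible with the inclusions, with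
`tr (b σ_n) = c tr b` for `b ∈ B_n`, `n ≥ 1`. -/
structure IsMarkovTrace (c : ℂ) (tr : ∀ n : ℕ, BraidGroup n → ℂ) : Prop where
  map_one : ∀ n, tr n 1 = 1
  tracial : ∀ n (a b : BraidGroup n), tr n (a * b) = tr n (b * a)
  positive : ∀ n (f : BraidGroup n →₀ ℂ), ∃ r : ℝ, 0 ≤ r ∧
    (f.sum fun a x => f.sum fun b y => conj x * y * tr n (a⁻¹ * b)) = (r : ℂ)
  compatible : ∀ n (b : BraidGroup n), tr (n + 1) (braidInclusion n b) = tr n b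
  markov : ∀ n (b : BraidGroup (n + 1)),
    tr (n + 2) (braidInclusion (n + 1) b * braidGen (n + 2) (Fin.last n)) = c * tr (n + 1) b

/-! ### The Ocneanu-Wenzl representations -/

/-- The angle `π / q`, which is `0` for `q = ∞`. -/
def channelAngle (q : ℕ∞) : ℝ := if q = ⊤ then 0 else Real.pi / (q.toNat : ℝ)

/-- For a word `r`, whose `i`-th letter is the (zero-based) row into which the `i`-th box is
placed, the length of row `a` after the first `j` boxes have been placed. -/
def rowLength {n : ℕ} (r : Fin n → Fin n) (j a : ℕ) : ℕ :=
  (Finset.univ.filter fun i : Fin n => (i : ℕ) < j ∧ (r i : ℕ) = a).card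

/-- Standard `(d, q)`-tableaux with `n` boxes, as words: after each step the row lengths form a
Young diagram with at most `d` rows and, for finite `d` and `q`, with
`(first row) - (d-th row) ≤ q - d`. -/
def IsTableau (q d : ℕ∞) {n : ℕ} (r : Fin n → Fin n) : Prop :=
  (∀ j a : ℕ, rowLength r j (a + 1) ≤ rowLength r j a) ∧
  (∀ i : Fin n, (((r i : ℕ) : ℕ∞)) < d) ∧
  ∀ k : ℕ, d = (k : ℕ∞) → ∀ j : ℕ,
    ((rowLength r j 0 : ℕ) : ℕ∞) + d ≤ q + ((rowLength r j (k - 1) : ℕ) : ℕ∞)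

/-- The set of standard `(d, q)`-tableaux with `n` boxes, over all shapes. -/
abbrev Tableau (q d : ℕ∞) (n : ℕ) : Type := {r : Fin n → Fin n // IsTableau q d r}

instance (q d : ℕ∞) (n : ℕ) : Fintype (Tableau q d n) :=
  Fintype.ofInjective Subtype.val Subtype.val_injective

/-- The content (column minus row) of the `i`-th box of a tableau. -/
def content {n : ℕ} (r : Fin n → Fin n) (i : Fin n) : ℤ :=
  (rowLength r i (r i) : ℤ) - ((r i : ℕ) : ℤ)

/-- Wenzl's weight `sin ((m+1)π/q) / (2 cos (π/q) sin (mπ/q))`, which is `(m+1) / (2m)` for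
`q = ∞`. -/
def wenzlWeight (q : ℕ∞) (m : ℤ) : ℝ :=
  if q = ⊤ then ((m : ℝ) + 1) / (2 * m)
  else Real.sin (((m : ℝ) + 1) * channelAngle q) /
    (2 * Real.cos (channelAngle q) * Real.sin ((m : ℝ) * channelAngle q))

/-- Wenzl's projection `e_{k+1}`: on the basis vector of a tableau `r` with content difference
`m` between the boxes `k` and `k + 1` (zero-based), `e v_r = a_m v_r + √(a_m (1 - a_m)) v_r'`,
where `r'` is `r` with these two boxes exchanged (a vector to be read as zero if `r'` is not a
tableau). -/
def wenzlProjection (q d : ℕ∞) (n : ℕ) (k : Fin (n - 1)) :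
    Matrix (Tableau q d n) (Tableau q d n) ℂ :=
  let i : Fin n := ⟨k, by omega⟩
  let j : Fin n := ⟨(k : ℕ) + 1, by omega⟩
  Matrix.of fun r' r =>
    let a : ℝ := wenzlWeight q (content r.1 i - content r.1 j)
    if r' = r then (a : ℂ)
    else if r'.1 = r.1 ∘ Equiv.swap i j then (Real.sqrt (a * (1 - a)) : ℂ)
    else 0

/-- The image `t - (1 + t) e_{k+1}` of the `(k+1)`-st Hecke algebra generator, with eigenvalues
`t` and `-1`, in the Ocneanu-Wenzl representation. -/
def ocneanuWenzlGen (q d : ℕ∞) (t : ℂ) (n : ℕ) (k : Fin (n - 1)) :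
    Matrix (Tableau q d n) (Tableau q d n) ℂ :=
  t • 1 - (1 + t) • wenzlProjection q d n k

/-- `π` is the Ocneanu-Wenzl representation of `B_n` with data `q`, `d`, `t`. -/
def IsOcneanuWenzl (q d : ℕ∞) (t : ℂ) (n : ℕ)
    (π : BraidGroup n →* Matrix.unitaryGroup (Tableau q d n) ℂ) : Prop :=
  ∀ k : Fin (n - 1), (π (braidGen n k) : Matrix _ _ ℂ) = ocneanuWenzlGen q d t n k

/-- The unitary representation `β` of `B_n` on `H` is unitarily equivalent to the direct sum of
(countably) infinitely many copies of `χ ⊗ π`, where `χ` is one-dimensional. -/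
def IsInfiniteMultiple {H : Type*} [NormedAddCommGroup H] [InnerProductSpace ℂ H]
    {n : ℕ} {ι : Type*} [Fintype ι] [DecidableEq ι]
    (β : BraidGroup n → H →L[ℂ] H)
    (χ : BraidGroup n →* Circle) (π : BraidGroup n →* Matrix.unitaryGroup ι ℂ) : Prop :=
  ∃ V : H ≃ₗᵢ[ℂ] lp (fun _ : ℕ => EuclideanSpace ℂ ι) 2,
    ∀ (b : BraidGroup n) (ψ : H) (i : ℕ),
      V (β b ψ) i =
        (χ b : ℂ) • Matrix.toEuclideanCLM (𝕜 := ℂ) (π b : Matrix ι ι ℂ) (V ψ i)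

end LQP

end

noncomputable section

namespace LQP

/-! ### Geometry of double cones -/

section Geometry

variable {s : ℕ}

/-! The field theory enters through one formula. By Haag duality, intertwiners between localized
endomorphisms are local. Hence `ε = ρ(u⋆) u` for a charge transporter `u` to a remote region that
implements `ρ` on any prescribed local algebra (`exists_transporter`). This gives `ε ∈ ρ²(𝒜)'`, the
braid relation, and the twist identity `φ(ε ρ(x) ε⋆) = ρ(φ(x))` for local `x`.

Since `ρ²` has two irreducible components, every operator in its commutant has scalar corners and so
satisfies a quadratic equation (`exists_quadratic_of_corners`). The statistics parameter is not a
phase: otherwise `ρ ∘ φ` would be the identity on local algebras, and the commutants of `ρ²(𝒜)` and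
`ρ(𝒜)` would coincide. So `ε` has two distinct eigenvalues and is a phase times a Hecke generator `g
= t - (1 + t) e`, with `φ(e) = η` and `0 < η < 1`. The structure `HeckeEndo` records what is needed
from here on; it is symmetric under `e ↔ 1 - e`.

Every element of the algebra of `g, ρ(g), …, ρ^k(g)` is a combination of terms `ρ(a)` and `ρ(a) g
ρ(b)` with `a, b` in the algebra with one generator fewer (`mem_doubleCoset`). Hence `φ` acts as a
conditional expectation onto the smaller algebra, its iterates are scalar valued, and the twist
identity makes them a faithful Markov trace.

The value of `η` is quantized as in Jones' and Wenzl's work on the index. The meets `G_k` of `1 - e,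
…, 1 - ρ^(k-1)(e)` satisfy `φ(G_{k+1}) = (1 - η / w_k) G_k` with explicit weights `w_k`. For `t ≠ 1`
the weights become nonpositive after finitely many steps, which kills a meet and forces `η` to be an
earlier weight. The same holds for `1 - η`, and together the two conditions give `t = exp(±2πi/q)`
and determine `d`. For `t = 1` positivity leaves the weights and the limiting value `1/2`
(`exists_parameters`).

The Ocneanu-Wenzl representation is found by diagonalizing the commuting Jucys-Murphy elements. A
recursion for `φ` of their resolvents gives an explicit rational function for every path of
contents. Its poles show which boxes can be added (`φ_resolv_mul_pathProj`, `transitionOrder_eq`).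
They are governed by `d` particles hopping on the residues modulo `q` with exclusion, and the row
lengths of a `(d,q)`-tableau are such a configuration. So the nonzero joint spectral projections are
labelled by the `(d,q)`-tableaux, and they sum to one.

In this decomposition `e` has Wenzl's diagonal coefficients, and its off-diagonal parts are
multiples of partial isometries exchanging two boxes. By the braid relation these isometries compose
coherently (`hexagon`, `ExchangePath.unique`), so they form a frame on which `e` acts by Wenzl's
matrices (`exists_frame`). Each projection in the frame has infinite rank, because `𝒜` contains no
nonzero operator of finite rank (`infiniteDimensional_range`). Orthonormal bases of the ranges then
split `H` into countably many copies. -/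

lemma forwardCone_add_closed {x y : Minkowski s} (hx : x ∈ forwardCone s)
    (hy : y ∈ closedForwardCone s) : x + y ∈ forwardCone s := by
  simp only [forwardCone, closedForwardCone, Set.mem_ofPred_eq, Prod.snd_add, Prod.fst_add] at *
  linarith [norm_add_le x.2 y.2]

lemma abs_coord_le (x : Minkowski s) : |x.2 0| ≤ ‖x.2‖ := by
  simpa using PiLp.norm_apply_le x.2 0

lemma forwardCone_coord {x : Minkowski s} (hx : x ∈ forwardCone s) : |x.2 0| < x.1 :=
  (abs_coord_le x).trans_lt hx

/-- The spatial translation by `r` along the first axis. -/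
def shiftVector (s : ℕ) (r : ℝ) : Minkowski s := (0, EuclideanSpace.single 0 r)

namespace DoubleCone

/-- The double cone with time axis from `-T` to `T`. -/
def centered (s : ℕ) (T : ℝ) (hT : 0 < T) : DoubleCone s where
  past := (-T, 0)
  future := (T, 0)
  mem_cone := by simp [forwardCone]; linarith

lemma region_subset_of_mem {O K : DoubleCone s}
    (h₁ : O.past - K.past ∈ closedForwardCone s)
    (h₂ : K.future - O.future ∈ closedForwardCone s) : O.region ⊆ K.region := by
  rintro z ⟨hz₁, hz₂⟩
  refine ⟨?_, ?_⟩
  · convert forwardCone_add_closed hz₁ h₁ using 1; abel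
  · convert forwardCone_add_closed hz₂ h₂ using 1; abel

lemma exists_subset_centered (O : DoubleCone s) :
    ∃ T₀ : ℝ, ∀ T (hT : 0 < T), T₀ ≤ T → O.region ⊆ (centered s T hT).region := by
  refine ⟨max (‖O.past.2‖ - O.past.1) (‖O.future.2‖ + O.future.1), fun T hT h => ?_⟩
  have h₁ := (le_max_left _ _).trans h
  have h₂ := (le_max_right _ _).trans h
  apply region_subset_of_mem
  · simp only [centered, closedForwardCone, Set.mem_ofPred_eq, Prod.snd_sub, Prod.fst_sub, sub_zero]
    linarith
  · simp only [centered, closedForwardCone, Set.mem_ofPred_eq, Prod.snd_sub, Prod.fst_sub, zero_sub,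
      norm_neg]
    linarith

lemma exists_common_superset (O₁ O₂ O₃ O₄ : DoubleCone s) :
    ∃ (T : ℝ) (hT : 0 < T), O₁.region ⊆ (centered s T hT).region ∧
      O₂.region ⊆ (centered s T hT).region ∧ O₃.region ⊆ (centered s T hT).region ∧
      O₄.region ⊆ (centered s T hT).region := by
  obtain ⟨T₁, h₁⟩ := O₁.exists_subset_centered
  obtain ⟨T₂, h₂⟩ := O₂.exists_subset_centered
  obtain ⟨T₃, h₃⟩ := O₃.exists_subset_centered
  obtain ⟨T₄, h₄⟩ := O₄.exists_subset_centered
  set T := |T₁| + |T₂| + |T₃| + |T₄| + 1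
  have a₁ := le_abs_self T₁
  have a₂ := le_abs_self T₂
  have a₃ := le_abs_self T₃
  have a₄ := le_abs_self T₄
  have b₁ := abs_nonneg T₁
  have b₂ := abs_nonneg T₂
  have b₃ := abs_nonneg T₃
  have b₄ := abs_nonneg T₄
  have hT : 0 < T := by positivity
  exact ⟨T, hT, h₁ T hT (by linarith), h₂ T hT (by linarith), h₃ T hT (by linarith),
    h₄ T hT (by linarith)⟩

lemma Precedes.causallyDisjoint {O₁ O₂ : DoubleCone s} (h : O₂.Precedes O₁) :
    O₂.CausallyDisjoint O₁ := fun x hx y hy => by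
  refine (h x hx y hy).trans_le ?_
  have := abs_coord_le (y - x)
  simp only [Prod.snd_sub, PiLp.sub_apply] at this
  exact (le_abs_self _).trans this

lemma CausallyDisjoint.symm {O₁ O₂ : DoubleCone s} (h : O₁.CausallyDisjoint O₂) :
    O₂.CausallyDisjoint O₁ := fun x hx y hy => by
  rw [abs_sub_comm, norm_sub_rev]; exact h y hy x hx

lemma CausallyDisjoint.mono {O₁ O₂ K : DoubleCone s} (h : K.CausallyDisjoint O₂)
    (hK : O₁.region ⊆ K.region) : O₁.CausallyDisjoint O₂ := fun x hx y hy => h x (hK hx) y hy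

lemma Precedes.mono {O₁ O₂ K L : DoubleCone s} (h : K.Precedes L)
    (h₁ : O₁.region ⊆ K.region) (h₂ : O₂.region ⊆ L.region) : O₁.Precedes O₂ :=
  fun x hx y hy => h x (h₁ hx) y (h₂ hy)

lemma mem_region_segment (O : DoubleCone s) {c : ℝ} (h₀ : 0 < c) (h₁ : c < 1) :
    O.past + c • (O.future - O.past) ∈ O.region := by
  have h := O.mem_cone
  have key : ∀ r : ℝ, 0 < r → r • (O.future - O.past) ∈ forwardCone s := fun r hr => by
    simp only [forwardCone, Set.mem_ofPred_eq, Prod.smul_fst, Prod.smul_snd, norm_smul,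
      Real.norm_eq_abs, abs_of_pos hr, smul_eq_mul] at *
    exact mul_lt_mul_of_pos_left h hr
  refine ⟨by simpa using key c h₀, ?_⟩
  convert key (1 - c) (by linarith) using 1
  module

/-- The double cone spanned by a double cone and its translate by `r` along the first axis. -/
def hull (O : DoubleCone s) (r : ℝ) (hr : 0 ≤ r) : DoubleCone s where
  past := O.past + (-r, EuclideanSpace.single 0 r)
  future := O.future + (r, EuclideanSpace.single 0 r)
  mem_cone := by
    have h := O.mem_cone
    simp only [forwardCone, Set.mem_ofPred_eq, Prod.snd_sub, Prod.fst_sub, Prod.snd_add,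
      Prod.fst_add, add_sub_add_right_eq_sub] at *
    linarith

lemma region_subset_hull (O : DoubleCone s) (r : ℝ) (hr : 0 ≤ r) :
    O.region ⊆ (O.hull r hr).region := by
  apply region_subset_of_mem
  · simp [hull, closedForwardCone, abs_of_nonneg hr]
  · simp [hull, closedForwardCone, abs_of_nonneg hr]

lemma translate_region_subset_hull (O : DoubleCone s) (r : ℝ) (hr : 0 ≤ r) :
    (O.translate (shiftVector s r)).region ⊆ (O.hull r hr).region := by
  apply region_subset_of_mem
  · simp [hull, closedForwardCone, translate, shiftVector, hr]
  · simp [hull, closedForwardCone, translate, shiftVector, hr]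

/-- The tips of a double cone do not belong to its open region. Inequalities on the axis between the
tips pass to a tip in this form, weakened from `<` to `≤`. -/
lemma le_of_forall_segment {a b c : ℝ} (h : ∀ r : ℝ, 0 < r → r < 1 → a < b + r * c) : a ≤ b := by
  by_contra! hab
  have hc : 0 < |c| + 1 := by positivity
  set r := min (1 / 2) ((a - b) / (2 * (|c| + 1)))
  have hr : 0 < r := lt_min (by norm_num) (by apply div_pos <;> linarith)
  have hr' : r ≤ (a - b) / (2 * (|c| + 1)) := min_le_right _ _
  have := h r hr ((min_le_left _ _).trans_lt (by norm_num))
  rw [le_div_iff₀ (by positivity)] at hr'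
  nlinarith [le_abs_self c]

/-- In null coordinates of the first axis, the wedge condition bounds `x⁰ + x¹` at the past tip of
`O₁` and `x¹ - x⁰` at its future tip from below. The hull moves each tip along the null direction in
which its own coordinate is constant, so both bounds persist. -/
lemma Precedes.hull {O₁ O₂ : DoubleCone s} (h : O₂.Precedes O₁) (r : ℝ) (hr : 0 ≤ r) :
    O₂.Precedes (O₁.hull r hr) := by
  intro x hx z hz
  have k₁ : x.1 + x.2 0 ≤ O₁.past.1 + O₁.past.2 0 := by
    refine le_of_forall_segment (c := (O₁.future - O₁.past).1 + (O₁.future - O₁.past).2 0)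
      fun c hc hc' => ?_
    have := h x hx _ (O₁.mem_region_segment hc hc')
    rw [abs_lt] at this
    simp at this ⊢
    linarith [this.1]
  have k₂ : x.2 0 - x.1 ≤ O₁.future.2 0 - O₁.future.1 := by
    refine le_of_forall_segment (c := (O₁.past - O₁.future).2 0 - (O₁.past - O₁.future).1)
      fun c hc hc' => ?_
    have := h x hx _ (O₁.mem_region_segment (c := 1 - c) (by linarith) (by linarith))
    rw [abs_lt] at this
    simp at this ⊢
    linarith [this.2]
  have z₁ := abs_lt.1 (forwardCone_coord hz.1)
  have z₂ := abs_lt.1 (forwardCone_coord hz.2)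
  simp [DoubleCone.hull] at z₁ z₂
  rw [abs_lt]
  constructor <;> linarith [z₁.1, z₂.2]

lemma centered_precedes_translate {T : ℝ} (hT : 0 < T) {r : ℝ} (hr : 4 * T ≤ r) :
    (centered s T hT).Precedes ((centered s T hT).translate (shiftVector s r)) := by
  intro x hx y hy
  have x₁ := abs_lt.1 (forwardCone_coord hx.1)
  have x₂ := abs_lt.1 (forwardCone_coord hx.2)
  have y₁ := abs_lt.1 (forwardCone_coord hy.1)
  have y₂ := abs_lt.1 (forwardCone_coord hy.2)
  simp [centered, translate, shiftVector] at x₁ x₂ y₁ y₂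
  rw [abs_lt]
  constructor <;> linarith [x₁.1, x₁.2, x₂.1, x₂.2, y₁.1, y₁.2, y₂.1, y₂.2]

lemma translate_region_mono {O K : DoubleCone s} (h : O.region ⊆ K.region) (a : Minkowski s) :
    (O.translate a).region ⊆ (K.translate a).region := by
  have key : ∀ (L : DoubleCone s) (z : Minkowski s),
      z ∈ (L.translate a).region ↔ z - a ∈ L.region := fun L z => by
    simp only [region, translate, Set.mem_ofPred_eq]
    rw [show z - a - L.past = z - (L.past + a) by abel,
      show L.future - (z - a) = L.future + a - z by abel]
  intro z hz
  rw [key] at hz ⊢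
  exact h hz

end DoubleCone

end Geometry

end LQP

end

noncomputable section

namespace LQP

section UnitaryCancel

variable {R : Type*} [Monoid R] [StarMul R] (u : unitary R)

lemma unitary_mul_star : (u : R) * star (u : R) = 1 := Unitary.mul_star_self_of_mem u.2

lemma unitary_star_mul : star (u : R) * (u : R) = 1 := Unitary.star_mul_self_of_mem u.2

lemma unitary_mul_star_mul (x : R) : (u : R) * (star (u : R) * x) = x := by
  rw [← mul_assoc, unitary_mul_star, one_mul]

lemma unitary_star_mul_mul (x : R) : star (u : R) * ((u : R) * x) = x := by
  rw [← mul_assoc, unitary_star_mul, one_mul]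

end UnitaryCancel

/-! ### Statistics operators -/

section Statistics

variable {s : ℕ} {H : Type*} [NormedAddCommGroup H] [InnerProductSpace ℂ H] [CompleteSpace H]
  {N : HaagKastlerNet s H}

namespace HaagKastlerNet

lemma mem_quasilocal {O : DoubleCone s} {T : H →L[ℂ] H} (hT : T ∈ N.alg O) :
    T ∈ N.quasilocal :=
  StarSubalgebra.le_topologicalClosure _
    (StarAlgebra.subset_adjoin ℂ _ (Set.mem_iUnion.2 ⟨O, hT⟩))

lemma mem_alg_of_commute {O : DoubleCone s} {T : H →L[ℂ] H}
    (h : ∀ O₁ : DoubleCone s, O.CausallyDisjoint O₁ → ∀ A ∈ N.alg O₁, A * T = T * A) :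
    T ∈ N.alg O := by
  change T ∈ (N.alg O : Set (H →L[ℂ] H))
  rw [N.haag_duality O, Set.mem_centralizer_iff]
  intro A hA
  simp only [Set.mem_iUnion] at hA
  obtain ⟨O₁, h₁, hA⟩ := hA
  exact h O₁ h₁ A hA

variable {ρ : N.quasilocal →⋆ₐ[ℂ] N.quasilocal}

@[simp]
lemma adComp_apply (u : unitary N.quasilocal) (x : N.quasilocal) :
    adComp u ρ x = (u : N.quasilocal) * ρ x * star (u : N.quasilocal) := rfl

lemma IsLocalizedIn.mono {O K : DoubleCone s} (h : IsLocalizedIn ρ O)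
    (hK : O.region ⊆ K.region) : IsLocalizedIn ρ K :=
  fun O₁ h₁ A hA => h O₁ (h₁.mono hK) A hA

/-- A transporter to `O` makes `ρ` inner on the algebras spacelike to `O`. Remote transporters
thereby give a formula for `ρ` on any fixed local algebra. -/
lemma IsLocalizedIn.apply_eq {u : unitary N.quasilocal} {O O₁ : DoubleCone s}
    (h : IsLocalizedIn (adComp u ρ) O) (h₁ : O.CausallyDisjoint O₁) {A : N.quasilocal}
    (hA : (A : H →L[ℂ] H) ∈ N.alg O₁) :
    ρ A = star (u : N.quasilocal) * A * u := by
  have := h O₁ h₁ A hA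
  rw [adComp_apply] at this
  conv_rhs => rw [← this]
  simp only [mul_assoc, unitary_star_mul_mul, unitary_star_mul, mul_one]

/-- Both transported endomorphisms act trivially on `𝒜(K')`, so `w u⋆` commutes with it and Haag
duality places it in `𝒜(K)`. -/
lemma intertwiner_mem {u w : unitary N.quasilocal} {K : DoubleCone s}
    (hu : IsLocalizedIn (adComp u ρ) K) (hw : IsLocalizedIn (adComp w ρ) K) :
    ((w * star u : unitary N.quasilocal) : N.quasilocal).1 ∈ N.alg K := by
  refine mem_alg_of_commute fun O h A hA => ?_
  have e : (star (u : N.quasilocal)) * ⟨A, mem_quasilocal hA⟩ * u =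
      star (w : N.quasilocal) * ⟨A, mem_quasilocal hA⟩ * w := by
    rw [← hu.apply_eq h (A := ⟨A, mem_quasilocal hA⟩) hA, hw.apply_eq h hA]
  have : (⟨A, mem_quasilocal hA⟩ : N.quasilocal) * ((w : N.quasilocal) * star (u : N.quasilocal)) =
      ((w : N.quasilocal) * star (u : N.quasilocal)) * ⟨A, mem_quasilocal hA⟩ := by
    have := congrArg (fun x => (w : N.quasilocal) * x * star (u : N.quasilocal)) e
    simp only [mul_assoc, unitary_mul_star, mul_one, unitary_mul_star_mul] at this
    simp only [mul_assoc]
    exact this.symm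
  exact congrArg Subtype.val this

/-- The operator `ρ(u₁⋆) u₂⋆ u₁ ρ(u₂)`. -/
def exchange (ρ : N.quasilocal →⋆ₐ[ℂ] N.quasilocal) (u₁ u₂ : unitary N.quasilocal) :
    N.quasilocal :=
  ρ (star (u₁ : N.quasilocal)) * star (u₂ : N.quasilocal) * (u₁ : N.quasilocal) *
      ρ (u₂ : N.quasilocal)

/-- The transporters differ by a unitary `w ∈ 𝒜(K)`. Since `u₂` leads to a region spacelike to `K`,
one has `ρ(w⋆) = u₂⋆ w⋆ u₂`, and the two occurrences of `w` cancel. -/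
lemma exchange_eq_left {u₁ u₂ v : unitary N.quasilocal} {K O₂ : DoubleCone s}
    (h₁ : IsLocalizedIn (adComp u₁ ρ) K) (hv : IsLocalizedIn (adComp v ρ) K)
    (h₂ : IsLocalizedIn (adComp u₂ ρ) O₂) (hK : O₂.CausallyDisjoint K) :
    exchange ρ u₁ u₂ = exchange ρ v u₂ := by
  set w : unitary N.quasilocal := v * star u₁ with hw
  have hv' : v = w * u₁ := by simp [hw, mul_assoc]
  have e : ρ (star (w : N.quasilocal)) =
      star (u₂ : N.quasilocal) * star (w : N.quasilocal) * u₂ := by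
    apply h₂.apply_eq hK
    exact star_mem (s := N.alg K) (intertwiner_mem h₁ hv)
  rw [exchange, exchange, hv']
  simp only [Submonoid.coe_mul, star_mul, map_mul, e]
  simp only [mul_assoc, unitary_mul_star_mul, unitary_star_mul_mul]

lemma exchange_eq_right {u₁ u₂ v : unitary N.quasilocal} {K O₁ : DoubleCone s}
    (h₁ : IsLocalizedIn (adComp u₁ ρ) O₁) (hv : IsLocalizedIn (adComp v ρ) K)
    (h₂ : IsLocalizedIn (adComp u₂ ρ) K) (hK : O₁.CausallyDisjoint K) :
    exchange ρ u₁ u₂ = exchange ρ u₁ v := by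
  set w : unitary N.quasilocal := v * star u₂ with hw
  have hv' : v = w * u₂ := by simp [hw, mul_assoc]
  have e : ρ (w : N.quasilocal) = star (u₁ : N.quasilocal) * (w : N.quasilocal) * u₁ :=
    h₁.apply_eq hK (intertwiner_mem h₂ hv)
  rw [exchange, exchange, hv']
  simp only [Submonoid.coe_mul, star_mul, map_mul, e]
  simp only [mul_assoc, unitary_mul_star_mul, unitary_star_mul_mul]

lemma isLocalizedIn_adComp_one {O : DoubleCone s} (h : IsLocalizedIn ρ O) :
    IsLocalizedIn (adComp 1 ρ) O := fun O₁ h₁ A hA => by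
  simpa using h O₁ h₁ A hA

/-- The statistics operator is computed by charge transporters to sufficiently remote regions. -/
theorem IsStatisticsOperator.exists_transporter {ε : N.quasilocal} (hε : IsStatisticsOperator ρ ε)
    (hρ : IsLocalizedEndomorphism ρ) {O₀ : DoubleCone s} (h₀ : IsLocalizedIn ρ O₀)
    (L : DoubleCone s) : ∃ u : unitary N.quasilocal,
      ε = ρ (star (u : N.quasilocal)) * u ∧
      ∀ A : N.quasilocal, (A : H →L[ℂ] H) ∈ N.alg L → ρ A = star (u : N.quasilocal) * A * u := by
  obtain ⟨O₁, O₂, u₁, u₂, h, h₁, h₂, rfl⟩ := hε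
  obtain ⟨T, hT, s₁, s₂, s₃, s₄⟩ := DoubleCone.exists_common_superset O₁ O₂ O₀ L
  set K := DoubleCone.centered s T hT
  have hr : (0 : ℝ) ≤ 4 * T := by positivity
  set R := O₁.translate (shiftVector s (4 * T))
  obtain ⟨v, hv⟩ := hρ.2 R
  have hKR : K.Precedes R := (DoubleCone.centered_precedes_translate hT le_rfl).mono subset_rfl
    (DoubleCone.translate_region_mono s₁ _)
  -- First `u₁` is replaced: its region moves to the far right inside a hull that stays to the right
  -- of `O₂`. Then `u₂` can be replaced by `1`, because `K` contains both `O₂` and `O₀` and is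
  -- spacelike to `R`.
  have e₁ : exchange ρ u₁ u₂ = exchange ρ v u₂ :=
    exchange_eq_left (h₁.mono (O₁.region_subset_hull _ hr))
      (hv.mono (O₁.translate_region_subset_hull _ hr)) h₂ (h.hull _ hr).causallyDisjoint
  have e₂ : exchange ρ v u₂ = exchange ρ v 1 :=
    exchange_eq_right hv ((isLocalizedIn_adComp_one h₀).mono s₃) (h₂.mono s₂)
      hKR.causallyDisjoint.symm
  refine ⟨v, ?_, fun A hA => hv.apply_eq (hKR.causallyDisjoint.mono s₄).symm hA⟩
  change exchange ρ u₁ u₂ = _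
  rw [e₁, e₂]
  simp [exchange]

end HaagKastlerNet

end Statistics

end LQP

end

noncomputable section

namespace LQP

section Endomorphism

variable {s : ℕ} {H : Type*} [NormedAddCommGroup H] [InnerProductSpace ℂ H] [CompleteSpace H]
  {N : HaagKastlerNet s H}

namespace HaagKastlerNet

lemma isClosed_quasilocal : IsClosed (N.quasilocal : Set (H →L[ℂ] H)) :=
  StarSubalgebra.isClosed_topologicalClosure _

attribute [local instance] isClosed_quasilocal

lemma exists_common_alg {O₁ O₂ : DoubleCone s} {A B : H →L[ℂ] H} (hA : A ∈ N.alg O₁)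
    (hB : B ∈ N.alg O₂) : ∃ O, A ∈ N.alg O ∧ B ∈ N.alg O := by
  obtain ⟨T, hT, s₁, s₂, -, -⟩ := DoubleCone.exists_common_superset O₁ O₂ O₁ O₁
  exact ⟨_, N.isotony _ _ s₁ hA, N.isotony _ _ s₂ hB⟩

lemma exists_alg_of_mem_adjoin (O₀ : DoubleCone s) {T : H →L[ℂ] H} (hT : T ∈ StarAlgebra.adjoin ℂ
    (⋃ O : DoubleCone s, (N.alg O : Set (H →L[ℂ] H)))) : ∃ O, T ∈ N.alg O := by
  induction hT using StarAlgebra.adjoin_induction with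
  | mem x hx => simpa using hx
  | algebraMap r => exact ⟨O₀, (N.alg O₀).toStarSubalgebra.algebraMap_mem r⟩
  | add x y _ _ hx hy =>
    obtain ⟨O₁, hx⟩ := hx
    obtain ⟨O₂, hy⟩ := hy
    obtain ⟨O, hx, hy⟩ := exists_common_alg hx hy
    exact ⟨O, add_mem hx hy⟩
  | mul x y _ _ hx hy =>
    obtain ⟨O₁, hx⟩ := hx
    obtain ⟨O₂, hy⟩ := hy
    obtain ⟨O, hx, hy⟩ := exists_common_alg hx hy
    exact ⟨O, mul_mem hx hy⟩
  | star x _ hx =>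
    obtain ⟨O₁, hx⟩ := hx
    exact ⟨O₁, star_mem hx⟩

lemma quasilocal_induction (O₀ : DoubleCone s) {p : N.quasilocal → Prop}
    (hp : IsClosed {x | p x})
    (h : ∀ (O : DoubleCone s) (A : N.quasilocal), (A : H →L[ℂ] H) ∈ N.alg O → p A)
    (x : N.quasilocal) : p x := by
  have hx : (x : H →L[ℂ] H) ∈ closure ((StarAlgebra.adjoin ℂ
    (⋃ O : DoubleCone s, (N.alg O : Set (H →L[ℂ] H))) : StarSubalgebra ℂ (H →L[ℂ] H)) :
      Set (H →L[ℂ] H)) := x.2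
  have : x ∈ closure {x : N.quasilocal | ∃ O : DoubleCone s, (x : H →L[ℂ] H) ∈ N.alg O} := by
    rw [closure_subtype]
    refine closure_mono ?_ hx
    intro T hT
    obtain ⟨O, hO⟩ := exists_alg_of_mem_adjoin O₀ hT
    exact ⟨⟨T, mem_quasilocal hO⟩, ⟨O, hO⟩, rfl⟩
  refine closure_minimal (fun y hy => ?_) hp this
  obtain ⟨O, hO⟩ := hy
  exact h O y hO

lemma commute_of_causallyDisjoint {O O₁ : DoubleCone s} (h : O.CausallyDisjoint O₁)
    {A B : H →L[ℂ] H} (hA : A ∈ N.alg O) (hB : B ∈ N.alg O₁) : B * A = A * B := by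
  change A ∈ (N.alg O : Set (H →L[ℂ] H)) at hA
  rw [N.haag_duality O, Set.mem_centralizer_iff] at hA
  exact hA B (Set.mem_iUnion₂.2 ⟨O₁, h, hB⟩)

variable {ρ : N.quasilocal →⋆ₐ[ℂ] N.quasilocal} {O₀ : DoubleCone s}

lemma IsLocalizedIn.pow (h₀ : IsLocalizedIn ρ O₀) (n : ℕ) : IsLocalizedIn (ρ ^ n) O₀ := by
  induction n with
  | zero => intro O₁ _ A _; rfl
  | succ n ih =>
    intro O₁ h₁ A hA
    rw [pow_succ]
    change (ρ ^ n) (ρ A) = A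
    rw [h₀ O₁ h₁ A hA, ih O₁ h₁ A hA]

/-- `ρ` is trivial on `𝒜(O₀')`, so Haag duality puts the commutant of `ρ(𝒜)` in all bounded
operators into `𝒜(O₀)`. Thus irreducibility inside `𝒜` is the same as irreducibility on `H`. -/
lemma IsLocalizedIn.mem_alg_of_commute (h₀ : IsLocalizedIn ρ O₀) {T : H →L[ℂ] H}
    (hT : ∀ y, T * (ρ y : H →L[ℂ] H) = ρ y * T) : T ∈ N.alg O₀ := by
  refine HaagKastlerNet.mem_alg_of_commute fun O₁ h₁ A hA => ?_
  have := hT ⟨A, mem_quasilocal hA⟩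
  rw [h₀ O₁ h₁ _ hA] at this
  exact this.symm

lemma IsLocalizedIn.map_mem_alg (h₀ : IsLocalizedIn ρ O₀) {A : N.quasilocal}
    (hA : (A : H →L[ℂ] H) ∈ N.alg O₀) : (ρ A : H →L[ℂ] H) ∈ N.alg O₀ := by
  refine HaagKastlerNet.mem_alg_of_commute fun O₁ h₁ B hB => ?_
  have e : (⟨B, mem_quasilocal hB⟩ : N.quasilocal) * A = A * ⟨B, mem_quasilocal hB⟩ :=
    Subtype.ext (commute_of_causallyDisjoint h₁ hA hB)
  have := congrArg ρ e
  rw [map_mul, map_mul, h₀ O₁ h₁ ⟨B, _⟩ hB] at this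
  exact congrArg Subtype.val this

/-! ### Left inverses -/

lemma star_eq_of_polarization {R : Type*} [AddCommGroup R] [Module ℂ R] [StarAddMonoid R]
    [StarModule ℂ R] {a b : R} (h₁ : star (a + b) = a + b)
    (h₂ : star (Complex.I • (b - a)) = Complex.I • (b - a)) : star a = b := by
  rw [star_add] at h₁
  rw [star_smul, star_sub] at h₂
  have h₃ : star a - star b = b - a := by
    have := congrArg (fun x => Complex.I • x) h₂
    simp only [smul_smul] at this
    simp only [Complex.star_def, Complex.conj_I, mul_neg, Complex.I_mul_I, neg_neg, one_smul,
      neg_smul, neg_sub] at this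
    rw [← neg_sub, this, neg_sub]
  have : (2 : ℂ) • star a = (2 : ℂ) • b := by
    rw [two_smul, two_smul]
    calc star a + star a = (star a + star b) + (star a - star b) := by abel
      _ = b + b := by rw [h₁, h₃]; abel
  exact smul_right_injective R (two_ne_zero (α := ℂ)) this

namespace IsLeftInverse

variable {φ : N.quasilocal →ₗ[ℂ] N.quasilocal}

lemma star_map_star_mul (hφ : IsLeftInverse ρ φ) (x : N.quasilocal) :
    star (φ (star x * x)) = φ (star x * x) :=
  Subtype.ext (hφ.positive x).isSelfAdjoint

/-- Positivity is assumed only on elements `x⋆ x`. The combination `c x⋆ + c̄ x` is half the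
difference of two such squares, and the choices `c = 1` and `c = i` separate `φ(x)` from `φ(x⋆)`. -/
lemma map_star_eq (hφ : IsLeftInverse ρ φ) (x : N.quasilocal) : φ (star x) = star (φ x) := by
  symm
  have key : ∀ c : ℂ, star (φ (c • star x + star c • x)) = φ (c • star x + star c • x) := by
    intro c
    have h := hφ.star_map_star_mul (x + c • 1)
    have h' := hφ.star_map_star_mul (x - c • 1)
    have e : c • star x + star c • x = (2 : ℂ)⁻¹ • (star (x + c • 1) * (x + c • 1) -
        star (x - c • 1) * (x - c • 1)) := by
      simp only [star_add, star_sub, star_smul, star_one, mul_add, add_mul, mul_sub, sub_mul,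
        mul_smul_comm, smul_mul_assoc, mul_one, one_mul]
      module
    rw [e, map_smul, map_sub, star_smul, star_sub, h, h']
    simp
  apply star_eq_of_polarization
  · simpa [add_comm] using key 1
  · have := key Complex.I
    simpa [smul_sub, sub_eq_add_neg] using this

lemma map_mul_left (hφ : IsLeftInverse ρ φ) (A B : N.quasilocal) :
    φ (ρ B * A) = B * φ A := by
  have := hφ.map_mul (star A) (star B)
  rw [map_star ρ, ← star_mul, hφ.map_star_eq, hφ.map_star_eq, ← star_mul] at this
  exact star_injective this

lemma map_apply (hφ : IsLeftInverse ρ φ) (A : N.quasilocal) : φ (ρ A) = A := by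
  have := hφ.map_mul 1 A
  rwa [one_mul, hφ.map_one, one_mul] at this

lemma map_mem_alg (hφ : IsLeftInverse ρ φ) {K : DoubleCone s} (h₀ : IsLocalizedIn ρ K)
    {A : N.quasilocal} (hA : (A : H →L[ℂ] H) ∈ N.alg K) : (φ A : H →L[ℂ] H) ∈ N.alg K := by
  refine HaagKastlerNet.mem_alg_of_commute fun O₁ h₁ B hB => ?_
  have e : (⟨B, mem_quasilocal hB⟩ : N.quasilocal) * A = A * ⟨B, mem_quasilocal hB⟩ :=
    Subtype.ext (commute_of_causallyDisjoint h₁ hA hB)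
  have h := h₀ O₁ h₁ ⟨B, mem_quasilocal hB⟩ hB
  have := congrArg φ e
  rw [← h, hφ.map_mul_left, hφ.map_mul] at this
  exact congrArg Subtype.val this

lemma exists_star_mul_self {x : N.quasilocal} (hx : (x : H →L[ℂ] H).IsPositive) :
    ∃ y : N.quasilocal, x = star y * y := by
  have hx' := (ContinuousLinearMap.nonneg_iff_isPositive _).2 hx
  have hs : cfc Real.sqrt (x : H →L[ℂ] H) ∈ N.quasilocal :=
    cfc_mem (𝕜 := ℝ) (s := N.quasilocal) (hs := isClosed_quasilocal) Real.sqrt x.2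
  refine ⟨⟨_, hs⟩, Subtype.ext ?_⟩
  change (x : H →L[ℂ] H) = star (cfc Real.sqrt (x : H →L[ℂ] H)) * cfc Real.sqrt (x : H →L[ℂ] H)
  have hsa : IsSelfAdjoint (cfc Real.sqrt (x : H →L[ℂ] H)) := cfc_predicate _ _
  rw [hsa.star_eq, ← cfc_mul ..]
  conv_lhs => rw [← cfc_id ℝ (x : H →L[ℂ] H) hx.isSelfAdjoint]
  refine cfc_congr fun r hr => ?_
  have : 0 ≤ r := spectrum_nonneg_of_nonneg hx' hr
  simp [Real.mul_self_sqrt this]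

lemma map_positive (hφ : IsLeftInverse ρ φ) {x : N.quasilocal}
    (hx : (x : H →L[ℂ] H).IsPositive) : (φ x : H →L[ℂ] H).IsPositive := by
  obtain ⟨y, rfl⟩ := exists_star_mul_self hx
  exact hφ.positive y

end IsLeftInverse

/-! ### Properties of the statistics operator -/

section

variable {φ : N.quasilocal →ₗ[ℂ] N.quasilocal} {ε : N.quasilocal}

lemma IsStatisticsOperator.star_mul_self (hε : IsStatisticsOperator ρ ε)
    (hρ : IsLocalizedEndomorphism ρ) : star ε * ε = 1 ∧ ε * star ε = 1 := by
  obtain ⟨O₀, h₀⟩ := hρ.1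
  obtain ⟨u, rfl, -⟩ := hε.exists_transporter hρ h₀ O₀
  have h₁ : ρ (u : N.quasilocal) * ρ (star (u : N.quasilocal)) = 1 := by
    rw [← map_mul, unitary_mul_star, map_one]
  have h₂ : ρ (star (u : N.quasilocal)) * ρ (u : N.quasilocal) = 1 := by
    rw [← map_mul, unitary_star_mul, map_one]
  simp only [star_mul, ← map_star, star_star]
  constructor
  · rw [mul_assoc, ← mul_assoc (ρ _), h₁, one_mul, unitary_star_mul]
  · rw [mul_assoc, unitary_mul_star_mul, h₂]

/-- For local `A` there is a transporter `u` that implements `ρ` on an algebra containing `A` and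
`ρ(A)`. Then `ρ²(A)` equals both `u⋆ ρ(A) u` and `ρ(u⋆) ρ(A) ρ(u)`, and `ε = ρ(u⋆) u` intertwines
the two expressions. Continuity extends this to `𝒜`. -/
lemma IsStatisticsOperator.commute (hε : IsStatisticsOperator ρ ε)
    (hρ : IsLocalizedEndomorphism ρ) (x : N.quasilocal) : Commute ε (ρ (ρ x)) := by
  obtain ⟨O₀, h₀⟩ := hρ.1
  open scoped CStarAlgebra in
  have hc : Continuous ρ := map_continuous ρ
  refine quasilocal_induction O₀ (p := fun x => Commute ε (ρ (ρ x))) ?_ (fun O A hA => ?_) x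
  · exact isClosed_eq (by fun_prop) (by fun_prop)
  obtain ⟨T, hT, s₁, s₂, -, -⟩ := DoubleCone.exists_common_superset O O₀ O O
  have h₀' := h₀.mono s₂
  have hA := N.isotony _ _ s₁ hA
  obtain ⟨u, rfl, hu⟩ := hε.exists_transporter hρ h₀ (DoubleCone.centered s T hT)
  have e₁ : ρ (ρ A) = star (u : N.quasilocal) * ρ A * u := hu _ (h₀'.map_mem_alg hA)
  have e₂ : ρ (ρ A) = ρ (star (u : N.quasilocal)) * ρ A * ρ (u : N.quasilocal) := by
    conv_lhs => rw [hu A hA]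
    simp only [map_mul]
  have h₁ : ρ (u : N.quasilocal) * ρ (star (u : N.quasilocal)) = 1 := by
    rw [← map_mul, unitary_mul_star, map_one]
  change _ = _
  conv_lhs => rw [e₁]
  conv_rhs => rw [e₂]
  simp only [mul_assoc, unitary_mul_star_mul]
  rw [← mul_assoc (ρ (u : N.quasilocal)), h₁, one_mul]

lemma IsStatisticsOperator.mem_alg (hε : IsStatisticsOperator ρ ε)
    (hρ : IsLocalizedEndomorphism ρ) (h₀ : IsLocalizedIn ρ O₀) :
    (ε : H →L[ℂ] H) ∈ N.alg O₀ :=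
  (h₀.pow 2).mem_alg_of_commute fun y => congrArg Subtype.val (hε.commute hρ y)

/-- With `ε = ρ(u⋆) u` the product `ρ(ε) ε` telescopes to `ρ²(u⋆) u`. Now `ε` moves past `ρ²(u⋆)`,
and `ε u = u ρ(ε)` because `u` implements `ρ` on the local algebra containing `ε`. -/
lemma IsStatisticsOperator.braid (hε : IsStatisticsOperator ρ ε)
    (hρ : IsLocalizedEndomorphism ρ) : ε * ρ ε * ε = ρ ε * ε * ρ ε := by
  obtain ⟨O₀, h₀⟩ := hρ.1
  obtain ⟨u, hεu, hu⟩ := hε.exists_transporter hρ h₀ O₀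
  have e₁ : ρ ε = star (u : N.quasilocal) * ε * u := hu _ (hε.mem_alg hρ h₀)
  have e₂ : ρ ε = ρ (ρ (star (u : N.quasilocal))) * ρ (u : N.quasilocal) := by
    conv_lhs => rw [hεu]
    rw [map_mul]
  have e₃ : ρ ε * ε = ρ (ρ (star (u : N.quasilocal))) * u := by
    rw [e₂]
    conv_lhs => rw [hεu]
    rw [mul_assoc, ← mul_assoc (ρ (u : N.quasilocal)), ← map_mul, unitary_mul_star, map_one,
      one_mul]
  rw [mul_assoc, e₃, ← mul_assoc, (hε.commute hρ _).eq, mul_assoc, mul_assoc]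
  conv_rhs => rw [e₁]
  rw [mul_assoc, unitary_mul_star_mul]

/-- If `u` implements `ρ` on an algebra containing `x` and `φ(x)`, then `ε ρ(x) ε⋆ = ρ(u⋆) x ρ(u)`,
and `φ` sends this to `u⋆ φ(x) u = ρ(φ(x))`. Faithfulness, the trace property and the resolvent
recursion all rest on this identity. -/
lemma IsStatisticsOperator.twist (hε : IsStatisticsOperator ρ ε)
    (hρ : IsLocalizedEndomorphism ρ) (hφ : IsLeftInverse ρ φ) {O : DoubleCone s}
    {x : N.quasilocal} (hx : (x : H →L[ℂ] H) ∈ N.alg O) :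
    φ (ε * ρ x * star ε) = ρ (φ x) := by
  obtain ⟨O₀, h₀⟩ := hρ.1
  obtain ⟨T, hT, s₁, s₂, -, -⟩ := DoubleCone.exists_common_superset O O₀ O O
  have h₀' := h₀.mono s₂
  have hx := N.isotony _ _ s₁ hx
  obtain ⟨u, rfl, hu⟩ := hε.exists_transporter hρ h₀ (DoubleCone.centered s T hT)
  rw [hu _ (hφ.map_mem_alg h₀' hx), hu x hx]
  simp only [star_mul, ← map_star ρ, star_star, mul_assoc, unitary_mul_star_mul]
  rw [hφ.map_mul_left, hφ.map_mul]

end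

end HaagKastlerNet

end Endomorphism

end LQP

end

/-! ### Commutants, minimal projections and operators with scalar corners. -/

noncomputable section

namespace LQP

section OperatorTheory

variable {H : Type*} [NormedAddCommGroup H] [InnerProductSpace ℂ H] [CompleteSpace H]

lemma commute_starProjection (K : Submodule ℂ H) [K.HasOrthogonalProjection] {A : H →L[ℂ] H}
    (h₁ : ∀ x ∈ K, A x ∈ K) (h₂ : ∀ x ∈ K, star A x ∈ K) : Commute A K.starProjection := by
  have key : ∀ B : H →L[ℂ] H, (∀ x ∈ K, B x ∈ K) →
      K.starProjection * B * K.starProjection = B * K.starProjection := by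
    intro B hB
    ext x
    exact Submodule.starProjection_eq_self_iff.2 (hB _ (Submodule.starProjection_apply_mem _ _))
  have hP : star K.starProjection = K.starProjection := (isSelfAdjoint_starProjection K).star_eq
  have e₁ := key A h₁
  have e₂ := congrArg star (key _ h₂)
  simp only [star_mul, hP, star_star] at e₂
  change _ = _
  rw [← e₁, mul_assoc, e₂]

lemma commute_starProjection_closure_range {x A : H →L[ℂ] H} (h₁ : Commute x A)
    (h₂ : Commute x (star A)) :
    Commute A (LinearMap.range (x : H →ₗ[ℂ] H)).topologicalClosure.starProjection := by
  have key : ∀ B : H →L[ℂ] H, Commute x B →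
      ∀ v ∈ (LinearMap.range (x : H →ₗ[ℂ] H)).topologicalClosure,
        B v ∈ (LinearMap.range (x : H →ₗ[ℂ] H)).topologicalClosure := by
    intro B hB v hv
    refine map_mem_closure B.continuous hv ?_
    rintro _ ⟨w, rfl⟩
    exact ⟨B w, congrArg (fun T : H →L[ℂ] H => T w) hB.eq⟩
  exact commute_starProjection _ (key A h₁) (key _ h₂)

/-- Every real `c` lies on one side of all the ratios `α / β` at once, so the ratio cannot vary: the
cut at its value for `i₀` serves for all indices. -/
lemma eq_of_forall_le_or_le {ι : Type*} {α β : ι → ℝ} (hβ : ∀ i, 0 ≤ β i) {i₀ : ι}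
    (h₀ : 0 < β i₀) (h : ∀ c : ℝ, (∀ i, c * β i ≤ α i) ∨ (∀ i, α i ≤ c * β i)) (i : ι) :
    α i = α i₀ / β i₀ * β i := by
  have e₀ : α i₀ / β i₀ * β i₀ = α i₀ := div_mul_cancel₀ _ h₀.ne'
  have lower : ∀ c < α i₀ / β i₀, c * β i ≤ α i := fun c hc => by
    rcases h c with h | h
    · exact h i
    · have := h i₀
      nlinarith [mul_lt_mul_of_pos_right hc h₀]
  have upper : ∀ c > α i₀ / β i₀, α i ≤ c * β i := fun c hc => by
    rcases h c with h | h
    · have := h i₀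
      nlinarith [mul_lt_mul_of_pos_right hc h₀]
    · exact h i
  rcases (hβ i).eq_or_lt with hi | hi
  · have l := lower (α i₀ / β i₀ - 1) (by linarith)
    have u := upper (α i₀ / β i₀ + 1) (by linarith)
    rw [← hi] at l u ⊢
    linarith
  · apply le_antisymm
    · rw [← div_le_iff₀ hi]
      refine le_of_forall_gt_imp_ge_of_dense fun c hc => ?_
      rw [div_le_iff₀ hi]
      exact upper c hc
    · rw [← le_div_iff₀ hi]
      refine le_of_forall_lt_imp_le_of_dense fun c hc => ?_
      rw [le_div_iff₀ hi]
      exact lower c hc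

lemma eq_zero_of_star_mul_self {x : H →L[ℂ] H} (h : star x * x = 0) : x = 0 :=
  CStarRing.star_mul_self_eq_zero_iff x |>.1 h

section Minimal

variable {𝒮 : Set (H →L[ℂ] H)} (hs : ∀ A ∈ 𝒮, star A ∈ 𝒮) {p : H →L[ℂ] H}
  (hp : IsStarProjection p) (hp₀ : p ≠ 0) (hpc : ∀ A ∈ 𝒮, Commute p A)
  (hmin : ∀ r : H →L[ℂ] H, IsStarProjection r → (∀ A ∈ 𝒮, Commute r A) → p * r = r →
    r = 0 ∨ r = p)

include hs hp hmin in
-- The projection onto the closed range of `z⁺` commutes with `𝒮` and lies below `p`, so it is `0`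
-- or `p`. In the first case `z⁺ = 0`. In the second `z⁻` vanishes on the range of `p`, hence `z⁻ =
-- z⁻ p = 0`.
lemma posPart_eq_zero_or_negPart_eq_zero {z : H →L[ℂ] H} (hz : IsSelfAdjoint z)
    (hzc : ∀ A ∈ 𝒮, Commute z A) (hzp : z * p = z) : z⁺ = 0 ∨ z⁻ = 0 := by
  have hps := hp.isSelfAdjoint.star_eq
  have hpz : p * z = z := by
    have := congrArg star hzp
    rwa [star_mul, hps, hz.star_eq] at this
  have hsa : star z⁺ = z⁺ := (CFC.posPart_nonneg z).isSelfAdjoint.star_eq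
  have hsn : star z⁻ = z⁻ := (CFC.negPart_nonneg z).isSelfAdjoint.star_eq
  have h₁ : z⁺ * z = z⁺ * z⁺ := by
    have := congrArg (z⁺ * ·) (CFC.posPart_sub_negPart z)
    simp only [mul_sub, CFC.posPart_mul_negPart, sub_zero] at this
    exact this.symm
  have h₂ : z⁻ * z = -(z⁻ * z⁻) := by
    have := congrArg (z⁻ * ·) (CFC.posPart_sub_negPart z)
    simp only [mul_sub, CFC.negPart_mul_posPart, zero_sub] at this
    exact this.symm
  have hz₁ : z⁺ * p = z⁺ := by
    rw [← sub_eq_zero]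
    apply eq_zero_of_star_mul_self
    rw [star_sub, star_mul, hsa, hps, mul_sub, ← mul_assoc, sub_mul, mul_assoc p, ← h₁, sub_mul,
      mul_assoc _ z, hzp, mul_assoc p, mul_assoc z⁺ z, hzp, sub_self]
  have hz₂ : z⁻ * p = z⁻ := by
    rw [← sub_eq_zero]
    apply eq_zero_of_star_mul_self
    have h₂' : z⁻ * z⁻ = -(z⁻ * z) := by rw [h₂, neg_neg]
    rw [star_sub, star_mul, hsn, hps, mul_sub, ← mul_assoc, sub_mul, mul_assoc p, h₂', sub_mul]
    simp only [mul_neg, neg_mul]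
    rw [mul_assoc _ z, hzp, mul_assoc p, mul_assoc z⁻ z, hzp, sub_self]
  have hpz₁ : p * z⁺ = z⁺ := by
    have := congrArg star hz₁
    rwa [star_mul, hps, hsa] at this
  set K := (LinearMap.range ((z⁺ : H →L[ℂ] H) : H →ₗ[ℂ] H)).topologicalClosure
  set r := K.starProjection
  have hrK : ∀ v, r v ∈ closure (LinearMap.range ((z⁺ : H →L[ℂ] H) : H →ₗ[ℂ] H) : Set H) :=
    fun v => Submodule.starProjection_apply_mem K v
  have hr : IsStarProjection r := isStarProjection_starProjection
  have hrz : r * z⁺ = z⁺ := by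
    ext v
    exact Submodule.starProjection_eq_self_iff.2
      (Submodule.le_topologicalClosure _ ⟨v, rfl⟩)
  have hrc : ∀ A ∈ 𝒮, Commute r A := fun A hA =>
    (commute_starProjection_closure_range ((hzc A hA).cfcₙ_real _)
      ((hzc _ (hs A hA)).cfcₙ_real _)).symm
  have hpr : p * r = r := by
    ext v
    have hcl : IsClosed {w : H | p w = w} := isClosed_eq p.continuous continuous_id
    have hsub : ((LinearMap.range ((z⁺ : H →L[ℂ] H) : H →ₗ[ℂ] H)) : Set H) ⊆ {w : H | p w = w} := by
      rintro _ ⟨w, rfl⟩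
      exact congrArg (fun T : H →L[ℂ] H => T w) hpz₁
    exact closure_minimal hsub hcl (hrK v)
  rcases hmin r hr hrc hpr with h | h
  · left
    rw [← hrz, h, zero_mul]
  · right
    have : z⁻ * r = 0 := by
      ext v
      have hcl : IsClosed {w : H | z⁻ w = 0} := isClosed_eq (z⁻ : H →L[ℂ] H).continuous
        continuous_const
      have hsub : ((LinearMap.range ((z⁺ : H →L[ℂ] H) : H →ₗ[ℂ] H)) : Set H) ⊆
          {w : H | z⁻ w = 0} := by
        rintro _ ⟨w, rfl⟩
        exact congrArg (fun T : H →L[ℂ] H => T w) (CFC.negPart_mul_posPart z)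
      exact closure_minimal hsub hcl (hrK v)
    rw [← hz₂, ← h, this]

include hs hp hp₀ hpc hmin in
-- For each real `c` the operator `y - c p` has a definite sign by the preceding lemma. So the
-- quadratic forms of `y` and `p` are comparable for every factor `c`, hence proportional.
lemma exists_eq_smul_of_isSelfAdjoint {y : H →L[ℂ] H} (hy : IsSelfAdjoint y)
    (hyc : ∀ A ∈ 𝒮, Commute y A) (hyp : y * p = y) : ∃ c : ℂ, y = c • p := by
  obtain ⟨v₀, hv₀⟩ : ∃ v, p v ≠ 0 := by
    by_contra! h
    exact hp₀ (ContinuousLinearMap.ext h)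
  have hpp : ∀ v, inner ℂ (p v) v = ((‖p v‖ ^ 2 : ℝ) : ℂ) := by
    intro v
    have h₁ : p (p v) = p v := congrArg (fun T : H →L[ℂ] H => T v) hp.isIdempotentElem.eq
    have h₂ : inner ℂ (p (p v)) v = inner ℂ (p v) (p v) := hp.isSelfAdjoint.isSymmetric _ _
    rw [h₁, inner_self_eq_norm_sq_to_K] at h₂
    rw [h₂]; simp
  have hyr : ∀ v, inner ℂ (y v) v = ((inner ℂ (y v) v : ℂ).re : ℂ) := fun v =>
    (hy.isSymmetric.coe_re_inner_apply_self v).symm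
  have key := eq_of_forall_le_or_le (α := fun v => (inner ℂ (y v) v : ℂ).re)
    (β := fun v => ‖p v‖ ^ 2) (fun v => by positivity) (i₀ := v₀)
    (by positivity) (fun c => by
      have hz : IsSelfAdjoint (y - (c : ℂ) • p) := by
        refine hy.sub ?_
        rw [isSelfAdjoint_iff, star_smul, hp.isSelfAdjoint.star_eq]
        simp
      have hform : ∀ v, (inner ℂ ((y - (c : ℂ) • p) v) v : ℂ).re =
          (inner ℂ (y v) v : ℂ).re - c * ‖p v‖ ^ 2 := by
        intro v
        simp only [sub_apply, smul_apply, inner_sub_left,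
          inner_smul_left, hpp v, Complex.sub_re, Complex.conj_ofReal, ← Complex.ofReal_mul,
          Complex.ofReal_re]
      rcases posPart_eq_zero_or_negPart_eq_zero hs hp hmin hz
        (fun A hA => (hyc A hA).sub_left ((hpc A hA).smul_left _))
        (by rw [sub_mul, hyp, smul_mul_assoc, hp.isIdempotentElem.eq]) with h | h
      · right
        intro v
        rw [CFC.posPart_eq_zero_iff _ hz, ← neg_nonneg,
          ContinuousLinearMap.nonneg_iff_isPositive] at h
        have := h.2 v
        simp only [ContinuousLinearMap.reApplyInnerSelf_apply, neg_apply,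
          inner_neg_left, map_neg] at this
        change 0 ≤ -(inner ℂ ((y - (c : ℂ) • p) v) v : ℂ).re at this
        rw [hform] at this
        linarith
      · left
        intro v
        rw [CFC.negPart_eq_zero_iff _ hz, ContinuousLinearMap.nonneg_iff_isPositive] at h
        have := h.2 v
        rw [ContinuousLinearMap.reApplyInnerSelf_apply] at this
        change 0 ≤ (inner ℂ ((y - (c : ℂ) • p) v) v : ℂ).re at this
        rw [hform] at this
        linarith)
  set c := (inner ℂ (y v₀) v₀ : ℂ).re / ‖p v₀‖ ^ 2
  refine ⟨c, ?_⟩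
  apply ContinuousLinearMap.coe_injective
  rw [← ext_inner_map]
  intro v
  change inner ℂ (y v) v = inner ℂ (((c : ℂ) • p) v) v
  rw [hyr, key v, smul_apply, inner_smul_left, hpp v]
  simp [c]

include hs hp hp₀ hpc hmin in
lemma exists_eq_smul_of_minimal {x : H →L[ℂ] H} (hx : ∀ A ∈ 𝒮, Commute x A) :
    ∃ c : ℂ, p * x * p = c • p := by
  have hps := hp.isSelfAdjoint.star_eq
  have hpi := hp.isIdempotentElem.eq
  have hxs : ∀ A ∈ 𝒮, Commute (star x) A := fun A hA => by
    have := (hx _ (hs A hA)).star_star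
    rwa [star_star] at this
  have key : ∀ y : H →L[ℂ] H, IsSelfAdjoint y → (∀ A ∈ 𝒮, Commute y A) →
      ∃ c : ℂ, p * y * p = c • p := by
    intro y hy hyc
    refine exists_eq_smul_of_isSelfAdjoint hs hp hp₀ hpc hmin ?_
      (fun A hA => ((hpc A hA).mul_left (hyc A hA)).mul_left (hpc A hA))
      (by rw [mul_assoc, hpi])
    rw [isSelfAdjoint_iff, star_mul, star_mul, hps, hy.star_eq, mul_assoc]
  obtain ⟨a, ha⟩ := key (x + star x) (IsSelfAdjoint.add_star_self x)
    (fun A hA => (hx A hA).add_left (hxs A hA))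
  obtain ⟨b, hb⟩ := key (Complex.I • (x - star x))
    (by rw [isSelfAdjoint_iff, star_smul, star_sub, star_star, Complex.star_def, Complex.conj_I,
          neg_smul, ← smul_neg, neg_sub])
    (fun A hA => ((hx A hA).sub_left (hxs A hA)).smul_left _)
  refine ⟨(2 : ℂ)⁻¹ * (a - Complex.I * b), ?_⟩
  have e : x = (2 : ℂ)⁻¹ • ((x + star x) - Complex.I • (Complex.I • (x - star x))) := by
    rw [smul_smul, Complex.I_mul_I]
    module
  conv_lhs => rw [e]
  rw [mul_smul_comm, smul_mul_assoc, mul_sub, sub_mul, ha, mul_smul_comm, smul_mul_assoc, hb]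
  module

end Minimal

omit [CompleteSpace H] in
-- Cayley-Hamilton for a two by two block matrix: the diagonal blocks are scalars `a`, `d`, and both
-- products of the off-diagonal blocks are the same scalar `e`, so trace `a + d` and determinant `a
-- d - e` make sense.
lemma exists_quadratic_of_corners {x p : H →L[ℂ] H} (hp : IsIdempotentElem p) (hp₀ : p ≠ 0)
    (hp₁ : 1 - p ≠ 0) {a d e e' : ℂ} (ha : p * x * p = a • p)
    (hd : (1 - p) * x * (1 - p) = d • (1 - p))
    (he : p * (x * (1 - p) * x) * p = e • p)
    (he' : (1 - p) * (x * p * x) * (1 - p) = e' • (1 - p)) :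
    ∃ l₁ l₂ : ℂ, (x - l₁ • 1) * (x - l₂ • 1) = 0 := by
  set q := 1 - p with hq
  have hpq : p * q = 0 := hp.mul_one_sub_self
  have hqp : q * p = 0 := hp.one_sub_mul_self
  have hqq : q * q = q := hp.one_sub.eq
  have hpp : p * p = p := hp.eq
  have h1 : p + q = 1 := by rw [hq]; abel
  have hyz : (p * x * q) * (q * x * p) = e • p := by
    rw [← he]; simp only [mul_assoc]; rw [← mul_assoc q q, hqq]
  have hzy : (q * x * p) * (p * x * q) = e' • q := by
    rw [← he']; simp only [mul_assoc]; rw [← mul_assoc p p, hpp]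
  -- The product `(p x q)(q x p)(p x q)` evaluates to `e` and to `e'` times `p x q`. If `p x q = 0`,
  -- both numbers vanish.
  have hee : e = e' := by
    by_cases hy : p * x * q = 0
    · rw [hy, zero_mul] at hyz
      rw [hy, mul_zero] at hzy
      rw [(smul_eq_zero.1 hyz.symm).resolve_right hp₀, (smul_eq_zero.1 hzy.symm).resolve_right hp₁]
    · have h : e • (p * x * q) = e' • (p * x * q) := by
        have h₁ : (p * x * q) * (q * x * p) * (p * x * q) = e • (p * x * q) := by
          rw [hyz, smul_mul_assoc, mul_assoc p x q, ← mul_assoc p p, hpp]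
        have h₂ : (p * x * q) * (q * x * p) * (p * x * q) = e' • (p * x * q) := by
          rw [mul_assoc (p * x * q), hzy, mul_smul_comm, mul_assoc (p * x), hqq]
        rw [← h₁, h₂]
      by_contra hne
      rw [← sub_eq_zero, ← sub_smul] at h
      exact (smul_eq_zero.1 h).elim (fun h => hne (sub_eq_zero.1 h)) hy
  -- A square root of the discriminant; the two witnesses are the roots of `X² - (a + d) X + (a d -
  -- e)`.
  obtain ⟨r, hr⟩ := IsAlgClosed.exists_pow_nat_eq ((a + d) ^ 2 - 4 * (a * d - e)) two_pos
  refine ⟨((a + d) + r) / 2, ((a + d) - r) / 2, ?_⟩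
  have hl : ((a + d) + r) / 2 * (((a + d) - r) / 2) = a * d - e := by linear_combination -hr / 4
  have expand : (x - (((a + d) + r) / 2) • (1 : H →L[ℂ] H)) * (x - (((a + d) - r) / 2) • 1) =
      x * x - (a + d) • x + (a * d - e) • 1 := by
    rw [← hl]
    simp only [sub_mul, mul_sub, smul_mul_assoc, mul_smul_comm, one_mul, mul_one]
    module
  rw [expand]
  have split : ∀ u v : H →L[ℂ] H, u * (x * x) * v = (u * x * p) * (p * x * v) +
      (u * x * q) * (q * x * v) := by
    intro u v
    have : (u * x * p) * (p * x * v) + (u * x * q) * (q * x * v) =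
        u * x * (p * p + q * q) * x * v := by noncomm_ring
    rw [this, hpp, hqq, h1, mul_one]
    noncomm_ring
  clear_value q
  have corner : ∀ (u v : H →L[ℂ] H) (b c : ℂ), u * (x * x - b • x + c • 1) * v =
      u * (x * x) * v - b • (u * x * v) + c • (u * v) := by
    intro u v b c
    simp only [mul_add, add_mul, mul_sub, sub_mul, mul_smul_comm, smul_mul_assoc, mul_one]
  have c₁ : p * (x * x - (a + d) • x + (a * d - e) • 1) * p = 0 := by
    rw [corner, split, hyz, ha, smul_mul_smul_comm, hpp]
    module
  have c₂ : q * (x * x - (a + d) • x + (a * d - e) • 1) * q = 0 := by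
    rw [corner, split, hzy, hd, smul_mul_smul_comm, hqq, hee]
    module
  have c₃ : p * (x * x - (a + d) • x + (a * d - e) • 1) * q = 0 := by
    rw [corner, split, ha, hd, hpq, smul_mul_assoc, mul_smul_comm, mul_assoc _ q q, hqq,
      ← mul_assoc p, ← mul_assoc p, hpp]
    module
  have c₄ : q * (x * x - (a + d) • x + (a * d - e) • 1) * p = 0 := by
    rw [corner, split, ha, hd, hqp, smul_mul_assoc, mul_smul_comm, mul_assoc _ p p, hpp,
      ← mul_assoc q, ← mul_assoc q, hqq]
    module
  set Z := x * x - (a + d) • x + (a * d - e) • (1 : H →L[ℂ] H)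
  calc Z = (p + q) * Z * (p + q) := by rw [h1, one_mul, mul_one]
    _ = p * Z * p + p * Z * q + (q * Z * p + q * Z * q) := by noncomm_ring
    _ = 0 := by rw [c₁, c₂, c₃, c₄]; simp

/-! ### Irreducible families of operators -/

section Irreducible

variable {𝒜 : Type*} [Ring 𝒜] [Algebra ℂ 𝒜] [StarRing 𝒜]
  {σ : 𝒜 →⋆ₐ[ℂ] (H →L[ℂ] H)} (hσ : ∀ T : H →L[ℂ] H, (∀ a, Commute T (σ a)) → ∃ c : ℂ, T = c • 1)

include hσ in
lemma dense_orbit_of_irreducible {ξ : H} (hξ : ξ ≠ 0) : Dense {v | ∃ a, σ a ξ = v} := by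
  let L : 𝒜 →ₗ[ℂ] H :=
    { toFun := fun a => σ a ξ
      map_add' := by simp
      map_smul' := by simp }
  set K := (LinearMap.range L).topologicalClosure with hK
  have hinv : ∀ a, ∀ v ∈ K, σ a v ∈ K := by
    intro a v hv
    refine map_mem_closure (σ a).continuous hv ?_
    rintro _ ⟨b, rfl⟩
    exact ⟨a * b, by simp [L]⟩
  obtain ⟨c, hc⟩ := hσ K.starProjection fun a =>
    (commute_starProjection K (hinv a) (by rw [← map_star]; exact hinv _)).symm
  have hξK : ξ ∈ K := Submodule.le_topologicalClosure _ ⟨1, by simp [L]⟩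
  have h₁ : K.starProjection ξ = ξ := Submodule.starProjection_eq_self_iff.2 hξK
  have hc₁ : c = 1 := by
    rw [hc] at h₁
    have : (c - 1) • ξ = 0 := by rw [sub_smul, one_smul]; exact sub_eq_zero.2 h₁
    exact sub_eq_zero.1 ((smul_eq_zero.1 this).resolve_right hξ)
  intro v
  have : K.starProjection v = v := by rw [hc, hc₁]; simp
  exact (Submodule.starProjection_eq_self_iff.1 this : v ∈ K)

include hσ in
-- On the dense orbit of `ξ`, `f` takes values in the line of `ξ`, because `f σ(a) ξ = f σ(a) f ξ`;
-- this line is closed.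
lemma rank_one_of_irreducible {f : H →L[ℂ] H} (hf : ∀ a, ∃ c : ℂ, f * σ a * f = c • f)
    {ξ : H} (hξ : ξ ≠ 0) (hfξ : f ξ = ξ) (v : H) : ∃ c : ℂ, f v = c • ξ := by
  have hcl : IsClosed {v : H | f v ∈ Submodule.span ℂ {ξ}} :=
    (Submodule.closed_of_finiteDimensional _).preimage f.continuous
  have : f v ∈ Submodule.span ℂ {ξ} := by
    refine closure_minimal (s := {v | ∃ a, σ a ξ = v}) ?_ hcl (dense_orbit_of_irreducible hσ hξ v)
    rintro _ ⟨a, rfl⟩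
    obtain ⟨c, hc⟩ := hf a
    have := congrArg (fun T : H →L[ℂ] H => T ξ) hc
    change f (σ a (f ξ)) = c • f ξ at this
    rw [hfξ] at this
    exact Submodule.mem_span_singleton.2 ⟨c, this.symm⟩
  obtain ⟨c, hc⟩ := Submodule.mem_span_singleton.1 this
  exact ⟨c, hc.symm⟩

end Irreducible

/-- A star algebra of operators containing a nonzero operator of finite rank contains a minimal
projection. -/
lemma exists_minimal_projection {A : StarSubalgebra ℂ (H →L[ℂ] H)} {x₀ : A} (hx₀ : x₀ ≠ 0)
    (hfin : FiniteDimensional ℂ (LinearMap.range ((x₀ : H →L[ℂ] H) : H →ₗ[ℂ] H))) :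
    ∃ e : A, e ≠ 0 ∧ e * e = e ∧ star e = e ∧ ∀ a : A, ∃ c : ℂ, e * a * e = c • e := by
  classical
  -- The minimal projection is obtained from a nonzero element `y` of least finite rank, as the
  -- normalization of `x = y⋆ y`.
  let P : ℕ → Prop := fun k => ∃ x : A, x ≠ 0 ∧
    FiniteDimensional ℂ (LinearMap.range ((x : H →L[ℂ] H) : H →ₗ[ℂ] H)) ∧
    Module.finrank ℂ (LinearMap.range ((x : H →L[ℂ] H) : H →ₗ[ℂ] H)) = k
  have hP : ∃ k, P k := ⟨_, x₀, hx₀, hfin, rfl⟩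
  obtain ⟨y, hy₀, hyf, hyk⟩ := Nat.find_spec hP
  have hmin : ∀ z : A, FiniteDimensional ℂ (LinearMap.range ((z : H →L[ℂ] H) : H →ₗ[ℂ] H)) →
      Module.finrank ℂ (LinearMap.range ((z : H →L[ℂ] H) : H →ₗ[ℂ] H)) < Nat.find hP → z = 0 := by
    intro z hz hlt
    by_contra h
    exact Nat.find_min hP hlt ⟨z, h, hz, rfl⟩
  set x : A := star y * y with hx
  have hx₀ : x ≠ 0 := fun h => hy₀ (Subtype.ext (eq_zero_of_star_mul_self (congrArg Subtype.val h)))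
  have hxs : star x = x := by rw [hx, star_mul, star_star]
  have hxr : LinearMap.range ((x : H →L[ℂ] H) : H →ₗ[ℂ] H) =
      (LinearMap.range ((y : H →L[ℂ] H) : H →ₗ[ℂ] H)).map
        (((star y : A) : H →L[ℂ] H) : H →ₗ[ℂ] H) := by
    rw [← LinearMap.range_comp]; rfl
  have hxf : FiniteDimensional ℂ (LinearMap.range ((x : H →L[ℂ] H) : H →ₗ[ℂ] H)) := by
    rw [hxr]; infer_instance
  have hxk : Module.finrank ℂ (LinearMap.range ((x : H →L[ℂ] H) : H →ₗ[ℂ] H)) ≤ Nat.find hP := by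
    rw [hxr, ← hyk]; exact Submodule.finrank_map_le _ _
  set R := LinearMap.range ((x : H →L[ℂ] H) : H →ₗ[ℂ] H) with hR
  have key : ∀ a : A, ∃ c : ℂ, x * a * x = c • x := by
    intro a
    let T : R →ₗ[ℂ] R := ((((x * a : A) : H →L[ℂ] H) : H →ₗ[ℂ] H).restrict
      (p := R) (q := R) fun v _ => ⟨(a : H →L[ℂ] H) v, rfl⟩)
    have hRn : Nontrivial R := by
      rw [Submodule.nontrivial_iff_ne_bot, Ne, hR, LinearMap.range_eq_bot]
      intro h
      exact hx₀ (Subtype.ext (ContinuousLinearMap.coe_injective h))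
    -- An eigenvalue `μ` of `x a` on the range of `x` makes the rank of `x a x - μ x` smaller than
    -- the minimum, so this element is zero.
    obtain ⟨μ, hμ⟩ := Module.End.exists_eigenvalue T
    obtain ⟨v, hv, hv₀⟩ := hμ.exists_hasEigenvector
    refine ⟨μ, ?_⟩
    rw [← sub_eq_zero]
    have hrange : LinearMap.range (((x * a * x - μ • x : A) : H →L[ℂ] H) : H →ₗ[ℂ] H) =
        (LinearMap.range (T - μ • 1)).map R.subtype := by
      ext w
      simp only [LinearMap.mem_range, Submodule.mem_map, exists_exists_eq_and]
      constructor
      · rintro ⟨u, rfl⟩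
        exact ⟨⟨(x : H →L[ℂ] H) u, u, rfl⟩, by simp [T]⟩
      · rintro ⟨⟨_, u, rfl⟩, rfl⟩
        exact ⟨u, by simp [T]⟩
    apply hmin
    · rw [hrange]; infer_instance
    · rw [hrange]
      refine (Submodule.finrank_map_le _ _).trans_lt (lt_of_lt_of_le ?_ hxk)
      have h₁ := LinearMap.finrank_range_add_finrank_ker (T - μ • 1)
      have h₂ : 0 < Module.finrank ℂ (LinearMap.ker (T - μ • 1)) := by
        rw [Module.finrank_pos_iff, Submodule.nontrivial_iff_ne_bot]
        intro h
        refine hv₀ ((Submodule.eq_bot_iff _).1 h v ?_)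
        rw [LinearMap.mem_ker]
        simpa [sub_eq_zero] using Module.End.mem_eigenspace_iff.1 hv
      omega
  obtain ⟨μ, hμ⟩ := key 1
  rw [mul_one] at hμ
  have hμ₀ : μ ≠ 0 := by
    rintro rfl
    rw [zero_smul] at hμ
    have h' : star x * x = 0 := by rw [hxs, hμ]
    exact hx₀ (Subtype.ext (eq_zero_of_star_mul_self (congrArg Subtype.val h')))
  have hμr : star μ = μ := by
    have h := congrArg star hμ
    rw [star_mul, hxs, hμ, star_smul, hxs, ← sub_eq_zero, ← sub_smul] at h
    exact (sub_eq_zero.1 ((smul_eq_zero.1 h).resolve_right hx₀)).symm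
  refine ⟨μ⁻¹ • x, smul_ne_zero (inv_ne_zero hμ₀) hx₀, ?_, ?_, fun a => ?_⟩
  · rw [smul_mul_smul_comm, hμ, smul_smul, mul_assoc, inv_mul_cancel₀ hμ₀, mul_one]
  · rw [star_smul, hxs, star_inv₀, hμr]
  · obtain ⟨c, hc⟩ := key a
    exact ⟨μ⁻¹ * c, by rw [smul_mul_assoc, smul_mul_smul_comm, hc]; module⟩

end OperatorTheory

end LQP

end

/-! ### Hecke data of an endomorphism, faithfulness of the left inverse, and absence of finite rank
operators. -/

noncomputable section

namespace LQP

section HeckeEndomorphism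

variable {H : Type*} [NormedAddCommGroup H] [InnerProductSpace ℂ H] [CompleteSpace H]

/-- The Hecke algebra generator `t - (1 + t) e` with eigenvalues `t` and `-1`. -/
def heckeGen {A : StarSubalgebra ℂ (H →L[ℂ] H)} (e : A) (t : ℂ) : A := t • 1 - (1 + t) • e

/-- An endomorphism `ρ` with left inverse `φ` of an algebra of operators, together with a
projection `e ∈ ρ²(A)'` such that the projections `ρ^k(e)` generate representations of the Hecke
algebras with parameter `t`. -/
structure HeckeEndo (A : StarSubalgebra ℂ (H →L[ℂ] H)) (ρ : A →⋆ₐ[ℂ] A) (φ : A →ₗ[ℂ] A) (e : A)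
    (t : ℂ) (η : ℝ) : Prop where
  norm_t : ‖t‖ = 1
  t_ne : 1 + t ≠ 0
  idem : e * e = e
  sa : star e = e
  e_comm : ∀ x, Commute e (ρ (ρ x))
  braid : e * ρ e * e - (t / (1 + t) ^ 2) • e = ρ e * e * ρ e - (t / (1 + t) ^ 2) • ρ e
  φ_one : φ 1 = 1
  φ_mul_ρ : ∀ x y, φ (x * ρ y) = φ x * y
  φ_ρ_mul : ∀ x y, φ (ρ x * y) = x * φ y
  φ_pos : ∀ x : A, (x : H →L[ℂ] H).IsPositive → (φ x : H →L[ℂ] H).IsPositive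
  φ_e : φ e = (η : ℂ) • 1
  η_pos : 0 < η
  η_lt : η < 1
  twist : ∀ x, (∃ n, ∀ y, Commute x ((ρ ^ n) y)) →
    φ (heckeGen e t * ρ x * star (heckeGen e t)) = ρ (φ x)
  faithful : t - (1 + t) * η ≠ 0 → ∀ x, (∃ n, ∀ y, Commute x ((ρ ^ n) y)) →
    φ (star x * x) = 0 → x = 0
  irred : ∀ x, (∀ y, Commute x (ρ y)) → ∃ c : ℂ, x = c • 1
  infinite : ∀ x : A, x ≠ 0 → ¬ FiniteDimensional ℂ (LinearMap.range ((x : H →L[ℂ] H) : H →ₗ[ℂ] H))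
  nontriv : Nontrivial H

end HeckeEndomorphism

section Endomorphism

variable {s : ℕ} {H : Type*} [NormedAddCommGroup H] [InnerProductSpace ℂ H] [CompleteSpace H]
  {N : HaagKastlerNet s H} {ρ : N.quasilocal →⋆ₐ[ℂ] N.quasilocal} {O₀ : DoubleCone s}
  {φ : N.quasilocal →ₗ[ℂ] N.quasilocal} {ε : N.quasilocal}

namespace HaagKastlerNet

attribute [local instance] isClosed_quasilocal

/-- `ρ` as a representation on the vacuum Hilbert space. -/
def asRepresentation (ρ : N.quasilocal →⋆ₐ[ℂ] N.quasilocal) :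
    N.quasilocal →⋆ₐ[ℂ] (H →L[ℂ] H) := N.quasilocal.subtype.comp ρ

lemma exists_eq_smul_one_of_commute (h₀ : IsLocalizedIn ρ O₀) (hirr : IsIrreducibleEndomorphism ρ)
    (T : H →L[ℂ] H) (hT : ∀ a, Commute T (asRepresentation ρ a)) : ∃ c : ℂ, T = c • 1 := by
  have hm : T ∈ N.alg O₀ := h₀.mem_alg_of_commute fun y => (hT y).eq
  obtain ⟨c, hc⟩ := hirr ⟨T, mem_quasilocal hm⟩ fun y => Subtype.ext (hT y).eq
  exact ⟨c, congrArg Subtype.val hc⟩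

/-- For `Y = ρ(x) ε⋆` one has `φ(Y) = λ̄ x`. The Schwarz inequality bounds `φ(Y)⋆ φ(Y)` by `φ(Y⋆
Y)`, which is `ρ(φ(x⋆ x)) = 0` by the twist identity. -/
lemma eq_zero_of_map_star_mul_self (hρ : IsLocalizedEndomorphism ρ) (hφ : IsLeftInverse ρ φ)
    (hε : IsStatisticsOperator ρ ε) {lam : ℂ} (hlam : φ ε = lam • 1) (hl : lam ≠ 0)
    {O : DoubleCone s} {x : N.quasilocal} (hx : (x : H →L[ℂ] H) ∈ N.alg O)
    (h : φ (star x * x) = 0) : x = 0 := by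
  set Y := ρ x * star ε with hY
  have hc : φ Y = star lam • x := by
    rw [hY, hφ.map_mul_left, hφ.map_star_eq, hlam, star_smul, star_one, mul_smul_comm, mul_one]
  have hYY : φ (star Y * Y) = 0 := by
    have : star Y * Y = ε * ρ (star x * x) * star ε := by
      rw [hY, star_mul, star_star, map_mul, map_star]; simp only [mul_assoc]
    rw [this, hε.twist hρ hφ (O := O) (mul_mem (star_mem hx) hx), h, map_zero]
  -- This is the proof of the Schwarz inequality: positivity of `φ` on the square of `Y - ρ(φ(Y))`.
  have hZ : φ (star (Y - ρ (φ Y)) * (Y - ρ (φ Y))) = - (star (φ Y) * φ Y) := by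
    have : star (Y - ρ (φ Y)) * (Y - ρ (φ Y)) = star Y * Y - ρ (star (φ Y)) * Y -
        star Y * ρ (φ Y) + ρ (star (φ Y)) * ρ (φ Y) := by
      rw [star_sub, ← map_star ρ]; noncomm_ring
    rw [this, map_add, map_sub, map_sub, hYY, hφ.map_mul_left, hφ.map_mul, hφ.map_mul,
      hφ.map_apply, hφ.map_star_eq Y]
    abel
  have hpos := hφ.positive (Y - ρ (φ Y))
  rw [hZ] at hpos
  have h0 : φ Y = 0 := by
    apply Subtype.ext
    ext v
    have := hpos.2 v
    rw [ContinuousLinearMap.reApplyInnerSelf_apply] at this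
    have e : inner ℂ (((-(star (φ Y) * φ Y) : N.quasilocal) : H →L[ℂ] H) v) v =
        -((‖(φ Y : H →L[ℂ] H) v‖ ^ 2 : ℝ) : ℂ) := by
      change inner ℂ (-(ContinuousLinearMap.adjoint (φ Y : H →L[ℂ] H) ((φ Y : H →L[ℂ] H) v))) v = _
      rw [inner_neg_left, ContinuousLinearMap.adjoint_inner_left, inner_self_eq_norm_sq_to_K]
      simp
    rw [e] at this
    rw [← Complex.ofReal_neg] at this
    have h2 : ‖(φ Y : H →L[ℂ] H) v‖ ^ 2 ≤ 0 := by
      have h2 : 0 ≤ -‖(φ Y : H →L[ℂ] H) v‖ ^ 2 := this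
      linarith
    have h3 : ‖(φ Y : H →L[ℂ] H) v‖ = 0 := by nlinarith [norm_nonneg ((φ Y : H →L[ℂ] H) v)]
    simpa using h3
  rw [h0] at hc
  exact (smul_eq_zero.1 hc.symm).resolve_left (star_ne_zero.2 hl)

lemma commute_of_local (T : H →L[ℂ] H) (O₀ : DoubleCone s)
    (h : ∀ (O : DoubleCone s) (A : N.quasilocal), (A : H →L[ℂ] H) ∈ N.alg O →
      Commute T (asRepresentation ρ A)) (x : N.quasilocal) : Commute T (asRepresentation ρ x) := by
  open scoped CStarAlgebra in
  have hc : Continuous ρ := map_continuous ρ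
  have hc' : Continuous (asRepresentation ρ) := continuous_subtype_val.comp hc
  exact quasilocal_induction O₀ (p := fun x => Commute T (asRepresentation ρ x))
    (isClosed_eq (by fun_prop) (by fun_prop)) h x

lemma HasTwoIrreducibleComponents.not_scalar (htwo : HasTwoIrreducibleComponents (ρ.comp ρ)) :
    ∃ p : H →L[ℂ] H, (∀ a, Commute p (asRepresentation ρ (ρ a))) ∧ ∀ c : ℂ, p ≠ c • 1 := by
  obtain ⟨p, ⟨⟨hp, hpc⟩, hp₀, -⟩, -, hp₁, -⟩ := htwo
  refine ⟨p, fun a => hpc a, ?_⟩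
  rintro c rfl
  have := hp.isIdempotentElem.eq
  rw [smul_mul_smul_comm, mul_one, ← sub_eq_zero, ← sub_smul] at this
  have h1 : (1 : H →L[ℂ] H) ≠ 0 := fun h => hp₀ (by rw [h, smul_zero])
  have hc := (smul_eq_zero.1 this).resolve_right h1
  have : c * (c - 1) = 0 := by linear_combination hc
  rcases mul_eq_zero.1 this with h | h
  · exact hp₀ (by rw [h, zero_smul])
  · exact hp₁ (by rw [sub_eq_zero.1 h, one_smul, sub_self])

/-- The statistics parameter of an endomorphism with reducible square is not a phase. -/
lemma norm_statisticsParameter_ne_one (hρ : IsLocalizedEndomorphism ρ)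
    (hirr : IsIrreducibleEndomorphism ρ) (htwo : HasTwoIrreducibleComponents (ρ.comp ρ))
    (hφ : IsLeftInverse ρ φ) (hε : IsStatisticsOperator ρ ε) {lam : ℂ}
    (hlam : φ ε = lam • 1) : ‖lam‖ ≠ 1 := by
  intro hl
  obtain ⟨O₀, h₀⟩ := hρ.1
  obtain ⟨p, hpc, hps⟩ := htwo.not_scalar
  have hl0 : lam ≠ 0 := by rintro rfl; simp at hl
  have hll : star lam * lam = 1 := by
    rw [Complex.star_def, Complex.conj_mul', hl]; simp
  have hu := hε.star_mul_self hρ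
  -- `φ((ε - λ)⋆ (ε - λ)) = 1 - |λ|² = 0`, and `φ` is faithful on local elements because `λ ≠ 0`.
  have hεl : ε - lam • 1 = 0 := by
    refine eq_zero_of_map_star_mul_self hρ hφ hε hlam hl0 (O := O₀) (sub_mem
      (hε.mem_alg hρ h₀) ((N.alg O₀).toStarSubalgebra.smul_mem (one_mem _) lam)) ?_
    have : star (ε - lam • 1) * (ε - lam • 1) = 1 - lam • star ε - star lam • ε +
        (star lam * lam) • 1 := by
      rw [star_sub, star_smul, star_one, sub_mul, mul_sub, hu.1]
      simp only [mul_sub, smul_mul_assoc, mul_smul_comm, one_mul, mul_one]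
      module
    rw [this, hll, map_add, map_sub, map_sub, map_smul, map_smul, map_smul, hφ.map_one,
      hφ.map_star_eq, hlam, star_smul, star_one, smul_smul, smul_smul, hll, mul_comm lam, hll]
    module
  have hεl : ε = lam • 1 := sub_eq_zero.1 hεl
  -- A scalar `ε` drops out of the twist identity and leaves `ρ(φ(A)) = A`. So the range of `ρ`
  -- contains every local algebra, and an operator commuting with `ρ²(𝒜)` commutes with `ρ(𝒜)`.
  have hloc : ∀ (O : DoubleCone s) (A : N.quasilocal), (A : H →L[ℂ] H) ∈ N.alg O →
      ρ (φ A) = A := by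
    intro O A hA
    have := hε.twist hρ hφ hA
    rw [hεl, star_smul, star_one, smul_mul_assoc, one_mul, mul_smul_comm, mul_one, smul_smul, hll,
      one_smul, hφ.map_apply] at this
    exact this.symm
  have : ∀ x, Commute p (asRepresentation ρ x) := commute_of_local p O₀ fun O A hA => by
    rw [← hloc O A hA]; exact hpc _
  obtain ⟨c, hc⟩ := exists_eq_smul_one_of_commute h₀ hirr p this
  exact hps c hc

/-- There are no nonzero operators of finite rank in the quasilocal algebra. -/
lemma infiniteDimensional_range (hρ : IsLocalizedEndomorphism ρ)
    (hirr : IsIrreducibleEndomorphism ρ) (htwo : HasTwoIrreducibleComponents (ρ.comp ρ))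
    (hφ : IsLeftInverse ρ φ) (x : N.quasilocal) (hx : x ≠ 0) :
    ¬ FiniteDimensional ℂ (LinearMap.range ((x : H →L[ℂ] H) : H →ₗ[ℂ] H)) := by
  intro hfin
  obtain ⟨O₀, h₀⟩ := hρ.1
  obtain ⟨p, hpc, hps⟩ := htwo.not_scalar
  have hirr' := exists_eq_smul_one_of_commute h₀ hirr
  have hinj : Function.Injective ρ := fun a b h => by
    rw [← hφ.map_apply a, h, hφ.map_apply]
  open scoped CStarAlgebra in
  have hc : Continuous ρ := map_continuous ρ
  have hc' : Continuous (asRepresentation ρ) := continuous_subtype_val.comp hc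
  obtain ⟨e, he₀, hee, hes, he⟩ := exists_minimal_projection hx hfin
  have exists_vec : ∀ f : N.quasilocal, f ≠ 0 → f * f = f →
      ∃ ξ : H, ξ ≠ 0 ∧ (f : H →L[ℂ] H) ξ = ξ := by
    intro f hf hff
    obtain ⟨v, hv⟩ : ∃ v, (f : H →L[ℂ] H) v ≠ 0 := by
      by_contra! h
      exact hf (Subtype.ext (ContinuousLinearMap.ext h))
    exact ⟨_, hv, congrArg (fun T : N.quasilocal => (T : H →L[ℂ] H) v) hff⟩
  have hρe₀ : ρ e ≠ 0 := fun h => he₀ (hinj (by rw [h, map_zero]))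
  have hρee : ρ e * ρ e = ρ e := by rw [← map_mul, hee]
  obtain ⟨ξ, hξ, hρξ⟩ := exists_vec _ hρe₀ hρee
  have hρρe₀ : ρ (ρ e) ≠ 0 := fun h => hρe₀ (hinj (by rw [h, map_zero]))
  obtain ⟨ζ, hζ, hρζ⟩ := exists_vec _ hρρe₀ (by rw [← map_mul, hρee])
  -- Compressions of `ρ(𝒜)` by `ρ(e)` are scalars since `e` is minimal. As `ρ(𝒜)` is irreducible,
  -- `ρ(e)` has rank one.
  have hrank : ∀ v, ∃ c : ℂ, (ρ e : H →L[ℂ] H) v = c • ξ := by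
    refine rank_one_of_irreducible (σ := asRepresentation ρ) hirr' (fun a => ?_) hξ hρξ
    obtain ⟨c, hc⟩ := he a
    refine ⟨c, ?_⟩
    have := congrArg ρ hc
    rw [map_mul, map_mul, map_smul] at this
    exact congrArg Subtype.val this
  -- Since `ρ(e)` has rank one and the orbit `ρ(𝒜) ξ` is dense, `B ρ(e)` is a norm limit of elements
  -- `ρ(a) ρ(e) = ρ(a e)`. Hence `p`, which commutes with `ρ²(𝒜)`, commutes with `ρ(B ρ(e))`.
  have hcomm : ∀ B : N.quasilocal, Commute p (asRepresentation ρ (B * ρ e)) := by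
    intro B
    have hcl : IsClosed {x : N.quasilocal | Commute p (asRepresentation ρ x)} :=
      isClosed_eq (by fun_prop) (by fun_prop)
    have hmem : B * ρ e ∈ closure {x : N.quasilocal | ∃ a, x = ρ (a * e)} := by
      rw [Metric.mem_closure_iff]
      intro δ hδ
      have hξ' : 0 < ‖ξ‖ := norm_pos_iff.2 hξ
      set K := ‖(ρ e : H →L[ℂ] H)‖ + 1
      have hK : 0 < K := by positivity
      obtain ⟨_, ⟨a, rfl⟩, ha⟩ := Metric.mem_closure_iff.1
        (dense_orbit_of_irreducible (σ := asRepresentation ρ) hirr' hξ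
          ((B : H →L[ℂ] H) ξ)) (δ / (2 * K) * ‖ξ‖) (by positivity)
      refine ⟨_, ⟨a, rfl⟩, ?_⟩
      rw [dist_eq_norm] at ha ⊢
      have : ‖((B * ρ e - ρ (a * e) : N.quasilocal) : H →L[ℂ] H)‖ ≤ δ / 2 := by
        refine ContinuousLinearMap.opNorm_le_bound _ (by positivity) fun v => ?_
        obtain ⟨c, hc⟩ := hrank v
        have e₁ : ((B * ρ e - ρ (a * e) : N.quasilocal) : H →L[ℂ] H) v =
            c • ((B : H →L[ℂ] H) ξ - asRepresentation ρ a ξ) := by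
          rw [map_mul]
          change (B : H →L[ℂ] H) ((ρ e : H →L[ℂ] H) v) -
            (ρ a : H →L[ℂ] H) ((ρ e : H →L[ℂ] H) v) = _
          rw [hc, map_smul, map_smul, smul_sub]; rfl
        have e₂ : ‖c‖ * ‖ξ‖ ≤ K * ‖v‖ := by
          rw [← norm_smul, ← hc]
          exact ((ρ e : H →L[ℂ] H).le_opNorm v).trans
            (mul_le_mul_of_nonneg_right (by simp [K]) (norm_nonneg _))
        rw [e₁, norm_smul]
        calc ‖c‖ * ‖(B : H →L[ℂ] H) ξ - asRepresentation ρ a ξ‖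
            ≤ ‖c‖ * (δ / (2 * K) * ‖ξ‖) := by gcongr
          _ = (‖c‖ * ‖ξ‖) * (δ / (2 * K)) := by ring
          _ ≤ (K * ‖v‖) * (δ / (2 * K)) := by gcongr
          _ = δ / 2 * ‖v‖ := by field_simp
      exact this.trans_lt (by linarith)
    refine closure_minimal ?_ hcl hmem
    rintro _ ⟨a, rfl⟩
    exact hpc _
  -- The vectors `ρ(C ρ(e)) ζ = ρ(C) ζ` are dense, and `p` commutes with `ρ(C ρ(e))` and with `ρ(B C
  -- ρ(e))`. Therefore `p` commutes with `ρ(B)`, which irreducibility excludes.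
  have : ∀ B, Commute p (asRepresentation ρ B) := by
    intro B
    have hzero : ∀ v, (p * asRepresentation ρ B - asRepresentation ρ B * p) v = 0 := by
      refine fun v => closure_minimal (s := {v | ∃ a, asRepresentation ρ a ζ = v})
        (t := {v | (p * asRepresentation ρ B - asRepresentation ρ B * p) v = 0}) ?_
        (isClosed_eq (by fun_prop) continuous_const)
        (dense_orbit_of_irreducible (σ := asRepresentation ρ) hirr' hζ v)
      rintro _ ⟨C, rfl⟩
      have h₁ : asRepresentation ρ C ζ = asRepresentation ρ (C * ρ e) ζ := by
        rw [map_mul]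
        change _ = asRepresentation ρ C ((ρ (ρ e) : H →L[ℂ] H) ζ)
        rw [hρζ]
      have h₂ : (p * asRepresentation ρ B - asRepresentation ρ B * p) *
          asRepresentation ρ (C * ρ e) = 0 := by
        rw [sub_mul, mul_assoc, mul_assoc, (hcomm C).eq, ← mul_assoc (asRepresentation ρ B),
          ← map_mul, ← mul_assoc B, (hcomm (B * C)).eq, sub_self]
      rw [Set.mem_ofPred_eq, h₁]
      exact congrArg (fun T : H →L[ℂ] H => T ζ) h₂
    exact sub_eq_zero.1 (ContinuousLinearMap.ext hzero)
  obtain ⟨c, hc⟩ := hirr' p this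
  exact hps c hc

end HaagKastlerNet

end Endomorphism

end LQP

end

/-! ### The two eigenvalues of the statistics operator and its normalization to a Hecke generator.
-/

noncomputable section

namespace LQP

lemma eq_zero_of_normal_of_sq {H : Type*} [NormedAddCommGroup H] [InnerProductSpace ℂ H]
    [CompleteSpace H] {x : H →L[ℂ] H} (hn : Commute (star x) x) (h : x * x = 0) : x = 0 := by
  apply eq_zero_of_star_mul_self
  apply eq_zero_of_star_mul_self
  rw [star_mul, star_star, mul_assoc, ← mul_assoc x, ← hn.eq, mul_assoc (star x) x x, h]
  simp

/-- Expanding with `e² = e` and `f² = f`, the terms symmetric in `e` and `f` cancel, and the braid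
relation reduces to `k³ (e f e - f e f) = a k (a + k) (f - e)`. -/
lemma braid_of_generator {R : Type*} [Ring R] [Algebra ℂ R] {e f : R} (he : e * e = e)
    (hf : f * f = f) {a k : ℂ} (hk : k ≠ 0)
    (h : (a • 1 + k • e) * (a • 1 + k • f) * (a • 1 + k • e) =
      (a • 1 + k • f) * (a • 1 + k • e) * (a • 1 + k • f)) :
    e * f * e - (-(a * (a + k)) / k ^ 2) • e = f * e * f - (-(a * (a + k)) / k ^ 2) • f := by
  have expand : ∀ e f : R, e * e = e → (a • 1 + k • e) * (a • 1 + k • f) * (a • 1 + k • e) =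
      a ^ 3 • (1 : R) + (2 * a ^ 2 * k + a * k ^ 2) • e + (a ^ 2 * k) • f +
        (a * k ^ 2) • (e * f + f * e) + k ^ 3 • (e * f * e) := by
    intro e f he
    simp only [add_mul, mul_add, smul_mul_assoc, mul_smul_comm, one_mul, mul_one, he]
    module
  rw [expand e f he, expand f e hf, add_comm (f * e)] at h
  have h' : k ^ 3 • (e * f * e - (-(a * (a + k)) / k ^ 2) • e) =
      k ^ 3 • (f * e * f - (-(a * (a + k)) / k ^ 2) • f) := by
    rw [smul_sub, smul_sub, smul_smul, smul_smul]
    have : k ^ 3 * (-(a * (a + k)) / k ^ 2) = -(a * (a + k) * k) := by field_simp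
    rw [this]
    have h₂ := sub_eq_zero.2 h
    rw [← sub_eq_zero, ← h₂]
    module
  exact smul_right_injective R (pow_ne_zero 3 hk) h'

section

variable {s : ℕ} {H : Type*} [NormedAddCommGroup H] [InnerProductSpace ℂ H] [CompleteSpace H]
  {N : HaagKastlerNet s H} {ρ : N.quasilocal →⋆ₐ[ℂ] N.quasilocal}
  {φ : N.quasilocal →ₗ[ℂ] N.quasilocal} {ε : N.quasilocal}

namespace HaagKastlerNet

attribute [local instance] isClosed_quasilocal

/-- Both projections `p` and `1 - p` are minimal in the commutant of `ρ²(𝒜)`. So all elements of the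
commutant have scalar corners, in particular `x`, `x (1 - p) x` and `x p x`. -/
lemma HasTwoIrreducibleComponents.exists_quadratic
    (htwo : HasTwoIrreducibleComponents (ρ.comp ρ)) {x : H →L[ℂ] H}
    (hx : ∀ a, Commute x (asRepresentation ρ (ρ a))) :
    ∃ l₁ l₂ : ℂ, (x - l₁ • 1) * (x - l₂ • 1) = 0 := by
  obtain ⟨p, ⟨⟨hp, hpc⟩, hp₀, hpm⟩, ⟨⟨hq, hqc⟩, hq₀, hqm⟩⟩ := htwo
  set 𝒮 : Set (H →L[ℂ] H) := Set.range fun a => asRepresentation ρ (ρ a) with h𝒮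
  have hs : ∀ A ∈ 𝒮, star A ∈ 𝒮 := by
    rintro _ ⟨a, rfl⟩
    refine ⟨star a, ?_⟩
    change asRepresentation ρ (ρ (star a)) = star (asRepresentation ρ (ρ a))
    rw [map_star, map_star]
  have hp𝒮 : ∀ A ∈ 𝒮, Commute p A := by rintro _ ⟨a, rfl⟩; exact hpc a
  have hq𝒮 : ∀ A ∈ 𝒮, Commute (1 - p) A := by rintro _ ⟨a, rfl⟩; exact hqc a
  have hx𝒮 : ∀ A ∈ 𝒮, Commute x A := by rintro _ ⟨a, rfl⟩; exact hx a
  have key₁ : ∀ y : H →L[ℂ] H, (∀ A ∈ 𝒮, Commute y A) → ∃ c : ℂ, p * y * p = c • p := fun y hy =>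
    exists_eq_smul_of_minimal hs hp hp₀ hp𝒮
      (fun r hr hrc => hpm r ⟨hr, fun a => (hrc _ ⟨a, rfl⟩).eq⟩) hy
  have key₂ : ∀ y : H →L[ℂ] H, (∀ A ∈ 𝒮, Commute y A) →
      ∃ c : ℂ, (1 - p) * y * (1 - p) = c • (1 - p) := fun y hy =>
    exists_eq_smul_of_minimal hs hq hq₀ hq𝒮
      (fun r hr hrc => hqm r ⟨hr, fun a => (hrc _ ⟨a, rfl⟩).eq⟩) hy
  obtain ⟨a, ha⟩ := key₁ x hx𝒮
  obtain ⟨d, hd⟩ := key₂ x hx𝒮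
  obtain ⟨e, he⟩ := key₁ (x * (1 - p) * x)
    fun A hA => ((hx𝒮 A hA).mul_left (hq𝒮 A hA)).mul_left (hx𝒮 A hA)
  obtain ⟨e', he'⟩ := key₂ (x * p * x)
    fun A hA => ((hx𝒮 A hA).mul_left (hp𝒮 A hA)).mul_left (hx𝒮 A hA)
  exact exists_quadratic_of_corners hp.isIdempotentElem hp₀ hq₀ ha hd he he'

variable (hρ : IsLocalizedEndomorphism ρ) (hirr : IsIrreducibleEndomorphism ρ)
  (htwo : HasTwoIrreducibleComponents (ρ.comp ρ)) (hφ : IsLeftInverse ρ φ)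
  (hε : IsStatisticsOperator ρ ε)

include hρ hirr htwo hφ hε in
lemma ne_smul_one {c : ℂ} : ε ≠ c • 1 := by
  intro h
  have hn : Nontrivial H := ⟨N.Ω, 0, fun h => by simpa [h] using N.norm_Ω⟩
  have hu := (hε.star_mul_self hρ).1
  refine norm_statisticsParameter_ne_one hρ hirr htwo hφ hε (lam := c) ?_ ?_
  · rw [h, map_smul, hφ.map_one]
  · rw [h, star_smul, star_one, smul_mul_smul_comm, mul_one] at hu
    have h1 : star c * c = 1 := by
      have h2 := congrArg (fun T : N.quasilocal => (T : H →L[ℂ] H) N.Ω) hu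
      have h3 : (star c * c) • N.Ω = (1 : ℂ) • N.Ω := by rw [one_smul]; exact h2
      have hΩ : N.Ω ≠ 0 := fun h => by simpa [h] using N.norm_Ω
      exact smul_left_injective ℂ hΩ h3
    rw [Complex.star_def, Complex.conj_mul'] at h1
    have h4 : ‖c‖ ^ 2 = 1 := by exact_mod_cast h1
    nlinarith [norm_nonneg c]

include hρ hirr htwo hφ hε in
lemma exists_eigenvalues : ∃ l₁ l₂ : ℂ, l₁ ≠ l₂ ∧ (ε - l₁ • 1) * (ε - l₂ • 1) = 0 := by
  obtain ⟨l₁, l₂, h⟩ := htwo.exists_quadratic (x := ε)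
    fun a => congrArg Subtype.val (hε.commute hρ a).eq
  refine ⟨l₁, l₂, ?_, Subtype.ext h⟩
  -- A double root would make the normal operator `ε - l₁` nilpotent, hence zero.
  rintro rfl
  refine ne_smul_one hρ hirr htwo hφ hε (c := l₁) (Subtype.ext (sub_eq_zero.1 ?_))
  refine eq_zero_of_normal_of_sq ?_ h
  have hu := hε.star_mul_self hρ
  have hu' : Commute (star ε) ε := by
    change _ = _
    rw [hu.1, hu.2]
  have h1 : Commute (star (ε - l₁ • (1 : N.quasilocal))) (ε - l₁ • (1 : N.quasilocal)) := by
    rw [star_sub, star_smul, star_one]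
    exact ((hu'.sub_right ((Commute.one_right _).smul_right _))).sub_left
      ((Commute.one_left _).smul_left _)
  exact congrArg Subtype.val h1.eq

lemma eigenprojection_add {l₁ l₂ : ℂ} (h : l₁ ≠ l₂) :
    eigenprojection ε l₁ l₂ = 1 - eigenprojection ε l₂ l₁ := by
  have h₁ : l₁ - l₂ ≠ 0 := sub_ne_zero.2 h
  have : (l₂ - l₁)⁻¹ = -(l₁ - l₂)⁻¹ := by rw [← neg_sub, inv_neg]
  rw [eigenprojection, eigenprojection, this]
  have e : (1 : N.quasilocal) - -(l₁ - l₂)⁻¹ • (ε - l₁ • 1) =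
      ((l₁ - l₂)⁻¹ * (l₁ - l₂)) • 1 - -(l₁ - l₂)⁻¹ • (ε - l₁ • 1) := by
    rw [inv_mul_cancel₀ h₁, one_smul]
  rw [e]
  module

include hρ hirr htwo hφ hε in
lemma norm_eigenvalue {l₁ l₂ : ℂ} (h : (ε - l₁ • 1) * (ε - l₂ • 1) = 0) : ‖l₁‖ = 1 := by
  set E := ε - l₂ • 1
  have hE : E ≠ 0 := fun h => ne_smul_one hρ hirr htwo hφ hε (sub_eq_zero.1 h)
  have hεE : ε * E = l₁ • E := by
    rw [sub_mul, smul_mul_assoc, one_mul] at h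
    exact sub_eq_zero.1 h
  have hEE : star E * E ≠ 0 := fun h => hE (Subtype.ext
    (eq_zero_of_star_mul_self (congrArg Subtype.val h)))
  have h1 : star E * E = (star l₁ * l₁) • (star E * E) := by
    have h2 : star (ε * E) * (ε * E) = star E * E := by
      rw [star_mul, mul_assoc, ← mul_assoc (star ε), (hε.star_mul_self hρ).1, one_mul]
    rw [hεE, star_smul, smul_mul_smul_comm] at h2
    exact h2.symm
  have h4 : (1 - star l₁ * l₁) • (star E * E) = 0 := by
    rw [sub_smul, one_smul, ← h1, sub_self]
  have h5 := (smul_eq_zero.1 h4).resolve_right hEE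
  rw [Complex.star_def, Complex.conj_mul'] at h5
  have h6 : ‖l₁‖ ^ 2 = 1 := by
    have := sub_eq_zero.1 h5
    exact_mod_cast this.symm
  nlinarith [norm_nonneg l₁]

lemma coeff_of_isPositive {c : ℂ} (h : ((c • 1 : N.quasilocal) : H →L[ℂ] H).IsPositive) :
    ∃ r : ℝ, 0 ≤ r ∧ c = r := by
  have h₁ := h.2 N.Ω
  have h₂ : inner ℂ (((c • 1 : N.quasilocal) : H →L[ℂ] H) N.Ω) N.Ω = conj c := by
    change inner ℂ (c • N.Ω) N.Ω = _
    rw [inner_smul_left, inner_self_eq_norm_sq_to_K, N.norm_Ω]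
    simp
  rw [ContinuousLinearMap.reApplyInnerSelf_apply, h₂] at h₁
  have h₃ := h.isSelfAdjoint.isSymmetric N.Ω N.Ω
  have h₄ : inner ℂ N.Ω (((c • 1 : N.quasilocal) : H →L[ℂ] H) N.Ω) = c := by
    change inner ℂ N.Ω (c • N.Ω) = _
    rw [inner_smul_right, inner_self_eq_norm_sq_to_K, N.norm_Ω]
    simp
  change inner ℂ (((c • 1 : N.quasilocal) : H →L[ℂ] H) N.Ω) N.Ω =
    inner ℂ N.Ω (((c • 1 : N.quasilocal) : H →L[ℂ] H) N.Ω) at h₃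
  rw [h₂, h₄] at h₃
  exact ⟨c.re, by simpa using h₁, (Complex.conj_eq_iff_re.1 h₃).symm⟩

include hρ hirr htwo hφ hε in
/-- The statistics operator of an endomorphism with two channels, with labelled eigenvalues,
generates Hecke algebra representations. -/
theorem heckeEndo_of_eigenvalues {l₁ l₂ : ℂ} (hl : l₁ ≠ l₂)
    (h : (ε - l₁ • 1) * (ε - l₂ • 1) = 0) :
    ‖l₁‖ = 1 ∧ ‖l₂‖ = 1 ∧
      ε = (-l₂) • heckeGen (eigenprojection ε l₂ l₁) (-(l₁ / l₂)) ∧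
      ∃ η : ℝ, HeckeEndo N.quasilocal ρ φ (eigenprojection ε l₂ l₁) (-(l₁ / l₂)) η := by
  have hcomm : (ε - l₂ • 1) * (ε - l₁ • 1) = 0 := by
    rw [← h]; simp only [sub_mul, mul_sub, smul_mul_assoc, mul_smul_comm, one_mul, mul_one]; module
  have n₁ := norm_eigenvalue hρ hirr htwo hφ hε h
  have n₂ := norm_eigenvalue hρ hirr htwo hφ hε hcomm
  have z₁ : l₁ ≠ 0 := by rintro rfl; simp at n₁
  have z₂ : l₂ ≠ 0 := by rintro rfl; simp at n₂
  have s₁ : star l₁ = l₁⁻¹ := by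
    refine eq_inv_of_mul_eq_one_left ?_
    rw [Complex.star_def, Complex.conj_mul', n₁]; simp
  have s₂ : star l₂ = l₂⁻¹ := by
    refine eq_inv_of_mul_eq_one_left ?_
    rw [Complex.star_def, Complex.conj_mul', n₂]; simp
  have hd : l₂ - l₁ ≠ 0 := sub_ne_zero.2 hl.symm
  set e := eigenprojection ε l₂ l₁ with he
  have hεe : ε = l₁ • 1 + (l₂ - l₁) • e := by
    rw [he, eigenprojection, smul_smul, mul_inv_cancel₀ hd, one_smul]; abel
  have hu := hε.star_mul_self hρ
  have hee : e * e = e := by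
    have : (ε - l₁ • 1) * (ε - l₁ • 1) = (l₂ - l₁) • (ε - l₁ • 1) := by
      rw [← sub_eq_zero, ← h]
      simp only [sub_mul, mul_sub, smul_mul_assoc, mul_smul_comm, one_mul, mul_one]; module
    rw [he, eigenprojection, smul_mul_smul_comm, this, smul_smul]
    congr 1
    field_simp
  have hes : star e = e := by
    -- Multiplying the quadratic equation by `ε⋆` and using unitarity expresses `ε⋆` as an affine
    -- function of `ε`.
    have h2 : l₁ • l₂ • star ε = (l₁ + l₂) • 1 - ε := by
      have h3 : ε * ε - (l₁ + l₂) • ε + (l₁ * l₂) • 1 = 0 := by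
        rw [← h]
        simp only [sub_mul, mul_sub, smul_mul_assoc, mul_smul_comm, one_mul, mul_one]; module
      have h4 := congrArg (star ε * ·) h3
      simp only [mul_add, mul_sub, mul_smul_comm, ← mul_assoc, hu.1, mul_one, one_mul,
        mul_zero] at h4
      rw [← sub_eq_zero, ← h4]
      module
    have h5 : star ε = (l₁ * l₂)⁻¹ • ((l₁ + l₂) • 1 - ε) := by
      rw [← h2, smul_smul, smul_smul, mul_assoc, inv_mul_cancel₀ (mul_ne_zero z₁ z₂), one_smul]
    rw [he, eigenprojection, star_smul, star_sub, star_smul, star_one, h5, star_inv₀, star_sub, s₁,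
      s₂]
    have h6 : (l₂⁻¹ - l₁⁻¹)⁻¹ = -(l₁ * l₂ * (l₂ - l₁)⁻¹) := by
      have : l₂⁻¹ - l₁⁻¹ = -((l₂ - l₁) / (l₁ * l₂)) := by field_simp; ring
      rw [this, inv_neg, inv_div, div_eq_mul_inv]
    rw [h6]
    have h7 : (l₁ * l₂)⁻¹ • ((l₁ + l₂) • (1 : N.quasilocal) - ε) - l₁⁻¹ • 1 =
        (l₁ * l₂)⁻¹ • (l₁ • 1 - ε) := by
      have : l₁⁻¹ = (l₁ * l₂)⁻¹ * l₂ := by field_simp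
      rw [this]; module
    rw [h7, smul_smul]
    have h8 : -(l₁ * l₂ * (l₂ - l₁)⁻¹) * (l₁ * l₂)⁻¹ = -(l₂ - l₁)⁻¹ := by field_simp
    rw [h8]; module
  have he_comm : ∀ x, Commute e (ρ (ρ x)) := fun x =>
    ((hε.commute hρ x).sub_left ((Commute.one_left _).smul_left _)).smul_left _
  -- Since `e ∈ ρ²(𝒜)'`, the bimodule property makes `φ(e)` commute with `ρ(𝒜)`, so it is a scalar.
  obtain ⟨c, hc⟩ : ∃ c : ℂ, φ e = c • 1 := by
    refine hirr _ fun A => ?_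
    rw [← hφ.map_mul_left, ← hφ.map_mul, (he_comm A).eq]
  obtain ⟨η, hη₀, hcη⟩ := coeff_of_isPositive (N := N) (c := c) (by
    have : c • (1 : N.quasilocal) = φ (star e * e) := by rw [hes, hee, hc]
    rw [this]
    exact hφ.positive _)
  obtain ⟨η', hη₀', hcη'⟩ := coeff_of_isPositive (N := N) (c := 1 - c) (by
    have : ((1 - c) • (1 : N.quasilocal)) = φ (star (1 - e) * (1 - e)) := by
      rw [star_sub, hes, star_one, show (1 - e) * (1 - e) = 1 - e by
        rw [mul_sub, sub_mul _ _ e, hee]; simp, map_sub, hc, hφ.map_one, sub_smul, one_smul]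
    rw [this]
    exact hφ.positive _)
  have hη₁ : η ≤ 1 := by
    have : ((1 - η : ℝ) : ℂ) = (η' : ℝ) := by rw [← hcη', hcη]; simp
    have := Complex.ofReal_injective this
    linarith
  subst hcη
  have hlam : φ ε = (l₁ + (l₂ - l₁) * η) • 1 := by
    conv_lhs => rw [hεe]
    rw [map_add, map_smul, map_smul, hφ.map_one, hc, smul_smul, add_smul]
  -- For `η = 0` or `η = 1` the statistics parameter would be one of the two eigenvalues, hence a
  -- phase.
  have hη0 : η ≠ 0 := by
    rintro rfl
    refine norm_statisticsParameter_ne_one hρ hirr htwo hφ hε hlam ?_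
    simpa using n₁
  have hη1 : η ≠ 1 := by
    rintro rfl
    refine norm_statisticsParameter_ne_one hρ hirr htwo hφ hε hlam ?_
    simpa using n₂
  have hgen : ε = (-l₂) • heckeGen e (-(l₁ / l₂)) := by
    rw [hεe, heckeGen, smul_sub, smul_smul, smul_smul]
    have e₁ : -l₂ * -(l₁ / l₂) = l₁ := by field_simp
    have e₂ : -l₂ * (1 + -(l₁ / l₂)) = -(l₂ - l₁) := by field_simp; ring
    rw [e₁, e₂]; module
  obtain ⟨O₀, h₀⟩ := hρ.1
  have hlocal : ∀ x : N.quasilocal, (∃ n, ∀ y, Commute x ((ρ ^ n) y)) →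
      (x : H →L[ℂ] H) ∈ N.alg O₀ := by
    rintro x ⟨n, hn⟩
    exact (h₀.pow n).mem_alg_of_commute fun y => congrArg Subtype.val (hn y).eq
  refine ⟨n₁, n₂, hgen, η, ?_⟩
  constructor
  · rw [norm_neg, norm_div, n₁, n₂, div_one]
  · intro h0
    apply hd
    field_simp at h0
    linear_combination h0
  · exact hee
  · exact hes
  · exact he_comm
  · have hb := hε.braid hρ
    have hρε : ρ ε = l₁ • 1 + (l₂ - l₁) • ρ e := by
      conv_lhs => rw [hεe]
      rw [map_add, map_smul, map_smul, map_one]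
    rw [hρε] at hb
    conv at hb => { lhs; rw [hεe] }
    conv at hb => { rhs; arg 1; arg 2; rw [hεe] }
    have := braid_of_generator hee (by rw [← map_mul, hee]) hd hb
    have hk : -(l₁ / l₂) / (1 + -(l₁ / l₂)) ^ 2 = -(l₁ * (l₁ + (l₂ - l₁))) / (l₂ - l₁) ^ 2 := by
      have : 1 + -(l₁ / l₂) = (l₂ - l₁) / l₂ := by field_simp; ring
      rw [this]; field_simp; ring
    rw [hk]
    exact this
  · exact hφ.map_one
  · exact hφ.map_mul
  · exact fun x y => hφ.map_mul_left y x
  · exact fun x hx => hφ.map_positive hx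
  · exact hc
  · exact lt_of_le_of_ne hη₀ (Ne.symm hη0)
  · exact lt_of_le_of_ne hη₁ hη1
  · intro x hx
    rw [← hε.twist hρ hφ (hlocal x hx), hgen, star_smul, smul_mul_assoc, smul_mul_assoc,
      mul_smul_comm, smul_smul, star_neg, s₂]
    have : -l₂ * -l₂⁻¹ = 1 := by field_simp
    rw [this, one_smul]
  · intro hne x hx hx0
    refine eq_zero_of_map_star_mul_self hρ hφ hε hlam ?_ (hlocal x hx) hx0
    intro h0
    apply hne
    field_simp
    linear_combination -h0
  · intro T hT
    exact hirr T fun A => (hT A).eq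
  · exact infiniteDimensional_range hρ hirr htwo hφ
  · exact ⟨N.Ω, 0, fun h => by simpa [h] using N.norm_Ω⟩

end HaagKastlerNet

end

end LQP

end

/-! ### Relations of the normalized generator and the symmetry between its two spectral projections.
-/

noncomputable section

namespace LQP

section HeckeEndomorphism

variable {H : Type*} [NormedAddCommGroup H] [InnerProductSpace ℂ H] [CompleteSpace H]
  {A : StarSubalgebra ℂ (H →L[ℂ] H)} {ρ : A →⋆ₐ[ℂ] A} {φ : A →ₗ[ℂ] A} {e : A} {t : ℂ} {η : ℝ}

namespace HeckeEndo

section Instances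

variable (A)

scoped instance : Module ℂ A := Algebra.toModule

scoped instance : DistribMulAction ℂ A := Module.toDistribMulAction

scoped instance : MulAction ℂ A := DistribMulAction.toMulAction

scoped instance : SMulZeroClass ℂ A := DistribSMul.toSMulZeroClass

end Instances

lemma t_ne_zero (h : HeckeEndo A ρ φ e t η) : t ≠ 0 := by
  rintro rfl
  simpa using h.norm_t

lemma star_t (h : HeckeEndo A ρ φ e t η) : star t = t⁻¹ := by
  refine eq_inv_of_mul_eq_one_left ?_
  rw [Complex.star_def, Complex.conj_mul', h.norm_t]; simp

lemma star_heckeGen (h : HeckeEndo A ρ φ e t η) :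
    star (heckeGen e t) = t⁻¹ • heckeGen e t + (t⁻¹ - 1) • 1 := by
  have ht := h.t_ne_zero
  have h1 : star (1 + t) = t⁻¹ * (1 + t) := by
    rw [star_add, star_one, h.star_t]; field_simp; ring
  rw [heckeGen, star_sub, star_smul, star_smul, star_one, h.sa, h1, h.star_t, smul_sub, smul_smul,
    smul_smul, inv_mul_cancel₀ ht]
  module

lemma heckeGen_mul_self (h : HeckeEndo A ρ φ e t η) :
    heckeGen e t * heckeGen e t = (t - 1) • heckeGen e t + t • 1 := by
  rw [heckeGen]
  simp only [sub_mul, mul_sub, smul_mul_assoc, mul_smul_comm, one_mul, mul_one, h.idem]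
  module

lemma star_mul_heckeGen (h : HeckeEndo A ρ φ e t η) : star (heckeGen e t) * heckeGen e t = 1 := by
  rw [h.star_heckeGen, add_mul, smul_mul_assoc, h.heckeGen_mul_self, smul_mul_assoc, one_mul,
    smul_add, smul_smul, smul_smul, inv_mul_cancel₀ h.t_ne_zero, mul_sub,
    inv_mul_cancel₀ h.t_ne_zero]
  module

lemma heckeGen_mul_star (h : HeckeEndo A ρ φ e t η) : heckeGen e t * star (heckeGen e t) = 1 := by
  rw [h.star_heckeGen, mul_add, mul_smul_comm, h.heckeGen_mul_self, mul_smul_comm, mul_one,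
    smul_add, smul_smul, smul_smul, inv_mul_cancel₀ h.t_ne_zero, mul_sub,
    inv_mul_cancel₀ h.t_ne_zero]
  module

lemma heckeGen_comm (h : HeckeEndo A ρ φ e t η) (x : A) : Commute (heckeGen e t) (ρ (ρ x)) :=
  ((Commute.one_left _).smul_left _).sub_left ((h.e_comm x).smul_left _)

lemma map_heckeGen (ρ : A →⋆ₐ[ℂ] A) (e : A) (t : ℂ) : ρ (heckeGen e t) = heckeGen (ρ e) t := by
  rw [heckeGen, heckeGen, map_sub, map_smul, map_smul, map_one]

lemma heckeGen_braid (h : HeckeEndo A ρ φ e t η) :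
    heckeGen e t * ρ (heckeGen e t) * heckeGen e t =
      ρ (heckeGen e t) * heckeGen e t * ρ (heckeGen e t) := by
  rw [map_heckeGen]
  have hf : ρ e * ρ e = ρ e := by rw [← map_mul, h.idem]
  have expand : ∀ e f : A, e * e = e → heckeGen e t * heckeGen f t * heckeGen e t =
      t ^ 3 • (1 : A) + (t * (1 + t) ^ 2 - 2 * t ^ 2 * (1 + t)) • e - (t ^ 2 * (1 + t)) • f +
        (t * (1 + t) ^ 2) • (e * f + f * e) - (1 + t) ^ 3 • (e * f * e) := by
    intro e f he
    simp only [heckeGen, sub_mul, mul_sub, smul_mul_assoc, mul_smul_comm, one_mul, mul_one, he]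
    module
  rw [expand e _ h.idem, expand _ e hf]
  have hb : e * ρ e * e = ρ e * e * ρ e - (t / (1 + t) ^ 2) • ρ e + (t / (1 + t) ^ 2) • e := by
    rw [← h.braid]; abel
  have hk : (1 + t) ^ 3 * (t / (1 + t) ^ 2) = t * (1 + t) := by have := h.t_ne; field_simp
  have hb' : (1 + t) ^ 3 • (e * ρ e * e) =
      (1 + t) ^ 3 • (ρ e * e * ρ e) - (t * (1 + t)) • ρ e + (t * (1 + t)) • e := by
    rw [hb, smul_add, smul_sub, smul_smul, smul_smul, hk]
  rw [hb']
  module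

/-- The statistics parameter of the normalised generator. -/
lemma φ_heckeGen (h : HeckeEndo A ρ φ e t η) : φ (heckeGen e t) = (t - (1 + t) * η) • 1 := by
  rw [heckeGen, map_sub, map_smul, map_smul, h.φ_one, h.φ_e, smul_smul, sub_smul]

lemma φ_ρ (h : HeckeEndo A ρ φ e t η) (x : A) : φ (ρ x) = x := by
  rw [← one_mul (ρ x), h.φ_mul_ρ, h.φ_one, one_mul]

lemma heckeGen_swap (h : HeckeEndo A ρ φ e t η) :
    heckeGen (1 - e) t⁻¹ = -t⁻¹ • heckeGen e t := by
  have ht := h.t_ne_zero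
  have h1 : -t⁻¹ * t = -1 := by field_simp
  have h2 : -t⁻¹ * (1 + t) = -(1 + t⁻¹) := by field_simp; ring
  rw [heckeGen, heckeGen, smul_sub (-t⁻¹), smul_smul, smul_smul, h1, h2]
  module

/-- Exchanging the roles of the two spectral projections. -/
theorem swap (h : HeckeEndo A ρ φ e t η) : HeckeEndo A ρ φ (1 - e) t⁻¹ (1 - η) := by
  have ht := h.t_ne_zero
  have h1 : 1 + t⁻¹ = t⁻¹ * (1 + t) := by field_simp; ring
  have hν : t⁻¹ - (1 + t⁻¹) * ((1 - η : ℝ) : ℂ) = -t⁻¹ * (t - (1 + t) * η) := by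
    push_cast; field_simp; ring
  constructor
  · rw [norm_inv, h.norm_t, inv_one]
  · rw [h1]; exact mul_ne_zero (inv_ne_zero ht) h.t_ne
  · rw [mul_sub, sub_mul _ _ e, h.idem]; simp
  · rw [star_sub, star_one, h.sa]
  · exact fun x => (Commute.one_left _).sub_left (h.e_comm x)
  · have hk : t⁻¹ / (1 + t⁻¹) ^ 2 = t / (1 + t) ^ 2 := by
      have := h.t_ne
      rw [h1]; field_simp
    have hf : ρ e * ρ e = ρ e := by rw [← map_mul, h.idem]
    have expand : ∀ e f : A, e * e = e → (1 - e) * (1 - f) * (1 - e) =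
        1 - e - f + (e * f + f * e) - e * f * e := by
      intro e f he
      simp only [sub_mul, mul_sub, one_mul, mul_one, he]
      abel
    have hb : e * ρ e * e = ρ e * e * ρ e - (t / (1 + t) ^ 2) • ρ e + (t / (1 + t) ^ 2) • e := by
      rw [← h.braid]; abel
    rw [hk, map_sub, map_one, expand e _ h.idem, expand _ e hf, hb]
    module
  · exact h.φ_one
  · exact h.φ_mul_ρ
  · exact h.φ_ρ_mul
  · exact h.φ_pos
  · rw [map_sub, h.φ_one, h.φ_e]; push_cast; module
  · linarith [h.η_lt]
  · linarith [h.η_pos]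
  · intro x hx
    have : -t⁻¹ * star (-t⁻¹) = 1 := by
      rw [star_neg, star_inv₀, h.star_t]; field_simp
    rw [h.heckeGen_swap, star_smul, smul_mul_assoc, smul_mul_assoc, mul_smul_comm, smul_smul, this,
      one_smul, h.twist x hx]
  · intro hne
    rw [hν] at hne
    exact h.faithful (right_ne_zero_of_mul hne)
  · exact h.irred
  · exact h.infinite
  · exact h.nontriv

/-! ### The Hecke algebras -/

variable (ρ) in
/-- The algebra generated by `x, ρ(x), …, ρ^(k-1)(x)`. -/
def orbitAlg (x : A) (k : ℕ) : Subalgebra ℂ A :=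
  Algebra.adjoin ℂ {y | ∃ i < k, y = (⇑ρ)^[i] x}

lemma orbitAlg_mono {x : A} {k l : ℕ} (hkl : k ≤ l) : orbitAlg ρ x k ≤ orbitAlg ρ x l :=
  Algebra.adjoin_mono fun _ ⟨i, hi, h⟩ => ⟨i, hi.trans_le hkl, h⟩

lemma iterate_mem_orbitAlg {x : A} {k i : ℕ} (hi : i < k) : (⇑ρ)^[i] x ∈ orbitAlg ρ x k :=
  Algebra.subset_adjoin ⟨i, hi, rfl⟩

lemma self_mem_orbitAlg (x : A) (k : ℕ) : x ∈ orbitAlg ρ x (k + 1) :=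
  iterate_mem_orbitAlg (i := 0) k.succ_pos

lemma map_mem_orbitAlg {x y : A} {k : ℕ} (hy : y ∈ orbitAlg ρ x k) :
    ρ y ∈ orbitAlg ρ x (k + 1) := by
  induction hy using Algebra.adjoin_induction with
  | mem y hy =>
    obtain ⟨i, hi, rfl⟩ := hy
    rw [← Function.iterate_succ_apply' ρ]
    exact iterate_mem_orbitAlg (by omega)
  | algebraMap r => rw [AlgHomClass.commutes]; exact Subalgebra.algebraMap_mem _ r
  | add a b _ _ ha hb => rw [map_add]; exact add_mem ha hb
  | mul a b _ _ ha hb => rw [map_mul]; exact mul_mem ha hb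

lemma orbitAlg_zero {x y : A} (hy : y ∈ orbitAlg ρ x 0) : ∃ c : ℂ, y = c • 1 := by
  have : {y | ∃ i < 0, y = (⇑ρ)^[i] x} = (∅ : Set A) := by ext; simp
  rw [orbitAlg, this, Algebra.adjoin_empty, Algebra.mem_bot] at hy
  obtain ⟨c, rfl⟩ := hy
  exact ⟨c, Algebra.algebraMap_eq_smul_one c⟩

lemma commute_of_mem_orbitAlg (h : HeckeEndo A ρ φ e t η) {x : A} {k : ℕ}
    (hx : x ∈ orbitAlg ρ (heckeGen e t) k) (y : A) : Commute x ((⇑ρ)^[k + 1] y) := by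
  induction hx using Algebra.adjoin_induction with
  | mem x hx =>
    obtain ⟨i, hi, rfl⟩ := hx
    obtain ⟨j, rfl⟩ := Nat.exists_eq_add_of_lt hi
    have : (⇑ρ)^[i + j + 1 + 1] y = (⇑ρ)^[i] (ρ (ρ ((⇑ρ)^[j] y))) := by
      rw [← Function.iterate_succ_apply' (⇑ρ), ← Function.iterate_succ_apply' (⇑ρ),
        ← Function.iterate_add_apply]
      rfl
    rw [this]
    have hm : ∀ (i : ℕ) (a b : A), Commute a b → Commute ((⇑ρ)^[i] a) ((⇑ρ)^[i] b) := by
      intro i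
      induction i with
      | zero => exact fun _ _ h => h
      | succ i ih =>
        intro a b hab
        rw [Function.iterate_succ_apply, Function.iterate_succ_apply]
        exact ih _ _ (hab.map ρ)
    exact hm i _ _ (h.heckeGen_comm _)
  | algebraMap r => exact Algebra.commutes r _
  | add a b _ _ ha hb => exact ha.add_left hb
  | mul a b _ _ ha hb => exact ha.mul_left hb

lemma local_of_mem_orbitAlg (h : HeckeEndo A ρ φ e t η) {x : A} {k : ℕ}
    (hx : x ∈ orbitAlg ρ (heckeGen e t) k) : ∃ n, ∀ y, Commute x ((ρ ^ n) y) := by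
  refine ⟨k + 1, fun y => ?_⟩
  have : ∀ n, ⇑(ρ ^ n) = (⇑ρ)^[n] := by
    intro n
    induction n with
    | zero => rfl
    | succ n ih => rw [pow_succ, Function.iterate_succ, ← ih]; rfl
  rw [this]
  exact h.commute_of_mem_orbitAlg hx y

lemma star_mem_orbitAlg (h : HeckeEndo A ρ φ e t η) {x : A} {k : ℕ}
    (hx : x ∈ orbitAlg ρ (heckeGen e t) k) : star x ∈ orbitAlg ρ (heckeGen e t) k := by
  induction hx using Algebra.adjoin_induction with
  | mem x hx =>
    obtain ⟨i, hi, rfl⟩ := hx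
    have hm : ∀ (i : ℕ) (a : A), star ((⇑ρ)^[i] a) = (⇑ρ)^[i] (star a) := by
      intro i
      induction i with
      | zero => exact fun _ => rfl
      | succ i ih =>
        intro a
        rw [Function.iterate_succ_apply, Function.iterate_succ_apply, ih, map_star]
    have hl : ∀ i : ℕ, (⇑ρ)^[i] (t⁻¹ • heckeGen e t + (t⁻¹ - 1) • 1) =
        t⁻¹ • (⇑ρ)^[i] (heckeGen e t) + (t⁻¹ - 1) • 1 := by
      intro i
      induction i with
      | zero => rfl
      | succ i ih => simp only [Function.iterate_succ_apply', ih, map_add, map_smul, map_one]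
    rw [hm, h.star_heckeGen, hl]
    exact add_mem (Subalgebra.smul_mem _ (iterate_mem_orbitAlg hi) _)
      (Subalgebra.smul_mem _ (one_mem _) _)
  | algebraMap r =>
    rw [Algebra.algebraMap_eq_smul_one, star_smul, star_one]
    exact Subalgebra.smul_mem _ (one_mem _) _
  | add a b _ _ ha hb => rw [star_add]; exact add_mem ha hb
  | mul a b _ _ ha hb => rw [star_mul]; exact mul_mem hb ha

/-- The span of `ρ(a)` and `ρ(a) g ρ(b)`, which is the Hecke algebra with one more generator. -/
def doubleCoset (ρ : A →⋆ₐ[ℂ] A) (g : A) (k : ℕ) : Submodule ℂ A :=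
  Submodule.span ℂ ({x | ∃ a ∈ orbitAlg ρ g k, x = ρ a} ∪
    {x | ∃ a ∈ orbitAlg ρ g k, ∃ b ∈ orbitAlg ρ g k, x = ρ a * g * ρ b})

lemma map_mem_doubleCoset {g a : A} {k : ℕ} (ha : a ∈ orbitAlg ρ g k) : ρ a ∈ doubleCoset ρ g k :=
  Submodule.subset_span (Or.inl ⟨a, ha, rfl⟩)

lemma mul_mul_mem_doubleCoset {g a b : A} {k : ℕ} (ha : a ∈ orbitAlg ρ g k)
    (hb : b ∈ orbitAlg ρ g k) : ρ a * g * ρ b ∈ doubleCoset ρ g k :=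
  Submodule.subset_span (Or.inr ⟨a, ha, b, hb, rfl⟩)

lemma map_mul_mem_doubleCoset {g a x : A} {k : ℕ} (ha : a ∈ orbitAlg ρ g k)
    (hx : x ∈ doubleCoset ρ g k) : ρ a * x ∈ doubleCoset ρ g k := by
  induction hx using Submodule.span_induction with
  | mem x hx =>
    obtain ⟨b, hb, rfl⟩ | ⟨b, hb, c, hc, rfl⟩ := hx
    · rw [← map_mul]; exact map_mem_doubleCoset (mul_mem ha hb)
    · rw [mul_assoc, ← mul_assoc, ← mul_assoc, ← map_mul]
      exact mul_mul_mem_doubleCoset (mul_mem ha hb) hc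
  | zero => rw [mul_zero]; exact zero_mem _
  | add x y _ _ hx hy => rw [mul_add]; exact add_mem hx hy
  | smul c x _ hx => rw [mul_smul_comm]; exact Submodule.smul_mem _ _ hx

lemma mul_map_mem_doubleCoset {g a x : A} {k : ℕ} (ha : a ∈ orbitAlg ρ g k)
    (hx : x ∈ doubleCoset ρ g k) : x * ρ a ∈ doubleCoset ρ g k := by
  induction hx using Submodule.span_induction with
  | mem x hx =>
    obtain ⟨b, hb, rfl⟩ | ⟨b, hb, c, hc, rfl⟩ := hx
    · rw [← map_mul]; exact map_mem_doubleCoset (mul_mem hb ha)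
    · rw [mul_assoc, ← map_mul]
      exact mul_mul_mem_doubleCoset hb (mul_mem hc ha)
  | zero => rw [zero_mul]; exact zero_mem _
  | add x y _ _ hx hy => rw [add_mul]; exact add_mem hx hy
  | smul c x _ hx => rw [smul_mul_assoc]; exact Submodule.smul_mem _ _ hx

lemma mem_doubleCoset_self {g : A} {k : ℕ} : g ∈ doubleCoset ρ g k := by
  simpa using mul_mul_mem_doubleCoset (ρ := ρ) (g := g) (k := k) (one_mem _) (one_mem _)

/-- The element `a` has its own decomposition. A part `ρ(b)` gives `ρ²(b)`, which commutes with `g`.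
A part `ρ(b) g ρ(c)` leaves `g ρ(g) g` between outer factors, and the braid relation replaces it by
`ρ(g) g ρ(g)`, with a single `g`. -/
lemma gen_mul_map_mul_gen_mem (h : HeckeEndo A ρ φ e t η) {k : ℕ}
    (ih : ∀ x ∈ orbitAlg ρ (heckeGen e t) k, k ≠ 0 → x ∈ doubleCoset ρ (heckeGen e t) (k - 1))
    {a : A} (ha : a ∈ orbitAlg ρ (heckeGen e t) k) :
    heckeGen e t * ρ a * heckeGen e t ∈ doubleCoset ρ (heckeGen e t) k := by
  have hsq : heckeGen e t * heckeGen e t ∈ doubleCoset ρ (heckeGen e t) k := by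
    rw [h.heckeGen_mul_self]
    refine add_mem (Submodule.smul_mem _ _ mem_doubleCoset_self) (Submodule.smul_mem _ _ ?_)
    rw [← map_one ρ]
    exact map_mem_doubleCoset (one_mem _)
  rcases Nat.eq_zero_or_pos k with rfl | hk
  · obtain ⟨c, rfl⟩ := orbitAlg_zero ha
    rw [map_smul, map_one, mul_smul_comm, smul_mul_assoc, mul_one]
    exact Submodule.smul_mem _ _ hsq
  · obtain ⟨j, rfl⟩ := Nat.exists_eq_add_of_lt hk
    have ha' := ih a ha (by omega)
    simp only [zero_add, Nat.add_sub_cancel] at ha' hsq ⊢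
    clear ha ih
    induction ha' using Submodule.span_induction with
    | mem x hx =>
      obtain ⟨b, hb, rfl⟩ | ⟨b, hb, c, hc, rfl⟩ := hx
      · rw [(h.heckeGen_comm b).eq, mul_assoc]
        exact map_mul_mem_doubleCoset (map_mem_orbitAlg hb) hsq
      · have : heckeGen e t * ρ (ρ b * heckeGen e t * ρ c) * heckeGen e t =
            ρ (ρ b * heckeGen e t) * heckeGen e t * ρ (heckeGen e t * ρ c) := by
          calc _ = (heckeGen e t * ρ (ρ b)) * ρ (heckeGen e t) * (ρ (ρ c) * heckeGen e t) := by
                simp only [map_mul, mul_assoc]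
            _ = ρ (ρ b) * (heckeGen e t * ρ (heckeGen e t) * heckeGen e t) * ρ (ρ c) := by
                rw [(h.heckeGen_comm b).eq, ← (h.heckeGen_comm c).eq]; simp only [mul_assoc]
            _ = _ := by rw [h.heckeGen_braid]; simp only [map_mul, mul_assoc]
        rw [this]
        exact mul_mul_mem_doubleCoset (mul_mem (map_mem_orbitAlg hb) (self_mem_orbitAlg _ _))
          (mul_mem (self_mem_orbitAlg _ _) (map_mem_orbitAlg hc))
    | zero => simp
    | add x y _ _ hx hy =>
      rw [map_add, mul_add, add_mul]; exact add_mem hx hy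
    | smul c x _ hx =>
      rw [map_smul, mul_smul_comm, smul_mul_assoc]; exact Submodule.smul_mem _ _ hx

lemma mem_doubleCoset_aux (h : HeckeEndo A ρ φ e t η) {k : ℕ}
    (ih : ∀ x ∈ orbitAlg ρ (heckeGen e t) k, k ≠ 0 → x ∈ doubleCoset ρ (heckeGen e t) (k - 1)) :
    ∀ x ∈ orbitAlg ρ (heckeGen e t) (k + 1), x ∈ doubleCoset ρ (heckeGen e t) k := by
  intro x hx
  suffices hm : ∀ y ∈ doubleCoset ρ (heckeGen e t) k, x * y ∈ doubleCoset ρ (heckeGen e t) k by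
    have h1 : (1 : A) ∈ doubleCoset ρ (heckeGen e t) k := by
      rw [← map_one ρ]; exact map_mem_doubleCoset (one_mem _)
    simpa using hm 1 h1
  induction hx using Algebra.adjoin_induction with
  | mem x hx =>
    obtain ⟨i, hi, rfl⟩ := hx
    intro y hy
    rcases i with - | i
    · rw [Function.iterate_zero, id]
      induction hy using Submodule.span_induction with
      | mem y hy =>
        obtain ⟨b, hb, rfl⟩ | ⟨b, hb, c, hc, rfl⟩ := hy
        · simpa using mul_mul_mem_doubleCoset (ρ := ρ) (g := heckeGen e t) (one_mem _) hb
        · rw [← mul_assoc, ← mul_assoc]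
          exact mul_map_mem_doubleCoset hc (h.gen_mul_map_mul_gen_mem ih hb)
      | zero => simp
      | add x y _ _ hx hy => rw [mul_add]; exact add_mem hx hy
      | smul c x _ hx => rw [mul_smul_comm]; exact Submodule.smul_mem _ _ hx
    · rw [Function.iterate_succ_apply' ρ]
      exact map_mul_mem_doubleCoset (iterate_mem_orbitAlg (by omega)) hy
  | algebraMap r =>
    intro y hy
    rw [← Algebra.smul_def]; exact Submodule.smul_mem _ _ hy
  | add a b _ _ ha hb => intro y hy; rw [add_mul]; exact add_mem (ha y hy) (hb y hy)
  | mul a b _ _ ha hb => intro y hy; rw [mul_assoc]; exact ha _ (hb y hy)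

/-- Sums of terms that contain `g` at most once are stable under left multiplication by all
generators; the only critical product `g ρ(b) g` is reduced by the braid and Hecke relations. -/
lemma mem_doubleCoset (h : HeckeEndo A ρ φ e t η) (k : ℕ) :
    ∀ x ∈ orbitAlg ρ (heckeGen e t) (k + 1), x ∈ doubleCoset ρ (heckeGen e t) k := by
  induction k with
  | zero => exact h.mem_doubleCoset_aux fun _ _ h => absurd rfl h
  | succ k ih => exact h.mem_doubleCoset_aux fun x hx _ => ih x hx

/-- On the double coset form the value is explicit: `ρ(b)` goes to `b`, and `ρ(b) g ρ(c)` goes to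
the multiple `(t - (1 + t) η) b c`. -/
lemma φ_mem_orbitAlg (h : HeckeEndo A ρ φ e t η) {k : ℕ} {x : A}
    (hx : x ∈ orbitAlg ρ (heckeGen e t) (k + 1)) : φ x ∈ orbitAlg ρ (heckeGen e t) k := by
  have hx' := h.mem_doubleCoset k x hx
  clear hx
  induction hx' using Submodule.span_induction with
  | mem x hx =>
    obtain ⟨b, hb, rfl⟩ | ⟨b, hb, c, hc, rfl⟩ := hx
    · rwa [h.φ_ρ]
    · rw [h.φ_mul_ρ, h.φ_ρ_mul, h.φ_heckeGen]
      exact mul_mem (mul_mem hb (Subalgebra.smul_mem _ (one_mem _) _)) hc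
  | zero => rw [map_zero]; exact zero_mem _
  | add x y _ _ hx hy => rw [map_add]; exact add_mem hx hy
  | smul c x _ hx => rw [map_smul]; exact Subalgebra.smul_mem _ hx _

lemma finiteDimensional_orbitAlg (h : HeckeEndo A ρ φ e t η) (k : ℕ) :
    FiniteDimensional ℂ (orbitAlg ρ (heckeGen e t) k) := by
  suffices hfg : (Subalgebra.toSubmodule (orbitAlg ρ (heckeGen e t) k)).FG from
    Module.Finite.iff_fg.2 hfg
  induction k with
  | zero =>
    have : {y | ∃ i < 0, y = (⇑ρ)^[i] (heckeGen e t)} = (∅ : Set A) := by ext; simp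
    rw [orbitAlg, this, Algebra.adjoin_empty, Algebra.toSubmodule_bot]
    exact Submodule.one_eq_span (R := ℂ) (A := A) ▸ Submodule.fg_span_singleton _
  | succ k ih =>
    set M := (Subalgebra.toSubmodule (orbitAlg ρ (heckeGen e t) k)).map
      ((ρ : A →ₐ[ℂ] A) : A →ₗ[ℂ] A) with hM
    have hMfg : M.FG := ih.map _
    have hmem : ∀ a ∈ orbitAlg ρ (heckeGen e t) k, ρ a ∈ M := fun a ha => ⟨a, ha, rfl⟩
    have hfg : (M ⊔ M * Submodule.span ℂ {heckeGen e t} * M).FG :=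
      hMfg.sup ((hMfg.mul (Submodule.fg_span_singleton _)).mul hMfg)
    have hle : Subalgebra.toSubmodule (orbitAlg ρ (heckeGen e t) (k + 1)) ≤
        M ⊔ M * Submodule.span ℂ {heckeGen e t} * M := by
      refine fun x hx => Submodule.span_le.2 ?_ (h.mem_doubleCoset k x hx)
      rintro _ (⟨a, ha, rfl⟩ | ⟨a, ha, b, hb, rfl⟩)
      · exact Submodule.mem_sup_left (hmem a ha)
      · exact Submodule.mem_sup_right (Submodule.mul_mem_mul (Submodule.mul_mem_mul (hmem a ha)
          (Submodule.mem_span_singleton_self _)) (hmem b hb))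
    have : FiniteDimensional ℂ ↥(M ⊔ M * Submodule.span ℂ {heckeGen e t} * M) :=
      Module.Finite.iff_fg.2 hfg
    exact Module.Finite.iff_fg.1 (Submodule.finiteDimensional_of_le hle)

/-! ### Faithfulness of the left inverse on the Hecke algebras -/

/-- The product `ρ^(j-1)(g) ⋯ ρ(g) g`. -/
def strand (ρ : A →⋆ₐ[ℂ] A) (g : A) : ℕ → A
  | 0 => 1
  | j + 1 => ρ (strand ρ g j) * g

/-- The strands play the role of coset representatives of one symmetric group in the next. The
coefficients need not be in the Hecke algebra; it is enough that they stand inside `ρ`. -/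
lemma exists_sum_strand (h : HeckeEndo A ρ φ e t η) {k : ℕ} : ∀ x ∈ orbitAlg ρ (heckeGen e t) k,
    ∃ a : ℕ → A, x = ∑ j ∈ Finset.range (k + 1), strand ρ (heckeGen e t) j * ρ (a j) := by
  induction k with
  | zero =>
    intro x hx
    obtain ⟨c, rfl⟩ := orbitAlg_zero hx
    exact ⟨fun _ => c • 1, by simp [strand]⟩
  | succ k ih =>
    intro x hx
    have hx' := h.mem_doubleCoset k x hx
    clear hx
    induction hx' using Submodule.span_induction with
    | mem x hx =>
      obtain ⟨b, hb, rfl⟩ | ⟨b, hb, c, hc, rfl⟩ := hx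
      · refine ⟨fun j => if j = 0 then b else 0, ?_⟩
        rw [Finset.sum_range_succ']
        simp [strand]
      · obtain ⟨a, ha⟩ := ih b hb
        refine ⟨fun j => if j = 0 then 0 else ρ (a (j - 1)) * c, ?_⟩
        rw [Finset.sum_range_succ', ha, map_sum, Finset.sum_mul, Finset.sum_mul]
        simp only [if_true, map_zero, mul_zero, add_zero, Nat.add_sub_cancel, strand]
        refine Finset.sum_congr rfl fun j _ => ?_
        rw [map_mul, mul_assoc _ (ρ (ρ (a j))), ← (h.heckeGen_comm (a j)).eq]
        simp [mul_assoc]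
    | zero => exact ⟨0, by simp⟩
    | add x y _ _ hx hy =>
      obtain ⟨a, rfl⟩ := hx
      obtain ⟨b, rfl⟩ := hy
      exact ⟨a + b, by simp [mul_add, Finset.sum_add_distrib]⟩
    | smul c x _ hx =>
      obtain ⟨a, rfl⟩ := hx
      exact ⟨c • a, by simp [Finset.smul_sum]⟩

/-- In this degenerate case `g` is self-adjoint with `φ(g) = 0`, and the twist identity removes one
factor `g` from both strands. So the strands are orthonormal for the form `φ(x⋆ y)`. -/
lemma φ_strand (h : HeckeEndo A ρ φ e t η) (h1 : t = 1) (h0 : t - (1 + t) * η = 0) :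
    ∀ i j : ℕ, φ (star (strand ρ (heckeGen e t) i) * strand ρ (heckeGen e t) j) =
      if i = j then 1 else 0
  | 0, 0 => by simp [strand, h.φ_one]
  | 0, j + 1 => by simp [strand, h.φ_ρ_mul, h.φ_heckeGen, h0]
  | i + 1, 0 => by
    have hs : star (heckeGen e t) = heckeGen e t := by rw [h.star_heckeGen, h1]; simp
    simp [strand, ← map_star ρ, h.φ_mul_ρ, hs, h.φ_heckeGen, h0]
  | i + 1, j + 1 => by
    have hs : star (heckeGen e t) = heckeGen e t := by rw [h.star_heckeGen, h1]; simp
    have hmem : ∀ j, strand ρ (heckeGen e t) j ∈ orbitAlg ρ (heckeGen e t) j := by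
      intro j
      induction j with
      | zero => exact one_mem _
      | succ j ih => exact mul_mem (map_mem_orbitAlg ih) (self_mem_orbitAlg _ _)
    have hl : star (strand ρ (heckeGen e t) i) * strand ρ (heckeGen e t) j ∈
        orbitAlg ρ (heckeGen e t) (i + j) :=
      mul_mem (h.star_mem_orbitAlg (orbitAlg_mono (by omega) (hmem i)))
        (orbitAlg_mono (by omega) (hmem j))
    have := h.twist _ (h.local_of_mem_orbitAlg hl)
    rw [h.φ_strand h1 h0 i j, hs] at this
    rw [strand, strand, star_mul, hs, ← map_star ρ, mul_assoc, ← mul_assoc (ρ _) (ρ _), ← map_mul,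
      ← mul_assoc, this]
    split_ifs <;> simp_all

/-- The left inverse is faithful on the Hecke algebras. -/
theorem faithful_orbitAlg (h : HeckeEndo A ρ φ e t η) {k : ℕ} {x : A}
    (hx : x ∈ orbitAlg ρ (heckeGen e t) k) (h0 : φ (star x * x) = 0) : x = 0 := by
  by_cases hν : t - (1 + t) * η = 0
  · have ht := h.t_ne_zero
    -- Conjugating `t = (1 + t) η`, with `η` real and `t̄ = t⁻¹`, gives `1 = (1 + t) η`.
    have h1 : t = 1 := by
      have h2 := congrArg star hν
      simp only [star_sub, star_mul, star_add, star_one, h.star_t, star_zero, Complex.star_def,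
        Complex.conj_ofReal] at h2
      field_simp at h2
      linear_combination hν - h2
    obtain ⟨a, rfl⟩ := h.exists_sum_strand x hx
    -- By orthonormality of the strands, `φ(x⋆ x) = ∑ a_j⋆ a_j`; this can vanish only if all
    -- coefficients do.
    have h2 : ∑ j ∈ Finset.range (k + 1), star (a j) * a j = 0 := by
      rw [← h0, star_sum, Finset.sum_mul_sum, map_sum]
      refine Finset.sum_congr rfl fun i hi => ?_
      rw [map_sum, Finset.sum_eq_single_of_mem i hi]
      · rw [star_mul, ← map_star ρ, mul_assoc, ← mul_assoc (star _), h.φ_ρ_mul, h.φ_mul_ρ,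
          h.φ_strand h1 hν, if_pos rfl, one_mul]
      · intro j _ hj
        rw [star_mul, ← map_star ρ, mul_assoc, ← mul_assoc (star _), h.φ_ρ_mul, h.φ_mul_ρ,
          h.φ_strand h1 hν, if_neg hj.symm, zero_mul, mul_zero]
    have h3 : ∀ v : H, ∑ j ∈ Finset.range (k + 1), ‖(a j : H →L[ℂ] H) v‖ ^ 2 = 0 := by
      intro v
      have h4 : inner ℂ v (((∑ j ∈ Finset.range (k + 1), star (a j) * a j : A) :
          H →L[ℂ] H) v) = 0 := by
        rw [h2]; exact inner_zero_right v
      rw [AddSubmonoidClass.coe_finsetSum, sum_apply, inner_sum] at h4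
      have h5 : ∀ j, inner ℂ v (((star (a j) * a j : A) : H →L[ℂ] H) v) =
          ((‖(a j : H →L[ℂ] H) v‖ ^ 2 : ℝ) : ℂ) := by
        intro j
        change inner ℂ v (ContinuousLinearMap.adjoint (a j : H →L[ℂ] H)
          ((a j : H →L[ℂ] H) v)) = _
        rw [ContinuousLinearMap.adjoint_inner_right, inner_self_eq_norm_sq_to_K]
        simp
      simp only [h5] at h4
      exact_mod_cast h4
    have h6 : ∀ j ∈ Finset.range (k + 1), a j = 0 := by
      intro j hj
      refine Subtype.ext (ContinuousLinearMap.ext fun v => ?_)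
      have := (Finset.sum_eq_zero_iff_of_nonneg fun _ _ => by positivity).1 (h3 v) j hj
      simpa using this
    exact Finset.sum_eq_zero fun j hj => by rw [h6 j hj, map_zero, mul_zero]
  · exact h.faithful hν x (h.local_of_mem_orbitAlg hx) h0

/-! ### The trace -/

lemma exists_φ_iterate (h : HeckeEndo A ρ φ e t η) {k : ℕ} : ∀ x ∈ orbitAlg ρ (heckeGen e t) k,
    ∃ c : ℂ, (⇑φ)^[k] x = c • 1 := by
  induction k with
  | zero => exact fun x hx => orbitAlg_zero hx
  | succ k ih => exact fun x hx => ih _ (h.φ_mem_orbitAlg hx)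

lemma φ_iterate_add (φ : A →ₗ[ℂ] A) (k : ℕ) (x y : A) :
    (⇑φ)^[k] (x + y) = (⇑φ)^[k] x + (⇑φ)^[k] y := by
  induction k generalizing x y with
  | zero => rfl
  | succ k ih => simp only [Function.iterate_succ_apply, map_add, ih]

lemma φ_iterate_smul (φ : A →ₗ[ℂ] A) (k : ℕ) (c : ℂ) (x : A) :
    (⇑φ)^[k] (c • x) = c • (⇑φ)^[k] x := by
  induction k generalizing x with
  | zero => rfl
  | succ k ih => simp only [Function.iterate_succ_apply, map_smul, ih]

/-- Substituting `g = t g⋆ + (t - 1)` for the right factor reduces the value to the twist identity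
and to `φ(g)`. -/
lemma φ_gen_mul_map_mul_gen (h : HeckeEndo A ρ φ e t η) {k : ℕ} {a : A}
    (ha : a ∈ orbitAlg ρ (heckeGen e t) k) :
    φ (heckeGen e t * ρ a * heckeGen e t) =
      t • ρ (φ a) + ((t - 1) * (t - (1 + t) * η)) • a := by
  have ht := h.t_ne_zero
  have hg : heckeGen e t = t • star (heckeGen e t) + (t - 1) • 1 := by
    rw [h.star_heckeGen, smul_add, smul_smul, smul_smul, mul_inv_cancel₀ ht, mul_sub,
      mul_inv_cancel₀ ht]
    module
  have h1 : heckeGen e t * ρ a * heckeGen e t =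
      t • (heckeGen e t * ρ a * star (heckeGen e t)) + (t - 1) • (heckeGen e t * ρ a) := by
    conv_lhs => { arg 2; rw [hg] }
    simp only [mul_add, mul_smul_comm, mul_one]
  rw [h1, map_add, map_smul, map_smul, h.twist _ (h.local_of_mem_orbitAlg ha), h.φ_mul_ρ,
    h.φ_heckeGen, smul_mul_assoc, one_mul, smul_smul]

/-- The iterated left inverse is a trace on the Hecke algebras. -/
theorem φ_iterate_mul_comm (h : HeckeEndo A ρ φ e t η) {k : ℕ} :
    ∀ x ∈ orbitAlg ρ (heckeGen e t) k, ∀ y ∈ orbitAlg ρ (heckeGen e t) k,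
      (⇑φ)^[k] (x * y) = (⇑φ)^[k] (y * x) := by
  induction k with
  | zero =>
    intro x hx y hy
    obtain ⟨c, rfl⟩ := orbitAlg_zero hx
    simp
  | succ k ih =>
    intro x hx y hy
    induction hy using Algebra.adjoin_induction generalizing x with
    | mem y hy =>
      obtain ⟨i, hi, rfl⟩ := hy
      rw [Function.iterate_succ_apply, Function.iterate_succ_apply]
      rcases i with - | i
      · have hx' := h.mem_doubleCoset k x hx
        rw [Function.iterate_zero, id]
        clear hx
        induction hx' using Submodule.span_induction with
        | mem x hx =>
          obtain ⟨b, hb, rfl⟩ | ⟨b, hb, c, hc, rfl⟩ := hx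
          · rw [h.φ_ρ_mul, h.φ_mul_ρ, h.φ_heckeGen]; simp
          · rw [mul_assoc, mul_assoc, h.φ_ρ_mul, ← mul_assoc, h.φ_gen_mul_map_mul_gen hc,
              ← mul_assoc, ← mul_assoc, h.φ_mul_ρ, h.φ_gen_mul_map_mul_gen hb, mul_add, add_mul (t • _),
              mul_smul_comm, mul_smul_comm, smul_mul_assoc, smul_mul_assoc]
            simp only [φ_iterate_add, φ_iterate_smul]
            congr 2
            -- It remains to compare `b ρ(φ(c))` with `ρ(φ(b)) c`. One more application of `φ` turns
            -- both into `φ(b) φ(c)`; for `k = 0`, where none is left, `b` and `c` are scalars.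
            rcases k with - | k
            · obtain ⟨c, rfl⟩ := orbitAlg_zero hc
              obtain ⟨b, rfl⟩ := orbitAlg_zero hb
              simp [h.φ_one, smul_smul]
            · rw [Function.iterate_succ_apply, Function.iterate_succ_apply, h.φ_mul_ρ, h.φ_ρ_mul]
        | zero => simp
        | add x y _ _ hx hy => simp only [add_mul, mul_add, map_add, φ_iterate_add, hx, hy]
        | smul c x _ hx =>
          simp only [smul_mul_assoc, mul_smul_comm, map_smul, φ_iterate_smul, hx]
      · rw [Function.iterate_succ_apply' ρ, h.φ_mul_ρ, h.φ_ρ_mul]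
        exact ih _ (h.φ_mem_orbitAlg hx) _ (iterate_mem_orbitAlg (by omega))
    | algebraMap r => rw [Algebra.commutes]
    | add a b ha hb iha ihb => rw [mul_add, add_mul, φ_iterate_add, φ_iterate_add, iha x hx, ihb x hx]
    | mul a b ha hb iha ihb =>
      rw [← mul_assoc, ihb _ (mul_mem hx ha), ← mul_assoc, iha _ (mul_mem hb hx), mul_assoc]

end HeckeEndo

end HeckeEndomorphism

end LQP

end

/-! ### Wenzl's weights and the meets of consecutive projections. -/

noncomputable section

namespace LQP

/-- Wenzl's sequence of weights, `w₀ = 1`, `w_{k+1} = 1 - K / w_k`. -/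
def weightSeq (K : ℝ) : ℕ → ℝ
  | 0 => 1
  | k + 1 => 1 - K / weightSeq K k

lemma weightSeq_zero_angle (k : ℕ) : weightSeq (1 / 4) k = (k + 2) / (2 * (k + 1)) := by
  induction k with
  | zero => norm_num [weightSeq]
  | succ k ih => rw [weightSeq, ih]; push_cast; field_simp; ring

/-- The recursion is `sin(x + θ) + sin(x - θ) = 2 cos θ sin x` divided by its right-hand side, at `x
= (k + 2) θ`. -/
lemma weightSeq_eq_sin {θ : ℝ} (hc : Real.cos θ ≠ 0) {k : ℕ}
    (hs : ∀ j ≤ k, Real.sin ((j + 1) * θ) ≠ 0) :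
    weightSeq (1 / (4 * Real.cos θ ^ 2)) k =
      Real.sin ((k + 2) * θ) / (2 * Real.cos θ * Real.sin ((k + 1) * θ)) := by
  induction k with
  | zero =>
    have h0 := hs 0 le_rfl
    simp only [Nat.cast_zero, zero_add, one_mul] at h0 ⊢
    rw [weightSeq, Real.sin_two_mul]
    field_simp
  | succ k ih =>
    have h1 := hs k (by omega)
    have h2 := hs (k + 1) le_rfl
    rw [weightSeq, ih fun j hj => hs j (by omega)]
    push_cast at h2 ⊢
    have e1 : ((k : ℝ) + 1 + 1) * θ = (k + 2) * θ := by ring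
    have e2 : ((k : ℝ) + 1 + 2) * θ = (k + 2) * θ + θ := by ring
    have e3 : ((k : ℝ) + 1) * θ = (k + 2) * θ - θ := by ring
    rw [e1] at h2
    rw [e1, e2, e3, Real.sin_add, Real.sin_sub]
    field_simp
    ring

section HeckeEndomorphism

variable {H : Type*} [NormedAddCommGroup H] [InnerProductSpace ℂ H] [CompleteSpace H]
  {A : StarSubalgebra ℂ (H →L[ℂ] H)} {ρ : A →⋆ₐ[ℂ] A} {φ : A →ₗ[ℂ] A} {e : A} {t : ℂ} {η : ℝ}

lemma StarSubalgebra.eq_zero_of_star_mul_self {x : A} (h : star x * x = 0) : x = 0 :=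
  Subtype.ext (LQP.eq_zero_of_star_mul_self (congrArg Subtype.val h))

lemma inner_smul_star_mul_self (Z : A) (c : ℝ) (v : H) :
    inner ℂ ((((c : ℂ) • (star Z * Z) : A) : H →L[ℂ] H) v) v =
      ((c * ‖(Z : H →L[ℂ] H) v‖ ^ 2 : ℝ) : ℂ) := by
  change inner ℂ ((c : ℂ) • ContinuousLinearMap.adjoint (Z : H →L[ℂ] H)
    ((Z : H →L[ℂ] H) v)) v = _
  rw [inner_smul_left, ContinuousLinearMap.adjoint_inner_left, inner_self_eq_norm_sq_to_K]
  simp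

lemma coe_pow_starAlgHom (ρ : A →⋆ₐ[ℂ] A) (n : ℕ) : ⇑(ρ ^ n) = (⇑ρ)^[n] := by
  induction n with
  | zero => rfl
  | succ n ih => rw [pow_succ, Function.iterate_succ, ← ih]; rfl

namespace HeckeEndo

/-- The meets of `1 - e, 1 - ρ(e), …, 1 - ρ^(k-1)(e)`, by Wenzl's recursion. -/
def meetSeq (ρ : A →⋆ₐ[ℂ] A) (e : A) (K : ℝ) : ℕ → A
  | 0 => 1
  | k + 1 => ρ (meetSeq ρ e K k) - ((weightSeq K k)⁻¹ : ℂ) •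
      (ρ (meetSeq ρ e K k) * e * ρ (meetSeq ρ e K k))

/-- The third condition carries the induction. It says that the compression `X` of `e` by `ρ(G_k)`
satisfies `X² = w_k X`, so that `w_k⁻¹ X` is a projection which can be subtracted from `ρ(G_k)`. -/
structure IsMeet (ρ : A →⋆ₐ[ℂ] A) (e : A) (K : ℝ) (k : ℕ) : Prop where
  sa : star (meetSeq ρ e K k) = meetSeq ρ e K k
  idem : meetSeq ρ e K k * meetSeq ρ e K k = meetSeq ρ e K k
  compress : ρ (meetSeq ρ e K k) * e * ρ (meetSeq ρ e K k) * e * ρ (meetSeq ρ e K k) =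
    (weightSeq K k : ℂ) • (ρ (meetSeq ρ e K k) * e * ρ (meetSeq ρ e K k))

lemma e_mem_orbitAlg (h : HeckeEndo A ρ φ e t η) (k : ℕ) :
    e ∈ orbitAlg ρ (heckeGen e t) (k + 1) := by
  have he : e = (1 + t)⁻¹ • (t • 1 - heckeGen e t) := by
    rw [heckeGen, sub_sub_cancel, smul_smul, inv_mul_cancel₀ h.t_ne, one_smul]
  have := (orbitAlg ρ (heckeGen e t) (k + 1)).smul_mem
    (sub_mem ((orbitAlg ρ (heckeGen e t) (k + 1)).smul_mem (one_mem _) t)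
    (self_mem_orbitAlg (heckeGen e t) k)) (1 + t)⁻¹
  rwa [← he] at this

lemma meetSeq_mem (h : HeckeEndo A ρ φ e t η) (K : ℝ) (k : ℕ) :
    meetSeq ρ e K k ∈ orbitAlg ρ (heckeGen e t) k := by
  induction k with
  | zero => exact one_mem _
  | succ k ih =>
    have := map_mem_orbitAlg ih
    exact sub_mem this (Subalgebra.smul_mem _ (mul_mem (mul_mem this (h.e_mem_orbitAlg k)) this) _)

/-- Subtracting the projection `w⁻¹ P e P` from `P = ρ(G_k)` gives `G_{k+1}` with `e G_{k+1} = 0`.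
The next compression is computed by inserting this formula and the braid relation into `e ρ(G_{k+1})
e`, which yields the factor `1 - K / w`. -/
lemma isMeet (h : HeckeEndo A ρ φ e t η) {K : ℝ} (hK : (K : ℂ) = t / (1 + t) ^ 2) {k : ℕ}
    (hw : ∀ j < k, weightSeq K j ≠ 0) : IsMeet ρ e K k := by
  induction k with
  | zero =>
    refine ⟨star_one _, one_mul _, ?_⟩
    simp [meetSeq, weightSeq, h.idem]
  | succ k ih =>
    obtain ⟨sa, idem, comp⟩ := ih fun j hj => hw j (by omega)
    have hwk := hw k (by omega)
    set w : ℂ := (weightSeq K k : ℂ) with hwdef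
    have hw0 : w ≠ 0 := by simpa [hwdef] using hwk
    set G := meetSeq ρ e K k
    set P := ρ G with hP
    have hPP : P * P = P := by rw [hP, ← map_mul, idem]
    have hPs : star P = P := by rw [hP, ← map_star, sa]
    set X := P * e * P with hX
    have hPX : P * X = X := by rw [hX, ← mul_assoc, ← mul_assoc, hPP]
    have hXP : X * P = X := by rw [hX, mul_assoc, hPP]
    have hXX : X * X = w • X := by
      rw [← comp, hX]
      calc _ = P * e * (P * P) * e * P := by simp only [mul_assoc]
        _ = _ := by rw [hPP]
    have hXs : star X = X := by rw [hX, star_mul, star_mul, hPs, h.sa, mul_assoc]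
    have hw_real : star w = w := by simp [hwdef]
    set G' := meetSeq ρ e K (k + 1)
    have hG' : G' = P - w⁻¹ • X := rfl
    have hG's : star G' = G' := by
      rw [hG', star_sub, star_smul, hPs, hXs, star_inv₀, hw_real]
    have hG'i : G' * G' = G' := by
      rw [hG', sub_mul, mul_sub, mul_sub, smul_mul_smul_comm, mul_smul_comm, smul_mul_assoc, hPP,
        hPX, hXP, hXX, smul_smul]
      have : w⁻¹ * w⁻¹ * w = w⁻¹ := by field_simp
      rw [this]; abel
    have heG' : e * G' = 0 := by
      apply StarSubalgebra.eq_zero_of_star_mul_self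
      have h1 : P * e * X = w • X := by rw [← comp, hX]; simp only [mul_assoc]
      have h2 : X * e * P = w • X := by rw [← comp, hX]
      have h3 : X * e * X = (w * w) • X := by
        have : X * e * X = X * e * P * X := by rw [mul_assoc (X * e) P, hPX]
        rw [this, h2, smul_mul_assoc, hXX, smul_smul]
      rw [star_mul, hG's, h.sa, mul_assoc, ← mul_assoc e, h.idem, ← mul_assoc, hG']
      simp only [sub_mul, mul_sub, smul_mul_assoc, mul_smul_comm]
      rw [h1, h2, h3, ← hX]
      have h4 : w⁻¹ • w • X = X := by rw [smul_smul, inv_mul_cancel₀ hw0, one_smul]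
      have h5 : w⁻¹ • (w * w) • X = w • X := by
        rw [smul_smul, ← mul_assoc, inv_mul_cancel₀ hw0, one_mul]
      rw [h4, h5, sub_self, zero_sub, neg_eq_zero] 
      simp
    refine ⟨hG's, hG'i, ?_⟩
    set P' := ρ G' with hP'
    set Q := ρ P with hQ
    have hP'e : P' * ρ e = 0 := by
      have : ρ e * P' = 0 := by rw [hP', ← map_mul, heG', map_zero]
      have := congrArg star this
      rwa [star_mul, ← map_star ρ e, h.sa, hP', ← map_star ρ G', hG's, star_zero] at this
    have hG'P : G' * P = G' := by rw [hG', sub_mul, smul_mul_assoc, hPP, hXP]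
    have hP'Q : P' * Q = P' := by rw [hP', hQ, ← map_mul, hG'P]
    have hPG' : P * G' = G' := by rw [hG', mul_sub, mul_smul_comm, hPP, hPX]
    have hQP' : Q * P' = P' := by rw [hP', hQ, ← map_mul, hPG']
    have hP'form : P' = Q - w⁻¹ • (Q * ρ e * Q) := by
      rw [hP', hG', hX, map_sub, map_smul, map_mul, map_mul]
    have hQQ : Q * Q = Q := by rw [hQ, ← map_mul, hPP]
    have hQe : Q * e = e * Q := (h.e_comm G).eq.symm
    have hmid : e * P' * e = Q * e - w⁻¹ • (Q * (e * ρ e * e) * Q) := by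
      rw [hP'form, mul_sub, sub_mul, mul_smul_comm, smul_mul_assoc]
      congr 1
      · rw [← hQe, mul_assoc, h.idem]
      · congr 1
        simp only [← mul_assoc]
        rw [← hQe]
        simp only [mul_assoc]
        rw [hQe]
    -- Between two factors `P'` the terms of the braid relation that contain `ρ(e)` vanish because
    -- `P' ρ(e) = 0`. Only `K e` survives.
    have hb : e * ρ e * e = ρ e * e * ρ e - (K : ℂ) • ρ e + (K : ℂ) • e := by
      rw [hK, ← h.braid]; abel
    have h1 : P' * e * P' * e * P' = P' * (e * P' * e) * P' := by simp only [mul_assoc]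
    rw [h1, hmid, hb]
    have h2 : P' * (Q * e - w⁻¹ • (Q * (ρ e * e * ρ e - (K : ℂ) • ρ e + (K : ℂ) • e) * Q)) * P' =
        (P' * Q) * e * P' - w⁻¹ • (((P' * Q) * ρ e) * e * ρ e * (Q * P')
          - (K : ℂ) • ((P' * Q) * ρ e * (Q * P')) + (K : ℂ) • ((P' * Q) * e * (Q * P'))) := by
      simp only [mul_sub, mul_add, sub_mul, add_mul, smul_mul_assoc, mul_smul_comm, mul_assoc]
    rw [h2, hP'Q, hQP', hP'e]
    simp only [zero_mul, smul_zero, sub_zero, zero_add, weightSeq]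
    push_cast
    rw [← hwdef, smul_smul, sub_smul, one_smul, div_eq_mul_inv, mul_comm]

/-- This scalar couples `η` to the weights: a meet can disappear only where the scalar vanishes, and
positivity of `φ` restricts its sign. -/
lemma φ_meetSeq_succ (h : HeckeEndo A ρ φ e t η) {K : ℝ} {k : ℕ} (hm : IsMeet ρ e K k) :
    φ (meetSeq ρ e K (k + 1)) = ((1 - η / weightSeq K k : ℝ) : ℂ) • meetSeq ρ e K k := by
  rw [meetSeq, map_sub, map_smul, h.φ_mul_ρ, h.φ_ρ_mul, h.φ_ρ, h.φ_e, mul_smul_comm, mul_one,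
    smul_mul_assoc, hm.idem, smul_smul]
  push_cast
  rw [sub_smul, one_smul, div_eq_mul_inv, mul_comm]

/-- The positive operator `X = P e P` satisfies `X² = w X` with `w ≤ 0`, so it vanishes; but `φ(X) =
η G_k` and `η > 0`. -/
lemma meetSeq_eq_zero_of_nonpos (h : HeckeEndo A ρ φ e t η) {K : ℝ} {k : ℕ}
    (hm : IsMeet ρ e K k) (hw : weightSeq K k ≤ 0) : meetSeq ρ e K k = 0 := by
  set G := meetSeq ρ e K k with hG
  set P := ρ G with hP
  have hPP : P * P = P := by rw [hP, ← map_mul, hm.idem]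
  have hPs : star P = P := by rw [hP, ← map_star, hm.sa]
  set Y := e * P with hY
  have hX : star Y * Y = P * e * P := by
    rw [hY, star_mul, hPs, h.sa, mul_assoc, ← mul_assoc e, h.idem, ← mul_assoc]
  have hXX : star (star Y * Y) * (star Y * Y) = (weightSeq K k : ℂ) • (star Y * Y) := by
    rw [star_mul, star_star, hX, ← hm.compress]
    calc _ = P * e * (P * P) * e * P := by simp only [mul_assoc]
      _ = _ := by rw [hPP]
  have h0 : star Y * Y = 0 := by
    refine Subtype.ext (ContinuousLinearMap.ext fun v => ?_)
    have h1 := inner_smul_star_mul_self (star Y * Y) 1 v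
    rw [hXX, Complex.ofReal_one, one_smul, inner_smul_star_mul_self, one_mul] at h1
    have h2 : weightSeq K k * ‖(Y : H →L[ℂ] H) v‖ ^ 2 =
        ‖((star Y * Y : A) : H →L[ℂ] H) v‖ ^ 2 := by exact_mod_cast h1
    have h3 : ‖((star Y * Y : A) : H →L[ℂ] H) v‖ = 0 := by
      nlinarith [sq_nonneg ‖(Y : H →L[ℂ] H) v‖, norm_nonneg (((star Y * Y : A) : H →L[ℂ] H) v)]
    simpa using h3
  have h1 := congrArg φ (hX.symm.trans h0)
  rw [hP, h.φ_mul_ρ, h.φ_ρ_mul, h.φ_e, mul_smul_comm, mul_one, smul_mul_assoc, hm.idem,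
    map_zero] at h1
  exact (smul_eq_zero.1 h1).resolve_left (by exact_mod_cast h.η_pos.ne')

lemma one_ne_zero' (h : HeckeEndo A ρ φ e t η) : (1 : A) ≠ 0 := by
  have := h.nontriv
  intro h0
  have : (1 : H →L[ℂ] H) = 0 := congrArg Subtype.val h0
  exact one_ne_zero this

lemma meetSeq_ne_zero (h : HeckeEndo A ρ φ e t η) {K : ℝ} (hK : (K : ℂ) = t / (1 + t) ^ 2) {k : ℕ}
    (hw : ∀ j < k, weightSeq K j ≠ 0) (hne : ∀ j < k, η ≠ weightSeq K j) :
    meetSeq ρ e K k ≠ 0 := by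
  induction k with
  | zero => exact h.one_ne_zero'
  | succ k ih =>
    intro h0
    have h1 := h.φ_meetSeq_succ (h.isMeet hK (k := k) fun j hj => hw j (by omega))
    rw [h0, map_zero] at h1
    rcases smul_eq_zero.1 h1.symm with h2 | h2
    · have h3 : 1 - η / weightSeq K k = 0 := by exact_mod_cast h2
      have := hw k (by omega)
      field_simp at h3
      exact hne k (by omega) (by linarith)
    · exact ih (fun j hj => hw j (by omega)) (fun j hj => hne j (by omega)) h2

/-- If `η` differed from all earlier weights, `φ` would send each meet to a nonzero multiple of the
previous one, and none could vanish. The weight `w₀ = 1` is excluded by `η < 1`. -/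
lemma exists_eq_weightSeq (h : HeckeEndo A ρ φ e t η) {K : ℝ} (hK : (K : ℂ) = t / (1 + t) ^ 2)
    {k : ℕ} (hw : ∀ j < k, 0 < weightSeq K j) (hwk : weightSeq K k ≤ 0) :
    ∃ j, 1 ≤ j ∧ j < k ∧ η = weightSeq K j := by
  by_contra! hcon
  refine h.meetSeq_ne_zero hK (fun j hj => (hw j hj).ne') (fun j hj => ?_)
    (h.meetSeq_eq_zero_of_nonpos (h.isMeet hK fun j hj => (hw j hj).ne') hwk)
  rcases Nat.eq_zero_or_pos j with rfl | hj'
  · exact h.η_lt.ne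
  · exact hcon j hj' hj

/-- Positivity of `φ(G_{k+1}) = (1 - η / w_k) G_k`, tested on a vector where `G_k` does not vanish.
-/
lemma le_weightSeq (h : HeckeEndo A ρ φ e t η) {K : ℝ} (hK : (K : ℂ) = t / (1 + t) ^ 2)
    (hw : ∀ j, 0 < weightSeq K j) (hne : ∀ j, η ≠ weightSeq K j) (k : ℕ) : η ≤ weightSeq K k := by
  have hm := h.isMeet hK (k := k) fun j _ => (hw j).ne'
  have hm' := h.isMeet hK (k := k + 1) fun j _ => (hw j).ne'
  have h0 := h.meetSeq_ne_zero hK (k := k) (fun j _ => (hw j).ne') fun j _ => hne j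
  have h1 := h.φ_meetSeq_succ hm
  obtain ⟨v, hv⟩ : ∃ v, (meetSeq ρ e K k : H →L[ℂ] H) v ≠ 0 := by
    by_contra! hcon
    exact h0 (Subtype.ext (ContinuousLinearMap.ext hcon))
  have hpos := h.φ_pos (meetSeq ρ e K (k + 1)) (by
    have : meetSeq ρ e K (k + 1) = star (meetSeq ρ e K (k + 1)) * meetSeq ρ e K (k + 1) := by
      rw [hm'.sa, hm'.idem]
    rw [this]
    exact ContinuousLinearMap.isPositive_adjoint_comp_self _)
  have h2 : meetSeq ρ e K k = star (meetSeq ρ e K k) * meetSeq ρ e K k := by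
    rw [hm.sa, hm.idem]
  rw [h1] at hpos
  have h3 := hpos.2 v
  rw [ContinuousLinearMap.reApplyInnerSelf_apply, h2, inner_smul_star_mul_self] at h3
  have h4 : 0 ≤ (1 - η / weightSeq K k) * ‖(meetSeq ρ e K k : H →L[ℂ] H) v‖ ^ 2 := h3
  have h5 : 0 < ‖(meetSeq ρ e K k : H →L[ℂ] H) v‖ ^ 2 := by positivity
  have h6 := nonneg_of_mul_nonneg_left h4 h5
  rwa [sub_nonneg, div_le_one (hw k)] at h6

lemma meetSeq_apply (K : ℝ) (k j : ℕ) (ψ : H)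
    (hψ : ∀ i < k, (((⇑ρ)^[i + j] e : A) : H →L[ℂ] H) ψ = 0) :
    (((⇑ρ)^[j] (meetSeq ρ e K k) : A) : H →L[ℂ] H) ψ = ψ := by
  induction k generalizing j with
  | zero =>
    rw [meetSeq, ← coe_pow_starAlgHom, map_one]; rfl
  | succ k ih =>
    have h1 := ih (j + 1) fun i hi => by
      rw [← add_assoc, add_right_comm]; exact hψ (i + 1) (by omega)
    have h0 := hψ 0 (by omega)
    rw [zero_add] at h0
    rw [meetSeq, ← coe_pow_starAlgHom, map_sub, map_smul, map_mul, map_mul, coe_pow_starAlgHom,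
      ← Function.iterate_succ_apply]
    change (((⇑ρ)^[j + 1] (meetSeq ρ e K k) : A) : H →L[ℂ] H) ψ - ((weightSeq K k)⁻¹ : ℂ) •
      (((⇑ρ)^[j + 1] (meetSeq ρ e K k) : A) : H →L[ℂ] H) ((((⇑ρ)^[j] e : A) : H →L[ℂ] H)
        ((((⇑ρ)^[j + 1] (meetSeq ρ e K k) : A) : H →L[ℂ] H) ψ)) = ψ
    rw [h1, h0, map_zero, smul_zero, sub_zero]

/-- For `η = w_k` the value `φ(G_{k+1})` is zero, so `G_{k+1} = 0` by faithfulness on the Hecke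
algebra, while `G_{k+1}` fixes `ψ`. -/
lemma eq_zero_of_cutoff (h : HeckeEndo A ρ φ e t η) {K : ℝ} (hK : (K : ℂ) = t / (1 + t) ^ 2)
    {k : ℕ} (hw : ∀ j ≤ k, 0 < weightSeq K j) (hη : η = weightSeq K k) {m : ℕ} (hm : k < m) (ψ : H)
    (hψ : ∀ i < m, (((⇑ρ)^[i] e : A) : H →L[ℂ] H) ψ = 0) : ψ = 0 := by
  have h0 := h.isMeet hK (k := k) fun j hj => (hw j hj.le).ne'
  have h1 := h.isMeet hK (k := k + 1) fun j hj => (hw j (by omega)).ne'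
  have h2 : meetSeq ρ e K (k + 1) = 0 := by
    refine h.faithful_orbitAlg (h.meetSeq_mem K (k + 1)) ?_
    have := (hw k le_rfl).ne'
    rw [h1.sa, h1.idem, h.φ_meetSeq_succ h0, ← hη, div_self (hη ▸ this)]
    simp
  have h3 := meetSeq_apply (ρ := ρ) (e := e) K (k + 1) 0 ψ fun i hi => hψ i (by omega)
  rw [Function.iterate_zero, id, h2] at h3
  exact h3.symm

/-! ### The parameters `q` and `d` -/

lemma exists_angle (h : HeckeEndo A ρ φ e t η) : ∃ θ δ : ℝ, 0 ≤ θ ∧ θ < Real.pi / 2 ∧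
    (δ = 1 ∨ δ = -1) ∧ t = Complex.exp (δ * (2 * θ) * Complex.I) := by
  have h1 : t = Complex.exp (t.arg * Complex.I) := by
    conv_lhs => rw [← Complex.norm_mul_exp_arg_mul_I t, h.norm_t]
    simp
  have h2 : t.arg ≠ Real.pi := by
    intro h0
    apply h.t_ne
    rw [h1, h0, Complex.exp_pi_mul_I]; ring
  have h3 := Complex.arg_le_pi t
  have h4 := Complex.neg_pi_lt_arg t
  have h5 := lt_of_le_of_ne h3 h2
  rcases le_total 0 t.arg with h6 | h6
  · refine ⟨t.arg / 2, 1, by linarith, by linarith, Or.inl rfl, ?_⟩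
    conv_lhs => rw [h1]
    push_cast; congr 1; ring
  · refine ⟨-t.arg / 2, -1, by linarith, by linarith, Or.inr rfl, ?_⟩
    conv_lhs => rw [h1]
    push_cast; congr 1; ring

lemma one_add_exp (δ θ : ℝ) : 1 + Complex.exp (δ * (2 * θ) * Complex.I) =
    2 * Complex.cos (δ * θ) * Complex.exp (δ * θ * Complex.I) := by
  have h1 : (δ * (2 * θ) * Complex.I : ℂ) = (δ * θ) * Complex.I + (δ * θ) * Complex.I := by ring
  rw [h1, Complex.exp_add, Complex.exp_mul_I]
  linear_combination -Complex.sin_sq_add_cos_sq (δ * θ) +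
    Complex.sin (δ * θ) ^ 2 * Complex.I_sq

lemma coe_weight (h : HeckeEndo A ρ φ e t η) {θ δ : ℝ} (hδ : δ = 1 ∨ δ = -1)
    (ht : t = Complex.exp (δ * (2 * θ) * Complex.I)) :
    ((1 / (4 * Real.cos θ ^ 2) : ℝ) : ℂ) = t / (1 + t) ^ 2 := by
  have hc : Complex.cos (δ * θ) = Complex.cos θ := by
    rcases hδ with rfl | rfl <;> simp
  have h1 := h.t_ne
  have h2 : t = Complex.exp (δ * θ * Complex.I) ^ 2 := by
    rw [ht, sq, ← Complex.exp_add]; congr 1; ring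
  have h3 : 1 + t = 2 * Complex.cos θ * Complex.exp (δ * θ * Complex.I) := by
    rw [← hc, ← one_add_exp, ht]
  have h4 : Complex.cos θ ≠ 0 := by
    intro h0; apply h1; rw [h3, h0]; ring
  have h5 := Complex.exp_ne_zero (δ * θ * Complex.I)
  rw [h3, h2]
  push_cast
  field_simp
  ring

/-- The weights are positive while `(k + 2) θ < π` and are nonpositive at the first `M` that
violates this. So `η` is a weight `w_j` with `1 ≤ j < M`, and `m = j + 1`. -/
lemma exists_weight_eq (h : HeckeEndo A ρ φ e t η) {θ δ : ℝ} (hδ : δ = 1 ∨ δ = -1)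
    (hθ : 0 < θ) (hθ' : θ < Real.pi / 2) (ht : t = Complex.exp (δ * (2 * θ) * Complex.I)) :
    ∃ m : ℕ, 2 ≤ m ∧ m * θ < Real.pi ∧
      η = Real.sin ((m + 1) * θ) / (2 * Real.cos θ * Real.sin (m * θ)) ∧
      ∀ (l : ℕ) (ψ : H), m ≤ l → (∀ i < l, (((⇑ρ)^[i] e : A) : H →L[ℂ] H) ψ = 0) → ψ = 0 := by
  have hK := h.coe_weight hδ ht
  have hc : 0 < Real.cos θ := Real.cos_pos_of_mem_Ioo ⟨by linarith, hθ'⟩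
  have hex : ∃ M : ℕ, Real.pi ≤ (M + 2) * θ := by
    obtain ⟨M, hM⟩ := exists_nat_ge (Real.pi / θ)
    refine ⟨M, ?_⟩
    rw [div_le_iff₀ hθ] at hM
    nlinarith
  classical
  set M := Nat.find hex with hM
  have hMs : Real.pi ≤ (M + 2) * θ := Nat.find_spec hex
  have hMlt : ∀ j < M, (j + 2) * θ < Real.pi := fun j hj => not_le.1 (Nat.find_min hex hj)
  have hM0 : M ≠ 0 := by
    intro h0
    rw [h0] at hMs
    norm_num at hMs
    linarith
  have hMs' : (M + 1) * θ < Real.pi := by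
    have := hMlt (M - 1) (by omega)
    have h1 : ((M - 1 : ℕ) : ℝ) = M - 1 := by rw [Nat.cast_sub (by omega)]; simp
    rw [h1] at this
    linarith
  have hsin : ∀ j ≤ M, 0 < Real.sin ((j + 1) * θ) := by
    intro j hj
    have : (j : ℝ) ≤ M := by exact_mod_cast hj
    exact Real.sin_pos_of_pos_of_lt_pi (by positivity) (by nlinarith)
  have hform : ∀ j ≤ M, weightSeq (1 / (4 * Real.cos θ ^ 2)) j =
      Real.sin ((j + 2) * θ) / (2 * Real.cos θ * Real.sin ((j + 1) * θ)) := fun j hj =>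
    weightSeq_eq_sin hc.ne' fun i hi => (hsin i (hi.trans hj)).ne'
  have hpos : ∀ j < M, 0 < weightSeq (1 / (4 * Real.cos θ ^ 2)) j := by
    intro j hj
    rw [hform j hj.le]
    have := hsin j hj.le
    have := Real.sin_pos_of_pos_of_lt_pi (x := (j + 2) * θ) (by positivity) (hMlt j hj)
    positivity
  have hneg : weightSeq (1 / (4 * Real.cos θ ^ 2)) M ≤ 0 := by
    rw [hform M le_rfl]
    have h1 := hsin M le_rfl
    have h2 : Real.sin ((M + 2) * θ) ≤ 0 := by
      have h3 := Real.sin_nonneg_of_nonneg_of_le_pi (x := (M + 2) * θ - Real.pi) (by linarith)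
        (by nlinarith)
      rw [Real.sin_sub_pi] at h3
      linarith
    exact div_nonpos_of_nonpos_of_nonneg h2 (by positivity)
  obtain ⟨j, hj1, hjM, hj⟩ := h.exists_eq_weightSeq hK hpos hneg
  refine ⟨j + 1, by omega, ?_, ?_, fun l ψ hl => h.eq_zero_of_cutoff hK
    (fun i hi => hpos i (by omega)) hj hl ψ⟩
  · have : (j : ℝ) ≤ M := by exact_mod_cast hjM.le
    push_cast
    nlinarith
  · rw [hj, hform j hjM.le]
    push_cast
    ring_nf

/-- At angle zero the weights stay above `1/2` and tend to it. A value `η` that is not a weight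
would be bounded by all of them, hence by `1/2`. -/
lemma exists_weight_eq_of_angle_zero (h : HeckeEndo A ρ φ e 1 η) (hη : 1 / 2 < η) :
    ∃ m : ℕ, 2 ≤ m ∧ η = (m + 1) / (2 * m) ∧
      ∀ (l : ℕ) (ψ : H), m ≤ l → (∀ i < l, (((⇑ρ)^[i] e : A) : H →L[ℂ] H) ψ = 0) → ψ = 0 := by
  have hK : ((1 / 4 : ℝ) : ℂ) = 1 / (1 + 1) ^ 2 := by norm_num
  have hpos : ∀ j, 0 < weightSeq (1 / 4) j := fun j => by
    rw [weightSeq_zero_angle]; positivity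
  by_cases hne : ∃ j, η = weightSeq (1 / 4) j
  · obtain ⟨j, hj⟩ := hne
    refine ⟨j + 1, ?_, ?_, fun l ψ hl => h.eq_zero_of_cutoff hK (fun i _ => hpos i) hj hl ψ⟩
    · rcases Nat.eq_zero_or_pos j with rfl | h0
      · exact absurd hj h.η_lt.ne
      · omega
    · rw [hj, weightSeq_zero_angle]; push_cast; ring
  · push Not at hne
    have hle := h.le_weightSeq hK hpos hne
    obtain ⟨k, hk⟩ := exists_nat_gt (1 / (2 * η - 1))
    have h1 := hle k
    have h2 : 0 < 2 * η - 1 := by linarith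
    rw [weightSeq_zero_angle, le_div_iff₀ (by positivity)] at h1
    rw [div_lt_iff₀ h2] at hk
    nlinarith

end HeckeEndo

end HeckeEndomorphism

end LQP

end

noncomputable section

namespace LQP

/-! ### Quantum numbers -/

lemma exp_zpow_sub_one {δ θ : ℝ} (hδ : δ = 1 ∨ δ = -1) (m : ℤ) :
    Complex.exp (δ * (2 * θ) * Complex.I) ^ m - 1 =
      Complex.exp (δ * (m * θ) * Complex.I) * (2 * δ * Complex.sin (m * θ) * Complex.I) := by
  have h1 : Complex.exp (δ * (2 * θ) * Complex.I) ^ m =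
      Complex.exp (δ * (m * θ) * Complex.I) * Complex.exp (δ * (m * θ) * Complex.I) := by
    rw [← Complex.exp_int_mul, ← Complex.exp_add]
    congr 1; ring
  have h2 : Complex.exp (δ * (m * θ) * Complex.I) =
      Complex.cos (m * θ) + δ * Complex.sin (m * θ) * Complex.I := by
    rw [Complex.exp_mul_I]
    rcases hδ with rfl | rfl <;> simp
  have h3 : (δ : ℂ) ^ 2 = 1 := by rcases hδ with rfl | rfl <;> simp
  rw [h1, h2]
  linear_combination Complex.sin_sq_add_cos_sq ((m : ℂ) * θ) -
    δ ^ 2 * Complex.sin (m * θ) ^ 2 * Complex.I_sq + Complex.sin (m * θ) ^ 2 * h3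

/-- The quantum number `[m] = 1 + t + ⋯ + t^(m-1)`. -/
def quantumInt (t : ℂ) (m : ℤ) : ℂ := if t = 1 then m else (t ^ m - 1) / (t - 1)

lemma quantumInt_zero (t : ℂ) : quantumInt t 0 = 0 := by simp [quantumInt]

lemma quantumInt_succ {t : ℂ} (ht : t ≠ 0) (m : ℤ) :
    quantumInt t (m + 1) = t * quantumInt t m + 1 := by
  rw [quantumInt, quantumInt]
  split_ifs with h
  · rw [h]; push_cast; ring
  · have : t - 1 ≠ 0 := sub_ne_zero.2 h
    rw [zpow_add_one₀ ht]
    field_simp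
    ring

lemma quantumInt_spec (t : ℂ) (m : ℤ) : (t - 1) * quantumInt t m + 1 = t ^ m := by
  rw [quantumInt]
  split_ifs with h
  · simp [h]
  · have : t - 1 ≠ 0 := sub_ne_zero.2 h
    field_simp; ring

/-- `Q` is the period of the quantum numbers, where `0` stands for the generic case `t = 1`. -/
def IsPeriod (t : ℂ) (Q : ℕ) : Prop := (t = 1 ∧ Q = 0) ∨ (IsPrimitiveRoot t Q ∧ 4 ≤ Q)

/-- The quantum numbers as a function of the residue class. -/
def quantumNumber (t : ℂ) {Q : ℕ} (c : ZMod Q) : ℂ := quantumInt t (c.cast : ℤ)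

namespace IsPeriod

variable {t : ℂ} {Q : ℕ}

lemma ne_zero (h : IsPeriod t Q) : t ≠ 0 := by
  rcases h with ⟨rfl, -⟩ | ⟨h, hQ⟩
  · exact one_ne_zero
  · exact h.ne_zero (by omega)

lemma ne_one (h : IsPeriod t Q) : Q ≠ 1 := by
  rcases h with ⟨-, rfl⟩ | ⟨-, hQ⟩ <;> omega

lemma quantumInt_inj (h : IsPeriod t Q) {m n : ℤ} :
    quantumInt t m = quantumInt t n ↔ (m : ZMod Q) = n := by
  rcases h with ⟨rfl, rfl⟩ | ⟨h, hQ⟩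
  · simp [quantumInt]
  · have h1 : t ≠ 1 := h.ne_one (by omega)
    have h2 : t - 1 ≠ 0 := sub_ne_zero.2 h1
    have h3 : t ≠ 0 := h.ne_zero (by omega)
    rw [quantumInt, quantumInt, if_neg h1, if_neg h1, div_left_inj' h2, sub_left_inj,
      ZMod.intCast_eq_intCast_iff_dvd_sub, ← h.zpow_eq_one_iff_dvd, zpow_sub₀ h3,
      div_eq_one_iff_eq (zpow_ne_zero _ h3), eq_comm]

lemma quantumNumber_intCast (h : IsPeriod t Q) (m : ℤ) :
    quantumNumber t (m : ZMod Q) = quantumInt t m := by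
  rw [quantumNumber, h.quantumInt_inj, ZMod.intCast_cast, ZMod.cast_id]

lemma quantumNumber_zero (h : IsPeriod t Q) : quantumNumber t (0 : ZMod Q) = 0 := by
  have := h.quantumNumber_intCast 0
  rwa [Int.cast_zero, quantumInt_zero] at this

lemma exists_int (c : ZMod Q) : ∃ m : ℤ, (m : ZMod Q) = c := ⟨c.cast, by simp⟩

lemma quantumNumber_add_one (h : IsPeriod t Q) (c : ZMod Q) :
    quantumNumber t (c + 1) = t * quantumNumber t c + 1 := by
  obtain ⟨m, rfl⟩ := exists_int c
  rw [← Int.cast_one, ← Int.cast_add, h.quantumNumber_intCast, h.quantumNumber_intCast,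
    quantumInt_succ h.ne_zero]

lemma quantumNumber_injective (h : IsPeriod t Q) :
    Function.Injective (quantumNumber t : ZMod Q → ℂ) := by
  intro c c' hc
  obtain ⟨m, rfl⟩ := exists_int c
  obtain ⟨n, rfl⟩ := exists_int c'
  rwa [h.quantumNumber_intCast, h.quantumNumber_intCast, h.quantumInt_inj] at hc

lemma quantumNumber_spec_ne_zero (h : IsPeriod t Q) (c : ZMod Q) :
    (t - 1) * quantumNumber t c + 1 ≠ 0 := by
  rw [quantumNumber, quantumInt_spec]
  exact zpow_ne_zero _ h.ne_zero

/-- The diagonal coefficient of the projection `e` in a path basis. -/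
lemma diag_coeff (h : IsPeriod t Q) {x c : ℤ} (hxc : (x : ZMod Q) ≠ c) :
    t - ((t - 1) * quantumInt t c + 1) / (quantumInt t c - quantumInt t x) =
      quantumInt t (x - c + 1) / quantumInt t (x - c) := by
  have h0 : quantumInt t c - quantumInt t x ≠ 0 := by
    rw [sub_ne_zero, Ne, h.quantumInt_inj]; exact Ne.symm hxc
  have h1 : quantumInt t (x - c) ≠ 0 := by
    rw [← quantumInt_zero t, Ne, h.quantumInt_inj]
    push_cast
    rwa [sub_eq_zero]
  have ht := h.ne_zero
  rw [quantumInt_succ ht, quantumInt_spec]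
  have h2 : quantumInt t c - quantumInt t x = -(t ^ c * quantumInt t (x - c)) := by
    rw [quantumInt, quantumInt, quantumInt]
    split_ifs with h
    · rw [h]; push_cast; rw [one_zpow]; ring
    · have : t - 1 ≠ 0 := sub_ne_zero.2 h
      rw [zpow_sub₀ ht]
      have := zpow_ne_zero c ht
      field_simp
      ring
  have h3 := zpow_ne_zero c ht
  rw [h2]
  field_simp
  ring

end IsPeriod

lemma channelAngle_top : channelAngle ⊤ = 0 := if_pos rfl

lemma channelAngle_coe (n : ℕ) : channelAngle n = Real.pi / n := by
  rw [channelAngle, if_neg (ENat.natCast_ne_top n), ENat.toNat_natCast]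

lemma isPeriod_of_exp {q : ℕ∞} (hq : 4 ≤ q) {δ : ℝ} (hδ : δ = 1 ∨ δ = -1) :
    IsPeriod (Complex.exp (δ * (2 * channelAngle q) * Complex.I)) q.toNat := by
  induction q using ENat.recTopCoe with
  | top => left; simp [channelAngle_top]
  | coe n =>
    right
    have hn : 4 ≤ n := by exact_mod_cast hq
    refine ⟨?_, by simpa using hn⟩
    rw [channelAngle_coe, ENat.toNat_natCast]
    have h1 := Complex.isPrimitiveRoot_exp n (by omega)
    have h2 : (n : ℂ) ≠ 0 := by exact_mod_cast (by omega : n ≠ 0)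
    rcases hδ with rfl | rfl
    · convert h1 using 2
      push_cast; field_simp
    · have h3 := h1.inv
      rw [← Complex.exp_neg] at h3
      have h4 : (((-1 : ℝ) : ℂ) * (2 * ((Real.pi / n : ℝ) : ℂ)) * Complex.I) =
          -(2 * Real.pi * Complex.I / n) := by push_cast; field_simp
      rw [h4]
      exact h3

/-- Writing `t^m - 1` as a phase times `sin(m θ)`, the phases cancel in `[m + 1] / ([m] (1 + t))`.
The sign `δ` cancels too, so the weight does not depend on which root of unity `t` is. -/
lemma wenzlWeight_mul {q : ℕ∞} (hq : 4 ≤ q) {δ : ℝ} (hδ : δ = 1 ∨ δ = -1) {t : ℂ}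
    (ht : t = Complex.exp (δ * (2 * channelAngle q) * Complex.I)) (ht1 : 1 + t ≠ 0) {m : ℤ}
    (hm : quantumInt t m ≠ 0) :
    (wenzlWeight q m : ℂ) = quantumInt t (m + 1) / quantumInt t m / (1 + t) := by
  induction q using ENat.recTopCoe with
  | top =>
    have : t = 1 := by rw [ht]; simp [channelAngle_top]
    simp only [quantumInt, if_pos this] at hm ⊢
    rw [this, wenzlWeight, if_pos rfl]
    push_cast
    field_simp
    ring
  | coe n =>
    have hp := isPeriod_of_exp hq hδ
    rw [← ht, ENat.toNat_natCast] at hp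
    have hn : 4 ≤ n := by exact_mod_cast hq
    have h1 : t ≠ 1 := by
      rcases hp with ⟨-, h⟩ | ⟨h, -⟩
      · omega
      · exact h.ne_one (by omega)
    have h2 : t - 1 ≠ 0 := sub_ne_zero.2 h1
    set θ := channelAngle n
    have e1 := exp_zpow_sub_one (θ := θ) hδ m
    have e2 := exp_zpow_sub_one (θ := θ) hδ (m + 1)
    rw [← ht] at e1 e2
    simp only [quantumInt, if_neg h1] at hm ⊢
    have h3 : t ^ m - 1 ≠ 0 := fun h => hm (by rw [h, zero_div])
    have h4 : 1 + t = 2 * Complex.cos θ * Complex.exp (δ * θ * Complex.I) := by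
      rw [ht, HeckeEndo.one_add_exp]
      rcases hδ with rfl | rfl <;> simp
    have h5 : Complex.cos θ ≠ 0 := by rintro h; apply ht1; rw [h4, h]; ring
    have h6 : Complex.exp (δ * (((m + 1 : ℤ) : ℂ) * θ) * Complex.I) =
        Complex.exp (δ * (m * θ) * Complex.I) * Complex.exp (δ * θ * Complex.I) := by
      rw [← Complex.exp_add]; congr 1; push_cast; ring
    have h7 : Complex.sin (m * θ) ≠ 0 := by
      intro h; apply h3; rw [e1, h]; ring
    have h8 : (δ : ℂ) ≠ 0 := by rcases hδ with rfl | rfl <;> simp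
    have h9 := Complex.exp_ne_zero (δ * θ * Complex.I)
    have h10 := Complex.exp_ne_zero (δ * (m * θ) * Complex.I)
    rw [div_div_div_cancel_right₀ h2, e1, e2, h4, h6, wenzlWeight, if_neg (ENat.natCast_ne_top n), show channelAngle n = θ from rfl]
    push_cast
    field_simp

section HeckeEndomorphism

variable {H : Type*} [NormedAddCommGroup H] [InnerProductSpace ℂ H] [CompleteSpace H]
  {A : StarSubalgebra ℂ (H →L[ℂ] H)} {ρ : A →⋆ₐ[ℂ] A} {φ : A →ₗ[ℂ] A} {e : A} {t : ℂ} {η : ℝ}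

namespace HeckeEndo

/-- The parameters `q` and `d`, with the cutoffs and the statistics parameter. -/
structure HasParameters (ρ : A →⋆ₐ[ℂ] A) (e : A) (t : ℂ) (η : ℝ) (q d : ℕ∞) (δ : ℝ) : Prop where
  four_le : 4 ≤ q
  two_le : 2 ≤ d
  add_two_le : d + 2 ≤ q
  sign : δ = 1 ∨ δ = -1
  t_eq : t = Complex.exp (δ * (2 * channelAngle q) * Complex.I)
  norm_ν : q ≠ ⊤ → ‖t - (1 + t) * η‖ =
    Real.sin (channelAngle q) / Real.sin (d.toNat * channelAngle q)
  ν_eq : q = ⊤ → d ≠ ⊤ → t - (1 + t) * η = 1 / (d.toNat : ℂ)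
  ν_top : d = ⊤ → t - (1 + t) * η = 0
  ν_mul : d ≠ ⊤ → (t - (1 + t) * η) * quantumInt t (-(d.toNat : ℤ)) = -1
  cutoff : ∀ (m : ℕ) (ψ : H), d ≤ m → (∀ i < m, (((⇑ρ)^[i] e : A) : H →L[ℂ] H) ψ = ψ) → ψ = 0
  cutoff' : ∀ (m : ℕ) (ψ : H), q < (m + 1 : ℕ) + d →
    (∀ i < m, (((⇑ρ)^[i] e : A) : H →L[ℂ] H) ψ = 0) → ψ = 0

lemma iterate_one_sub_apply (i : ℕ) (ψ : H) (h : (((⇑ρ)^[i] e : A) : H →L[ℂ] H) ψ = ψ) :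
    (((⇑ρ)^[i] (1 - e) : A) : H →L[ℂ] H) ψ = 0 := by
  rw [← coe_pow_starAlgHom, map_sub, map_one, coe_pow_starAlgHom]
  change ψ - (((⇑ρ)^[i] e : A) : H →L[ℂ] H) ψ = 0
  rw [h, sub_self]

/-- The quantization of `η` and, for the swapped data, of `1 - η` gives two integers `m` and `d`.
That the two weights add up to one forces `(m + d) θ = π`, so `q = m + d`. The hypothesis for `t =
1` fixes the labelling that makes `1 - η` the value at least `1/2`. -/
theorem exists_parameters (h : HeckeEndo A ρ φ e t η) (hη : t = 1 → η ≤ 1 / 2) :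
    ∃ (q d : ℕ∞) (δ : ℝ), HasParameters ρ e t η q d δ := by
  obtain ⟨θ, δ, hθ0, hθ, hδ, ht⟩ := h.exists_angle
  rcases hθ0.eq_or_lt with rfl | hθ0
  · have h1 : t = 1 := by rw [ht]; simp
    subst h1
    rcases (hη rfl).eq_or_lt with h2 | h2
    -- For `η = 1/2` the statistics parameter vanishes and both cutoffs are void.
    · refine ⟨⊤, ⊤, 1, le_top, le_top, le_top, Or.inl rfl, by simp [channelAngle_top], by simp,
        by simp, fun _ => by rw [h2]; norm_num, by simp, fun m _ hm => ?_, fun m _ hm => ?_⟩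
      · exact absurd (top_le_iff.1 hm) (ENat.natCast_ne_top m)
      · exact absurd hm not_top_lt
    · obtain ⟨d, hd, hd1, hd2⟩ := HeckeEndo.exists_weight_eq_of_angle_zero
        (by simpa using h.swap) (by linarith : 1 / 2 < 1 - η)
      have hd0 : (d : ℂ) ≠ 0 := by exact_mod_cast (by omega : d ≠ 0)
      have hν : (1 : ℂ) - (1 + 1) * η = 1 / (d : ℂ) := by
        have h3 := congrArg Complex.ofReal hd1
        push_cast at h3
        have h4 : (η : ℂ) = 1 - (d + 1) / (2 * d) := by rw [← h3]; ring
        rw [h4]; field_simp; ring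
      refine ⟨⊤, d, 1, le_top, by exact_mod_cast hd, le_top, Or.inl rfl,
        by simp [channelAngle_top], by simp, fun _ _ => by simpa using hν, by simp, fun _ => ?_,
        fun m ψ hm hψ => hd2 m ψ (by exact_mod_cast hm) fun i hi =>
          iterate_one_sub_apply i ψ (hψ i hi), fun m ψ hm => ?_⟩
      · rw [hν]; simp [quantumInt]; field_simp
      · exact absurd hm not_top_lt
  · obtain ⟨m, hm2, hmπ, hm, hmc⟩ := h.exists_weight_eq hδ hθ0 hθ ht
    have hδ' : -δ = 1 ∨ -δ = -1 := by rcases hδ with rfl | rfl <;> simp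
    have ht' : t⁻¹ = Complex.exp ((-δ : ℝ) * (2 * θ) * Complex.I) := by
      rw [ht, ← Complex.exp_neg]; congr 1; push_cast; ring
    obtain ⟨d, hd2, hdπ, hd, hdc⟩ := h.swap.exists_weight_eq hδ' hθ0 hθ ht'
    have hc : 0 < Real.cos θ := Real.cos_pos_of_mem_Ioo ⟨by linarith, hθ⟩
    have hm0 : (0 : ℝ) < m := by exact_mod_cast (by omega : 0 < m)
    have hd0 : (0 : ℝ) < d := by exact_mod_cast (by omega : 0 < d)
    have hsm := Real.sin_pos_of_pos_of_lt_pi (by positivity) hmπ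
    have hsd := Real.sin_pos_of_pos_of_lt_pi (by positivity) hdπ
    have hsθ := Real.sin_pos_of_pos_of_lt_pi hθ0 (by linarith)
    have hsum : Real.sin ((m + d) * θ) = 0 := by
      have h1 : (m + 1 : ℝ) * θ = m * θ + θ := by ring
      have h2 : (d + 1 : ℝ) * θ = d * θ + θ := by ring
      rw [h1, Real.sin_add] at hm
      rw [h2, Real.sin_add, hm] at hd
      rw [add_mul, Real.sin_add]
      generalize Real.sin (d * θ) = sd at *
      generalize Real.cos (d * θ) = cd at *
      generalize Real.sin (m * θ) = sm at *
      generalize Real.cos (m * θ) = cm at *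
      field_simp at hd
      have h3 : Real.sin θ * (sm * cd + cm * sd) = 0 := by linear_combination -hd
      exact (mul_eq_zero.1 h3).resolve_left hsθ.ne'
    -- Each of `m θ` and `d θ` lies strictly between `0` and `π`, so the only possible zero of the
    -- sine at their sum is `π`.
    have hπ : (m + d) * θ = Real.pi := by
      have h1 : Real.sin ((m + d) * θ - Real.pi) = 0 := by rw [Real.sin_sub_pi, hsum, neg_zero]
      have h2 := (Real.sin_eq_zero_iff_of_lt_of_lt (by nlinarith) (by nlinarith)).1 h1
      linarith
    have hmd : ((m + d : ℕ) : ℝ) ≠ 0 := by exact_mod_cast (by omega : m + d ≠ 0)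
    have hθq : channelAngle ((m + d : ℕ) : ℕ∞) = θ := by
      rw [channelAngle_coe, ← hπ]; push_cast at hmd ⊢; field_simp
    -- Expressing `η` through `d` rather than `m` gives `φ(g)` as a phase times `sin θ / sin(d θ)`.
    -- The modulus and the relation with the quantum number `[-d]` are both read off from this form.
    have hν : t - (1 + t) * η =
        Complex.exp (δ * ((d + 1) * θ) * Complex.I) * (Real.sin θ / Real.sin (d * θ) : ℝ) := by
      have h1 : (η : ℂ) = 1 - ((Real.sin ((d + 1) * θ) /
          (2 * Real.cos θ * Real.sin (d * θ)) : ℝ) : ℂ) := by rw [← hd]; push_cast; ring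
      have h2 : 1 + t = 2 * Complex.cos θ * Complex.exp (δ * θ * Complex.I) := by
        rw [ht, one_add_exp]
        rcases hδ with rfl | rfl <;> simp
      have h3 : ∀ x : ℂ, Complex.exp (δ * x * Complex.I) =
          Complex.cos x + δ * Complex.sin x * Complex.I := by
        intro x
        rw [Complex.exp_mul_I]
        rcases hδ with rfl | rfl <;> simp
      have h4 : t = 2 * Complex.cos θ * Complex.exp (δ * θ * Complex.I) - 1 := by rw [← h2]; ring
      have h5 : Complex.cos θ ≠ 0 := by exact_mod_cast hc.ne'
      have h6 : Complex.sin (d * θ) ≠ 0 := by exact_mod_cast hsd.ne'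
      have h7 : ((d : ℂ) + 1) * θ = d * θ + θ := by ring
      rw [h1, h2, h4, h3, h3]
      push_cast
      rw [h7, Complex.sin_add, Complex.cos_add]
      field_simp
      linear_combination Complex.sin (d * θ) * Complex.sin_sq_add_cos_sq (θ : ℂ)
    refine ⟨(m + d : ℕ), d, δ, by exact_mod_cast (by omega : 4 ≤ m + d), by exact_mod_cast hd2,
      by exact_mod_cast (by omega : d + 2 ≤ m + d), hδ, by rw [hθq, ht], fun _ => ?_,
      fun h => absurd h (ENat.natCast_ne_top _), fun h => absurd h (ENat.natCast_ne_top _), fun _ => ?_,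
      fun l ψ hl hψ => hdc l ψ (by exact_mod_cast hl) fun i hi =>
          iterate_one_sub_apply i ψ (hψ i hi), fun l ψ hl => hmc l ψ ?_⟩
    · rw [hν, hθq, ENat.toNat_natCast, norm_mul, Complex.norm_real, Real.norm_eq_abs,
        abs_of_pos (by positivity)]
      have : (δ * ((d + 1) * θ) * Complex.I : ℂ) = ((δ * ((d + 1) * θ) : ℝ) : ℂ) * Complex.I := by
        push_cast; ring
      rw [this, Complex.norm_exp_ofReal_mul_I, one_mul]
    · have e1 := exp_zpow_sub_one (θ := θ) hδ (-(d : ℤ))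
      have e2 := exp_zpow_sub_one (θ := θ) hδ 1
      rw [← ht] at e1 e2
      rw [zpow_one] at e2
      have h1 : Complex.sin θ ≠ 0 := by exact_mod_cast hsθ.ne'
      have h2 : Complex.sin (d * θ) ≠ 0 := by exact_mod_cast hsd.ne'
      have h3 : (δ : ℂ) ≠ 0 := by rcases hδ with rfl | rfl <;> simp
      have h4 : t ≠ 1 := by
        intro h4
        rw [h4, sub_self] at e2
        refine mul_ne_zero (Complex.exp_ne_zero _) ?_ e2.symm
        simpa [Complex.I_ne_zero, h3] using h1
      have h5 : Complex.exp (δ * ((d + 1) * θ) * Complex.I) *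
          Complex.exp (δ * ((-(d : ℤ) : ℤ) * θ) * Complex.I) =
          Complex.exp (δ * ((1 : ℤ) * θ) * Complex.I) := by
        rw [← Complex.exp_add]; congr 1; push_cast; ring
      have h6 := Complex.exp_ne_zero (δ * ((1 : ℤ) * θ) * Complex.I)
      rw [hν, ENat.toNat_natCast, quantumInt, if_neg h4, e1, e2]
      calc _ = (Complex.exp (δ * ((d + 1) * θ) * Complex.I) *
          Complex.exp (δ * ((-(d : ℤ) : ℤ) * θ) * Complex.I)) *
          ((Real.sin θ / Real.sin (d * θ) : ℝ) *
          (2 * δ * Complex.sin ((-(d : ℤ) : ℤ) * θ) * Complex.I)) /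
          (Complex.exp (δ * ((1 : ℤ) * θ) * Complex.I) *
            (2 * δ * Complex.sin ((1 : ℤ) * θ) * Complex.I)) := by ring
        _ = -1 := by
          rw [h5]
          push_cast
          rw [neg_mul, Complex.sin_neg, one_mul]
          generalize Complex.sin (d * θ) = sd at *
          have := Complex.I_ne_zero
          push_cast at h6
          rw [one_mul] at h6
          field_simp
    · have : m + d < l + 1 + d := by exact_mod_cast hl
      omega

end HeckeEndo

end HeckeEndomorphism

end LQP

end

/-! ### Spectral projections of normal elements annihilated by a polynomial. -/

noncomputable section

namespace LQP

section SpectralProjections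

open Polynomial

variable {H : Type*} [NormedAddCommGroup H] [InnerProductSpace ℂ H] [CompleteSpace H]
  {A : StarSubalgebra ℂ (H →L[ℂ] H)}

lemma commute_aeval {x T : A} (h : Commute x T) (p : ℂ[X]) : Commute x (aeval T p) := by
  induction p using Polynomial.induction_on' with
  | add p q hp hq => rw [map_add]; exact hp.add_right hq
  | monomial n a =>
    rw [aeval_monomial]
    exact Commute.mul_right (Algebra.commutes a x).symm (h.pow_right n)

lemma commute_star_aeval {T : A} (hn : Commute (star T) T) (p q : ℂ[X]) :
    Commute (star (aeval T p)) (aeval T q) := by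
  have h1 := commute_aeval hn p
  have h2 : Commute (star (aeval T p)) T := by
    have := h1.star_star
    rw [star_star] at this
    exact this.symm
  exact commute_aeval h2 q

lemma eq_zero_of_normal_of_pow {x : A} (hn : Commute (star x) x) {k : ℕ} (h : x ^ (k + 1) = 0) :
    x = 0 := by
  induction k with
  | zero => simpa using h
  | succ k ih =>
    apply ih
    have h1 : Commute (star (x ^ (k + 1))) (x ^ (k + 1)) := by
      rw [star_pow]; exact hn.pow_pow _ _
    refine Subtype.ext (eq_zero_of_normal_of_sq (congrArg Subtype.val h1.eq) ?_)
    have h2 : x ^ (k + 1) * x ^ (k + 1) = 0 := by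
      rw [← pow_add, show k + 1 + (k + 1) = (k + 1 + 1) + k by ring, pow_add, h, zero_mul]
    exact congrArg Subtype.val h2

/-- The eigenvalues of an operator which is annihilated by a polynomial. -/
def eigenset (T : A) : Finset ℂ := (minpoly ℂ T).roots.toFinset

open Classical in
/-- The spectral projections of a normal operator which is annihilated by a polynomial. -/
def specProj (T : A) (a : ℂ) : A :=
  if a ∈ eigenset T then aeval T (Lagrange.basis (eigenset T) id a) else 0

variable {T : A} (hn : Commute (star T) T) (hi : IsIntegral ℂ T)

include hn hi in
-- The product of `X - a` over the distinct eigenvalues has a power divisible by the minimal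
-- polynomial, so its value at `T` is nilpotent. It is also normal, hence zero, and it divides every
-- polynomial vanishing on the eigenvalues.
lemma aeval_eq_zero_of_eval {p : ℂ[X]} (hp : ∀ a ∈ eigenset T, p.eval a = 0) :
    aeval T p = 0 := by
  have h1 : ∏ a ∈ eigenset T, (X - C a) ∣ p := by
    refine Finset.prod_dvd_of_coprime (fun a _ b _ hab => ?_) fun a ha => ?_
    · exact isCoprime_X_sub_C_of_isUnit_sub (sub_ne_zero.2 hab).isUnit
    · exact dvd_iff_isRoot.2 (hp a ha)
  suffices h0 : aeval T (∏ a ∈ eigenset T, (X - C a)) = 0 by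
    obtain ⟨q, rfl⟩ := h1
    rw [map_mul, h0, zero_mul]
  have h2 : ∀ m : Multiset ℂ, (∀ a ∈ m, a ∈ eigenset T) →
      (m.map fun a => X - C a).prod ∣ (∏ a ∈ eigenset T, (X - C a)) ^ Multiset.card m := by
    intro m
    induction m using Multiset.induction with
    | empty => simp
    | cons a m ih =>
      intro hm
      rw [Multiset.map_cons, Multiset.prod_cons, Multiset.card_cons, pow_succ']
      exact mul_dvd_mul (Finset.dvd_prod_of_mem _ (hm a (Multiset.mem_cons_self a m)))
        (ih fun b hb => hm b (Multiset.mem_cons_of_mem hb))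
  have h3 := h2 (minpoly ℂ T).roots fun a ha => Multiset.mem_toFinset.2 ha
  rw [← (IsAlgClosed.splits (minpoly ℂ T)).eq_prod_roots_of_monic (minpoly.monic hi)] at h3
  obtain ⟨q, hq⟩ := h3
  have h4 : aeval T (∏ a ∈ eigenset T, (X - C a)) ^ (Multiset.card (minpoly ℂ T).roots + 1) = 0 := by
    rw [pow_succ, ← map_pow, hq, map_mul, minpoly.aeval, zero_mul, zero_mul]
  exact eq_zero_of_normal_of_pow (commute_star_aeval hn _ _) h4

include hn hi in
lemma aeval_eq_of_eval {p q : ℂ[X]} (hp : ∀ a ∈ eigenset T, p.eval a = q.eval a) :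
    aeval T p = aeval T q := by
  rw [← sub_eq_zero, ← map_sub]
  exact aeval_eq_zero_of_eval hn hi fun a ha => by rw [eval_sub, hp a ha, sub_self]

open Classical in
lemma eval_basis {a b : ℂ} (ha : a ∈ eigenset T) (hb : b ∈ eigenset T) :
    (Lagrange.basis (eigenset T) id a).eval b = if a = b then 1 else 0 := by
  split_ifs with h
  · subst h
    exact Lagrange.eval_basis_self (v := id) (Set.injOn_id _) ha
  · exact Lagrange.eval_basis_of_ne (v := id) h hb

include hn hi in
lemma sum_specProj : ∑ a ∈ eigenset T, specProj T a = 1 := by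
  classical
  rw [Finset.sum_congr rfl fun a ha => by rw [specProj, if_pos ha], ← map_sum,
    ← map_one (aeval T : ℂ[X] →ₐ[ℂ] A)]
  refine aeval_eq_of_eval hn hi fun b hb => ?_
  rw [eval_finsetSum, eval_one, Finset.sum_congr rfl fun a ha => eval_basis ha hb,
    Finset.sum_ite_eq' _ b, if_pos hb]

include hn hi in
lemma mul_specProj (a : ℂ) : T * specProj T a = a • specProj T a := by
  rw [specProj]
  split_ifs with ha
  · have : aeval T (X * Lagrange.basis (eigenset T) id a) =
        aeval T (a • Lagrange.basis (eigenset T) id a) := by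
      refine aeval_eq_of_eval hn hi fun b hb => ?_
      rw [eval_mul, eval_X, eval_smul, eval_basis ha hb]
      split_ifs with h
      · rw [h]; simp
      · simp
    rwa [map_mul, aeval_X, map_smul] at this
  · simp

open Classical in
include hn hi in
lemma specProj_mul_specProj (a b : ℂ) :
    specProj T a * specProj T b = if a = b then specProj T a else 0 := by
  by_cases ha : a ∈ eigenset T
  · by_cases hb : b ∈ eigenset T
    · simp only [specProj, if_pos ha, if_pos hb]
      split_ifs with h
      · subst h
        rw [← map_mul]
        refine aeval_eq_of_eval hn hi fun c hc => ?_
        rw [eval_mul, eval_basis ha hc]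
        split_ifs <;> simp
      · rw [← map_mul]
        refine aeval_eq_zero_of_eval hn hi fun c hc => ?_
        rw [eval_mul, eval_basis ha hc, eval_basis hb hc]
        split_ifs with h1 h2
        · exact absurd (h1.trans h2.symm) h
        all_goals simp
    · have : a ≠ b := fun h => hb (h ▸ ha)
      simp only [specProj, if_neg hb, mul_zero, if_neg this]
  · simp [specProj, if_neg ha]

include hn hi in
-- A normal idempotent `P` is self-adjoint: normality gives `P (1 - P⋆) = 0`, so `P = P P⋆`.
lemma star_specProj (a : ℂ) : star (specProj T a) = specProj T a := by
  set P := specProj T a with hP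
  have h1 : P * P = P := by rw [hP, specProj_mul_specProj hn hi, if_pos rfl]
  have h2 : Commute (star P) P := by
    rw [hP, specProj]
    split_ifs
    · exact commute_star_aeval hn _ _
    · simp
  have h3 : P * (1 - star P) = 0 := by
    apply StarSubalgebra.eq_zero_of_star_mul_self
    have h5 : (1 - P) * P = 0 := by rw [sub_mul, one_mul, h1, sub_self]
    have h4 : star (P * (1 - star P)) * (P * (1 - star P)) =
        star P * ((1 - P) * P) * (1 - star P) := by
      rw [star_mul, star_sub, star_one, star_star]
      have : (1 - P) * star P = star P * (1 - P) := by rw [sub_mul, mul_sub, one_mul, mul_one, h2.eq]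
      rw [this]; simp only [mul_assoc]
    rw [h4, h5, mul_zero, zero_mul]
  rw [mul_sub, mul_one, sub_eq_zero] at h3
  rw [h3, star_mul, star_star]

lemma commute_specProj {x : A} (h : Commute x T) (a : ℂ) : Commute x (specProj T a) := by
  rw [specProj]
  split_ifs
  · exact commute_aeval h _
  · exact Commute.zero_right _

lemma specProj_mem {S : Subalgebra ℂ A} (h : T ∈ S) (a : ℂ) : specProj T a ∈ S := by
  rw [specProj]
  split_ifs
  · exact Algebra.adjoin_le (S := S) (Set.singleton_subset_iff.2 h)
      (Polynomial.aeval_mem_adjoin_singleton ℂ T)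
  · exact zero_mem _

include hn hi in
lemma specProj_mul_eq_self {u : A} {a : ℂ} (h : T * u = a • u) : specProj T a * u = u := by
  classical
  have h1 : ∀ b, b ≠ a → specProj T b * u = 0 := by
    intro b hb
    have h2 : specProj T b * (T * u) = b • (specProj T b * u) := by
      have hc : Commute T (specProj T b) := commute_specProj (Commute.refl T) b
      rw [← mul_assoc, ← hc.eq, mul_specProj hn hi, smul_mul_assoc]
    rw [h, mul_smul_comm, ← sub_eq_zero, ← sub_smul] at h2
    exact (smul_eq_zero.1 h2).resolve_left (sub_ne_zero.2 hb.symm)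
  have h3 : ∑ b ∈ eigenset T, specProj T b * u = u := by
    rw [← Finset.sum_mul, sum_specProj hn hi, one_mul]
  by_cases ha : a ∈ eigenset T
  · rwa [Finset.sum_eq_single_of_mem a ha fun b _ hb => h1 b hb] at h3
  · rw [← h3, Finset.sum_eq_zero fun b hb => h1 b fun h => ha (h ▸ hb), mul_zero]

/-- The resolvent of `T`. -/
def resolv (T : A) (z : ℂ) : A := ∑ a ∈ eigenset T, (z - a)⁻¹ • specProj T a

include hn hi in
lemma sub_mul_resolv {z : ℂ} (hz : z ∉ eigenset T) : (z • 1 - T) * resolv T z = 1 := by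
  rw [resolv, Finset.mul_sum]
  refine (Finset.sum_congr rfl fun a ha => ?_).trans (sum_specProj hn hi)
  have h : z - a ≠ 0 := sub_ne_zero.2 fun h => hz (h ▸ ha)
  rw [mul_smul_comm, sub_mul, mul_specProj hn hi, smul_mul_assoc, one_mul, ← sub_smul, smul_smul,
    inv_mul_cancel₀ h, one_smul]

lemma commute_resolv {x : A} (h : Commute x T) (z : ℂ) : Commute x (resolv T z) :=
  Commute.sum_right _ _ _ fun a _ => (commute_specProj h a).smul_right _

lemma resolv_mem {S : Subalgebra ℂ A} (h : T ∈ S) (z : ℂ) : resolv T z ∈ S :=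
  sum_mem fun a _ => S.smul_mem (specProj_mem h a) _

include hn hi in
lemma resolv_mul_sub {z : ℂ} (hz : z ∉ eigenset T) : resolv T z * (z • 1 - T) = 1 := by
  have : Commute (z • 1 - T) (resolv T z) :=
    commute_resolv (((Commute.one_left T).smul_left z).sub_left (Commute.refl T)) z
  rw [← this.eq, sub_mul_resolv hn hi hz]

end SpectralProjections

/-! ### Jucys-Murphy elements: normality, commutation and exchange relations. -/

section HeckeEndomorphism

variable {H : Type*} [NormedAddCommGroup H] [InnerProductSpace ℂ H] [CompleteSpace H]
  {A : StarSubalgebra ℂ (H →L[ℂ] H)} {ρ : A →⋆ₐ[ℂ] A} {φ : A →ₗ[ℂ] A} {e : A} {t : ℂ} {η : ℝ}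

/-- The Jucys-Murphy elements. -/
def jucysMurphy (ρ : A →⋆ₐ[ℂ] A) (e : A) (t : ℂ) : ℕ → A
  | 0 => 0
  | n + 1 => t⁻¹ • (heckeGen e t * ρ (jucysMurphy ρ e t n) * heckeGen e t + heckeGen e t)

namespace HeckeEndo

lemma jucysMurphy_mem (n : ℕ) :
    jucysMurphy ρ e t n ∈ orbitAlg ρ (heckeGen e t) n := by
  induction n with
  | zero => exact zero_mem _
  | succ n ih =>
    have := self_mem_orbitAlg (ρ := ρ) (heckeGen e t) n
    exact Subalgebra.smul_mem _ (add_mem (mul_mem (mul_mem this (map_mem_orbitAlg ih)) this) this) _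

lemma isIntegral_jucysMurphy (h : HeckeEndo A ρ φ e t η) (n : ℕ) :
    IsIntegral ℂ (jucysMurphy ρ e t n) := by
  have := h.finiteDimensional_orbitAlg n
  have h1 := IsIntegral.of_finite ℂ
    (⟨jucysMurphy ρ e t n, jucysMurphy_mem n⟩ : orbitAlg ρ (heckeGen e t) n)
  exact h1.map (orbitAlg ρ (heckeGen e t) n).val

/-- The invertible form of the Jucys-Murphy elements. -/
def jucysMurphyUnitary (ρ : A →⋆ₐ[ℂ] A) (e : A) (t : ℂ) (n : ℕ) : A :=
  1 + (t - 1) • jucysMurphy ρ e t n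

/-- By the quadratic relation of `g` the inhomogeneous term of the additive recursion is absorbed.
The purely multiplicative recursion shows that these elements are unitary. -/
lemma jucysMurphyUnitary_succ (h : HeckeEndo A ρ φ e t η) (n : ℕ) :
    jucysMurphyUnitary ρ e t (n + 1) =
      t⁻¹ • (heckeGen e t * ρ (jucysMurphyUnitary ρ e t n) * heckeGen e t) := by
  have ht := h.t_ne_zero
  rw [jucysMurphyUnitary, jucysMurphyUnitary, jucysMurphy, map_add, map_one, map_smul, mul_add,
    add_mul, mul_one, h.heckeGen_mul_self, mul_smul_comm, smul_mul_assoc]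
  have h1 : (1 : A) = (t⁻¹ * t) • 1 := by rw [inv_mul_cancel₀ ht, one_smul]
  conv_lhs => { arg 1; rw [h1] }
  module

lemma jucysMurphyUnitary_unitary (h : HeckeEndo A ρ φ e t η) (n : ℕ) :
    star (jucysMurphyUnitary ρ e t n) * jucysMurphyUnitary ρ e t n = 1 ∧
      jucysMurphyUnitary ρ e t n * star (jucysMurphyUnitary ρ e t n) = 1 := by
  have ht := h.t_ne_zero
  induction n with
  | zero => simp [jucysMurphyUnitary, jucysMurphy]
  | succ n ih =>
    have h1 : star t⁻¹ * t⁻¹ = 1 := by rw [star_inv₀, h.star_t, inv_inv, mul_inv_cancel₀ ht]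
    have h2 : t⁻¹ * star t⁻¹ = 1 := by rw [mul_comm, h1]
    have h3 := congrArg ρ ih.1
    have h4 := congrArg ρ ih.2
    rw [map_mul, map_star, map_one] at h3 h4
    have h5 := h.star_mul_heckeGen
    have h6 := h.heckeGen_mul_star
    rw [h.jucysMurphyUnitary_succ, star_smul, smul_mul_smul_comm, smul_mul_smul_comm, h1, h2,
      one_smul, one_smul]
    generalize ρ (jucysMurphyUnitary ρ e t n) = L at *
    generalize heckeGen e t = g at *
    constructor
    · calc _ = star g * (star L * (star g * g) * L) * g := by simp only [star_mul, mul_assoc]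
        _ = 1 := by rw [h5, mul_one, h3, mul_one, h5]
    · calc _ = g * (L * (g * star g) * star L) * star g := by simp only [star_mul, mul_assoc]
        _ = 1 := by rw [h6, mul_one, h4, mul_one, h6]

/-- For `t = 1` the elements are self-adjoint; otherwise they are affine functions of a unitary. -/
lemma normal_jucysMurphy (h : HeckeEndo A ρ φ e t η) (n : ℕ) :
    Commute (star (jucysMurphy ρ e t n)) (jucysMurphy ρ e t n) := by
  by_cases h1 : t = 1
  · have h2 : star (jucysMurphy ρ e t n) = jucysMurphy ρ e t n := by
      have hs : star (heckeGen e t) = heckeGen e t := by rw [h.star_heckeGen, h1]; simp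
      induction n with
      | zero => exact star_zero _
      | succ n ih =>
        have h3 : star t⁻¹ = t⁻¹ := by rw [h1]; simp
        rw [jucysMurphy, star_smul, h3, star_add, star_mul, star_mul, hs, ← map_star, ih, mul_assoc]
    rw [h2]
  · have h2 : t - 1 ≠ 0 := sub_ne_zero.2 h1
    have h3 : jucysMurphy ρ e t n = (t - 1)⁻¹ • (jucysMurphyUnitary ρ e t n - 1) := by
      rw [jucysMurphyUnitary, add_sub_cancel_left, smul_smul, inv_mul_cancel₀ h2, one_smul]
    have h4 : Commute (star (jucysMurphyUnitary ρ e t n)) (jucysMurphyUnitary ρ e t n) := by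
      have := h.jucysMurphyUnitary_unitary n
      exact this.1.trans this.2.symm
    rw [h3, star_smul, star_sub, star_one]
    exact (((h4.sub_right (Commute.one_right _)).sub_left (Commute.one_left _)).smul_right
      _).smul_left _

/-- Only the first generator `f = ρ(g)` is critical. After unfolding the recursion twice, it passes
through `g f Z f g` by the braid relation on either side of `Z = ρ²(L_n)`, which commutes with `g`;
the remaining terms are handled by the Hecke relation. Generators `ρ²(·)` commute with `g` and are
covered by the induction. -/
lemma commute_map_jucysMurphy (h : HeckeEndo A ρ φ e t η) (n : ℕ) :
    ∀ x ∈ orbitAlg ρ (heckeGen e t) n, Commute (ρ x) (jucysMurphy ρ e t (n + 1)) := by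
  induction n with
  | zero =>
    intro x hx
    obtain ⟨c, rfl⟩ := orbitAlg_zero hx
    rw [map_smul, map_one]
    exact (Commute.one_left _).smul_left c
  | succ n ih =>
    intro x hx
    induction hx using Algebra.adjoin_induction with
    | mem x hx =>
      obtain ⟨i, hi, rfl⟩ := hx
      rcases i with - | i
      · set g := heckeGen e t with hg
        set f := ρ g with hf
        set Z := ρ (ρ (jucysMurphy ρ e t n)) with hZ
        have hgZ : g * Z = Z * g := h.heckeGen_comm _
        have hb : g * f * g = f * g * f := h.heckeGen_braid
        have hff : f * f = (t - 1) • f + t • 1 := by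
          rw [hf, ← map_mul, h.heckeGen_mul_self, map_add, map_smul, map_smul, map_one]
        have hfJ : ρ (jucysMurphy ρ e t (n + 1)) = t⁻¹ • (f * Z * f + f) := by
          rw [jucysMurphy, map_smul, map_add, map_mul, map_mul]
        have e1 : jucysMurphy ρ e t (n + 1 + 1) =
            t⁻¹ • (t⁻¹ • (g * f * Z * f * g) + (t⁻¹ • (f * g * f) + g)) := by
          rw [jucysMurphy, hfJ, mul_smul_comm, smul_mul_assoc, mul_add, add_mul, ← hg, hb]
          simp only [mul_assoc, smul_add, add_assoc]
        rw [Function.iterate_zero, id, ← hf, e1]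
        refine Commute.smul_right (Commute.add_right (Commute.smul_right ?_ _) ?_) _
        · change f * _ = _ * f
          calc f * (g * f * Z * f * g) = (f * g * f) * Z * f * g := by simp only [mul_assoc]
            _ = g * f * (g * Z) * f * g := by rw [← hb]; simp only [mul_assoc]
            _ = g * f * Z * (g * f * g) := by rw [hgZ]; simp only [mul_assoc]
            _ = _ := by rw [hb]; simp only [mul_assoc]
        · change f * _ = _ * f
          have e2 : f * (f * g * f) = (t - 1) • (f * g * f) + t • (g * f) := by
            rw [mul_assoc, ← mul_assoc, hff, add_mul, smul_mul_assoc, smul_mul_assoc, one_mul]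
          have e3 : f * g * f * f = (t - 1) • (f * g * f) + t • (f * g) := by
            rw [mul_assoc _ f f, hff, mul_add, mul_smul_comm, mul_smul_comm, mul_one]
          rw [mul_add, add_mul, mul_smul_comm, smul_mul_assoc, e2, e3, smul_add, smul_add,
            smul_smul t⁻¹ t, smul_smul t⁻¹ t, inv_mul_cancel₀ h.t_ne_zero, one_smul, one_smul]
          abel
      · rw [Function.iterate_succ_apply' ρ, jucysMurphy]
        have h1 := h.heckeGen_comm ((⇑ρ)^[i] (heckeGen e t))
        have h2 := (ih _ (iterate_mem_orbitAlg (x := heckeGen e t) (i := i) (by omega))).map ρ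
        exact ((((h1.symm.mul_right h2).mul_right h1.symm)).add_right h1.symm).smul_right _
    | algebraMap r =>
      rw [AlgHomClass.commutes]; exact Algebra.commutes r _
    | add a b _ _ ha hb => rw [map_add]; exact ha.add_left hb
    | mul a b _ _ ha hb => rw [map_mul]; exact ha.mul_left hb

lemma commute_jucysMurphy (h : HeckeEndo A ρ φ e t η) {n k : ℕ} (hk : k ≤ n - 1) {x : A}
    (hx : x ∈ orbitAlg ρ (heckeGen e t) k) : Commute (ρ x) (jucysMurphy ρ e t n) := by
  rcases n with - | n
  · exact Commute.zero_right _
  · exact h.commute_map_jucysMurphy n x (orbitAlg_mono (by omega) hx)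

/-- This and its mirror image are the exchange relations of the affine Hecke algebra. They say how
`g` interchanges two consecutive Jucys-Murphy elements up to a correction free of `g`. -/
lemma gen_mul_map_jucysMurphy (h : HeckeEndo A ρ φ e t η) (n : ℕ) :
    heckeGen e t * ρ (jucysMurphy ρ e t n) = jucysMurphy ρ e t (n + 1) * heckeGen e t -
      ((t - 1) • jucysMurphy ρ e t (n + 1) + 1) := by
  set g := heckeGen e t with hg
  set X := ρ (jucysMurphy ρ e t n)
  have ht := h.t_ne_zero
  have h1 : jucysMurphy ρ e t (n + 1) = t⁻¹ • (g * X * g + g) := rfl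
  have h2 : g * g = (t - 1) • g + t • 1 := h.heckeGen_mul_self
  have e1 : (g * X * g + g) * g = (t - 1) • (g * X * g + g) + t • (g * X + 1) := by
    rw [add_mul, mul_assoc _ g g, h2, mul_add, mul_smul_comm, mul_smul_comm, mul_one]
    module
  rw [h1, smul_mul_assoc, e1, smul_add, smul_smul t⁻¹ t, inv_mul_cancel₀ ht, one_smul,
    smul_comm (t - 1)]
  abel

lemma map_jucysMurphy_mul_gen (h : HeckeEndo A ρ φ e t η) (n : ℕ) :
    ρ (jucysMurphy ρ e t n) * heckeGen e t = heckeGen e t * jucysMurphy ρ e t (n + 1) -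
      ((t - 1) • jucysMurphy ρ e t (n + 1) + 1) := by
  set g := heckeGen e t with hg
  set X := ρ (jucysMurphy ρ e t n)
  have ht := h.t_ne_zero
  have h1 : jucysMurphy ρ e t (n + 1) = t⁻¹ • (g * X * g + g) := rfl
  have h2 : g * g = (t - 1) • g + t • 1 := h.heckeGen_mul_self
  have e1 : g * (g * X * g + g) = (t - 1) • (g * X * g + g) + t • (X * g + 1) := by
    rw [mul_add, mul_assoc g X g, ← mul_assoc g g, h2, add_mul, smul_mul_assoc, smul_mul_assoc,
      one_mul, ← mul_assoc]
    module
  rw [h1, mul_smul_comm, e1, smul_add, smul_smul t⁻¹ t, inv_mul_cancel₀ ht, one_smul,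
    smul_comm (t - 1)]
  abel

end HeckeEndo

end HeckeEndomorphism

end LQP

end

noncomputable section

namespace LQP

open Filter Topology

/-! ### Local orders of functions -/

/-- `f` has order `k` at `a`. -/
def HasOrder (f : ℂ → ℂ) (a : ℂ) (k : ℤ) : Prop :=
  ∃ g : ℂ → ℂ, ContinuousAt g a ∧ g a ≠ 0 ∧ ∀ᶠ z in 𝓝[≠] a, f z = (z - a) ^ k * g z

namespace HasOrder

variable {f g : ℂ → ℂ} {a : ℂ} {k l : ℤ}

lemma mul (hf : HasOrder f a k) (hg : HasOrder g a l) :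
    HasOrder (fun z => f z * g z) a (k + l) := by
  obtain ⟨f', hf1, hf2, hf3⟩ := hf
  obtain ⟨g', hg1, hg2, hg3⟩ := hg
  refine ⟨fun z => f' z * g' z, hf1.mul hg1, mul_ne_zero hf2 hg2, ?_⟩
  filter_upwards [hf3, hg3, self_mem_nhdsWithin] with z h1 h2 h3
  have : z - a ≠ 0 := sub_ne_zero.2 h3
  rw [h1, h2, zpow_add₀ this]; ring

lemma inv (hf : HasOrder f a k) : HasOrder (fun z => (f z)⁻¹) a (-k) := by
  obtain ⟨f', hf1, hf2, hf3⟩ := hf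
  refine ⟨fun z => (f' z)⁻¹, hf1.inv₀ hf2, inv_ne_zero hf2, ?_⟩
  filter_upwards [hf3] with z h1
  rw [h1, mul_inv, zpow_neg]

lemma sub_const (a b : ℂ) : HasOrder (fun z => z - b) a (if a = b then 1 else 0) := by
  split_ifs with h
  · subst h
    exact ⟨fun _ => 1, continuousAt_const, one_ne_zero, by simp⟩
  · refine ⟨fun z => z - b, by fun_prop, sub_ne_zero.2 h, by simp⟩

lemma const {c : ℂ} (hc : c ≠ 0) (a : ℂ) : HasOrder (fun _ => c) a 0 :=
  ⟨fun _ => c, continuousAt_const, hc, by simp⟩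

lemma tendsto_mul_zero (hf : HasOrder f a k) (hk : 0 ≤ k) :
    Tendsto (fun z => (z - a) * f z) (𝓝[≠] a) (𝓝 0) := by
  obtain ⟨g, hg1, hg2, hg3⟩ := hf
  obtain ⟨n, rfl⟩ := Int.eq_ofNat_of_zero_le hk
  have h1 : ContinuousAt (fun z => (z - a) ^ (n + 1) * g z) a := by fun_prop
  have h2 := h1.tendsto.mono_left (nhdsWithin_le_nhds (s := {a}ᶜ))
  simp only [sub_self, zero_pow n.succ_ne_zero, zero_mul] at h2
  refine h2.congr' ?_
  filter_upwards [hg3] with z hz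
  rw [hz, zpow_natCast]; ring

lemma exists_tendsto_mul (hf : HasOrder f a (-1)) :
    ∃ c : ℂ, c ≠ 0 ∧ Tendsto (fun z => (z - a) * f z) (𝓝[≠] a) (𝓝 c) := by
  obtain ⟨g, hg1, hg2, hg3⟩ := hf
  refine ⟨g a, hg2, (hg1.tendsto.mono_left nhdsWithin_le_nhds).congr' ?_⟩
  filter_upwards [hg3, self_mem_nhdsWithin] with z hz h3
  have : z - a ≠ 0 := sub_ne_zero.2 h3
  rw [hz, zpow_neg_one, mul_inv_cancel_left₀ this]

end HasOrder

/-- The exchange relation, multiplied by the resolvents `S` of `Y` and `P` of `X`, moves `S` past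
`g`; doing so twice eliminates `S g`. Every term on the right has a form that `φ` can evaluate: `g P
g'` by the twist identity and the others by the bimodule property. -/
lemma resolvent_identity {R : Type*} [Ring R] [Algebra ℂ R] {t z : ℂ} {g g' X Y P S : R}
    (hgX : g * X = Y * g - ((t - 1) • Y + 1)) (hXP : (z • 1 - X) * P = 1)
    (hSY : S * (z • 1 - Y) = 1) (hPS : P * S = S * P) (hgg : g * g' = 1)
    (hgs : t • g' = g - (t - 1) • 1) :
    t • S = t • (g * P * g') + ((t - 1) * z + 1) • (P * g * P +
        ((t - 1) * z + 1) • (P * S * P) - (t - 1) • (P * P) - (t - 1) • (P * S)) -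
      (t - 1) • (P * g - (t - 1) • P) := by
  have hSY' : S * Y = z • S - 1 := by
    rw [mul_sub, mul_smul_comm, mul_one] at hSY
    rw [← hSY]; abel
  have hXP' : X * P = z • P - 1 := by
    rw [sub_mul, smul_mul_assoc, one_mul] at hXP
    rw [← hXP]; abel
  have hSg : S * g = g * P + ((t - 1) * z + 1) • (S * P) - (t - 1) • P := by
    have e1 : S * (g * X) * P = S * (Y * g - ((t - 1) • Y + 1)) * P := by rw [hgX]
    have e2 : S * (g * X) * P = z • (S * g * P) - S * g := by
      rw [mul_assoc, mul_assoc, hXP', mul_sub, mul_sub, mul_smul_comm, mul_smul_comm, mul_one,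
        ← mul_assoc]
    have e3 : S * (Y * g - ((t - 1) • Y + 1)) * P =
        z • (S * g * P) - g * P - ((t - 1) • (z • (S * P) - P) + S * P) := by
      rw [mul_sub, mul_add, mul_one, mul_smul_comm, ← mul_assoc, hSY']
      simp only [sub_mul, add_mul, smul_mul_assoc, one_mul]
    rw [e2, e3] at e1
    have e4 : S * g = z • (S * g * P) - (z • (S * g * P) - S * g) := by abel
    rw [e4, e1]
    module
  have hPg : t • (P * g') = P * g - (t - 1) • P := by
    rw [← mul_smul_comm, hgs, mul_sub, mul_smul_comm, mul_one]
  have hSPg : t • (S * P * g') = P * g * P + ((t - 1) * z + 1) • (P * S * P) - (t - 1) • (P * P) -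
      (t - 1) • (P * S) := by
    have e1 : S * P * g = P * (S * g) := by rw [← hPS, mul_assoc]
    have e2 : S * P * (g - (t - 1) • 1) = P * (S * g) - (t - 1) • (P * S) := by
      rw [mul_sub, mul_smul_comm, mul_one, e1, hPS]
    rw [← mul_smul_comm, hgs, e2, hSg, mul_sub, mul_add, mul_smul_comm, mul_smul_comm,
      ← mul_assoc P g, ← mul_assoc P S]
  have hS : S = g * P * g' + ((t - 1) * z + 1) • (S * P * g') - (t - 1) • (P * g') := by
    have e1 : S * g * g' = (g * P + ((t - 1) * z + 1) • (S * P) - (t - 1) • P) * g' := by rw [hSg]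
    rw [mul_assoc, hgg, mul_one, sub_mul, add_mul, smul_mul_assoc, smul_mul_assoc] at e1
    exact e1
  conv_lhs => rw [hS]
  rw [smul_sub, smul_add, smul_comm t ((t - 1) * z + 1), hSPg, smul_comm t (t - 1), hPg]

/-! ### Transition functions from the resolvents of the Jucys-Murphy elements. -/

section HeckeEndomorphism

variable {H : Type*} [NormedAddCommGroup H] [InnerProductSpace ℂ H] [CompleteSpace H]
  {A : StarSubalgebra ℂ (H →L[ℂ] H)} {ρ : A →⋆ₐ[ℂ] A} {φ : A →ₗ[ℂ] A} {e : A} {t : ℂ} {η : ℝ}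
  {Q : ℕ}

/-- The generating function of the transition coefficients. -/
def transition (t ν : ℂ) : List (ZMod Q) → ℂ → ℂ
  | [], z => z⁻¹ + ν
  | x :: w, z => transition t ν w z * ((z - quantumNumber t x) * (z - quantumNumber t x)) *
      ((z - quantumNumber t (x + 1)) * (z - quantumNumber t (x - 1)))⁻¹

open Classical in
/-- The order of the generating function of the transition coefficients. -/
def transitionOrder (t ν : ℂ) : List (ZMod Q) → ℂ → ℤ
  | [], a => (if ν ≠ 0 ∧ ν * a = -1 then 1 else 0) - if a = 0 then 1 else 0
  | x :: w, a => transitionOrder t ν w a + 2 * (if a = quantumNumber t x then 1 else 0) -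
      (if a = quantumNumber t (x + 1) then 1 else 0) -
      (if a = quantumNumber t (x - 1) then 1 else 0)

lemma hasOrder_transition (t ν : ℂ) (w : List (ZMod Q)) (a : ℂ) :
    HasOrder (transition t ν w) a (transitionOrder t ν w a) := by
  classical
  induction w with
  | nil =>
    have h1 : HasOrder (fun z => 1 + ν * z) a (if ν ≠ 0 ∧ ν * a = -1 then 1 else 0) := by
      by_cases hν : ν = 0
      · subst hν
        simpa using HasOrder.const one_ne_zero a
      · have h2 := (HasOrder.const hν a).mul (HasOrder.sub_const a (-ν⁻¹))
        have h3 : (a = -ν⁻¹) = (ν ≠ 0 ∧ ν * a = -1) := by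
          rw [eq_iff_iff]
          constructor
          · rintro rfl; exact ⟨hν, by field_simp⟩
          · rintro ⟨-, h⟩; field_simp; linear_combination h
        simp only [h3, zero_add] at h2
        convert h2 using 2 with z
        field_simp; ring
    have h2 := h1.mul (HasOrder.sub_const a 0).inv
    rw [← sub_eq_add_neg] at h2
    obtain ⟨g, g1, g2, g3⟩ := h2
    refine ⟨g, g1, g2, ?_⟩
    filter_upwards [g3, nhdsNE_le_cofinite a (Set.finite_singleton 0).eventually_cofinite_notMem]
      with z hz hz0
    have hz0 : z ≠ 0 := hz0
    refine Eq.trans ?_ hz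
    rw [transition, sub_zero]
    field_simp
  | cons x w ih =>
    have h1 := (ih.mul ((HasOrder.sub_const a (quantumNumber t x)).mul
      (HasOrder.sub_const a (quantumNumber t x)))).mul
      ((HasOrder.sub_const a (quantumNumber t (x + 1))).mul
        (HasOrder.sub_const a (quantumNumber t (x - 1)))).inv
    have h2 : transitionOrder t ν (x :: w) a = transitionOrder t ν w a +
        ((if a = quantumNumber t x then 1 else 0) + (if a = quantumNumber t x then 1 else 0)) +
        -((if a = quantumNumber t (x + 1) then 1 else 0) +
          (if a = quantumNumber t (x - 1) then 1 else 0)) := by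
      simp only [transitionOrder]; ring
    rw [h2]
    exact h1

namespace HeckeEndo

/-- The projections onto the joint spectral subspaces of the Jucys-Murphy elements. -/
def pathProj (ρ : A →⋆ₐ[ℂ] A) (e : A) (t : ℂ) : List (ZMod Q) → A
  | [] => 1
  | c :: w => ρ (pathProj ρ e t w) * specProj (jucysMurphy ρ e t w.length) (quantumNumber t c)

lemma pathProj_mem (w : List (ZMod Q)) :
    pathProj ρ e t w ∈ orbitAlg ρ (heckeGen e t) (w.length - 1) := by
  induction w with
  | nil => exact one_mem _
  | cons c w ih =>
    rcases w with - | ⟨c', w⟩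
    · rw [pathProj, pathProj, map_one, one_mul]
      exact specProj_mem (jucysMurphy_mem _) _
    · exact mul_mem (map_mem_orbitAlg ih) (specProj_mem (jucysMurphy_mem _) _)

lemma commute_map_pathProj (h : HeckeEndo A ρ φ e t η) (w : List (ZMod Q)) :
    Commute (ρ (pathProj ρ e t w)) (jucysMurphy ρ e t w.length) :=
  h.commute_jucysMurphy le_rfl (pathProj_mem w)

lemma pathProj_star_idem (h : HeckeEndo A ρ φ e t η) (w : List (ZMod Q)) :
    star (pathProj ρ e t w) = pathProj ρ e t w ∧
      pathProj ρ e t w * pathProj ρ e t w = pathProj ρ e t w := by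
  classical
  induction w with
  | nil => exact ⟨star_one _, one_mul _⟩
  | cons c w ih =>
    have h1 := commute_specProj (h.commute_map_pathProj w) (quantumNumber t c)
    have h2 := star_specProj (h.normal_jucysMurphy w.length) (h.isIntegral_jucysMurphy _)
      (quantumNumber t c)
    have h3 := specProj_mul_specProj (h.normal_jucysMurphy w.length) (h.isIntegral_jucysMurphy _)
      (quantumNumber t c) (quantumNumber t c)
    rw [if_pos rfl] at h3
    rw [pathProj]
    refine ⟨?_, ?_⟩
    · rw [star_mul, h2, ← map_star, ih.1, h1.eq]
    · rw [mul_assoc, ← mul_assoc _ (ρ _), ← h1.eq, mul_assoc (ρ _) _ (specProj _ _), h3,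
        ← mul_assoc, ← map_mul, ih.2]

lemma pathProj_orthogonal (h : HeckeEndo A ρ φ e t η) (hQ : IsPeriod t Q) :
    ∀ {w w' : List (ZMod Q)}, w.length = w'.length → w ≠ w' →
      pathProj ρ e t w * pathProj ρ e t w' = 0
  | [], [], _, hne => absurd rfl hne
  | [], c :: w, hl, _ => by simp at hl
  | c :: w, [], hl, _ => by simp at hl
  | c :: w, c' :: w', hl, hne => by
    classical
    have hl' : w.length = w'.length := by simpa using hl
    have h1 := commute_specProj (h.commute_map_pathProj w) (quantumNumber t c)
    have h2 := commute_specProj (h.commute_map_pathProj w') (quantumNumber t c)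
    rw [← hl'] at h2
    rw [pathProj, pathProj, ← hl', mul_assoc, ← mul_assoc _ (ρ _), ← h2.eq,
      mul_assoc (ρ _) _ (specProj _ _), ← mul_assoc,
      specProj_mul_specProj (h.normal_jucysMurphy w.length) (h.isIntegral_jucysMurphy _)]
    by_cases hw : w = w'
    · subst hw
      have hc : c ≠ c' := fun h => hne (by rw [h])
      rw [if_neg (fun h => hc (hQ.quantumNumber_injective h)), mul_zero]
    · rw [← map_mul, h.pathProj_orthogonal hQ hl' hw, map_zero, zero_mul]

/-- The recursion for the conditional expectations of the resolvents. -/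
lemma φ_resolv_recursion (h : HeckeEndo A ρ φ e t η) {n : ℕ} {z : ℂ}
    (hz : z ∉ eigenset (jucysMurphy ρ e t n)) (hz' : z ∉ eigenset (jucysMurphy ρ e t (n + 1))) :
    t • φ (resolv (jucysMurphy ρ e t (n + 1)) z) =
      t • ρ (φ (resolv (jucysMurphy ρ e t n) z)) +
      ((t - 1) * z + 1) • ((t - (1 + t) * η) •
          (resolv (jucysMurphy ρ e t n) z * resolv (jucysMurphy ρ e t n) z) +
        ((t - 1) * z + 1) • (resolv (jucysMurphy ρ e t n) z *
          φ (resolv (jucysMurphy ρ e t (n + 1)) z) * resolv (jucysMurphy ρ e t n) z) -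
        (t - 1) • (resolv (jucysMurphy ρ e t n) z * resolv (jucysMurphy ρ e t n) z) -
        (t - 1) • (resolv (jucysMurphy ρ e t n) z *
          φ (resolv (jucysMurphy ρ e t (n + 1)) z))) -
      (t - 1) • ((t - (1 + t) * η) • resolv (jucysMurphy ρ e t n) z -
        (t - 1) • resolv (jucysMurphy ρ e t n) z) := by
  have hXP := congrArg ρ (sub_mul_resolv (h.normal_jucysMurphy n) (h.isIntegral_jucysMurphy n) hz)
  rw [map_mul, map_sub, map_smul, map_one] at hXP
  have hgs : t • star (heckeGen e t) = heckeGen e t - (t - 1) • 1 := by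
    rw [h.star_heckeGen, smul_add, smul_smul, smul_smul, mul_inv_cancel₀ h.t_ne_zero, mul_sub,
      mul_inv_cancel₀ h.t_ne_zero]
    module
  have hPR : Commute (ρ (resolv (jucysMurphy ρ e t n) z)) (resolv (jucysMurphy ρ e t (n + 1)) z) :=
    commute_resolv (h.commute_map_jucysMurphy n _ (resolv_mem (jucysMurphy_mem n) z)) z
  have key := congrArg φ (resolvent_identity (h.gen_mul_map_jucysMurphy n) hXP
    (resolv_mul_sub (h.normal_jucysMurphy (n + 1)) (h.isIntegral_jucysMurphy _) hz') hPR.eq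
    h.heckeGen_mul_star hgs)
  have htw := h.twist _ (h.local_of_mem_orbitAlg
    (resolv_mem (jucysMurphy_mem (ρ := ρ) (e := e) (t := t) n) z))
  simp only [map_add, map_sub, map_smul, h.φ_mul_ρ, h.φ_ρ_mul, h.φ_ρ, h.φ_heckeGen, htw,
    mul_smul_comm, smul_mul_assoc, mul_one] at key
  exact key

lemma jucysMurphy_mul_pathProj (h : HeckeEndo A ρ φ e t η) (x : ZMod Q) (w : List (ZMod Q)) :
    jucysMurphy ρ e t w.length * pathProj ρ e t (x :: w) =
      quantumNumber t x • pathProj ρ e t (x :: w) := by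
  rw [pathProj, ← mul_assoc, ← (h.commute_map_pathProj w).eq, mul_assoc,
    mul_specProj (h.normal_jucysMurphy _) (h.isIntegral_jucysMurphy _), mul_smul_comm]

lemma resolv_mul_of_eigen (h : HeckeEndo A ρ φ e t η) {n : ℕ} {u : A} {a z : ℂ}
    (hu : jucysMurphy ρ e t n * u = a • u) (hz : z ∉ eigenset (jucysMurphy ρ e t n)) (hza : z ≠ a) :
    resolv (jucysMurphy ρ e t n) z * u = (z - a)⁻¹ • u := by
  have h1 := resolv_mul_sub (h.normal_jucysMurphy n) (h.isIntegral_jucysMurphy n) hz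
  have h2 : (z • 1 - jucysMurphy ρ e t n) * u = (z - a) • u := by
    rw [sub_mul, hu, smul_mul_assoc, one_mul, sub_smul]
  have h3 : (z - a) • (resolv (jucysMurphy ρ e t n) z * u) = u := by
    rw [← mul_smul_comm, ← h2, ← mul_assoc, h1, one_mul]
  rw [← h3, smul_smul, h3, inv_mul_cancel₀ (sub_ne_zero.2 hza), one_smul]

lemma eventually_cofinite_linear_ne (t : ℂ) : ∀ᶠ z in cofinite, (t - 1) * z + 1 ≠ 0 := by
  by_cases ht : t - 1 = 0
  · simp [ht]
  · filter_upwards [(Set.finite_singleton (-(t - 1)⁻¹)).eventually_cofinite_notMem] with z hz h0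
    apply hz
    rw [Set.mem_singleton_iff]
    field_simp
    linear_combination h0

/-- The conditional expectation of the resolvent is a scalar on the path projections. -/
theorem φ_resolv_mul_pathProj (h : HeckeEndo A ρ φ e t η) (hQ : IsPeriod t Q)
    (w : List (ZMod Q)) : ∀ᶠ z in cofinite,
      φ (resolv (jucysMurphy ρ e t w.length) z) * pathProj ρ e t w =
        ((transition t (t - (1 + t) * η) w z - (t - (1 + t) * η - (t - 1))) /
          ((t - 1) * z + 1)) • pathProj ρ e t w := by
  induction w with
  | nil =>
    filter_upwards [eventually_cofinite_linear_ne t,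
      (eigenset (jucysMurphy ρ e t 0)).finite_toSet.eventually_cofinite_notMem,
      (Set.finite_singleton 0).eventually_cofinite_notMem] with z hζ hz hz0
    have hz0 : z ≠ 0 := hz0
    have h1 := h.resolv_mul_of_eigen (n := 0) (u := 1) (a := 0) (z := z)
      (by simp [jucysMurphy]) hz hz0
    rw [mul_one, sub_zero] at h1
    rw [List.length_nil, h1, map_smul, h.φ_one, pathProj, mul_one]
    congr 1
    rw [transition, eq_div_iff hζ]
    field_simp
    ring
  | cons x w ih =>
    filter_upwards [ih, eventually_cofinite_linear_ne t,
      (eigenset (jucysMurphy ρ e t w.length)).finite_toSet.eventually_cofinite_notMem,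
      (eigenset (jucysMurphy ρ e t (w.length + 1))).finite_toSet.eventually_cofinite_notMem,
      (Set.finite_singleton (quantumNumber t x)).eventually_cofinite_notMem,
      (Set.finite_singleton (quantumNumber t (x + 1))).eventually_cofinite_notMem,
      (Set.finite_singleton (quantumNumber t (x - 1))).eventually_cofinite_notMem]
      with z hM hζ hz hz' hzx hzx1 hzx2
    have ht := h.t_ne_zero
    have hx1 := hQ.quantumNumber_add_one x
    have hx2 : quantumNumber t (x - 1) = (quantumNumber t x - 1) / t := by
      have := hQ.quantumNumber_add_one (x - 1)
      rw [sub_add_cancel] at this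
      rw [this]; field_simp; ring
    have hzx : z - quantumNumber t x ≠ 0 := sub_ne_zero.2 hzx
    have hzx1 : z - quantumNumber t (x + 1) ≠ 0 := sub_ne_zero.2 hzx1
    have hzx2 : z - quantumNumber t (x - 1) ≠ 0 := sub_ne_zero.2 hzx2
    have hSq := h.resolv_mul_of_eigen (h.jucysMurphy_mul_pathProj x w) hz (sub_ne_zero.1 hzx)
    -- On the path projection the resolvent acts as the number `(z - [x])⁻¹`, and the induction
    -- hypothesis makes `ρ(φ(·))` of it a number too. The recursion becomes a linear equation for
    -- the unknown `F q`.
    have key := congrArg (· * pathProj ρ e t (x :: w)) (h.φ_resolv_recursion hz hz')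
    have hcomm : resolv (jucysMurphy ρ e t w.length) z *
        φ (resolv (jucysMurphy ρ e t (w.length + 1)) z) =
        φ (resolv (jucysMurphy ρ e t (w.length + 1)) z) *
        resolv (jucysMurphy ρ e t w.length) z := by
      rw [← h.φ_ρ_mul, ← h.φ_mul_ρ]
      congr 1
      exact commute_resolv (h.commute_map_jucysMurphy _ _ (resolv_mem (jucysMurphy_mem _) z)) z
    have hMq : ρ (φ (resolv (jucysMurphy ρ e t w.length) z)) * pathProj ρ e t (x :: w) =
        ((transition t (t - (1 + t) * η) w z - (t - (1 + t) * η - (t - 1))) /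
          ((t - 1) * z + 1)) • pathProj ρ e t (x :: w) := by
      rw [pathProj, ← mul_assoc, ← map_mul, hM, map_smul, smul_mul_assoc]
    rw [List.length_cons]
    generalize φ (resolv (jucysMurphy ρ e t (w.length + 1)) z) = F at *
    generalize ρ (φ (resolv (jucysMurphy ρ e t w.length) z)) = G at *
    generalize resolv (jucysMurphy ρ e t w.length) z = S at *
    generalize pathProj ρ e t (x :: w) = q at *
    have h1 : S * S * q = ((z - quantumNumber t x)⁻¹ * (z - quantumNumber t x)⁻¹) • q := by
      rw [mul_assoc, hSq, mul_smul_comm, hSq, smul_smul]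
    have h2 : S * F * q = (z - quantumNumber t x)⁻¹ • (F * q) := by
      rw [hcomm, mul_assoc, hSq, mul_smul_comm]
    have h3 : S * F * S * q = ((z - quantumNumber t x)⁻¹ * (z - quantumNumber t x)⁻¹) •
        (F * q) := by
      rw [mul_assoc, hSq, mul_smul_comm, h2, smul_smul]
    -- The left side is `t (z - [x + 1]) (z - [x - 1])`. The identity shows that this product,
    -- divided by `(z - [x])²`, is the coefficient of the unknown, which explains the poles of the
    -- transition function.
    have hD : (z - (t * quantumNumber t x + 1)) * (t * z - (quantumNumber t x - 1)) =
        t * (z - quantumNumber t x) ^ 2 - ((t - 1) * z + 1) ^ 2 +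
          ((t - 1) * z + 1) * (t - 1) * (z - quantumNumber t x) := by ring
    have hzx2' : t * z - (quantumNumber t x - 1) ≠ 0 := by
      have : z - (quantumNumber t x - 1) / t = (t * z - (quantumNumber t x - 1)) / t := by
        field_simp
      rw [hx2, this] at hzx2
      exact (div_ne_zero_iff.1 hzx2).1
    have e2 : z - quantumNumber t (x - 1) = (t * z - (quantumNumber t x - 1)) / t := by
      rw [hx2]; field_simp
    rw [hx1] at hzx1
    rw [transition, e2, hx1]
    clear ih hM hcomm
    generalize transition t (t - (1 + t) * η) w z = T at *
    generalize (t - (1 + t) * (η : ℂ)) = ν at *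
    generalize (t - 1) * z + 1 = ζ at *
    generalize t - 1 = τ at *
    generalize t * z - (quantumNumber t x - 1) = b at *
    generalize z - (t * quantumNumber t x + 1) = c at *
    generalize z - quantumNumber t x = d at *
    simp only [add_mul, sub_mul, smul_mul_assoc, h1, h2, h3, hMq, hSq] at key
    generalize F * q = y at *
    have hy : (c * b * (d⁻¹ * d⁻¹)) • y =
        (t * ((T - (ν - τ)) / ζ) + ζ * (ν - τ) * (d⁻¹ * d⁻¹) - τ * (ν - τ) * d⁻¹) • q := by
      have e1 : (c * b * (d⁻¹ * d⁻¹)) • y =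
          t • y - (ζ ^ 2 * (d⁻¹ * d⁻¹) - ζ * τ * d⁻¹) • y := by
        rw [hD, ← sub_smul]
        congr 1
        field_simp
        ring
      rw [e1, key]
      module
    have hDne : c * b * (d⁻¹ * d⁻¹) ≠ 0 := by
      have := inv_ne_zero hzx
      exact mul_ne_zero (mul_ne_zero hzx1 hzx2') (mul_ne_zero this this)
    apply smul_right_injective A hDne
    simp only
    rw [hy, smul_smul]
    congr 1
    have e3 : c * b * (d⁻¹ * d⁻¹) * ((T * (d * d) * (c * (b / t))⁻¹ - (ν - τ)) / ζ) =
        (T * t - (ν - τ) * (c * b) * (d⁻¹ * d⁻¹)) / ζ := by field_simp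
    rw [e3, hD]
    field_simp
    ring

end HeckeEndo

end HeckeEndomorphism

end LQP

end

noncomputable section

namespace LQP

open Filter Topology

/-! ### Occupation numbers -/

section Occupation

variable {Q : ℕ}

open Classical in
/-- The occupation numbers of the configuration reached from `{0, -1, …, -(d-1)}` by moving, for
each letter `c` of the word, a particle from `c` to `c + 1`. -/
def occupation (d : ℕ∞) : List (ZMod Q) → ZMod Q → ℤ
  | [], c => if ∃ i : ℕ, (i : ℕ∞) < d ∧ c = -(i : ZMod Q) then 1 else 0
  | x :: w, c => occupation d w c + (if c = x + 1 then 1 else 0) - if c = x then 1 else 0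

/-- Words in which each letter moves a particle to an empty site. -/
def Legal (d : ℕ∞) : List (ZMod Q) → Prop
  | [] => True
  | c :: w => Legal d w ∧ occupation d w c = 1 ∧ occupation d w (c + 1) = 0

lemma Legal.occupation_eq {d : ℕ∞} (hQ : Q ≠ 1) {w : List (ZMod Q)} (hw : Legal d w) (c : ZMod Q) :
    occupation d w c = 0 ∨ occupation d w c = 1 := by
  have : Nontrivial (ZMod Q) := ZMod.nontrivial_iff.2 hQ
  induction w generalizing c with
  | nil => rw [occupation]; split_ifs <;> simp
  | cons x w ih =>
    obtain ⟨h1, h2, h3⟩ := hw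
    rw [occupation]
    have hx : x + 1 ≠ x := by simp
    rcases eq_or_ne c (x + 1) with rfl | hc1
    · rw [if_pos rfl, if_neg hx, h3]; simp
    · rw [if_neg hc1]
      rcases eq_or_ne c x with rfl | hc2
      · rw [if_pos rfl, h2]; simp
      · rw [if_neg hc2]
        simpa using ih h1 c

end Occupation

section HeckeEndomorphism

variable {H : Type*} [NormedAddCommGroup H] [InnerProductSpace ℂ H] [CompleteSpace H]
  {A : StarSubalgebra ℂ (H →L[ℂ] H)} {ρ : A →⋆ₐ[ℂ] A} {φ : A →ₗ[ℂ] A} {e : A} {t : ℂ} {η : ℝ}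
  {Q : ℕ} {q d : ℕ∞} {δ : ℝ}

namespace HeckeEndo

namespace HasParameters

lemma isPeriod (hp : HasParameters ρ e t η q d δ) : IsPeriod t q.toNat := by
  rw [hp.t_eq]
  exact isPeriod_of_exp hp.four_le hp.sign

lemma add_one_lt (hp : HasParameters ρ e t η q d δ) {i : ℕ} (hi : (i : ℕ∞) ≤ d) :
    q.toNat = 0 ∨ i + 1 < q.toNat := by
  have h := hp.add_two_le
  induction q using ENat.recTopCoe with
  | top => left; rfl
  | coe n =>
    right
    have h1 : ((i + 2 : ℕ) : ℕ∞) ≤ n := by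
      push_cast
      exact (add_le_add_left hi 2).trans h
    have h2 : i + 2 ≤ n := by exact_mod_cast h1
    simp only [ENat.toNat_natCast]
    omega

lemma natCast_inj (hp : HasParameters ρ e t η q d δ) {i j : ℕ} (hi : (i : ℕ∞) ≤ d)
    (hj : (j : ℕ∞) ≤ d) (h : (i : ZMod q.toNat) = j) : i = j := by
  have h1 := hp.add_one_lt hi
  have h2 := hp.add_one_lt hj
  rw [ZMod.natCast_eq_natCast_iff'] at h
  rcases h1 with h1 | h1
  · rwa [h1, Nat.mod_zero, Nat.mod_zero] at h
  · rw [Nat.mod_eq_of_lt (by omega), Nat.mod_eq_of_lt (by omega)] at h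
    exact h

lemma natCast_add_one_ne_zero (hp : HasParameters ρ e t η q d δ) {i : ℕ} (hi : (i : ℕ∞) ≤ d) :
    (i : ZMod q.toNat) + 1 ≠ 0 := by
  intro h
  have h1 := hp.add_one_lt hi
  have h2 : ((i + 1 : ℕ) : ZMod q.toNat) = (0 : ℕ) := by push_cast; exact h
  rw [ZMod.natCast_eq_natCast_iff'] at h2
  rcases h1 with h1 | h1
  · rw [h1, Nat.mod_zero, Nat.mod_zero] at h2; omega
  · rw [Nat.mod_eq_of_lt h1, Nat.zero_mod] at h2; omega

/-- The function `z⁻¹ + ν` has a pole at `0` and, if `ν ≠ 0`, a zero at `-1/ν = [-d]`. These are the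
two places where the occupation of `{0, -1, …, -(d-1)}` jumps; `d + 2 ≤ q` keeps the sites distinct
on the circle. -/
lemma transitionOrder_nil (hp : HasParameters ρ e t η q d δ) (c : ZMod q.toNat) :
    transitionOrder t (t - (1 + t) * η) ([] : List (ZMod q.toNat)) (quantumNumber t c) =
      occupation d [] (c + 1) - occupation d [] c := by
  classical
  have hQ := hp.isPeriod
  have hd0 : (0 : ℕ∞) < d := lt_of_lt_of_le (by norm_num) hp.two_le
  have h0 : quantumNumber t c = 0 ↔ c = 0 := by
    rw [← hQ.quantumNumber_zero, hQ.quantumNumber_injective.eq_iff]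
  have h1 : (t - (1 + t) * η ≠ 0 ∧ (t - (1 + t) * η) * quantumNumber t c = -1) ↔
      ∃ n : ℕ, d = n ∧ c = -(n : ZMod q.toNat) := by
    constructor
    · rintro ⟨h1, h2⟩
      have h3 : d ≠ ⊤ := fun h => h1 (hp.ν_top h)
      refine ⟨d.toNat, (ENat.natCast_toNat h3).symm, ?_⟩
      have h4 := hp.ν_mul h3
      rw [← hQ.quantumNumber_intCast, ← h2] at h4
      have h5 := hQ.quantumNumber_injective (mul_left_cancel₀ h1 h4)
      rw [← h5]; push_cast; rfl
    · rintro ⟨n, rfl, rfl⟩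
      have h4 := hp.ν_mul (ENat.natCast_ne_top n)
      rw [← hQ.quantumNumber_intCast] at h4
      push_cast [ENat.toNat_natCast] at h4
      refine ⟨fun h => ?_, h4⟩
      rw [h, zero_mul] at h4
      norm_num at h4
  simp only [transitionOrder, occupation, h0, h1]
  by_cases hc0 : c = 0
  · subst hc0
    rw [if_neg, if_pos rfl, if_neg, if_pos ⟨0, hd0, by simp⟩]
    · rintro ⟨i, hi, h⟩
      exact hp.natCast_add_one_ne_zero hi.le (by linear_combination h)
    · rintro ⟨n, rfl, h⟩
      have h2 : ((n : ℕ) : ZMod q.toNat) = (0 : ℕ) := by push_cast; linear_combination h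
      have h3 := hp.natCast_inj le_rfl hd0.le h2
      subst h3; simp at hd0
  · rw [if_neg hc0]
    by_cases hcd : ∃ n : ℕ, d = n ∧ c = -(n : ZMod q.toNat)
    · rw [if_pos hcd]
      obtain ⟨n, rfl, rfl⟩ := hcd
      have hn : 0 < n := by exact_mod_cast hd0
      rw [if_pos, if_neg]
      · rintro ⟨i, hi, h⟩
        have hi' : i < n := by exact_mod_cast hi
        have h2 : ((i : ℕ) : ZMod q.toNat) = (n : ℕ) := (neg_injective h).symm
        have h3 := hp.natCast_inj hi.le le_rfl h2
        omega
      · refine ⟨n - 1, by exact_mod_cast (by omega : n - 1 < n), ?_⟩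
        rw [Nat.cast_sub hn]; push_cast; ring
    · rw [if_neg hcd]
      have : (∃ i : ℕ, (i : ℕ∞) < d ∧ c + 1 = -(i : ZMod q.toNat)) ↔
          ∃ i : ℕ, (i : ℕ∞) < d ∧ c = -(i : ZMod q.toNat) := by
        constructor
        · rintro ⟨i, hi, h⟩
          have h2 : c = -((i + 1 : ℕ) : ZMod q.toNat) := by push_cast; linear_combination h
          have h3 : ((i + 1 : ℕ) : ℕ∞) ≤ d := by
            push_cast; exact Order.add_one_le_of_lt hi
          rcases h3.eq_or_lt with h4 | h4
          · exact absurd ⟨i + 1, h4.symm, h2⟩ hcd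
          · exact ⟨i + 1, h4, h2⟩
        · rintro ⟨i, hi, h⟩
          rcases i with - | i
          · exact absurd (by simpa using h) hc0
          · refine ⟨i, lt_of_le_of_lt (by exact_mod_cast Nat.le_succ i) hi, ?_⟩
            rw [h]; push_cast; ring
      simp only [this]; ring

/-- Moving a particle from `x` to `x + 1` changes the discrete derivative of the occupation by `+2`
at `x` and by `-1` at `x + 1` and `x - 1`, exactly as the new factor changes the order. -/
lemma transitionOrder_eq (hp : HasParameters ρ e t η q d δ) (w : List (ZMod q.toNat))
    (c : ZMod q.toNat) : transitionOrder t (t - (1 + t) * η) w (quantumNumber t c) =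
      occupation d w (c + 1) - occupation d w c := by
  classical
  induction w with
  | nil => exact hp.transitionOrder_nil c
  | cons x w ih =>
    have hinj := hp.isPeriod.quantumNumber_injective
    rw [transitionOrder, ih, occupation, occupation]
    simp only [hinj.eq_iff, add_left_inj, eq_sub_iff_add_eq]
    ring

lemma transitionOrder_nonneg (hp : HasParameters ρ e t η q d δ) (w : List (ZMod q.toNat)) {a : ℂ}
    (ha : ∀ c : ZMod q.toNat, a ≠ quantumNumber t c) :
    0 ≤ transitionOrder t (t - (1 + t) * η) w a := by
  classical
  induction w with
  | nil =>
    have h0 : a ≠ 0 := by rw [← hp.isPeriod.quantumNumber_zero]; exact ha 0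
    simp only [transitionOrder, if_neg h0]
    split_ifs <;> simp
  | cons x w ih =>
    simp only [transitionOrder, if_neg (ha _)]
    simpa using ih

end HasParameters

/-! ### The nonvanishing path projections -/

/-- Such an `a` would give the unitary `1 + (t - 1) L_n` the eigenvalue zero. This disposes of the
point where the denominator `(t - 1) z + 1` vanishes. -/
lemma specProj_jucysMurphy_eq_zero (h : HeckeEndo A ρ φ e t η) {n : ℕ} {a : ℂ}
    (ha : (t - 1) * a + 1 = 0) : specProj (jucysMurphy ρ e t n) a = 0 := by
  have h1 := mul_specProj (h.normal_jucysMurphy n) (h.isIntegral_jucysMurphy n) a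
  have h2 : jucysMurphyUnitary ρ e t n * specProj (jucysMurphy ρ e t n) a = 0 := by
    rw [jucysMurphyUnitary, add_mul, smul_mul_assoc, h1, one_mul, smul_smul]
    have : (1 + (t - 1) * a) • specProj (jucysMurphy ρ e t n) a = 0 := by
      rw [add_comm, ha, zero_smul]
    rw [← this]; module
  rw [← one_mul (specProj _ _), ← (h.jucysMurphyUnitary_unitary n).1, mul_assoc, h2, mul_zero]

/-- Spectral projections are residues of the resolvent, and `φ` is linear on the finite spectral
sum. Knowledge of `φ` on the resolvent becomes knowledge of `φ` on the spectral projections. -/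
lemma tendsto_φ_resolv (φ : A →ₗ[ℂ] A) (n : ℕ) (p : A) (a : ℂ) :
    Tendsto (fun z => (z - a) • (φ (resolv (jucysMurphy ρ e t n) z) * p)) (𝓝[≠] a)
      (𝓝 (φ (specProj (jucysMurphy ρ e t n) a) * p)) := by
  classical
  set T := jucysMurphy ρ e t n
  have h1 : ∀ z, (z - a) • (φ (resolv T z) * p) =
      ∑ b ∈ eigenset T, ((z - a) * (z - b)⁻¹) • (φ (specProj T b) * p) := by
    intro z
    rw [resolv, map_sum, Finset.sum_mul, Finset.smul_sum]
    refine Finset.sum_congr rfl fun b _ => ?_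
    rw [map_smul, smul_mul_assoc, smul_smul]
  have h2 : φ (specProj T a) * p =
      ∑ b ∈ eigenset T, (if b = a then (1 : ℂ) else 0) • (φ (specProj T b) * p) := by
    by_cases ha : a ∈ eigenset T
    · rw [Finset.sum_eq_single_of_mem a ha fun b _ hb => by rw [if_neg hb, zero_smul], if_pos rfl,
        one_smul]
    · have : specProj T a = 0 := if_neg ha
      rw [this, map_zero, zero_mul]
      refine (Finset.sum_eq_zero fun b hb => ?_).symm
      have hba : ¬ b = a := fun hba => ha (hba ▸ hb)
      rw [if_neg hba, zero_smul]
  simp only [h1]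
  rw [h2]
  refine tendsto_finsetSum _ fun b _ => Tendsto.smul_const ?_ _
  split_ifs with hb
  · subst hb
    refine tendsto_const_nhds.congr' ?_
    filter_upwards [self_mem_nhdsWithin] with z hz
    rw [mul_inv_cancel₀ (sub_ne_zero.2 hz)]
  · have h3 : ContinuousAt (fun z : ℂ => (z - a) * (z - b)⁻¹) a :=
      ContinuousAt.mul (by fun_prop) (ContinuousAt.inv₀ (by fun_prop) (sub_ne_zero.2 (Ne.symm hb)))
    have h4 := h3.tendsto.mono_left (nhdsWithin_le_nhds (s := {a}ᶜ))
    simpa using h4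

lemma φ_specProj_mul_pathProj (h : HeckeEndo A ρ φ e t η) (hQ : IsPeriod t Q) (w : List (ZMod Q))
    {a L : ℂ} (ha : (t - 1) * a + 1 ≠ 0)
    (hL : Tendsto (fun z => (z - a) * transition t (t - (1 + t) * η) w z) (𝓝[≠] a) (𝓝 L)) :
    φ (specProj (jucysMurphy ρ e t w.length) a) * pathProj ρ e t w =
      (L / ((t - 1) * a + 1)) • pathProj ρ e t w := by
  refine tendsto_nhds_unique (tendsto_φ_resolv φ w.length (pathProj ρ e t w) a) ?_
  have h1 : Tendsto (fun z => (((z - a) * transition t (t - (1 + t) * η) w z -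
      (z - a) * (t - (1 + t) * η - (t - 1))) / ((t - 1) * z + 1)) • pathProj ρ e t w) (𝓝[≠] a)
      (𝓝 ((L / ((t - 1) * a + 1)) • pathProj ρ e t w)) := by
    refine Tendsto.smul_const ?_ _
    have h2 : Tendsto (fun z => (z - a) * (t - (1 + t) * η - (t - 1))) (𝓝[≠] a) (𝓝 0) := by
      have : ContinuousAt (fun z => (z - a) * (t - (1 + t) * η - (t - 1))) a := by fun_prop
      simpa using this.tendsto.mono_left (nhdsWithin_le_nhds (s := {a}ᶜ))
    have h3 : Tendsto (fun z => (t - 1) * z + 1) (𝓝[≠] a) (𝓝 ((t - 1) * a + 1)) := by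
      have : ContinuousAt (fun z => (t - 1) * z + 1) a := by fun_prop
      exact this.tendsto.mono_left nhdsWithin_le_nhds
    have h4 := (hL.sub h2).div h3 ha
    rw [sub_zero] at h4
    exact h4
  refine h1.congr' ?_
  filter_upwards [nhdsNE_le_cofinite a (h.φ_resolv_mul_pathProj hQ w)] with z hz
  rw [hz, smul_smul]
  congr 1
  ring

lemma φ_map_pathProj_mul_specProj (h : HeckeEndo A ρ φ e t η) (w : List (ZMod Q)) (a : ℂ) :
    φ (ρ (pathProj ρ e t w) * specProj (jucysMurphy ρ e t w.length) a) =
      φ (specProj (jucysMurphy ρ e t w.length) a) * pathProj ρ e t w := by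
  rw [(commute_specProj (h.commute_map_pathProj w) a).eq, h.φ_mul_ρ]

lemma map_pathProj_mul_specProj_eq_zero (h : HeckeEndo A ρ φ e t η) (w : List (ZMod Q)) {a : ℂ}
    (h0 : φ (specProj (jucysMurphy ρ e t w.length) a) * pathProj ρ e t w = 0) :
    ρ (pathProj ρ e t w) * specProj (jucysMurphy ρ e t w.length) a = 0 := by
  classical
  have hc := commute_specProj (h.commute_map_pathProj w) a
  have h1 := h.pathProj_star_idem w
  have h2 := star_specProj (h.normal_jucysMurphy w.length) (h.isIntegral_jucysMurphy _) a
  have h3 := specProj_mul_specProj (h.normal_jucysMurphy w.length) (h.isIntegral_jucysMurphy _) a a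
  rw [if_pos rfl] at h3
  have hmem : ρ (pathProj ρ e t w) * specProj (jucysMurphy ρ e t w.length) a ∈
      orbitAlg ρ (heckeGen e t) (w.length + 1) :=
    mul_mem (orbitAlg_mono (by omega) (map_mem_orbitAlg (pathProj_mem w)))
      (orbitAlg_mono (by omega) (specProj_mem (jucysMurphy_mem _) a))
  refine h.faithful_orbitAlg hmem ?_
  have h4 : star (ρ (pathProj ρ e t w) * specProj (jucysMurphy ρ e t w.length) a) *
      (ρ (pathProj ρ e t w) * specProj (jucysMurphy ρ e t w.length) a) =
      ρ (pathProj ρ e t w) * specProj (jucysMurphy ρ e t w.length) a := by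
    rw [star_mul, h2, ← map_star, h1.1, mul_assoc, ← mul_assoc (ρ _) (ρ _), ← map_mul, h1.2,
      hc.eq, ← mul_assoc, h3]
  rw [h4, h.φ_map_pathProj_mul_specProj, h0]

lemma map_pathProj_mul_specProj_eq_zero_of_order (h : HeckeEndo A ρ φ e t η)
    (hQ : IsPeriod t Q) (w : List (ZMod Q)) {a : ℂ}
    (ho : 0 ≤ transitionOrder t (t - (1 + t) * η) w a) :
    ρ (pathProj ρ e t w) * specProj (jucysMurphy ρ e t w.length) a = 0 := by
  by_cases ha : (t - 1) * a + 1 = 0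
  · rw [h.specProj_jucysMurphy_eq_zero ha, mul_zero]
  · refine h.map_pathProj_mul_specProj_eq_zero w ?_
    rw [h.φ_specProj_mul_pathProj hQ w ha ((hasOrder_transition t _ w a).tendsto_mul_zero ho),
      zero_div, zero_smul]

/-- After a legal word all occupations are `0` or `1`, so a pole at `[c]` requires a particle at `c`
and an empty site `c + 1`. Without a pole `φ` vanishes on the projection, which is then zero by
faithfulness. -/
theorem pathProj_eq_zero (h : HeckeEndo A ρ φ e t η) (hp : HasParameters ρ e t η q d δ)
    {w : List (ZMod q.toNat)} (hw : ¬ Legal d w) : pathProj ρ e t w = 0 := by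
  induction w with
  | nil => exact absurd trivial hw
  | cons c w ih =>
    by_cases hl : Legal d w
    · refine h.map_pathProj_mul_specProj_eq_zero_of_order hp.isPeriod w ?_
      rw [hp.transitionOrder_eq]
      have h1 := hl.occupation_eq hp.isPeriod.ne_one c
      have h2 := hl.occupation_eq hp.isPeriod.ne_one (c + 1)
      by_contra hcon
      exact hw ⟨hl, by omega, by omega⟩
    · rw [pathProj, ih hl, map_zero, zero_mul]

/-- A legal letter produces a simple pole, whose nonzero residue makes `φ` of the new projection a
nonzero multiple of the old one. -/
theorem pathProj_ne_zero (h : HeckeEndo A ρ φ e t η) (hp : HasParameters ρ e t η q d δ)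
    {w : List (ZMod q.toNat)} (hw : Legal d w) : pathProj ρ e t w ≠ 0 := by
  induction w with
  | nil => exact h.one_ne_zero'
  | cons c w ih =>
    obtain ⟨h1, h2, h3⟩ := hw
    have ho := hasOrder_transition t (t - (1 + t) * η) w (quantumNumber t c)
    rw [hp.transitionOrder_eq, h2, h3, zero_sub] at ho
    obtain ⟨L, hL, hL'⟩ := ho.exists_tendsto_mul
    have ha := hp.isPeriod.quantumNumber_spec_ne_zero c
    have h4 := h.φ_specProj_mul_pathProj hp.isPeriod w ha hL'
    intro h0
    rw [← h.φ_map_pathProj_mul_specProj] at h4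
    rw [pathProj] at h0
    rw [h0, map_zero] at h4
    exact ih h1 ((smul_eq_zero.1 h4.symm).resolve_left (div_ne_zero hL ha))

/-- The branching rule. -/
theorem map_pathProj_eq_sum (h : HeckeEndo A ρ φ e t η) (hp : HasParameters ρ e t η q d δ)
    (w : List (ZMod q.toNat)) (C : Finset (ZMod q.toNat)) (hC : ∀ c, Legal d (c :: w) → c ∈ C) :
    ρ (pathProj ρ e t w) = ∑ c ∈ C, pathProj ρ e t (c :: w) := by
  classical
  set T := jucysMurphy ρ e t w.length with hT
  have h1 : ρ (pathProj ρ e t w) = ∑ a ∈ eigenset T, ρ (pathProj ρ e t w) * specProj T a := by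
    rw [← Finset.mul_sum, sum_specProj (h.normal_jucysMurphy _) (h.isIntegral_jucysMurphy _),
      mul_one]
  have h2 : ∑ c ∈ C, pathProj ρ e t (c :: w) =
      ∑ a ∈ C.image (quantumNumber t), ρ (pathProj ρ e t w) * specProj T a := by
    rw [Finset.sum_image fun c _ c' _ hcc => hp.isPeriod.quantumNumber_injective hcc]
    rfl
  rw [h1, h2]
  have h3 : eigenset T ⊆ eigenset T ∪ C.image (quantumNumber t) := Finset.subset_union_left
  have h4 : C.image (quantumNumber t) ⊆ eigenset T ∪ C.image (quantumNumber t) :=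
    Finset.subset_union_right
  have h5 := Finset.sum_subset (f := fun a => ρ (pathProj ρ e t w) * specProj T a) h3
    fun a _ ha => by rw [show specProj T a = 0 from if_neg ha, mul_zero]
  have h6 := Finset.sum_subset (f := fun a => ρ (pathProj ρ e t w) * specProj T a) h4
    fun a _ ha => ?_
  · exact h5.trans h6.symm
  -- Points that are not quantum numbers are not poles, so eigenvalues other than the `[c]`
  -- contribute nothing.
  · by_cases hc : ∃ c : ZMod q.toNat, a = quantumNumber t c
    · obtain ⟨c, rfl⟩ := hc
      have h3 : c ∉ C := fun hc => ha (Finset.mem_image_of_mem _ hc)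
      exact h.pathProj_eq_zero hp (w := c :: w) fun hl => h3 (hC c hl)
    · push Not at hc
      exact h.map_pathProj_mul_specProj_eq_zero_of_order hp.isPeriod w
        (hp.transitionOrder_nonneg w hc)

end HeckeEndo

end HeckeEndomorphism

end LQP

end

/-! ### Matrix coefficients of `e` on the path projections, and the isometries exchanging two boxes.
-/

noncomputable section

namespace LQP

section Coefficients

variable {Q : ℕ}

/-- The diagonal coefficient for a path which ends with the boxes of contents `x` and `c`. -/
def letterWeight (q : ℕ∞) (c x : ZMod Q) : ℝ := wenzlWeight q ((x - c).cast : ℤ)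

/-- The off-diagonal coefficient for a path which ends with the boxes of contents `x` and `c`. -/
def exchangeCoeff (q : ℕ∞) (c x : ZMod Q) : ℝ :=
  Real.sqrt (letterWeight q c x * (1 - letterWeight q c x))

/-- Two contents which are neither equal nor adjacent. -/
def Far (c x : ZMod Q) : Prop := c ≠ x ∧ c ≠ x + 1 ∧ x ≠ c + 1

lemma Far.symm {c x : ZMod Q} (h : Far c x) : Far x c := ⟨h.1.symm, h.2.2, h.2.1⟩

lemma not_legal_cons_cons (hQ : Q ≠ 1) (d : ℕ∞) (c : ZMod Q) (w : List (ZMod Q)) :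
    ¬ Legal d (c :: c :: w) := by
  have : Nontrivial (ZMod Q) := ZMod.nontrivial_iff.2 hQ
  rintro ⟨⟨-, h1, -⟩, h2, -⟩
  have hc : c ≠ c + 1 := by simp
  rw [occupation, h1, if_neg hc, if_pos rfl] at h2
  omega

end Coefficients

section HeckeEndomorphism

variable {H : Type*} [NormedAddCommGroup H] [InnerProductSpace ℂ H] [CompleteSpace H]
  {A : StarSubalgebra ℂ (H →L[ℂ] H)} {ρ : A →⋆ₐ[ℂ] A} {φ : A →ₗ[ℂ] A} {e : A} {t : ℂ} {η : ℝ}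
  {Q : ℕ} {q d : ℕ∞} {δ : ℝ}

lemma map_specProj_mul_eq_self {T : A} (hn : Commute (star T) T) (hi : IsIntegral ℂ T) {u : A}
    {a : ℂ} (h : ρ T * u = a • u) : ρ (specProj T a) * u = u := by
  classical
  have h1 : ∀ b, b ≠ a → ρ (specProj T b) * u = 0 := by
    intro b hb
    have h2 : ρ (specProj T b) * (ρ T * u) = b • (ρ (specProj T b) * u) := by
      have hc : Commute T (specProj T b) := commute_specProj (Commute.refl T) b
      rw [← mul_assoc, ← map_mul, ← hc.eq, mul_specProj hn hi, map_smul, smul_mul_assoc]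
    rw [h, mul_smul_comm, ← sub_eq_zero, ← sub_smul] at h2
    exact (smul_eq_zero.1 h2).resolve_left (sub_ne_zero.2 hb.symm)
  have h3 : ∑ b ∈ eigenset T, ρ (specProj T b) * u = u := by
    rw [← Finset.sum_mul, ← map_sum, sum_specProj hn hi, map_one, one_mul]
  by_cases ha : a ∈ eigenset T
  · rwa [Finset.sum_eq_single_of_mem a ha fun b _ hb => h1 b hb] at h3
  · rw [← h3, Finset.sum_eq_zero fun b hb => h1 b fun h => ha (h ▸ hb), mul_zero]

namespace HeckeEndo

namespace HasParameters

lemma letterWeight_eq (h : HeckeEndo A ρ φ e t η) (hp : HasParameters ρ e t η q d δ)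
    {c x : ZMod q.toNat} (hcx : c ≠ x) : (letterWeight q c x : ℂ) =
      (t - ((t - 1) * quantumNumber t c + 1) / (quantumNumber t c - quantumNumber t x)) /
        (1 + t) := by
  have hQ := hp.isPeriod
  have h1 : (((x - c).cast : ℤ) : ZMod q.toNat) = x - c := by simp
  have h2 : quantumInt t ((x - c).cast : ℤ) ≠ 0 := by
    rw [← quantumInt_zero t, Ne, hQ.quantumInt_inj, h1, Int.cast_zero, sub_eq_zero]
    exact hcx.symm
  rw [letterWeight, wenzlWeight_mul hp.four_le hp.sign hp.t_eq h.t_ne h2]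
  have h3 : (((x.cast : ℤ) : ZMod q.toNat)) ≠ ((c.cast : ℤ) : ZMod q.toNat) := by
    simpa using hcx.symm
  have h4 := hQ.diag_coeff h3
  have h5 : quantumInt t ((x - c).cast : ℤ) = quantumInt t ((x.cast : ℤ) - c.cast) := by
    rw [hQ.quantumInt_inj]; simp
  have h6 : quantumInt t ((x - c).cast + 1 : ℤ) = quantumInt t ((x.cast : ℤ) - c.cast + 1) := by
    rw [hQ.quantumInt_inj]; simp
  rw [h5, h6, ← h4]
  rfl

/-- Contents of tableaux are integers, whereas paths only know their residues. Wenzl's weight is a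
ratio of quantum numbers, so the residue determines it. -/
lemma wenzlWeight_intCast (h : HeckeEndo A ρ φ e t η) (hp : HasParameters ρ e t η q d δ)
    {c x : ZMod q.toNat} (hcx : c ≠ x) {m : ℤ} (hm : (m : ZMod q.toNat) = x - c) :
    wenzlWeight q m = letterWeight q c x := by
  have hQ := hp.isPeriod
  have h1 : (((x - c).cast : ℤ) : ZMod q.toNat) = x - c := by simp
  have h5 : quantumInt t m = quantumInt t ((x - c).cast : ℤ) := by
    rw [hQ.quantumInt_inj, h1, hm]
  have h6 : quantumInt t (m + 1) = quantumInt t ((x - c).cast + 1 : ℤ) := by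
    rw [hQ.quantumInt_inj, Int.cast_add, Int.cast_add, h1, hm]
  have h2 : quantumInt t ((x - c).cast : ℤ) ≠ 0 := by
    rw [← quantumInt_zero t, Ne, hQ.quantumInt_inj, h1, Int.cast_zero, sub_eq_zero]
    exact hcx.symm
  rw [letterWeight, ← Complex.ofReal_inj, wenzlWeight_mul hp.four_le hp.sign hp.t_eq h.t_ne h2,
    wenzlWeight_mul hp.four_le hp.sign hp.t_eq h.t_ne (h5 ▸ h2), h5, h6]

lemma letterWeight_swap (h : HeckeEndo A ρ φ e t η) (hp : HasParameters ρ e t η q d δ)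
    {c x : ZMod q.toNat} (hcx : c ≠ x) : letterWeight q x c = 1 - letterWeight q c x := by
  rw [← Complex.ofReal_inj, Complex.ofReal_sub, letterWeight_eq h hp hcx,
    letterWeight_eq h hp hcx.symm]
  have h1 : quantumNumber t c - quantumNumber t x ≠ 0 :=
    sub_ne_zero.2 fun h => hcx (hp.isPeriod.quantumNumber_injective h)
  have h2 : quantumNumber t x - quantumNumber t c ≠ 0 :=
    sub_ne_zero.2 fun h => hcx (hp.isPeriod.quantumNumber_injective h.symm)
  have h3 := h.t_ne
  have h4 : quantumNumber t x - quantumNumber t c = -(quantumNumber t c - quantumNumber t x) := by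
    ring
  rw [h4, div_neg]
  field_simp
  push_cast
  ring

lemma exchangeCoeff_swap (h : HeckeEndo A ρ φ e t η) (hp : HasParameters ρ e t η q d δ)
    (c x : ZMod q.toNat) : exchangeCoeff q x c = exchangeCoeff q c x := by
  rcases eq_or_ne c x with rfl | hcx
  · rfl
  · rw [exchangeCoeff, exchangeCoeff, letterWeight_swap h hp hcx]
    congr 1; ring

lemma letterWeight_ne_zero (h : HeckeEndo A ρ φ e t η) (hp : HasParameters ρ e t η q d δ)
    {c x : ZMod q.toNat} (hcx : Far c x) : letterWeight q c x ≠ 0 := by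
  have hQ := hp.isPeriod
  have h1 : (((x - c).cast : ℤ) : ZMod q.toNat) = x - c := by simp
  have h2 : quantumInt t ((x - c).cast : ℤ) ≠ 0 := by
    rw [← quantumInt_zero t, Ne, hQ.quantumInt_inj, h1, Int.cast_zero, sub_eq_zero]
    exact hcx.1.symm
  have h3 : quantumInt t ((x - c).cast + 1 : ℤ) ≠ 0 := by
    rw [← quantumInt_zero t, Ne, hQ.quantumInt_inj, Int.cast_add, h1, Int.cast_zero]
    intro h
    exact hcx.2.1 (by push_cast at h; linear_combination -h)
  rw [← Complex.ofReal_ne_zero, letterWeight, wenzlWeight_mul hp.four_le hp.sign hp.t_eq h.t_ne h2]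
  exact div_ne_zero (div_ne_zero h3 h2) h.t_ne

lemma letterWeight_eq_of_adjacent (h : HeckeEndo A ρ φ e t η) (hp : HasParameters ρ e t η q d δ)
    (c : ZMod q.toNat) : letterWeight q (c + 1) c = 0 ∧ letterWeight q c (c + 1) = 1 := by
  have hQ := hp.isPeriod
  have : Nontrivial (ZMod q.toNat) := ZMod.nontrivial_iff.2 hQ.ne_one
  have h1 : letterWeight q (c + 1) c = 0 := by
    have h1 : (((c - (c + 1)).cast : ℤ) : ZMod q.toNat) = -1 := by simp
    have h2 : quantumInt t ((c - (c + 1)).cast : ℤ) ≠ 0 := by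
      rw [← quantumInt_zero t, Ne, hQ.quantumInt_inj, h1, Int.cast_zero, neg_eq_zero]
      exact one_ne_zero
    have h3 : quantumInt t ((c - (c + 1)).cast + 1 : ℤ) = 0 := by
      rw [← quantumInt_zero t, hQ.quantumInt_inj, Int.cast_add, h1]; simp
    rw [← Complex.ofReal_inj, letterWeight,
      wenzlWeight_mul hp.four_le hp.sign hp.t_eq h.t_ne h2, h3]
    simp
  refine ⟨h1, ?_⟩
  rw [letterWeight_swap h hp (by simp), h1, sub_zero]

lemma exchangeCoeff_eq_zero (h : HeckeEndo A ρ φ e t η) (hp : HasParameters ρ e t η q d δ)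
    {c x : ZMod q.toNat} (hcx : c = x + 1 ∨ x = c + 1) : exchangeCoeff q c x = 0 := by
  rcases hcx with rfl | rfl
  · rw [exchangeCoeff, (letterWeight_eq_of_adjacent h hp _).1]; simp
  · rw [exchangeCoeff, (letterWeight_eq_of_adjacent h hp _).2]; simp

end HasParameters

/-- `S` intertwines the path projections of `w` and `w'`. -/
structure Intertwines (ρ : A →⋆ₐ[ℂ] A) (e : A) (t : ℂ) (w w' : List (ZMod Q)) (S : A) : Prop where
  length_eq : w.length = w'.length
  mem : S ∈ orbitAlg ρ (heckeGen e t) (w.length - 1)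
  comm : pathProj ρ e t w' * S = S * pathProj ρ e t w

lemma Intertwines.cons (h : HeckeEndo A ρ φ e t η) {w w' : List (ZMod Q)} {S : A}
    (hS : Intertwines ρ e t w w' S) (c : ZMod Q) :
    Intertwines ρ e t (c :: w) (c :: w') (ρ S) := by
  refine ⟨by simp [hS.length_eq], ?_, ?_⟩
  · rcases w with - | ⟨x, w⟩
    · obtain ⟨z, rfl⟩ := orbitAlg_zero hS.mem
      rw [map_smul, map_one]
      exact Subalgebra.smul_mem _ (one_mem _) _
    · exact map_mem_orbitAlg hS.mem
  · have h1 := commute_specProj (h.commute_jucysMurphy le_rfl hS.mem) (quantumNumber t c)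
    rw [pathProj, pathProj, ← hS.length_eq, mul_assoc, ← h1.eq, ← mul_assoc, ← map_mul, hS.comm,
      map_mul, mul_assoc]

lemma Intertwines.append (h : HeckeEndo A ρ φ e t η) {w w' : List (ZMod Q)} {S : A}
    (hS : Intertwines ρ e t w w' S) (l : List (ZMod Q)) :
    Intertwines ρ e t (l ++ w) (l ++ w') ((⇑ρ)^[l.length] S) := by
  induction l with
  | nil => exact hS
  | cons c l ih =>
    rw [List.length_cons, Function.iterate_succ_apply']
    exact ih.cons h c

lemma map_pathProj_mul_pathProj (h : HeckeEndo A ρ φ e t η) (c : ZMod Q) (w : List (ZMod Q)) :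
    ρ (pathProj ρ e t w) * pathProj ρ e t (c :: w) = pathProj ρ e t (c :: w) ∧
      pathProj ρ e t (c :: w) * ρ (pathProj ρ e t w) = pathProj ρ e t (c :: w) := by
  have h1 := h.pathProj_star_idem w
  have h2 := commute_specProj (h.commute_map_pathProj w) (quantumNumber t c)
  constructor
  · rw [pathProj, ← mul_assoc, ← map_mul, h1.2]
  · rw [pathProj, mul_assoc, ← h2.eq, ← mul_assoc, ← map_mul, h1.2]

/-- The combination `(c - x) g p - ((t - 1) c + 1) p` is the affine Hecke intertwiner: the
correction terms of the exchange relations cancel in it, so it carries joint eigenvalues `(x, c)` to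
`(c, x)`. -/
lemma exchange_eigen {R : Type*} [Ring R] [Algebra ℂ R] {t c x : ℂ} {g X Y p : R}
    (hXg : X * g = g * Y - ((t - 1) • Y + 1)) (hYg : Y * g = g * X + ((t - 1) • Y + 1))
    (hX : X * p = x • p) (hY : Y * p = c • p) :
    X * ((c - x) • (g * p) - ((t - 1) * c + 1) • p) =
        c • ((c - x) • (g * p) - ((t - 1) * c + 1) • p) ∧
      Y * ((c - x) • (g * p) - ((t - 1) * c + 1) • p) =
        x • ((c - x) • (g * p) - ((t - 1) * c + 1) • p) := by
  have h1 : X * (g * p) = c • (g * p) - ((t - 1) * c + 1) • p := by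
    rw [← mul_assoc, hXg, sub_mul, mul_assoc, hY, add_mul, smul_mul_assoc, hY, one_mul,
      mul_smul_comm, smul_smul, add_smul, one_smul]
  have h2 : Y * (g * p) = x • (g * p) + ((t - 1) * c + 1) • p := by
    rw [← mul_assoc, hYg, add_mul, mul_assoc, hX, add_mul, smul_mul_assoc, hY, one_mul,
      mul_smul_comm, smul_smul, add_smul, one_smul]
  constructor
  · rw [mul_sub, mul_smul_comm, mul_smul_comm, h1, hX]; module
  · rw [mul_sub, mul_smul_comm, mul_smul_comm, h2, hY]; module

/-- The intertwiner applied to the path projection has the two last contents exchanged, so it lies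
under the projection of the exchanged path. Solving for `e` gives the diagonal coefficient, and the
rest is the off-diagonal block. -/
theorem e_mul_pathProj (h : HeckeEndo A ρ φ e t η) (hp : HasParameters ρ e t η q d δ)
    (c x : ZMod q.toNat) (w : List (ZMod q.toNat)) :
    e * pathProj ρ e t (c :: x :: w) =
      (letterWeight q c x : ℂ) • pathProj ρ e t (c :: x :: w) +
        pathProj ρ e t (x :: c :: w) * e * pathProj ρ e t (c :: x :: w) := by
  rcases eq_or_ne c x with rfl | hcx
  · rw [h.pathProj_eq_zero hp (not_legal_cons_cons hp.isPeriod.ne_one d c w)]; simp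
  have hQ := hp.isPeriod
  have hX : ρ (jucysMurphy ρ e t w.length) * pathProj ρ e t (c :: x :: w) =
      quantumNumber t x • pathProj ρ e t (c :: x :: w) := by
    rw [← (h.map_pathProj_mul_pathProj c (x :: w)).1, ← mul_assoc, ← map_mul,
      h.jucysMurphy_mul_pathProj, map_smul, smul_mul_assoc]
  have hY : jucysMurphy ρ e t (w.length + 1) * pathProj ρ e t (c :: x :: w) =
      quantumNumber t c • pathProj ρ e t (c :: x :: w) := h.jucysMurphy_mul_pathProj c (x :: w)
  have hYg := h.gen_mul_map_jucysMurphy w.length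
  obtain ⟨hXu, hYu⟩ := exchange_eigen (h.map_jucysMurphy_mul_gen w.length)
    (by rw [hYg]; abel) hX hY
  have hu : pathProj ρ e t (x :: c :: w) *
      ((quantumNumber t c - quantumNumber t x) • (heckeGen e t * pathProj ρ e t (c :: x :: w)) -
        ((t - 1) * quantumNumber t c + 1) • pathProj ρ e t (c :: x :: w)) =
      (quantumNumber t c - quantumNumber t x) • (heckeGen e t * pathProj ρ e t (c :: x :: w)) -
        ((t - 1) * quantumNumber t c + 1) • pathProj ρ e t (c :: x :: w) := by
    have h1 : ρ (ρ (pathProj ρ e t w)) * pathProj ρ e t (c :: x :: w) =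
        pathProj ρ e t (c :: x :: w) := by
      rw [← (h.map_pathProj_mul_pathProj c (x :: w)).1, ← mul_assoc, ← map_mul,
        (h.map_pathProj_mul_pathProj x w).1]
    have h2 : pathProj ρ e t (x :: c :: w) = ρ (ρ (pathProj ρ e t w)) *
        ρ (specProj (jucysMurphy ρ e t w.length) (quantumNumber t c)) *
        specProj (jucysMurphy ρ e t (w.length + 1)) (quantumNumber t x) := by
      rw [pathProj, pathProj, map_mul]; rfl
    rw [h2, mul_assoc, specProj_mul_eq_self (h.normal_jucysMurphy _) (h.isIntegral_jucysMurphy _)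
      hYu, mul_assoc, map_specProj_mul_eq_self (h.normal_jucysMurphy _)
      (h.isIntegral_jucysMurphy _) hXu, mul_sub, mul_smul_comm, mul_smul_comm, h1, ← mul_assoc,
      ← (h.heckeGen_comm (pathProj ρ e t w)).eq, mul_assoc, h1]
  have ho : pathProj ρ e t (x :: c :: w) * pathProj ρ e t (c :: x :: w) = 0 :=
    h.pathProj_orthogonal hQ (by simp) (by simp [hcx.symm])
  have hc : quantumNumber t c - quantumNumber t x ≠ 0 :=
    sub_ne_zero.2 fun h => hcx (hQ.quantumNumber_injective h)
  have he : e * pathProj ρ e t (c :: x :: w) = (letterWeight q c x : ℂ) •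
      pathProj ρ e t (c :: x :: w) + (-((1 + t) * (quantumNumber t c - quantumNumber t x))⁻¹) •
      ((quantumNumber t c - quantumNumber t x) • (heckeGen e t * pathProj ρ e t (c :: x :: w)) -
        ((t - 1) * quantumNumber t c + 1) • pathProj ρ e t (c :: x :: w)) := by
    have ht := h.t_ne
    have hg : heckeGen e t * pathProj ρ e t (c :: x :: w) = t • pathProj ρ e t (c :: x :: w) -
        (1 + t) • (e * pathProj ρ e t (c :: x :: w)) := by
      rw [heckeGen, sub_mul, smul_mul_assoc, smul_mul_assoc, one_mul]
    rw [HasParameters.letterWeight_eq h hp hcx, hg]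
    generalize quantumNumber t c = a at *
    generalize quantumNumber t x = b at *
    generalize e * pathProj ρ e t (c :: x :: w) = y
    generalize pathProj ρ e t (c :: x :: w) = p
    match_scalars <;> field_simp
    ring
  rw [mul_assoc, he, mul_add, mul_smul_comm, mul_smul_comm, hu, ho, smul_zero, zero_add]

lemma pathProj_mul_e (h : HeckeEndo A ρ φ e t η) (hp : HasParameters ρ e t η q d δ)
    (c x : ZMod q.toNat) (w : List (ZMod q.toNat)) :
    pathProj ρ e t (c :: x :: w) * e =
      (letterWeight q c x : ℂ) • pathProj ρ e t (c :: x :: w) +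
        pathProj ρ e t (c :: x :: w) * e * pathProj ρ e t (x :: c :: w) := by
  have h1 := congrArg star (h.e_mul_pathProj hp c x w)
  rw [star_mul, star_add, star_smul, star_mul, star_mul, h.sa, (h.pathProj_star_idem _).1,
    (h.pathProj_star_idem _).1, Complex.star_def, Complex.conj_ofReal, ← mul_assoc] at h1
  exact h1

/-- From `p e p = a p` and `e² = e`, the part of `p e² p` that passes through the exchanged path is
`(a - a²) p`. -/
lemma pathProj_mul_e_mul_pathProj (h : HeckeEndo A ρ φ e t η) (hp : HasParameters ρ e t η q d δ)
    (c x : ZMod q.toNat) (w : List (ZMod q.toNat)) :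
    star (pathProj ρ e t (x :: c :: w) * e * pathProj ρ e t (c :: x :: w)) *
      (pathProj ρ e t (x :: c :: w) * e * pathProj ρ e t (c :: x :: w)) =
      ((letterWeight q c x * (1 - letterWeight q c x) : ℝ) : ℂ) •
        pathProj ρ e t (c :: x :: w) := by
  rcases eq_or_ne c x with rfl | hcx
  · rw [h.pathProj_eq_zero hp (not_legal_cons_cons hp.isPeriod.ne_one d c w)]; simp
  have h1 := h.e_mul_pathProj hp c x w
  have h2 := h.pathProj_mul_e hp c x w
  have ho : pathProj ρ e t (c :: x :: w) * pathProj ρ e t (x :: c :: w) = 0 :=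
    h.pathProj_orthogonal hp.isPeriod (by simp) (by simp [hcx])
  have hi := (h.pathProj_star_idem (c :: x :: w)).2
  have hi' := (h.pathProj_star_idem (x :: c :: w)).2
  have hs := (h.pathProj_star_idem (c :: x :: w)).1
  have hs' := (h.pathProj_star_idem (x :: c :: w)).1
  rw [star_mul, star_mul, hs, hs', h.sa]
  generalize (letterWeight q c x : ℝ) = a at *
  generalize pathProj ρ e t (c :: x :: w) = p at *
  generalize pathProj ρ e t (x :: c :: w) = p' at *
  have hid := h.idem
  have h3 : p * (e * p) = (a : ℂ) • p := by
    rw [h1, mul_add, mul_smul_comm, hi, ← mul_assoc p, ← mul_assoc p, ho]; simp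
  have h4 : p * e * (e * p) = (a : ℂ) • p := by
    rw [mul_assoc, ← mul_assoc e e, hid, h3]
  rw [h1, mul_add, mul_smul_comm, mul_assoc p e p, h3, smul_smul] at h4
  have h5 : p * (e * p') * (p' * e * p) = p * e * (p' * e * p) := by
    rw [mul_assoc, mul_assoc e, ← mul_assoc p', ← mul_assoc p' p', hi', mul_assoc, mul_assoc]
  rw [h5, eq_sub_of_add_eq' h4]
  push_cast
  module

lemma nonneg_of_star_mul_self {S p : A} {r : ℝ} (hp : star p * p = p) (hp0 : p ≠ 0)
    (h : star S * S = (r : ℂ) • p) : 0 ≤ r := by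
  have h1 : ∃ v, (p : H →L[ℂ] H) v ≠ 0 := by
    by_contra! hcon
    exact hp0 (Subtype.ext (ContinuousLinearMap.ext hcon))
  obtain ⟨v, hv⟩ := h1
  have h2 := inner_smul_star_mul_self p r v
  have h3 := inner_smul_star_mul_self S 1 v
  rw [hp, ← h, ← one_smul ℂ (star S * S), ← Complex.ofReal_one, h3, Complex.ofReal_inj] at h2
  have h4 : 0 < ‖(p : H →L[ℂ] H) v‖ ^ 2 := by positivity
  have h5 : 0 ≤ r * ‖(p : H →L[ℂ] H) v‖ ^ 2 := by rw [← h2]; positivity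
  exact nonneg_of_mul_nonneg_left h5 h4

/-- If the path projection is nonzero, then `a (1 - a) ≥ 0` because it is the factor in a positive
operator, and the real square root behaves as intended. Otherwise both sides vanish. -/
lemma exchangeCoeff_sq_smul (h : HeckeEndo A ρ φ e t η) (hp : HasParameters ρ e t η q d δ)
    (c x : ZMod q.toNat) (w : List (ZMod q.toNat)) :
    ((exchangeCoeff q c x : ℂ) * exchangeCoeff q c x) • pathProj ρ e t (c :: x :: w) =
      ((letterWeight q c x * (1 - letterWeight q c x) : ℝ) : ℂ) •
        pathProj ρ e t (c :: x :: w) := by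
  by_cases h0 : pathProj ρ e t (c :: x :: w) = 0
  · rw [h0, smul_zero, smul_zero]
  · have h1 := h.pathProj_mul_e_mul_pathProj hp c x w
    have h2 : 0 ≤ letterWeight q c x * (1 - letterWeight q c x) := by
      refine nonneg_of_star_mul_self ?_ h0 h1
      rw [(h.pathProj_star_idem _).1, (h.pathProj_star_idem _).2]
    rw [exchangeCoeff, ← Complex.ofReal_mul, Real.mul_self_sqrt h2]

/-- The partial isometries which exchange the last two boxes of a path. -/
def exchange (ρ : A →⋆ₐ[ℂ] A) (e : A) (t : ℂ) (q : ℕ∞) (c x : ZMod Q) (w : List (ZMod Q)) : A :=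
  (exchangeCoeff q c x : ℂ)⁻¹ • (pathProj ρ e t (x :: c :: w) * e * pathProj ρ e t (c :: x :: w))

lemma star_exchange (h : HeckeEndo A ρ φ e t η) (hp : HasParameters ρ e t η q d δ)
    (c x : ZMod q.toNat) (w : List (ZMod q.toNat)) :
    star (exchange ρ e t q c x w) = exchange ρ e t q x c w := by
  rw [exchange, exchange, star_smul, star_mul, star_mul, (h.pathProj_star_idem _).1,
    (h.pathProj_star_idem _).1, h.sa, star_inv₀, Complex.star_def, Complex.conj_ofReal,
    HasParameters.exchangeCoeff_swap h hp, mul_assoc]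

lemma e_mul_pathProj_eq (h : HeckeEndo A ρ φ e t η) (hp : HasParameters ρ e t η q d δ)
    (c x : ZMod q.toNat) (w : List (ZMod q.toNat)) :
    e * pathProj ρ e t (c :: x :: w) =
      (letterWeight q c x : ℂ) • pathProj ρ e t (c :: x :: w) +
        (exchangeCoeff q c x : ℂ) • exchange ρ e t q c x w := by
  rw [h.e_mul_pathProj hp, exchange, smul_smul]
  by_cases h0 : (exchangeCoeff q c x : ℂ) = 0
  · have h1 := h.pathProj_mul_e_mul_pathProj hp c x w
    rw [← h.exchangeCoeff_sq_smul hp, h0, zero_mul, zero_smul] at h1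
    rw [StarSubalgebra.eq_zero_of_star_mul_self h1, smul_zero]
  · rw [mul_inv_cancel₀ h0, one_smul]

lemma exchange_mul_exchange (h : HeckeEndo A ρ φ e t η) (hp : HasParameters ρ e t η q d δ)
    {c x : ZMod q.toNat} (hcx : Far c x) (w : List (ZMod q.toNat)) :
    exchange ρ e t q x c w * exchange ρ e t q c x w = pathProj ρ e t (c :: x :: w) := by
  by_cases h0 : pathProj ρ e t (c :: x :: w) = 0
  · rw [exchange, exchange, h0]; simp
  · have h1 := h.exchangeCoeff_sq_smul hp c x w
    have h2 := smul_left_injective ℂ h0 h1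
    have h3 : ((letterWeight q c x * (1 - letterWeight q c x) : ℝ) : ℂ) ≠ 0 := by
      rw [← HasParameters.letterWeight_swap h hp hcx.1, Complex.ofReal_ne_zero]
      exact mul_ne_zero (HasParameters.letterWeight_ne_zero h hp hcx)
        (HasParameters.letterWeight_ne_zero h hp hcx.symm)
    rw [← h.star_exchange hp, exchange, star_smul, smul_mul_smul_comm,
      h.pathProj_mul_e_mul_pathProj hp, smul_smul, star_inv₀, Complex.star_def,
      Complex.conj_ofReal, ← mul_inv, show _ = _ from h2, inv_mul_cancel₀ h3, one_smul]

lemma pathProj_mul_exchange (h : HeckeEndo A ρ φ e t η) (c x : ZMod Q) (w : List (ZMod Q)) :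
    pathProj ρ e t (x :: c :: w) * exchange ρ e t q c x w = exchange ρ e t q c x w := by
  rw [exchange, mul_smul_comm, ← mul_assoc, ← mul_assoc, (h.pathProj_star_idem _).2]

lemma exchange_mul_pathProj (h : HeckeEndo A ρ φ e t η) (c x : ZMod Q) (w : List (ZMod Q)) :
    exchange ρ e t q c x w * pathProj ρ e t (c :: x :: w) = exchange ρ e t q c x w := by
  rw [exchange, smul_mul_assoc, mul_assoc, (h.pathProj_star_idem _).2]

lemma e_mem_orbitAlg' (h : HeckeEndo A ρ φ e t η) (k : ℕ) :
    e ∈ orbitAlg ρ (heckeGen e t) (k + 1) := by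
  have h1 : e = (1 + t)⁻¹ • (t • 1 - heckeGen e t) := by
    rw [heckeGen, sub_sub_cancel, smul_smul, inv_mul_cancel₀ h.t_ne, one_smul]
  have h2 : (1 + t)⁻¹ • (t • 1 - heckeGen e t) ∈ orbitAlg ρ (heckeGen e t) (k + 1) :=
    Subalgebra.smul_mem _ (sub_mem (Subalgebra.smul_mem _ (one_mem _) _)
      (self_mem_orbitAlg _ _)) _
  rwa [← h1] at h2

lemma exchange_mem (h : HeckeEndo A ρ φ e t η) (c x : ZMod Q) (w : List (ZMod Q)) :
    pathProj ρ e t (x :: c :: w) * e * pathProj ρ e t (c :: x :: w) ∈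
      orbitAlg ρ (heckeGen e t) (w.length + 1) := by
  have h1 : pathProj ρ e t (x :: c :: w) ∈ orbitAlg ρ (heckeGen e t) (w.length + 1) :=
    pathProj_mem (x :: c :: w)
  have h2 : pathProj ρ e t (c :: x :: w) ∈ orbitAlg ρ (heckeGen e t) (w.length + 1) :=
    pathProj_mem (c :: x :: w)
  exact mul_mem (mul_mem h1 (h.e_mem_orbitAlg' _)) h2

lemma intertwines_exchange (h : HeckeEndo A ρ φ e t η) (c x : ZMod Q) (w : List (ZMod Q)) :
    Intertwines ρ e t (c :: x :: w) (x :: c :: w) (exchange ρ e t q c x w) := by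
  refine ⟨rfl, ?_, by rw [h.pathProj_mul_exchange, h.exchange_mul_pathProj]⟩
  exact Subalgebra.smul_mem _ (h.exchange_mem c x w) _

lemma Intertwines.exchange_comm (h : HeckeEndo A ρ φ e t η) {w w' : List (ZMod Q)} {S : A}
    (hS : Intertwines ρ e t w w' S) (c x : ZMod Q) :
    exchange ρ e t q c x w' * ρ (ρ S) = ρ (ρ S) * exchange ρ e t q c x w := by
  have h1 := ((hS.cons h x).cons h c).comm
  have h2 := ((hS.cons h c).cons h x).comm
  rw [exchange, exchange, smul_mul_assoc, mul_smul_comm, mul_assoc, h1, mul_assoc,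
    ← mul_assoc e, (h.e_comm S).eq, mul_assoc, ← mul_assoc _ (ρ (ρ S)), h2]
  simp only [mul_assoc]

/-- The braid relation is compressed between the first and the last of six mutually related paths.
Diagonal terms and detours vanish by orthogonality, so each side keeps only the route along its half
of the hexagon. -/
lemma sandwich {R : Type*} [Ring R] [Algebra ℂ R] {e f p₁ p₂ p₃ p₄ p₅ p₆ : R} {a b a' b' K : ℂ}
    (hb : e * f * e - K • e = f * e * f - K • f)
    (he : e * p₁ = a • p₁ + p₂ * e * p₁) (he' : p₆ * e = a' • p₆ + p₆ * e * p₅)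
    (hf : f * p₁ = b • p₁ + p₃ * f * p₁) (hf' : p₆ * f = b' • p₆ + p₆ * f * p₄)
    (h61 : p₆ * p₁ = 0) (h62 : p₆ * p₂ = 0) (h63 : p₆ * p₃ = 0) (h41 : p₄ * p₁ = 0)
    (h42 : p₄ * p₂ = 0) (h51 : p₅ * p₁ = 0) (h53 : p₅ * p₃ = 0) :
    p₆ * e * p₅ * f * p₂ * e * p₁ = p₆ * f * p₄ * e * p₃ * f * p₁ := by
  have e61 : p₆ * e * p₁ = 0 := by
    rw [he', add_mul, smul_mul_assoc, h61, mul_assoc _ p₅, h51]; simp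
  have f61 : p₆ * f * p₁ = 0 := by
    rw [hf', add_mul, smul_mul_assoc, h61, mul_assoc _ p₄, h41]; simp
  have f62 : p₆ * f * p₂ = 0 := by
    rw [hf', add_mul, smul_mul_assoc, h62, mul_assoc _ p₄, h42]; simp
  have e63 : p₆ * e * p₃ = 0 := by
    rw [he', add_mul, smul_mul_assoc, h63, mul_assoc _ p₅, h53]; simp
  have f51 : p₅ * f * p₁ = 0 := by
    rw [mul_assoc, hf, mul_add, mul_smul_comm, h51, mul_assoc p₃, ← mul_assoc p₅, h53]; simp
  have e41 : p₄ * e * p₁ = 0 := by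
    rw [mul_assoc, he, mul_add, mul_smul_comm, h41, mul_assoc p₂, ← mul_assoc p₄, h42]; simp
  have h1 : p₆ * (e * f * e) * p₁ = p₆ * e * p₅ * f * p₂ * e * p₁ := by
    calc p₆ * (e * f * e) * p₁ = (p₆ * e) * f * (e * p₁) := by simp only [mul_assoc]
      _ = (a' • p₆ + p₆ * e * p₅) * f * (a • p₁ + p₂ * e * p₁) := by rw [← he, ← he']
      _ = (a' * a) • (p₆ * f * p₁) + a' • (p₆ * f * p₂ * e * p₁) +
          a • (p₆ * e * (p₅ * f * p₁)) + p₆ * e * p₅ * f * p₂ * e * p₁ := by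
        simp only [add_mul, mul_add, smul_mul_assoc, mul_smul_comm, mul_assoc]
        module
      _ = _ := by rw [f61, f62, f51]; simp
  have h2 : p₆ * (f * e * f) * p₁ = p₆ * f * p₄ * e * p₃ * f * p₁ := by
    calc p₆ * (f * e * f) * p₁ = (p₆ * f) * e * (f * p₁) := by simp only [mul_assoc]
      _ = (b' • p₆ + p₆ * f * p₄) * e * (b • p₁ + p₃ * f * p₁) := by rw [← hf, ← hf']
      _ = (b' * b) • (p₆ * e * p₁) + b' • (p₆ * e * p₃ * f * p₁) +
          b • (p₆ * f * (p₄ * e * p₁)) + p₆ * f * p₄ * e * p₃ * f * p₁ := by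
        simp only [add_mul, mul_add, smul_mul_assoc, mul_smul_comm, mul_assoc]
        module
      _ = _ := by rw [e61, e63, e41]; simp
  have h3 : p₆ * (e * f * e - K • e) * p₁ = p₆ * (f * e * f - K • f) * p₁ := by rw [hb]
  rw [mul_sub, sub_mul, mul_sub, sub_mul, h1, h2, mul_smul_comm, smul_mul_assoc, e61,
    mul_smul_comm, smul_mul_assoc, f61] at h3
  simpa using h3

lemma map_e_mul_pathProj (h : HeckeEndo A ρ φ e t η) (hp : HasParameters ρ e t η q d δ)
    (b c x : ZMod q.toNat) (w : List (ZMod q.toNat)) :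
    ρ e * pathProj ρ e t (b :: c :: x :: w) =
      (letterWeight q c x : ℂ) • pathProj ρ e t (b :: c :: x :: w) +
        pathProj ρ e t (b :: x :: c :: w) * ρ e * pathProj ρ e t (b :: c :: x :: w) := by
  have h1 : Intertwines ρ e t (c :: x :: w) (x :: c :: w)
      (pathProj ρ e t (x :: c :: w) * e * pathProj ρ e t (c :: x :: w)) := by
    refine ⟨rfl, h.exchange_mem c x w, ?_⟩
    rw [← mul_assoc, ← mul_assoc, (h.pathProj_star_idem _).2, mul_assoc _ (pathProj ρ e t _),
      (h.pathProj_star_idem _).2]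
  have h2 := (h1.cons h b).comm
  have h3 := (h.map_pathProj_mul_pathProj b (c :: x :: w)).1
  have h4 := (h.map_pathProj_mul_pathProj b (x :: c :: w)).2
  have h5 := (h.pathProj_star_idem (b :: c :: x :: w)).2
  have h6 := congrArg ρ (h.e_mul_pathProj hp c x w)
  rw [map_add, map_smul, map_mul, map_mul, map_mul] at h6
  rw [map_mul, map_mul] at h2
  generalize pathProj ρ e t (b :: c :: x :: w) = p at *
  generalize pathProj ρ e t (b :: x :: c :: w) = p' at *
  generalize ρ (pathProj ρ e t (c :: x :: w)) = r at *
  generalize ρ (pathProj ρ e t (x :: c :: w)) = r' at *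
  have h7 : r' * ρ e * r * p = p' * ρ e * p := by
    rw [← h5, ← mul_assoc, ← h2, ← mul_assoc, ← mul_assoc, h4, mul_assoc _ r, h3, h5]
  calc ρ e * p = ρ e * r * p := by rw [mul_assoc, h3]
    _ = _ := by rw [h6, add_mul, smul_mul_assoc, h3, h7]

lemma pathProj_mul_map_e (h : HeckeEndo A ρ φ e t η) (hp : HasParameters ρ e t η q d δ)
    (b c x : ZMod q.toNat) (w : List (ZMod q.toNat)) :
    pathProj ρ e t (b :: c :: x :: w) * ρ e =
      (letterWeight q c x : ℂ) • pathProj ρ e t (b :: c :: x :: w) +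
        pathProj ρ e t (b :: c :: x :: w) * ρ e * pathProj ρ e t (b :: x :: c :: w) := by
  have h1 := congrArg star (h.map_e_mul_pathProj hp b c x w)
  rw [star_mul, star_add, star_smul, star_mul, star_mul, ← map_star ρ e, h.sa,
    (h.pathProj_star_idem _).1, (h.pathProj_star_idem _).1, Complex.star_def, Complex.conj_ofReal,
    ← mul_assoc] at h1
  exact h1

lemma map_exchange (h : HeckeEndo A ρ φ e t η) (b c x : ZMod Q) (w : List (ZMod Q)) :
    ρ (exchange ρ e t q c x w) * pathProj ρ e t (b :: c :: x :: w) =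
      (exchangeCoeff q c x : ℂ)⁻¹ •
        (pathProj ρ e t (b :: x :: c :: w) * ρ e * pathProj ρ e t (b :: c :: x :: w)) := by
  have h2 := ((h.intertwines_exchange (q := q) c x w).cons h b).comm
  have h3 := (h.map_pathProj_mul_pathProj b (c :: x :: w)).1
  have h4 := (h.map_pathProj_mul_pathProj b (x :: c :: w)).2
  have h5 := (h.pathProj_star_idem (b :: c :: x :: w)).2
  rw [← h5, ← mul_assoc, ← h2, exchange, map_smul, map_mul, map_mul, mul_smul_comm, smul_mul_assoc,
    ← mul_assoc, ← mul_assoc, h4, mul_assoc _ (ρ _) (pathProj ρ e t _), h3, h5]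

/-- Both ways of reversing `x, y, z` exchange each pair once, so the normalizing coefficients agree.
The compressed braid relation then identifies the operators. -/
theorem hexagon (h : HeckeEndo A ρ φ e t η) (hp : HasParameters ρ e t η q d δ)
    {x y z : ZMod q.toNat} (hxy : x ≠ y) (hxz : x ≠ z) (hyz : y ≠ z) (w : List (ZMod q.toNat)) :
    exchange ρ e t q y z (x :: w) * ρ (exchange ρ e t q x z w) * exchange ρ e t q x y (z :: w) =
      ρ (exchange ρ e t q x y w) * exchange ρ e t q x z (y :: w) *
        ρ (exchange ρ e t q y z w) * pathProj ρ e t (x :: y :: z :: w) := by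
  have ho : ∀ {w w' : List (ZMod q.toNat)}, w.length = w'.length → w ≠ w' →
      pathProj ρ e t w * pathProj ρ e t w' = 0 := h.pathProj_orthogonal hp.isPeriod
  have key := sandwich h.braid (h.e_mul_pathProj hp x y (z :: w))
    (h.pathProj_mul_e hp z y (x :: w)) (h.map_e_mul_pathProj hp x y z w)
    (h.pathProj_mul_map_e hp z y x w) (ho (by simp) (by simp [hxz.symm]))
    (ho (by simp) (by simp [hyz.symm])) (ho (by simp) (by simp [hxz.symm]))
    (ho (by simp) (by simp [hxz.symm])) (ho (by simp) (by simp [hyz.symm]))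
    (ho (by simp) (by simp [hxy.symm])) (ho (by simp) (by simp [hxy.symm]))
  have hi := fun w : List (ZMod q.toNat) => (h.pathProj_star_idem w).2
  have e1 : exchange ρ e t q y z (x :: w) * ρ (exchange ρ e t q x z w) *
      exchange ρ e t q x y (z :: w) =
      ((exchangeCoeff q y z : ℂ)⁻¹ * ((exchangeCoeff q x z : ℂ)⁻¹ * (exchangeCoeff q x y : ℂ)⁻¹)) •
      (pathProj ρ e t (z :: y :: x :: w) * e * pathProj ρ e t (y :: z :: x :: w) * ρ e *
        pathProj ρ e t (y :: x :: z :: w) * e * pathProj ρ e t (x :: y :: z :: w)) := by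
    rw [← h.pathProj_mul_exchange x y (z :: w), mul_assoc, ← mul_assoc (ρ _), h.map_exchange,
      exchange, exchange]
    simp only [smul_mul_assoc, mul_smul_comm, smul_smul]
    congr 1
    · ring
    have i1 := hi (y :: z :: x :: w)
    have i2 := hi (y :: x :: z :: w)
    generalize pathProj ρ e t (y :: z :: x :: w) = P at *
    generalize pathProj ρ e t (y :: x :: z :: w) = P' at *
    simp only [mul_assoc]
    rw [← mul_assoc P P, i1, ← mul_assoc P' P', i2]
  have e2 : ρ (exchange ρ e t q x y w) * exchange ρ e t q x z (y :: w) *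
        ρ (exchange ρ e t q y z w) * pathProj ρ e t (x :: y :: z :: w) =
      ((exchangeCoeff q y z : ℂ)⁻¹ * ((exchangeCoeff q x z : ℂ)⁻¹ * (exchangeCoeff q x y : ℂ)⁻¹)) •
      (pathProj ρ e t (z :: y :: x :: w) * ρ e * pathProj ρ e t (z :: x :: y :: w) * e *
        pathProj ρ e t (x :: z :: y :: w) * ρ e * pathProj ρ e t (x :: y :: z :: w)) := by
    rw [← h.pathProj_mul_exchange x z (y :: w), mul_assoc, h.map_exchange x y z w, ← mul_assoc,
      h.map_exchange z x y w, exchange]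
    simp only [smul_mul_assoc, mul_smul_comm, smul_smul]
    congr 1
    have i1 := hi (z :: x :: y :: w)
    have i2 := hi (x :: z :: y :: w)
    generalize pathProj ρ e t (z :: x :: y :: w) = P at *
    generalize pathProj ρ e t (x :: z :: y :: w) = P' at *
    simp only [mul_assoc]
    rw [← mul_assoc P P, i1, ← mul_assoc P' P', i2]
  rw [e1, e2, key]

end HeckeEndo

end HeckeEndomorphism

end LQP

end

/-! ### Coherence of the exchange isometries. -/

noncomputable section

namespace LQP

section HeckeEndomorphism

variable {H : Type*} [NormedAddCommGroup H] [InnerProductSpace ℂ H] [CompleteSpace H]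
  {A : StarSubalgebra ℂ (H →L[ℂ] H)} {ρ : A →⋆ₐ[ℂ] A} {φ : A →ₗ[ℂ] A} {e : A} {t : ℂ} {η : ℝ}
  {Q : ℕ} {q d : ℕ∞} {δ : ℝ}

lemma iterate_map_mul (ρ : A →⋆ₐ[ℂ] A) (k : ℕ) (x y : A) :
    (⇑ρ)^[k] (x * y) = (⇑ρ)^[k] x * (⇑ρ)^[k] y := by
  rw [← coe_pow_starAlgHom, map_mul]

lemma iterate_map_star (ρ : A →⋆ₐ[ℂ] A) (k : ℕ) (x : A) :
    (⇑ρ)^[k] (star x) = star ((⇑ρ)^[k] x) := by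
  rw [← coe_pow_starAlgHom, map_star]

namespace HeckeEndo

/-- The products of the partial isometries which exchange two consecutive boxes with nonadjacent
contents. -/
inductive ExchangePath (ρ : A →⋆ₐ[ℂ] A) (e : A) (t : ℂ) (q : ℕ∞) :
    List (ZMod Q) → List (ZMod Q) → A → Prop
  | refl (w : List (ZMod Q)) : ExchangePath ρ e t q w w (pathProj ρ e t w)
  | step {w l₁ l₂ : List (ZMod Q)} {c x : ZMod Q} {S : A}
      (hS : ExchangePath ρ e t q w (l₁ ++ c :: x :: l₂) S) (hcx : Far c x) :
      ExchangePath ρ e t q w (l₁ ++ x :: c :: l₂) ((⇑ρ)^[l₁.length] (exchange ρ e t q c x l₂) * S)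

lemma iterate_map_pathProj_mul (h : HeckeEndo A ρ φ e t η) (l w : List (ZMod Q)) :
    (⇑ρ)^[l.length] (pathProj ρ e t w) * pathProj ρ e t (l ++ w) = pathProj ρ e t (l ++ w) := by
  induction l with
  | nil => exact (h.pathProj_star_idem w).2
  | cons c l ih =>
    rw [List.cons_append, ← (h.map_pathProj_mul_pathProj c (l ++ w)).1, ← mul_assoc,
      List.length_cons, Function.iterate_succ_apply', ← map_mul, ih]

lemma ExchangePath.intertwines (h : HeckeEndo A ρ φ e t η) {w r : List (ZMod Q)} {S : A}
    (hS : ExchangePath ρ e t q w r S) : Intertwines ρ e t w r S ∧ S * pathProj ρ e t w = S := by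
  induction hS with
  | refl => exact ⟨⟨rfl, pathProj_mem w, rfl⟩, (h.pathProj_star_idem w).2⟩
  | @step l₁ l₂ c x S hS hcx ih =>
    have hX := (h.intertwines_exchange (q := q) c x l₂).append h l₁
    obtain ⟨⟨h1, h2, h3⟩, h4⟩ := ih
    refine ⟨⟨h1.trans hX.length_eq, ?_, ?_⟩, by rw [mul_assoc, h4]⟩
    · refine mul_mem ?_ h2
      rw [h1]; exact hX.mem
    · rw [← mul_assoc, hX.comm, mul_assoc, h3, ← mul_assoc]

lemma ExchangePath.star_mul_self (h : HeckeEndo A ρ φ e t η) (hp : HasParameters ρ e t η q d δ)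
    {w r : List (ZMod q.toNat)} {S : A} (hS : ExchangePath ρ e t q w r S) :
    star S * S = pathProj ρ e t w ∧ S * star S = pathProj ρ e t r := by
  induction hS with
  | refl =>
    have := h.pathProj_star_idem w
    rw [this.1, this.2, and_self]
  | @step l₁ l₂ c x S hS hcx ih =>
    have hX := (h.intertwines_exchange (q := q) c x l₂).append h l₁
    obtain ⟨⟨-, -, h3⟩, h4⟩ := hS.intertwines h
    have hpS : pathProj ρ e t (l₁ ++ c :: x :: l₂) * S = S := by rw [h3, h4]
    have hXX : star ((⇑ρ)^[l₁.length] (exchange ρ e t q c x l₂)) *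
        (⇑ρ)^[l₁.length] (exchange ρ e t q c x l₂) =
          (⇑ρ)^[l₁.length] (pathProj ρ e t (c :: x :: l₂)) := by
      rw [← iterate_map_star, h.star_exchange hp, ← iterate_map_mul,
        h.exchange_mul_exchange hp hcx]
    have hXX' : (⇑ρ)^[l₁.length] (exchange ρ e t q c x l₂) *
        star ((⇑ρ)^[l₁.length] (exchange ρ e t q c x l₂)) =
          (⇑ρ)^[l₁.length] (pathProj ρ e t (x :: c :: l₂)) := by
      rw [← iterate_map_star, h.star_exchange hp, ← iterate_map_mul,
        h.exchange_mul_exchange hp hcx.symm]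
    have hp1 := h.iterate_map_pathProj_mul l₁ (c :: x :: l₂)
    have hp2 := h.iterate_map_pathProj_mul l₁ (x :: c :: l₂)
    have hs := (h.pathProj_star_idem (l₁ ++ x :: c :: l₂)).1
    have hXc := hX.comm
    generalize (⇑ρ)^[l₁.length] (exchange ρ e t q c x l₂) = X at *
    constructor
    · rw [star_mul, mul_assoc, ← mul_assoc (star X), hXX, ← hpS, ← mul_assoc _ _ S, hp1, hpS, ih.1]
    · rw [star_mul, mul_assoc, ← mul_assoc S, ih.2, ← mul_assoc, ← hXc, mul_assoc, hXX', ← hs,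
        ← star_inj, star_mul, star_star, ← iterate_map_star, (h.pathProj_star_idem _).1, hp2]

/-- Moving the box with content `x` through the boxes `ys`. -/
def insertion (ρ : A →⋆ₐ[ℂ] A) (e : A) (t : ℂ) (q : ℕ∞) (x : ZMod Q) (w : List (ZMod Q)) :
    List (ZMod Q) → A
  | [] => 1
  | y :: ys => ρ (insertion ρ e t q x w ys) * exchange ρ e t q x y (ys ++ w)

lemma intertwines_insertion (h : HeckeEndo A ρ φ e t η) (x : ZMod Q) (w ys : List (ZMod Q)) :
    Intertwines ρ e t (x :: (ys ++ w)) (ys ++ x :: w) (insertion ρ e t q x w ys) := by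
  induction ys with
  | nil => exact ⟨rfl, one_mem _, by rw [insertion, mul_one, one_mul]; rfl⟩
  | cons y ys ih =>
    have h1 := h.intertwines_exchange (q := q) x y (ys ++ w)
    have h2 := ih.cons h y
    refine ⟨by simp [add_assoc], mul_mem h2.mem h1.mem, ?_⟩
    rw [insertion, ← mul_assoc, List.cons_append, h2.comm, mul_assoc, h1.comm, ← mul_assoc]
    rfl

lemma insertion_snoc (x b : ZMod Q) (w ys : List (ZMod Q)) :
    insertion ρ e t q x w (ys ++ [b]) =
      (⇑ρ)^[ys.length] (exchange ρ e t q x b w) * insertion ρ e t q x (b :: w) ys := by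
  induction ys with
  | nil => simp [insertion]
  | cons y ys ih =>
    rw [List.cons_append, insertion, ih, insertion, map_mul, List.length_cons,
      Function.iterate_succ_apply', mul_assoc, List.append_assoc]
    rfl

lemma insertion_natural (h : HeckeEndo A ρ φ e t η) {w w' : List (ZMod Q)} {S : A}
    (hS : Intertwines ρ e t w w' S) (x : ZMod Q) (ys : List (ZMod Q)) :
    (⇑ρ)^[ys.length + 1] S * insertion ρ e t q x w ys =
      insertion ρ e t q x w' ys * (⇑ρ)^[ys.length + 1] S := by
  induction ys with
  | nil => simp [insertion]
  | cons y ys ih =>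
    have h1 := (hS.append h ys).exchange_comm h (q := q) x y
    rw [insertion, insertion, List.length_cons, Function.iterate_succ_apply', ← mul_assoc,
      ← map_mul, ih, map_mul, mul_assoc, Function.iterate_succ_apply', ← h1, mul_assoc]

/-- Exchanging two letters before or after `x` has moved through them gives the same operator. At
the two letters this is the hexagon; exchanges at a distance simply commute. -/
lemma exchange_mul_insertion (h : HeckeEndo A ρ φ e t η) (hp : HasParameters ρ e t η q d δ)
    {x a b : ZMod q.toNat} (hxa : x ≠ a) (hxb : x ≠ b) (hab : a ≠ b)
    (w l₁ l₂ : List (ZMod q.toNat)) :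
    (⇑ρ)^[l₁.length] (exchange ρ e t q a b (l₂ ++ x :: w)) *
        insertion ρ e t q x w (l₁ ++ a :: b :: l₂) *
          pathProj ρ e t (x :: (l₁ ++ a :: b :: l₂ ++ w)) =
      insertion ρ e t q x w (l₁ ++ b :: a :: l₂) *
        ρ ((⇑ρ)^[l₁.length] (exchange ρ e t q a b (l₂ ++ w))) *
          pathProj ρ e t (x :: (l₁ ++ a :: b :: l₂ ++ w)) := by
  induction l₁ with
  | nil =>
    have h1 := (h.intertwines_insertion (q := q) x w l₂).exchange_comm h (q := q) a b
    have h2 := h.hexagon hp hxa hxb hab (l₂ ++ w)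
    have h3 := (h.pathProj_star_idem (x :: a :: b :: (l₂ ++ w))).2
    simp only [List.nil_append, List.length_nil, Function.iterate_zero, id, insertion, map_mul,
      List.cons_append]
    calc _ = (exchange ρ e t q a b (l₂ ++ x :: w) * ρ (ρ (insertion ρ e t q x w l₂))) *
          ρ (exchange ρ e t q x b (l₂ ++ w)) * exchange ρ e t q x a (b :: (l₂ ++ w)) *
          pathProj ρ e t (x :: a :: b :: (l₂ ++ w)) := by simp only [mul_assoc]
      _ = ρ (ρ (insertion ρ e t q x w l₂)) * (exchange ρ e t q a b (x :: (l₂ ++ w)) *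
          ρ (exchange ρ e t q x b (l₂ ++ w)) * exchange ρ e t q x a (b :: (l₂ ++ w))) *
          pathProj ρ e t (x :: a :: b :: (l₂ ++ w)) := by rw [h1]; simp only [mul_assoc]
      _ = _ := by rw [h2]; simp only [mul_assoc, h3]
  | cons y l₁ ih =>
    have h1 := (h.intertwines_exchange (q := q) x y (l₁ ++ a :: b :: l₂ ++ w)).comm
    have h2 := (h.map_pathProj_mul_pathProj y (x :: (l₁ ++ a :: b :: l₂ ++ w))).1
    have h3 := ((h.intertwines_exchange (q := q) a b (l₂ ++ w)).append h l₁).exchange_comm h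
      (q := q) x y
    have h4 := congrArg ρ ih
    simp only [List.cons_append, List.length_cons, Function.iterate_succ_apply', insertion, map_mul,
      List.append_assoc] at *
    generalize exchange ρ e t q x y (l₁ ++ a :: b :: (l₂ ++ w)) = E at *
    generalize exchange ρ e t q x y (l₁ ++ b :: a :: (l₂ ++ w)) = E' at *
    generalize pathProj ρ e t (x :: y :: (l₁ ++ a :: b :: (l₂ ++ w))) = p at *
    generalize pathProj ρ e t (y :: x :: (l₁ ++ a :: b :: (l₂ ++ w))) = p' at *
    generalize ρ (pathProj ρ e t (x :: (l₁ ++ a :: b :: (l₂ ++ w)))) = r at *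
    generalize ρ (insertion ρ e t q x w (l₁ ++ a :: b :: l₂)) = I at *
    generalize ρ (insertion ρ e t q x w (l₁ ++ b :: a :: l₂)) = I' at *
    generalize ρ ((⇑ρ)^[l₁.length] (exchange ρ e t q a b (l₂ ++ x :: w))) = X at *
    generalize ρ (ρ ((⇑ρ)^[l₁.length] (exchange ρ e t q a b (l₂ ++ w)))) = Y at *
    have h5 : r * (E * p) = E * p := by rw [← h1, ← mul_assoc, h2]
    calc X * (I * E) * p = X * I * r * (E * p) := by rw [mul_assoc _ r, h5]; simp only [mul_assoc]
      _ = I' * (Y * E) * p := by rw [h4, mul_assoc _ r, h5]; simp only [mul_assoc]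
      _ = _ := by rw [← h3]; simp only [mul_assoc]

/-- A normal form: the letters other than the head `x` are rearranged first, and `x` is then moved
to its final place. A further exchange either moves `x` one place on or back, or is a rearrangement
on one side of `x` that can be pulled through the insertion. -/
lemma ExchangePath.exists_insertion (h : HeckeEndo A ρ φ e t η)
    (hp : HasParameters ρ e t η q d δ) {x : ZMod q.toNat} {c w r : List (ZMod q.toNat)} {S : A}
    (hS : ExchangePath ρ e t q w r S) (hw : w = x :: c) :
    ∃ (ys v : List (ZMod q.toNat)) (S' : A), r = ys ++ x :: v ∧ (∀ y ∈ ys, Far x y) ∧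
      ExchangePath ρ e t q c (ys ++ v) S' ∧
      S = insertion ρ e t q x v ys * ρ S' * pathProj ρ e t (x :: c) := by
  induction hS with
  | refl =>
    subst hw
    refine ⟨[], c, _, rfl, by simp, .refl c, ?_⟩
    rw [insertion, one_mul, (h.map_pathProj_mul_pathProj x c).1]
  | @step l₁ l₂ a b S hS hab ih =>
    obtain ⟨ys, v, S', hr, hys, hS', rfl⟩ := ih
    subst hw
    have hc := hS'.intertwines h
    have hSp : pathProj ρ e t (x :: (ys ++ v)) * (ρ S' * pathProj ρ e t (x :: c)) =
        ρ S' * pathProj ρ e t (x :: c) := by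
      rw [← mul_assoc, (hc.1.cons h x).comm, mul_assoc, (h.pathProj_star_idem _).2]
    have case1 : ∀ {l v : List (ZMod q.toNat)}, l = ys → v = b :: l₂ → l₁ = l → a = x →
        ExchangePath ρ e t q c (ys ++ v) S' →
        ∃ (ys v' : List (ZMod q.toNat)) (T : A), l₁ ++ b :: a :: l₂ = ys ++ x :: v' ∧
          (∀ y ∈ ys, Far x y) ∧ ExchangePath ρ e t q c (ys ++ v') T ∧
          (⇑ρ)^[l₁.length] (exchange ρ e t q a b l₂) * (insertion ρ e t q x v l * ρ S' *
            pathProj ρ e t (x :: c)) =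
            insertion ρ e t q x v' ys * ρ T * pathProj ρ e t (x :: c) := by
      rintro l v rfl rfl rfl rfl hS'
      refine ⟨l₁ ++ [b], l₂, S', by simp, ?_, by simpa using hS', ?_⟩
      · intro y hy
        rcases List.mem_append.1 hy with hy | hy
        · exact hys y hy
        · rw [List.mem_singleton.1 hy]; exact hab
      · rw [insertion_snoc]; simp only [mul_assoc]
    rcases List.append_eq_append_iff.1 hr with ⟨l, h1, h2⟩ | ⟨l, h1, h2⟩
    · rcases l with - | ⟨a', l⟩
      · obtain ⟨h3, h4⟩ := List.cons_eq_cons.1 (h2.trans (List.nil_append _))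
        exact case1 rfl h4.symm (by simpa using h1.symm) h3 hS'
      rcases l with - | ⟨b', l⟩
      -- Here `x` moves back through the last letter it passed, and the two exchanges cancel.
      · simp only [List.cons_append, List.nil_append, List.cons.injEq] at h2
        obtain ⟨rfl, rfl, rfl⟩ := h2
        subst h1
        refine ⟨l₁, a :: l₂, S', rfl, fun y hy => hys y (by simp [hy]), by simpa using hS', ?_⟩
        have h5 := (h.intertwines_insertion (q := q) b (a :: l₂) l₁).comm
        have h6 := h.iterate_map_pathProj_mul l₁ (b :: a :: l₂)
        rw [List.append_assoc, List.singleton_append] at hSp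
        have h7 := h.exchange_mul_exchange hp hab.symm l₂
        have h9 : (⇑ρ)^[l₁.length] (pathProj ρ e t (b :: a :: l₂)) *
            (insertion ρ e t q b (a :: l₂) l₁ * (ρ S' * pathProj ρ e t (b :: c))) =
            insertion ρ e t q b (a :: l₂) l₁ * (ρ S' * pathProj ρ e t (b :: c)) := by
          have h10 : insertion ρ e t q b (a :: l₂) l₁ * (ρ S' * pathProj ρ e t (b :: c)) =
              pathProj ρ e t (l₁ ++ b :: a :: l₂) *
                (insertion ρ e t q b (a :: l₂) l₁ * (ρ S' * pathProj ρ e t (b :: c))) := by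
            rw [← mul_assoc (pathProj ρ e t _), h5, mul_assoc _ (pathProj ρ e t _), hSp]
          rw [h10, ← mul_assoc, h6]
        rw [insertion_snoc, mul_assoc, mul_assoc, mul_assoc, ← mul_assoc, ← iterate_map_mul, h7, h9]
      -- Both letters have been passed by `x`; the hexagon pulls their exchange through the
      -- insertion.
      · simp only [List.cons_append, List.cons.injEq] at h2
        obtain ⟨rfl, rfl, rfl⟩ := h2
        subst h1
        refine ⟨l₁ ++ b :: a :: l, v, (⇑ρ)^[l₁.length] (exchange ρ e t q a b (l ++ v)) * S',
          by simp, fun y hy => hys y ?_, ?_, ?_⟩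
        · simp only [List.mem_append, List.mem_cons] at hy ⊢; tauto
        · have h7 : ExchangePath ρ e t q c (l₁ ++ a :: b :: (l ++ v)) S' := by simpa using hS'
          simpa using h7.step hab
        · have h8 := h.exchange_mul_insertion hp (hys a (by simp)).1 (hys b (by simp)).1 hab.1 v l₁ l
          rw [mul_assoc, ← hSp, ← mul_assoc, ← mul_assoc, h8, mul_assoc, hSp, map_mul]
          simp only [mul_assoc]
    · rcases l with - | ⟨x', l⟩
      · obtain ⟨h3, h4⟩ := List.cons_eq_cons.1 (h2.trans (List.nil_append _))
        exact case1 rfl h4 (by simpa using h1) h3.symm hS'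
      -- Both letters lie beyond `x`, and their exchange commutes with the insertion.
      · simp only [List.cons_append, List.cons.injEq] at h2
        obtain ⟨rfl, rfl⟩ := h2
        subst h1
        refine ⟨ys, l ++ b :: a :: l₂,
          (⇑ρ)^[(ys ++ l).length] (exchange ρ e t q a b l₂) * S', by simp, hys, ?_, ?_⟩
        · have h7 : ExchangePath ρ e t q c ((ys ++ l) ++ a :: b :: l₂) S' := by simpa using hS'
          simpa using h7.step hab
        · have h8 := h.insertion_natural (q := q)
            ((h.intertwines_exchange (q := q) a b l₂).append h l) x ys
          have h9 : ∀ y : A, (⇑ρ)^[(ys ++ x :: l).length] y =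
              (⇑ρ)^[ys.length + 1] ((⇑ρ)^[l.length] y) := fun y => by
            rw [← Function.iterate_add_apply]; congr 2; simp; ring
          have h10 : ∀ y : A, ρ ((⇑ρ)^[(ys ++ l).length] y) =
              (⇑ρ)^[ys.length + 1] ((⇑ρ)^[l.length] y) := fun y => by
            rw [← Function.iterate_add_apply, ← Function.iterate_succ_apply' ρ]; congr 2; simp; ring
          rw [map_mul, h9, h10, ← mul_assoc, ← mul_assoc, h8]
          simp only [mul_assoc]

/-- The head `x` never passes a letter equal to itself, so its final place is the first occurrence
of `x` in `r`. This determines both insertions, and the induction applies to the remaining letters.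
-/
theorem ExchangePath.unique (h : HeckeEndo A ρ φ e t η) (hp : HasParameters ρ e t η q d δ)
    {w r : List (ZMod q.toNat)} {S S' : A} (hS : ExchangePath ρ e t q w r S)
    (hS' : ExchangePath ρ e t q w r S') : S = S' := by
  induction w generalizing r S S' with
  | nil =>
    have h1 : ∀ {w r : List (ZMod q.toNat)} {S : A}, ExchangePath ρ e t q w r S → w = [] →
        S = 1 := by
      intro w r S hS
      cases hS with
      | refl => rintro rfl; rfl
      | step hS hcx =>
        rintro rfl
        have := (hS.intertwines h).1.length_eq
        simp at this
    rw [h1 hS rfl, h1 hS' rfl]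
  | cons x c ih =>
    obtain ⟨ys, v, T, hr, hys, hT, rfl⟩ := hS.exists_insertion h hp rfl
    obtain ⟨ys', v', T', hr', hys', hT', rfl⟩ := hS'.exists_insertion h hp rfl
    have hx : ∀ {ys : List (ZMod q.toNat)}, (∀ y ∈ ys, Far x y) → x ∉ ys :=
      fun hys hx => (hys x hx).1 rfl
    obtain ⟨rfl, rfl⟩ : ys = ys' ∧ v = v' := by
      rcases List.append_eq_append_iff.1 (hr.symm.trans hr') with ⟨l, h1, h2⟩ | ⟨l, h1, h2⟩ <;>
      rcases l with - | ⟨z, l⟩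
      · simp_all
      · obtain rfl : x = z := (List.cons.inj h2).1
        exact absurd (by simp [h1]) (hx hys')
      · simp_all
      · obtain rfl : x = z := (List.cons.inj h2).1
        exact absurd (by simp [h1]) (hx hys)
    rw [ih hT hT']

lemma ExchangePath.iterate_e_mul (h : HeckeEndo A ρ φ e t η) (hp : HasParameters ρ e t η q d δ)
    {w l₁ l₂ : List (ZMod q.toNat)} {c x : ZMod q.toNat} {S : A}
    (hS : ExchangePath ρ e t q w (l₁ ++ c :: x :: l₂) S) :
    (⇑ρ)^[l₁.length] e * S = (letterWeight q c x : ℂ) • S +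
      (exchangeCoeff q c x : ℂ) • ((⇑ρ)^[l₁.length] (exchange ρ e t q c x l₂) * S) := by
  obtain ⟨⟨-, -, h3⟩, h4⟩ := hS.intertwines h
  have h5 : (⇑ρ)^[l₁.length] (pathProj ρ e t (c :: x :: l₂)) * S = S := by
    rw [← h4, ← h3, ← mul_assoc, h.iterate_map_pathProj_mul]
  have h6 := congrArg (fun y => (⇑ρ)^[l₁.length] y * S) (h.e_mul_pathProj_eq hp c x l₂)
  simp only [← coe_pow_starAlgHom, map_mul, map_add, map_smul, add_mul, smul_mul_assoc] at h5 h6 ⊢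
  rwa [mul_assoc, h5] at h6

lemma ExchangePath.trans_exists {u v w : List (ZMod Q)} {S T : A}
    (hS : ExchangePath ρ e t q u v S) (hT : ExchangePath ρ e t q v w T) :
    ∃ R, ExchangePath ρ e t q u w R := by
  induction hT with
  | refl => exact ⟨S, hS⟩
  | step _ hcx ih =>
    obtain ⟨R, hR⟩ := ih
    exact ⟨_, hR.step hcx⟩

lemma ExchangePath.symm_exists {w r : List (ZMod Q)} {S : A} (hS : ExchangePath ρ e t q w r S) :
    ∃ T, ExchangePath ρ e t q r w T := by
  induction hS with
  | refl => exact ⟨_, .refl _⟩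
  | step hS hcx ih =>
    obtain ⟨T, hT⟩ := ih
    exact ((ExchangePath.refl _).step hcx.symm).trans_exists hT

end HeckeEndo

end HeckeEndomorphism

end LQP

end

/-! ### Rows of tableaux as particles on a circle. -/

noncomputable section

namespace LQP

section RowLists

variable {Q : ℕ}

/-- The conditions on the shape of a `(d, q)`-tableau, given by the list of the rows of its
boxes. -/
def IsShape (q d : ℕ∞) (l : List ℕ) : Prop :=
  (∀ a, l.count (a + 1) ≤ l.count a) ∧
    ∀ k : ℕ, d = k → ((l.count 0 : ℕ) : ℕ∞) + d ≤ q + ((l.count (k - 1) : ℕ) : ℕ∞)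

/-- The lists of rows of `(d, q)`-tableaux, the last box first. -/
def IsRowList (q d : ℕ∞) : List ℕ → Prop
  | [] => True
  | b :: l => IsRowList q d l ∧ (b : ℕ∞) < d ∧ IsShape q d (b :: l)

/-- The residue class of the content of the next box in row `b`. -/
def nextContent (Q : ℕ) (l : List ℕ) (b : ℕ) : ZMod Q := (l.count b : ZMod Q) - b

/-- The contents of the boxes of a tableau, the last box first. -/
def contents (Q : ℕ) : List ℕ → List (ZMod Q)
  | [] => []
  | b :: l => nextContent Q l b :: contents Q l

lemma length_contents (l : List ℕ) : (contents Q l).length = l.length := by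
  induction l with
  | nil => rfl
  | cons b l ih => simp [contents, ih]

lemma nextContent_cons_self (l : List ℕ) (b : ℕ) :
    nextContent Q (b :: l) b = nextContent Q l b + 1 := by
  rw [nextContent, nextContent, List.count_cons_self]; push_cast; ring

lemma nextContent_cons_of_ne (l : List ℕ) {b b' : ℕ} (h : b' ≠ b) :
    nextContent Q (b :: l) b' = nextContent Q l b' := by
  rw [nextContent, nextContent, List.count_cons_of_ne h.symm]

variable {q d : ℕ∞}

lemma isShape_nil (hdq : d + 2 ≤ q) : IsShape q d [] := by
  refine ⟨by simp, fun k _ => ?_⟩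
  simpa using le_self_add.trans hdq

lemma IsRowList.isShape (hdq : d + 2 ≤ q) {l : List ℕ} (h : IsRowList q d l) : IsShape q d l := by
  cases l with
  | nil => exact isShape_nil hdq
  | cons b l => exact h.2.2

lemma IsShape.antitone {l : List ℕ} (h : IsShape q d l) {a b : ℕ} (hab : a ≤ b) :
    l.count b ≤ l.count a := by
  induction b, hab using Nat.le_induction with
  | base => exact le_rfl
  | succ b _ ih => exact (h.1 b).trans ih

/-- The difference of the two positions is positive and at most `(q - d) + (d - 1) < q`, by the
bound on the first row minus the last. So the positions stay distinct modulo `q`. -/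
lemma IsShape.nextContent_ne_of_lt (hdq : d + 2 ≤ q) {l : List ℕ} (h : IsShape q d l) {a b : ℕ}
    (hb : (b : ℕ∞) < d) (hab : a < b) : nextContent q.toNat l a ≠ nextContent q.toNat l b := by
  intro heq
  have h1 := h.antitone hab.le
  have h2 : (((l.count a + (b - a) : ℕ)) : ZMod q.toNat) = (l.count b : ℕ) := by
    rw [nextContent, nextContent] at heq
    push_cast [Nat.cast_sub hab.le]
    linear_combination heq
  rw [ZMod.natCast_eq_natCast_iff] at h2
  have h3 := (Nat.modEq_iff_dvd' (h1.trans le_self_add)).1 h2.symm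
  induction q using ENat.recTopCoe with
  | top =>
    rw [ENat.toNat_top, zero_dvd_iff] at h3
    omega
  | coe n =>
    induction d using ENat.recTopCoe with
    | top => simp at hdq
    | coe k =>
      have h4 := h.2 k rfl
      have h5 : l.count 0 + k ≤ n + l.count (k - 1) := by exact_mod_cast h4
      have h6 : b < k := by exact_mod_cast hb
      have h7 := h.antitone (show b ≤ k - 1 by omega)
      have h8 := h.antitone (Nat.zero_le a)
      rw [ENat.toNat_natCast] at h3
      have := Nat.le_of_dvd (by omega) h3
      omega

lemma IsShape.nextContent_inj (hdq : d + 2 ≤ q) {l : List ℕ} (h : IsShape q d l) {a b : ℕ}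
    (ha : (a : ℕ∞) < d) (hb : (b : ℕ∞) < d)
    (heq : nextContent q.toNat l a = nextContent q.toNat l b) : a = b := by
  rcases lt_trichotomy a b with hab | hab | hab
  · exact absurd heq (h.nextContent_ne_of_lt hdq hb hab)
  · exact hab
  · exact absurd heq.symm (h.nextContent_ne_of_lt hdq ha hab)

/-- The particle of row `b` can be stopped by the row above it, which is the Young diagram
condition. For `b = 0` it can only be stopped by row `d - 1` around the circle, which is the
condition on the first row minus the last. -/
lemma isShape_cons_iff (hd : 2 ≤ d) (hdq : d + 2 ≤ q) (hQ : q.toNat ≠ 1) {l : List ℕ}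
    (h : IsShape q d l) {b : ℕ} (hb : (b : ℕ∞) < d) : IsShape q d (b :: l) ↔
      ∀ a : ℕ, (a : ℕ∞) < d → nextContent q.toNat l a ≠ nextContent q.toNat l b + 1 := by
  have : Nontrivial (ZMod q.toNat) := ZMod.nontrivial_iff.2 hQ
  constructor
  · intro h' a ha heq
    rcases eq_or_ne a b with rfl | hab
    · simp at heq
    · rw [← nextContent_cons_self, ← nextContent_cons_of_ne l hab] at heq
      exact hab (h'.nextContent_inj hdq ha hb heq)
  · intro hne
    constructor
    · intro a
      have h1 := h.1 a
      rcases eq_or_ne b (a + 1) with rfl | hba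
      · rw [List.count_cons_self, List.count_cons_of_ne (by omega)]
        by_contra hcon
        have h2 : l.count (a + 1) = l.count a := by omega
        refine hne a (lt_of_le_of_lt (by exact_mod_cast Nat.le_succ a) hb) ?_
        rw [nextContent, nextContent, h2]; push_cast; ring
      · rw [List.count_cons_of_ne hba]
        exact h1.trans List.count_le_count_cons
    · rintro k rfl
      have h1 := h.2 k rfl
      have hk : 2 ≤ k := by exact_mod_cast hd
      have h3 : (b :: l).count (k - 1) ≥ l.count (k - 1) := List.count_le_count_cons
      induction q using ENat.recTopCoe with
      | top => simp
      | coe n =>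
        have h5 : l.count 0 + k ≤ n + l.count (k - 1) := by exact_mod_cast h1
        suffices h6 : (b :: l).count 0 + k ≤ n + (b :: l).count (k - 1) by exact_mod_cast h6
        rcases eq_or_ne b 0 with rfl | hb0
        · by_contra hcon
          rw [List.count_cons_self] at hcon
          have h7 : l.count 0 + k = n + l.count (k - 1) := by omega
          refine hne (k - 1) (by exact_mod_cast (by omega : k - 1 < k)) ?_
          have h8 : ((l.count 0 + k : ℕ) : ZMod n) = ((n + l.count (k - 1) : ℕ) : ZMod n) := by
            rw [h7]
          push_cast at h8
          rw [ZMod.natCast_self] at h8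
          rw [nextContent, nextContent, Nat.cast_sub (by omega), ENat.toNat_natCast]
          push_cast
          linear_combination -h8
        · rw [List.count_cons_of_ne hb0]
          omega

open Classical in
-- Row `a` of length `l_a` is a particle at `l_a - a`; the empty diagram gives the initial
-- configuration, and a new box moves its row by one site.
lemma IsRowList.occupation_contents (hd : 2 ≤ d) (hdq : d + 2 ≤ q) (hQ : q.toNat ≠ 1) {l : List ℕ}
    (h : IsRowList q d l) (c : ZMod q.toNat) : occupation d (contents q.toNat l) c =
      if ∃ a : ℕ, (a : ℕ∞) < d ∧ c = nextContent q.toNat l a then 1 else 0 := by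
  have : Nontrivial (ZMod q.toNat) := ZMod.nontrivial_iff.2 hQ
  induction l with
  | nil => simp [contents, occupation, nextContent]
  | cons b l ih =>
    obtain ⟨h1, h2, h3⟩ := h
    have hne := (isShape_cons_iff hd hdq hQ (h1.isShape hdq) h2).1 h3
    rw [contents, occupation, ih h1]
    rcases eq_or_ne c (nextContent q.toNat l b + 1) with rfl | hc1
    · rw [if_neg, if_pos rfl, if_neg (by simp), if_pos]
      · simp
      · exact ⟨b, h2, (nextContent_cons_self l b).symm⟩
      · rintro ⟨a, ha, heq⟩; exact hne a ha heq.symm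
    · rw [if_neg hc1]
      rcases eq_or_ne c (nextContent q.toNat l b) with rfl | hc2
      · rw [if_pos ⟨b, h2, rfl⟩, if_pos rfl, if_neg]
        · simp
        · rintro ⟨a, ha, heq⟩
          rcases eq_or_ne a b with rfl | hab
          · rw [nextContent_cons_self] at heq; exact hc1 heq
          · rw [nextContent_cons_of_ne l hab] at heq
            exact hab ((h1.isShape hdq).nextContent_inj hdq ha h2 heq.symm)
      · rw [if_neg hc2, add_zero, sub_zero]
        congr 1
        refine propext (exists_congr fun a => and_congr_right fun ha => ?_)
        rcases eq_or_ne a b with rfl | hab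
        · rw [nextContent_cons_self]; simp [hc1, hc2]
        · rw [nextContent_cons_of_ne l hab]

lemma legal_contents_iff (hd : 2 ≤ d) (hdq : d + 2 ≤ q) (hQ : q.toNat ≠ 1) {l : List ℕ}
    (hl : ∀ b ∈ l, (b : ℕ∞) < d) : Legal d (contents q.toNat l) ↔ IsRowList q d l := by
  classical
  induction l with
  | nil => exact Iff.rfl
  | cons b l ih =>
    rw [contents, Legal, IsRowList, ih fun b hb => hl b (by simp [hb])]
    have hb := hl b (by simp)
    refine and_congr_right fun h1 => ?_
    rw [h1.occupation_contents hd hdq hQ, h1.occupation_contents hd hdq hQ,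
      isShape_cons_iff hd hdq hQ (h1.isShape hdq) hb, if_pos ⟨b, hb, rfl⟩]
    simp only [true_and, hb, ne_eq]
    constructor
    · intro h2 a ha heq
      rw [if_pos ⟨a, ha, heq.symm⟩] at h2
      exact one_ne_zero h2
    · intro h2
      rw [if_neg]
      rintro ⟨a, ha, heq⟩
      exact h2 a ha heq.symm

lemma IsRowList.mem_lt {l : List ℕ} (h : IsRowList q d l) : ∀ b ∈ l, (b : ℕ∞) < d := by
  induction l with
  | nil => simp
  | cons b l ih =>
    intro a ha
    rcases List.mem_cons.1 ha with rfl | ha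
    · exact h.2.1
    · exact ih h.1 a ha

lemma exists_isRowList (hd : 2 ≤ d) (hdq : d + 2 ≤ q) (hQ : q.toNat ≠ 1)
    {w : List (ZMod q.toNat)} (hw : Legal d w) : ∃ l, IsRowList q d l ∧ contents q.toNat l = w := by
  classical
  induction w with
  | nil => exact ⟨[], trivial, rfl⟩
  | cons c w ih =>
    obtain ⟨l, hl, rfl⟩ := ih hw.1
    have h1 := hw.2.1
    rw [hl.occupation_contents hd hdq hQ] at h1
    have h2 : ∃ a : ℕ, (a : ℕ∞) < d ∧ c = nextContent q.toNat l a := by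
      by_contra hcon
      rw [if_neg hcon] at h1
      exact zero_ne_one h1
    obtain ⟨a, ha, rfl⟩ := h2
    refine ⟨a :: l, (legal_contents_iff hd hdq hQ ?_).1 hw, rfl⟩
    intro b hb
    rcases List.mem_cons.1 hb with rfl | hb
    · exact ha
    · exact hl.mem_lt b hb

lemma IsRowList.contents_inj (hdq : d + 2 ≤ q) {l l' : List ℕ} (h : IsRowList q d l)
    (h' : IsRowList q d l') (heq : contents q.toNat l = contents q.toNat l') : l = l' := by
  induction l generalizing l' with
  | nil => cases l' with
    | nil => rfl
    | cons b l' => simp [contents] at heq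
  | cons b l ih => cases l' with
    | nil => simp [contents] at heq
    | cons b' l' =>
      rw [contents, contents, List.cons.injEq] at heq
      obtain rfl := ih h.1 h'.1 heq.2
      rw [(h.1.isShape hdq).nextContent_inj hdq h.2.1 h'.2.1 heq.1]

/-- All rows above an occupied one are occupied, so `n` boxes use only row indices below `n`; this
is why words with values in `Fin n` suffice. -/
lemma IsShape.lt_length {l : List ℕ} (h : IsShape q d l) {b : ℕ} (hb : b ∈ l) : b < l.length := by
  have h1 : Finset.range (b + 1) ⊆ l.toFinset := by
    intro a ha
    rw [Finset.mem_range] at ha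
    have h2 := h.antitone (show a ≤ b by omega)
    have h3 := List.count_pos_iff.2 hb
    exact List.mem_toFinset.2 (List.count_pos_iff.1 (by omega))
  have h2 := (Finset.card_le_card h1).trans (List.toFinset_card_le l)
  rw [Finset.card_range] at h2
  omega

end RowLists

section Tableaux

variable {q d : ℕ∞} {n : ℕ}

/-- The list of the rows of the first `j` boxes, the last box first. -/
def rowsUpTo (r : Fin n → Fin n) : ℕ → List ℕ
  | 0 => []
  | j + 1 => (if h : j < n then (r ⟨j, h⟩ : ℕ) else 0) :: rowsUpTo r j

lemma length_rowsUpTo (r : Fin n → Fin n) (j : ℕ) : (rowsUpTo r j).length = j := by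
  induction j with
  | zero => rfl
  | succ j ih => simp [rowsUpTo, ih]

lemma count_rowsUpTo (r : Fin n → Fin n) {j : ℕ} (hj : j ≤ n) (a : ℕ) :
    (rowsUpTo r j).count a = rowLength r j a := by
  induction j with
  | zero => simp [rowsUpTo, rowLength]
  | succ j ih =>
    have hjn : j < n := hj
    rw [rowsUpTo, List.count_cons, ih hjn.le, dif_pos hjn, rowLength, rowLength]
    have h1 : (Finset.univ.filter fun i : Fin n => (i : ℕ) < j + 1 ∧ (r i : ℕ) = a) =
        (Finset.univ.filter fun i : Fin n => (i : ℕ) < j ∧ (r i : ℕ) = a) ∪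
          (if (r ⟨j, hjn⟩ : ℕ) = a then {⟨j, hjn⟩} else ∅) := by
      ext i
      simp only [Finset.mem_filter, Finset.mem_univ, true_and, Finset.mem_union]
      split_ifs with h
      · rw [Finset.mem_singleton]
        constructor
        · rintro ⟨h2, h3⟩
          rcases Nat.lt_succ_iff_lt_or_eq.1 h2 with h4 | h4
          · exact Or.inl ⟨h4, h3⟩
          · exact Or.inr (Fin.ext h4)
        · rintro (⟨h2, h3⟩ | rfl)
          · exact ⟨by omega, h3⟩
          · exact ⟨by simp, h⟩
      · simp only [Finset.notMem_empty, or_false]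
        constructor
        · rintro ⟨h2, h3⟩
          refine ⟨?_, h3⟩
          by_contra h4
          have h5 : i = ⟨j, hjn⟩ := Fin.ext (show (i : ℕ) = j by omega)
          exact h (h5 ▸ h3)
        · rintro ⟨h2, h3⟩
          exact ⟨by omega, h3⟩
    rw [h1, Finset.card_union_of_disjoint]
    · congr 1
      split_ifs with h2 h3 h3 <;> simp_all
    · split_ifs
      · rw [Finset.disjoint_singleton_right]; simp
      · exact Finset.disjoint_empty_right _

lemma rowLength_of_le (r : Fin n → Fin n) {j : ℕ} (hj : n ≤ j) (a : ℕ) :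
    rowLength r j a = rowLength r n a := by
  rw [rowLength, rowLength]
  congr 1
  ext i
  have := i.2
  simp only [Finset.mem_filter, Finset.mem_univ, true_and]
  constructor <;> rintro ⟨h1, h2⟩ <;> exact ⟨by omega, h2⟩

lemma isRowList_rowsUpTo_iff (r : Fin n → Fin n) {j : ℕ} (hj : j ≤ n) :
    IsRowList q d (rowsUpTo r j) ↔ (∀ i : Fin n, (i : ℕ) < j → ((r i : ℕ) : ℕ∞) < d) ∧
      ∀ i, 1 ≤ i → i ≤ j → IsShape q d (rowsUpTo r i) := by
  induction j with
  | zero =>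
    simp only [rowsUpTo, IsRowList, true_iff]
    exact ⟨by simp, fun i h1 h2 => by omega⟩
  | succ j ih =>
    have hjn : j < n := hj
    have hr : rowsUpTo r (j + 1) = (r ⟨j, hjn⟩ : ℕ) :: rowsUpTo r j := by rw [rowsUpTo, dif_pos hjn]
    rw [hr, IsRowList, ih hjn.le, ← hr]
    constructor
    · rintro ⟨⟨h1, h2⟩, h3, h4⟩
      refine ⟨fun i hi => ?_, fun i hi hi' => ?_⟩
      · rcases Nat.lt_succ_iff_lt_or_eq.1 hi with h5 | h5
        · exact h1 i h5
        · rwa [show i = ⟨j, hjn⟩ from Fin.ext h5]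
      · rcases hi'.lt_or_eq with h5 | rfl
        · exact h2 i hi (by omega)
        · exact h4
    · rintro ⟨h1, h2⟩
      exact ⟨⟨fun i hi => h1 i (by omega), fun i hi hi' => h2 i hi (by omega)⟩,
        h1 ⟨j, hjn⟩ (by simp), h2 _ (by omega) le_rfl⟩

lemma isTableau_iff (hdq : d + 2 ≤ q) (r : Fin n → Fin n) :
    IsTableau q d r ↔ IsRowList q d (rowsUpTo r n) := by
  have key : ∀ j, j ≤ n → (IsShape q d (rowsUpTo r j) ↔
      (∀ a, rowLength r j (a + 1) ≤ rowLength r j a) ∧ ∀ k : ℕ, d = k →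
        ((rowLength r j 0 : ℕ) : ℕ∞) + d ≤ q + ((rowLength r j (k - 1) : ℕ) : ℕ∞)) := by
    intro j hj
    simp only [IsShape, count_rowsUpTo r hj]
  rw [isRowList_rowsUpTo_iff r le_rfl]
  constructor
  · rintro ⟨h1, h2, h3⟩
    exact ⟨fun i _ => h2 i, fun i _ hi => (key i hi).2 ⟨h1 i, fun k hk => h3 k hk i⟩⟩
  · rintro ⟨h1, h2⟩
    have h4 : ∀ j, (∀ a, rowLength r j (a + 1) ≤ rowLength r j a) ∧ ∀ k : ℕ, d = k →
        ((rowLength r j 0 : ℕ) : ℕ∞) + d ≤ q + ((rowLength r j (k - 1) : ℕ) : ℕ∞) := by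
      have h5 : ∀ j ≤ n, IsShape q d (rowsUpTo r j) := by
        intro j hj
        rcases Nat.eq_zero_or_pos j with rfl | hj'
        · exact isShape_nil hdq
        · exact h2 j hj' hj
      intro j
      rcases le_total j n with hj | hj
      · exact (key j hj).1 (h5 j hj)
      · simp only [rowLength_of_le r hj]
        exact (key n le_rfl).1 (h5 n le_rfl)
    exact ⟨fun j a => (h4 j).1 a, fun i => h1 i i.2, fun k hk j => (h4 j).2 k hk⟩

lemma rowsUpTo_inj {r r' : Fin n → Fin n} (h : rowsUpTo r n = rowsUpTo r' n) : r = r' := by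
  have key : ∀ j ≤ n, rowsUpTo r j = rowsUpTo r' j → ∀ i : Fin n, (i : ℕ) < j → r i = r' i := by
    intro j
    induction j with
    | zero => intro _ _ i hi; omega
    | succ j ih =>
      intro hj heq i hi
      have hjn : j < n := hj
      rw [rowsUpTo, rowsUpTo, List.cons.injEq, dif_pos hjn, dif_pos hjn] at heq
      rcases Nat.lt_succ_iff_lt_or_eq.1 hi with h5 | h5
      · exact ih hjn.le heq.2 i h5
      · rw [show i = ⟨j, hjn⟩ from Fin.ext h5]; exact Fin.ext heq.1
  exact funext fun i => key n le_rfl h i i.2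

lemma exists_rowsUpTo {l : List ℕ} (hl : l.length = n) (hb : ∀ b ∈ l, b < n) :
    ∃ r : Fin n → Fin n, rowsUpTo r n = l := by
  have key : ∀ (l' : List ℕ) (r : Fin n → Fin n), l' <:+ l → (∀ i : Fin n, (i : ℕ) < l'.length →
      l'.reverse[(i : ℕ)]? = some (r i : ℕ)) → rowsUpTo r l'.length = l' := by
    intro l'
    induction l' with
    | nil => intro _ _ _; rfl
    | cons b l' ih =>
      intro r hs hr
      have h1 : (b :: l').length ≤ n := hl ▸ hs.length_le
      have h2 : l'.length < n := by simpa using h1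
      have h3 := hr ⟨l'.length, h2⟩ (by simp)
      rw [List.length_cons, rowsUpTo, dif_pos h2, ih r ((List.suffix_cons b l').trans hs)]
      · simp only [List.reverse_cons] at h3
        rw [List.getElem?_append_right (by simp)] at h3
        simp at h3
        rw [← h3]
      · intro i hi
        have h4 := hr i (by simp; omega)
        rwa [List.reverse_cons, List.getElem?_append_left (by simpa using hi)] at h4
  have hlr : l.reverse.length = n := by rw [List.length_reverse, hl]
  refine ⟨fun i => ⟨l.reverse[(i : ℕ)]'(by rw [hlr]; exact i.2),
    hb _ (List.mem_reverse.1 (List.getElem_mem _))⟩, ?_⟩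
  have h5 := key l (fun i => ⟨l.reverse[(i : ℕ)]'(by rw [hlr]; exact i.2),
    hb _ (List.mem_reverse.1 (List.getElem_mem _))⟩) List.suffix_rfl
    fun i hi => List.getElem?_eq_getElem _
  rwa [hl] at h5

/-- The residue classes of the contents of the boxes of a tableau, the last box first. -/
def word (q : ℕ∞) (r : Fin n → Fin n) : List (ZMod q.toNat) := contents q.toNat (rowsUpTo r n)

lemma length_word (r : Fin n → Fin n) : (word q r).length = n := by
  rw [word, length_contents, length_rowsUpTo]

lemma word_injective (hdq : d + 2 ≤ q) {r r' : Fin n → Fin n} (hr : IsTableau q d r)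
    (hr' : IsTableau q d r') (h : word q r = word q r') : r = r' :=
  rowsUpTo_inj (((isTableau_iff hdq r).1 hr).contents_inj hdq ((isTableau_iff hdq r').1 hr') h)

lemma exists_tableau (hd : 2 ≤ d) (hdq : d + 2 ≤ q) (hQ : q.toNat ≠ 1) {w : List (ZMod q.toNat)}
    (hw : Legal d w) (hn : w.length = n) : ∃ r : Tableau q d n, word q r.1 = w := by
  obtain ⟨l, hl, rfl⟩ := exists_isRowList hd hdq hQ hw
  rw [length_contents] at hn
  obtain ⟨r, hr⟩ := exists_rowsUpTo hn fun b hb => hn ▸ (hl.isShape hdq).lt_length hb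
  exact ⟨⟨r, (isTableau_iff hdq r).2 (by rwa [hr])⟩, by rw [word, hr]⟩

lemma legal_word (hd : 2 ≤ d) (hdq : d + 2 ≤ q) (hQ : q.toNat ≠ 1) (r : Tableau q d n) :
    Legal d (word q r.1) := by
  have h := (isTableau_iff hdq r.1).1 r.2
  exact (legal_contents_iff hd hdq hQ h.mem_lt).2 h

lemma content_intCast (r : Fin n → Fin n) (i : Fin n) :
    ((content r i : ℤ) : ZMod q.toNat) = nextContent q.toNat (rowsUpTo r i) (r i) := by
  rw [content, nextContent, count_rowsUpTo r i.2.le]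
  push_cast; rfl

lemma rowsUpTo_succ (r : Fin n → Fin n) {j : ℕ} (hj : j < n) :
    rowsUpTo r (j + 1) = (r ⟨j, hj⟩ : ℕ) :: rowsUpTo r j := by
  rw [rowsUpTo, dif_pos hj]

lemma rowsUpTo_congr {r r' : Fin n → Fin n} {j : ℕ} (hj : j ≤ n)
    (h : ∀ i : Fin n, (i : ℕ) < j → r i = r' i) : rowsUpTo r j = rowsUpTo r' j := by
  induction j with
  | zero => rfl
  | succ j ih =>
    rw [rowsUpTo_succ r hj, rowsUpTo_succ r' hj, h ⟨j, hj⟩ (by simp),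
      ih (by omega) fun i hi => h i (by omega)]

/-- The effect on the word of a tableau of exchanging two boxes in different rows. -/
lemma word_swap (q : ℕ∞) (r : Fin n → Fin n) {k : ℕ} (hk : k + 1 < n) :
    ∃ l₁ l₂ : List (ZMod q.toNat), l₁.length = n - 2 - k ∧
      word q r = l₁ ++ (content r ⟨k + 1, hk⟩ : ZMod q.toNat) ::
        (content r ⟨k, by omega⟩ : ZMod q.toNat) :: l₂ ∧
      (r ⟨k, by omega⟩ ≠ r ⟨k + 1, hk⟩ →
        word q (r ∘ Equiv.swap ⟨k, by omega⟩ ⟨k + 1, hk⟩) =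
          l₁ ++ (content r ⟨k, by omega⟩ : ZMod q.toNat) ::
            (content r ⟨k + 1, hk⟩ : ZMod q.toNat) :: l₂) := by
  have hk' : k < n := by omega
  set r' := r ∘ Equiv.swap ⟨k, hk'⟩ ⟨k + 1, hk⟩ with hr'
  have hr1 : r' ⟨k, hk'⟩ = r ⟨k + 1, hk⟩ := by simp [hr']
  have hr2 : r' ⟨k + 1, hk⟩ = r ⟨k, hk'⟩ := by simp [hr']
  have hr3 : ∀ i : Fin n, (i : ℕ) ≠ k → (i : ℕ) ≠ k + 1 → r' i = r i := by
    intro i h1 h2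
    rw [hr', Function.comp_apply, Equiv.swap_apply_of_ne_of_ne]
    · exact fun h => h1 (congrArg Fin.val h)
    · exact fun h => h2 (congrArg Fin.val h)
  have hR : rowsUpTo r' k = rowsUpTo r k :=
    rowsUpTo_congr hk'.le fun i hi => hr3 i (by omega) (by omega)
  have hc1 := content_intCast (q := q) r ⟨k, hk'⟩
  have hc2 := content_intCast (q := q) r ⟨k + 1, hk⟩
  rw [rowsUpTo_succ r hk'] at hc2
  have key : ∀ m : ℕ, k + 2 + m ≤ n → (rowsUpTo r' (k + 2 + m)).Perm (rowsUpTo r (k + 2 + m)) ∧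
      ∃ l₁ : List (ZMod q.toNat), l₁.length = m ∧
      contents q.toNat (rowsUpTo r (k + 2 + m)) = l₁ ++ (content r ⟨k + 1, hk⟩ : ZMod q.toNat) ::
        (content r ⟨k, by omega⟩ : ZMod q.toNat) :: contents q.toNat (rowsUpTo r k) ∧
      (r ⟨k, by omega⟩ ≠ r ⟨k + 1, hk⟩ → contents q.toNat (rowsUpTo r' (k + 2 + m)) =
        l₁ ++ (content r ⟨k, by omega⟩ : ZMod q.toNat) ::
          (content r ⟨k + 1, hk⟩ : ZMod q.toNat) :: contents q.toNat (rowsUpTo r k)) := by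
    intro m
    induction m with
    | zero =>
      intro _
      rw [add_zero, rowsUpTo_succ r hk, rowsUpTo_succ r' hk, rowsUpTo_succ r hk',
        rowsUpTo_succ r' hk', hR, hr1, hr2]
      refine ⟨List.Perm.swap _ _ _, [], rfl, ?_, fun hne => ?_⟩
      · rw [hc1, hc2]; rfl
      · have hne' : (r ⟨k, hk'⟩ : ℕ) ≠ r ⟨k + 1, hk⟩ := fun h => hne (Fin.ext h)
        rw [nextContent_cons_of_ne _ hne'.symm] at hc2
        rw [hc1, hc2, contents, contents, nextContent_cons_of_ne _ hne']; rfl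
    | succ m ih =>
      intro hm
      have hm' : k + 2 + m < n := hm
      obtain ⟨h1, l₁, h2, h3, h4⟩ := ih hm'.le
      have h5 : r' ⟨k + 2 + m, hm'⟩ = r ⟨k + 2 + m, hm'⟩ :=
        hr3 _ (show k + 2 + m ≠ k by omega) (show k + 2 + m ≠ k + 1 by omega)
      rw [← add_assoc, rowsUpTo_succ r hm', rowsUpTo_succ r' hm', h5]
      refine ⟨h1.cons _, nextContent q.toNat (rowsUpTo r (k + 2 + m)) (r ⟨k + 2 + m, hm'⟩) :: l₁,
        by simp [h2], by rw [contents, h3]; rfl, fun hne => ?_⟩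
      rw [contents, h4 hne, nextContent, h1.count_eq]; rfl
  obtain ⟨-, l₁, h1, h2, h3⟩ := key (n - 2 - k) (by omega)
  rw [show k + 2 + (n - 2 - k) = n by omega] at h2 h3
  exact ⟨l₁, _, h1, h2, h3⟩

end Tableaux

end LQP

end

/-! ### Resolution of the identity by tableaux and the frame of the Ocneanu-Wenzl representation. -/

noncomputable section

namespace LQP

lemma mem_rowsUpTo {n : ℕ} (r : Fin n → Fin n) {j : ℕ} (hj : j ≤ n) {b : ℕ}
    (hb : b ∈ rowsUpTo r j) : ∃ i, b = (r i : ℕ) := by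
  induction j with
  | zero => simp [rowsUpTo] at hb
  | succ j ih =>
    rw [rowsUpTo_succ r hj] at hb
    rcases List.mem_cons.1 hb with rfl | hb
    · exact ⟨_, rfl⟩
    · exact ih (by omega) hb

lemma Legal.of_append {Q : ℕ} {d : ℕ∞} {l w : List (ZMod Q)} (h : Legal d (l ++ w)) :
    Legal d w := by
  induction l with
  | nil => exact h
  | cons c l ih => exact ih h.1

lemma isTableau_of_legal {q d : ℕ∞} {n : ℕ} (hd : 2 ≤ d) (hdq : d + 2 ≤ q) (hQ : q.toNat ≠ 1)
    {r : Fin n → Fin n} (hr : ∀ i, ((r i : ℕ) : ℕ∞) < d) (hw : Legal d (word q r)) :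
    IsTableau q d r := by
  rw [isTableau_iff hdq]
  refine (legal_contents_iff hd hdq hQ fun b hb => ?_).1 hw
  obtain ⟨i, rfl⟩ := mem_rowsUpTo r le_rfl hb
  exact hr i

section HeckeEndomorphism

variable {H : Type*} [NormedAddCommGroup H] [InnerProductSpace ℂ H] [CompleteSpace H]
  {A : StarSubalgebra ℂ (H →L[ℂ] H)} {ρ : A →⋆ₐ[ℂ] A} {φ : A →ₗ[ℂ] A} {e : A} {t : ℂ} {η : ℝ}
  {Q : ℕ} {q d : ℕ∞} {δ : ℝ} {n : ℕ}

namespace HeckeEndo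

/-- Applying `ρ` to the decomposition of `1` for `n` boxes and using the branching rule refines it
to `n + 1` boxes. Illegal words contribute zero, and the legal ones are the words of tableaux. -/
theorem sum_pathProj (h : HeckeEndo A ρ φ e t η) (hp : HasParameters ρ e t η q d δ) (n : ℕ) :
    ∑ r : Tableau q d n, pathProj ρ e t (word q r.1) = 1 := by
  classical
  have hQ := hp.isPeriod.ne_one
  have himage : ∀ n, ∑ r : Tableau q d n, pathProj ρ e t (word q r.1) =
      ∑ w ∈ Finset.univ.image fun r : Tableau q d n => word q r.1, pathProj ρ e t w := by
    intro n
    rw [Finset.sum_image]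
    intro r _ r' _ hrr
    exact Subtype.ext (word_injective hp.add_two_le r.2 r'.2 hrr)
  have hmem : ∀ {n} {w : List (ZMod q.toNat)}, Legal d w → w.length = n →
      w ∈ Finset.univ.image fun r : Tableau q d n => word q r.1 := by
    intro n w hw hn
    obtain ⟨r, rfl⟩ := exists_tableau hp.two_le hp.add_two_le hQ hw hn
    exact Finset.mem_image_of_mem _ (Finset.mem_univ r)
  induction n with
  | zero =>
    rw [himage, Finset.sum_eq_single []]
    · rfl
    · intro w hw hne
      obtain ⟨r, -, rfl⟩ := Finset.mem_image.1 hw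
      exact absurd (List.length_eq_zero_iff.1 (length_word r.1)) hne
    · intro hne
      exact absurd (hmem (n := 0) (w := []) trivial rfl) hne
  | succ n ih =>
    rw [himage] at ih ⊢
    set C : Finset (ZMod q.toNat) := (Finset.univ.image fun r : Tableau q d (n + 1) =>
      word q r.1).image fun w => w.headD 0 with hC
    have h1 : ∀ w ∈ Finset.univ.image (fun r : Tableau q d n => word q r.1),
        ρ (pathProj ρ e t w) = ∑ c ∈ C, pathProj ρ e t (c :: w) := by
      intro w hw
      obtain ⟨r, -, rfl⟩ := Finset.mem_image.1 hw
      refine h.map_pathProj_eq_sum hp _ C fun c hc => ?_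
      exact Finset.mem_image.2 ⟨_, hmem hc (by simp [length_word]), rfl⟩
    rw [← map_one ρ, ← ih, map_sum, Finset.sum_congr rfl h1, ← Finset.sum_product',
      ← Finset.sum_image (f := pathProj ρ e t)
        (g := fun x : List (ZMod q.toNat) × ZMod q.toNat => x.2 :: x.1)]
    · refine Finset.sum_subset (fun w hw => ?_) fun w hw hne => ?_
      · obtain ⟨r, -, rfl⟩ := Finset.mem_image.1 hw
        have h2 := legal_word hp.two_le hp.add_two_le hQ r
        have h3 := length_word (q := q) r.1
        rcases hr : word q r.1 with - | ⟨c, w⟩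
        · rw [hr] at h3; simp at h3
        · rw [hr] at h2 h3
          refine Finset.mem_image.2 ⟨(w, c), Finset.mem_product.2 ⟨hmem h2.1 (by simpa using h3), ?_⟩,
            rfl⟩
          refine Finset.mem_image.2 ⟨word q r.1, hw, ?_⟩
          simp [hr]
      · obtain ⟨⟨w', c⟩, hwc, rfl⟩ := Finset.mem_image.1 hw
        obtain ⟨r, -, rfl⟩ := Finset.mem_image.1 (Finset.mem_product.1 hwc).1
        refine h.pathProj_eq_zero hp fun hl => hne (hmem hl ?_)
        simp [length_word]
    · rintro ⟨w, c⟩ _ ⟨w', c'⟩ _ heq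
      simp only [List.cons.injEq] at heq
      exact Prod.ext heq.2 heq.1

lemma sum_ite_smul {ι M : Type*} [Fintype ι] [AddCommGroup M] [Module ℂ M] (P : ι → Prop)
    [DecidableEq ι] [DecidablePred P] (V : ι → M) (a b : ℂ) (r s : ι) (hrs : s ≠ r)
    (hP : ∀ i, P i ↔ i = s) :
    ∑ i, (if i = r then a else if P i then b else 0) • V i = a • V r + b • V s := by
  have h1 : ∀ i, (if i = r then a else if P i then b else 0) • V i =
      (if i = r then a • V i else 0) + if i = s then b • V i else 0 := by
    intro i
    by_cases h2 : i = r
    · have h3 : i ≠ s := fun h => hrs (h.symm.trans h2)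
      simp [h2, hrs.symm]
    · by_cases h3 : i = s
      · rw [if_neg h2, if_pos ((hP i).2 h3), if_neg h2, if_pos h3, zero_add]
      · rw [if_neg h2, if_neg (mt (hP i).1 h3), if_neg h2, if_neg h3, zero_smul, zero_add]
  simp only [h1, Finset.sum_add_distrib, Finset.sum_ite_eq', Finset.mem_univ, if_true]

/-- The partial isometries along exchange paths intertwine the projections `e` with Wenzl's
projections. -/
theorem iterate_e_mul_frame (h : HeckeEndo A ρ φ e t η) (hp : HasParameters ρ e t η q d δ)
    {cls : Tableau q d n → Tableau q d n} {V : Tableau q d n → A}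
    (hV : ∀ r, ExchangePath ρ e t q (word q (cls r).1) (word q r.1) (V r))
    (hcls : ∀ r r' S, ExchangePath ρ e t q (word q r.1) (word q r'.1) S → cls r = cls r')
    (hidem : ∀ r, cls (cls r) = cls r)
    (k : Fin (n - 1)) (r : Tableau q d n) :
    (⇑ρ)^[n - 2 - k] e * V r = ∑ r', wenzlProjection q d n k r' r • V r' ∧
      ∀ r', wenzlProjection q d n k r' r ≠ 0 → cls r' = cls r := by
  classical
  have hQ := hp.isPeriod
  have : Nontrivial (ZMod q.toNat) := ZMod.nontrivial_iff.2 hQ.ne_one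
  have hk : (k : ℕ) + 1 < n := by have := k.2; omega
  have hk' : (k : ℕ) < n := by omega
  obtain ⟨l₁, l₂, hl, hw, hw'⟩ := word_swap q r.1 hk
  have hleg := legal_word hp.two_le hp.add_two_le hQ.ne_one r
  set i : Fin n := ⟨k, hk'⟩ with hi
  set j : Fin n := ⟨(k : ℕ) + 1, hk⟩ with hj
  set c : ZMod q.toNat := (content r.1 j : ZMod q.toNat) with hc
  set x : ZMod q.toNat := (content r.1 i : ZMod q.toNat) with hx
  have hcx : c ≠ x := by
    intro heq
    rw [hw, heq] at hleg
    exact not_legal_cons_cons hQ.ne_one d x l₂ hleg.of_append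
  have ha : wenzlWeight q (content r.1 i - content r.1 j) = letterWeight q c x :=
    HasParameters.wenzlWeight_intCast h hp hcx (by push_cast; rfl)
  have hE : ∀ r' : Tableau q d n, wenzlProjection q d n k r' r =
      if r' = r then (letterWeight q c x : ℂ) else
        if r'.1 = r.1 ∘ Equiv.swap i j then (exchangeCoeff q c x : ℂ) else 0 := by
    intro r'
    rw [exchangeCoeff, ← ha]
    simp only [wenzlProjection, Matrix.of_apply, hi, hj]
  have hVr := hV r
  rw [hw] at hVr
  have hmul := hVr.iterate_e_mul h hp
  rw [hl] at hmul
  by_cases hfar : Far c x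
  · have hrne : r.1 i ≠ r.1 j := by
      intro heq
      have h1 := content_intCast (q := q) r.1 i
      have h2 := content_intCast (q := q) r.1 j
      rw [hj, rowsUpTo_succ r.1 hk', ← hi, ← hj, heq, nextContent_cons_self, ← heq] at h2
      exact hfar.2.1 (by rw [hc, hx, h1, h2])
    have hstep := hVr.step hfar
    -- The exchange is isometric on the nonzero projection of the class representative, so the
    -- exchanged path is nonzero. Hence its word is legal and it comes from a tableau.
    have hne : pathProj ρ e t (l₁ ++ x :: c :: l₂) ≠ 0 := by
      intro h0
      have h1 := hstep.star_mul_self h hp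
      rw [h0] at h1
      have h2 : (⇑ρ)^[l₁.length] (exchange ρ e t q c x l₂) * V r = 0 := by
        rw [← star_eq_zero]
        refine StarSubalgebra.eq_zero_of_star_mul_self ?_
        rw [star_star]; exact h1.2
      rw [h2, mul_zero] at h1
      exact h.pathProj_ne_zero hp (legal_word hp.two_le hp.add_two_le hQ.ne_one _) h1.1.symm
    have hleg' : Legal d (word q (r.1 ∘ Equiv.swap i j)) := by
      rw [hw' hrne]
      by_contra hcon
      exact hne (h.pathProj_eq_zero hp hcon)
    set s : Tableau q d n := ⟨r.1 ∘ Equiv.swap i j, isTableau_of_legal hp.two_le hp.add_two_le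
      hQ.ne_one (fun a => r.2.2.1 _) hleg'⟩ with hs
    have hws : word q s.1 = l₁ ++ x :: c :: l₂ := hw' hrne
    rw [← hws] at hstep
    have hclss : cls s = cls r := by rw [← hcls _ _ _ hstep, hidem]
    have hVs : V s = (⇑ρ)^[n - 2 - k] (exchange ρ e t q c x l₂) * V r := by
      have h1 := hV s
      rw [hclss] at h1
      rw [← hl]
      exact h1.unique h hp hstep
    have hsr : s ≠ r := by
      intro heq
      have h1 := congrFun (congrArg Subtype.val heq) i
      simp only [hs, Function.comp_apply, Equiv.swap_apply_left] at h1
      exact hrne h1.symm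
    have hPs : ∀ r' : Tableau q d n, r'.1 = r.1 ∘ Equiv.swap i j ↔ r' = s := fun r' =>
      ⟨fun h => Subtype.ext h, fun h => by rw [h]⟩
    constructor
    · simp only [hE]
      rw [sum_ite_smul (fun r' : Tableau q d n => r'.1 = r.1 ∘ Equiv.swap i j) V _ _ r s hsr hPs,
        hmul, hVs]
    · intro r' hr'
      rw [hE] at hr'
      split_ifs at hr' with h1 h2
      · rw [h1]
      · rw [(hPs r').1 h2, hclss]
      · exact absurd rfl hr'
  -- For adjacent contents the off-diagonal coefficient vanishes, whether or not the exchanged word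
  -- is a tableau.
  · have h0 : exchangeCoeff q c x = 0 := by
      refine HasParameters.exchangeCoeff_eq_zero h hp ?_
      by_contra hcon
      push Not at hcon
      exact hfar ⟨hcx, hcon⟩
    rw [h0] at hmul hE
    simp only [Complex.ofReal_zero, ite_self] at hE
    constructor
    · simp only [hE]
      rw [hmul]
      simp only [ite_smul, zero_smul, Finset.sum_ite_eq', Finset.mem_univ, if_true]
      simp
    · intro r' hr'
      rw [hE] at hr'
      split_ifs at hr' with h1
      · rw [h1]
      · exact absurd rfl hr'

/-- The product `g ρ(g) ⋯ ρ^(m-1)(g)`. -/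
def shift (ρ : A →⋆ₐ[ℂ] A) (g : A) : ℕ → A
  | 0 => 1
  | m + 1 => g * ρ (shift ρ g m)

/-- The image of the half twist. -/
def halfTwist (ρ : A →⋆ₐ[ℂ] A) (g : A) : ℕ → A
  | 0 => 1
  | m + 1 => ρ (halfTwist ρ g m) * shift ρ g (m + 1)

lemma shift_succ (ρ : A →⋆ₐ[ℂ] A) (g : A) (m : ℕ) :
    shift ρ g (m + 1) = shift ρ g m * (⇑ρ)^[m] g := by
  induction m with
  | zero => simp [shift]
  | succ m ih =>
    have h1 : shift ρ g (m + 1 + 1) = g * ρ (shift ρ g m * (⇑ρ)^[m] g) := by rw [← ih]; rfl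
    rw [h1, map_mul, ← mul_assoc, Function.iterate_succ_apply']; rfl

lemma shift_mem_orbitAlg (ρ : A →⋆ₐ[ℂ] A) (g : A) (m : ℕ) : shift ρ g m ∈ orbitAlg ρ g m := by
  induction m with
  | zero => exact one_mem _
  | succ m ih => exact mul_mem (self_mem_orbitAlg _ _) (map_mem_orbitAlg ih)

lemma shift_mul_iterate (h : HeckeEndo A ρ φ e t η) (m : ℕ) : ∀ k < m,
    shift ρ (heckeGen e t) (m + 1) * (⇑ρ)^[k] (heckeGen e t) =
      ρ ((⇑ρ)^[k] (heckeGen e t)) * shift ρ (heckeGen e t) (m + 1) := by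
  induction m with
  | zero => intro k hk; omega
  | succ m ih =>
    intro k hk
    rcases k with - | k
    · have h1 := (h.heckeGen_comm (shift ρ (heckeGen e t) m)).eq
      have h2 := h.heckeGen_braid
      have h3 : shift ρ (heckeGen e t) (m + 1 + 1) =
          heckeGen e t * (ρ (heckeGen e t) * ρ (ρ (shift ρ (heckeGen e t) m))) := by
        rw [← map_mul]; rfl
      rw [Function.iterate_zero, id, h3]
      generalize heckeGen e t = g at *
      rw [mul_assoc, mul_assoc, ← h1, ← mul_assoc (ρ g) g, ← mul_assoc g, ← mul_assoc g, h2]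
      simp only [mul_assoc]
    · have h1 := congrArg ρ (ih k (by omega))
      have h2 := (h.heckeGen_comm ((⇑ρ)^[k] (heckeGen e t))).eq
      have h3 : shift ρ (heckeGen e t) (m + 1 + 1) =
          heckeGen e t * ρ (shift ρ (heckeGen e t) (m + 1)) := rfl
      rw [map_mul, map_mul] at h1
      rw [Function.iterate_succ_apply', h3, mul_assoc, h1, ← mul_assoc, h2, mul_assoc]

lemma shift_mul (h : HeckeEndo A ρ φ e t η) {m : ℕ} {y : A}
    (hy : y ∈ orbitAlg ρ (heckeGen e t) m) :
    shift ρ (heckeGen e t) (m + 1) * y = ρ y * shift ρ (heckeGen e t) (m + 1) := by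
  induction hy using Algebra.adjoin_induction with
  | mem y hy =>
    obtain ⟨k, hk, rfl⟩ := hy
    exact h.shift_mul_iterate m k hk
  | algebraMap r =>
    rw [Algebra.algebraMap_eq_smul_one, map_smul, map_one, mul_smul_comm, smul_mul_assoc, one_mul,
      mul_one]
  | add x y _ _ hx hy => rw [mul_add, map_add, add_mul, hx, hy]
  | mul x y _ _ hx hy => rw [← mul_assoc, hx, mul_assoc, hy, map_mul, mul_assoc]

/-- The half twist reverses the order of the generators. All but the last generator are first raised
by the shift factor and then reversed inside `ρ` by induction; the last one becomes `g` through the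
identity for the square of the shift. -/
theorem halfTwist_mul (h : HeckeEndo A ρ φ e t η) (m : ℕ) : ∀ k < m,
    halfTwist ρ (heckeGen e t) m * (⇑ρ)^[k] (heckeGen e t) =
      (⇑ρ)^[m - 1 - k] (heckeGen e t) * halfTwist ρ (heckeGen e t) m := by
  induction m with
  | zero => intro k hk; omega
  | succ m ih =>
    intro k hk
    rcases Nat.lt_succ_iff_lt_or_eq.1 hk with hkm | rfl
    · have h1 := congrArg ρ (ih k hkm)
      rw [map_mul, map_mul, ← Function.iterate_succ_apply' ρ (m - 1 - k)] at h1
      rw [halfTwist, mul_assoc, h.shift_mul_iterate m k hkm, ← mul_assoc, h1, mul_assoc,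
        show m + 1 - 1 - k = (m - 1 - k).succ by omega]
    · rcases k with - | m
      · simp [halfTwist, shift]
      · have h1 := h.shift_mul (shift_mem_orbitAlg ρ (heckeGen e t) (m + 1))
        have h2 := shift_succ ρ (heckeGen e t) (m + 1)
        have h3 := (h.heckeGen_comm (halfTwist ρ (heckeGen e t) m)).eq
        have h4 : shift ρ (heckeGen e t) (m + 1 + 1) * shift ρ (heckeGen e t) (m + 1 + 1) =
            ρ (shift ρ (heckeGen e t) (m + 1)) * shift ρ (heckeGen e t) (m + 1 + 1) *
              (⇑ρ)^[m + 1] (heckeGen e t) := by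
          rw [← h1, mul_assoc, ← h2]
        have h5 : shift ρ (heckeGen e t) (m + 1 + 1) =
          heckeGen e t * ρ (shift ρ (heckeGen e t) (m + 1)) := rfl
        rw [show m + 1 + 1 - 1 - (m + 1) = 0 by omega, Function.iterate_zero, id, halfTwist,
          halfTwist, map_mul]
        calc _ = ρ (ρ (halfTwist ρ (heckeGen e t) m)) * (ρ (shift ρ (heckeGen e t) (m + 1)) *
              shift ρ (heckeGen e t) (m + 1 + 1) * (⇑ρ)^[m + 1] (heckeGen e t)) := by
              simp only [mul_assoc]
          _ = (ρ (ρ (halfTwist ρ (heckeGen e t) m)) * heckeGen e t) *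
              (ρ (shift ρ (heckeGen e t) (m + 1)) * shift ρ (heckeGen e t) (m + 1 + 1)) := by
              rw [← h4]; nth_rewrite 1 [h5]; simp only [mul_assoc]
          _ = _ := by rw [← h3]; simp only [mul_assoc]

lemma unitary_iterate (h : HeckeEndo A ρ φ e t η) (k : ℕ) :
    (⇑ρ)^[k] (heckeGen e t) ∈ unitary A := by
  rw [Unitary.mem_iff, ← iterate_map_star, ← iterate_map_mul, ← iterate_map_mul,
    h.star_mul_heckeGen, h.heckeGen_mul_star, ← coe_pow_starAlgHom, map_one, and_self]

lemma halfTwist_mem_unitary (h : HeckeEndo A ρ φ e t η) (m : ℕ) :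
    halfTwist ρ (heckeGen e t) m ∈ unitary A := by
  have hρ : ∀ {x : A}, x ∈ unitary A → ρ x ∈ unitary A := by
    intro x hx
    rw [Unitary.mem_iff] at hx ⊢
    rw [← map_star ρ x, ← map_mul, ← map_mul, hx.1, hx.2, map_one, and_self]
  have hs : ∀ m, shift ρ (heckeGen e t) m ∈ unitary A := by
    intro m
    induction m with
    | zero => exact one_mem _
    | succ m ih => exact mul_mem (h.unitary_iterate 0) (hρ ih)
  induction m with
  | zero => exact one_mem _
  | succ m ih => exact mul_mem (hρ ih) (hs _)

/-- A system of partial isometries which exhibits the multiples of the Ocneanu-Wenzl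
representations. -/
theorem exists_frame (h : HeckeEndo A ρ φ e t η) (hp : HasParameters ρ e t η q d δ) (n : ℕ) :
    ∃ (cls : Tableau q d n → Tableau q d n) (P V : Tableau q d n → A),
      (∀ r, star (P r) = P r ∧ P r * P r = P r ∧ P r ≠ 0) ∧
      (∀ r, star (V r) * V r = P (cls r)) ∧ (∀ r s, r ≠ s → star (V r) * V s = 0) ∧
      ∑ r, V r * star (V r) = 1 ∧
      (∀ (k : Fin (n - 1)) r, (⇑ρ)^[(k : ℕ)] e * V r =
        ∑ r', wenzlProjection q d n k r' r • V r') ∧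
      ∀ (k : Fin (n - 1)) r r', wenzlProjection q d n k r' r ≠ 0 → cls r' = cls r := by
  classical
  -- Tableaux are grouped by what exchanges of nonadjacent contents can reach. One representative
  -- per class is fixed, and `V r` is the isometry leading from it to `r`.
  let S : Setoid (Tableau q d n) :=
    { r := fun r r' => ∃ S, ExchangePath ρ e t q (word q r.1) (word q r'.1) S
      iseqv := ⟨fun r => ⟨_, .refl _⟩, fun ⟨_, hS⟩ => hS.symm_exists,
        fun ⟨_, hS⟩ ⟨_, hT⟩ => hS.trans_exists hT⟩ }
  let cls : Tableau q d n → Tableau q d n := fun r => (Quotient.mk S r).out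
  have hcls1 : ∀ r, ∃ T, ExchangePath ρ e t q (word q (cls r).1) (word q r.1) T := fun r =>
    Quotient.exact (s := S) (Quotient.out_eq (Quotient.mk S r))
  have hcls2 : ∀ r r' T, ExchangePath ρ e t q (word q r.1) (word q r'.1) T → cls r = cls r' := by
    intro r r' T hT
    have : Quotient.mk S r = Quotient.mk S r' := Quotient.sound ⟨T, hT⟩
    change (Quotient.mk S r).out = (Quotient.mk S r').out
    rw [this]
  have hcls3 : ∀ r, cls (cls r) = cls r := fun r => by
    obtain ⟨T, hT⟩ := hcls1 r
    exact hcls2 _ _ _ hT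
  choose V hV using hcls1
  have hframe := fun k r => h.iterate_e_mul_frame hp hV hcls2 hcls3 k r
  have hVV := fun r => (hV r).star_mul_self h hp
  -- Paths list the last box first, so Wenzl's `k`-th projection is realized by `ρ^(n-2-k)(e)`.
  -- Conjugation with the half twist turns this into `ρ^k(e)`.
  set D := halfTwist ρ (heckeGen e t) (n - 1) with hD
  obtain ⟨hD1, hD2⟩ := Unitary.mem_iff.1 (h.halfTwist_mem_unitary (n - 1))
  rw [← hD] at hD1 hD2
  have hsV : ∀ r s, star (star D * V r) * (star D * V s) = star (V r) * V s := fun r s => by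
    rw [star_mul, star_star, mul_assoc, ← mul_assoc D, hD2, one_mul]
  refine ⟨cls, fun r => pathProj ρ e t (word q r.1), fun r => star D * V r, fun r => ?_, fun r => ?_,
    fun r s hrs => ?_, ?_, fun k r => ?_, fun k r r' hr => (hframe k r).2 r' hr⟩
  · exact ⟨(h.pathProj_star_idem _).1, (h.pathProj_star_idem _).2,
      h.pathProj_ne_zero hp (legal_word hp.two_le hp.add_two_le hp.isPeriod.ne_one r)⟩
  · rw [hsV, (hVV r).1]
  · rw [hsV]
    have h1 : ∀ r, pathProj ρ e t (word q r.1) * V r = V r := fun r => by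
      have := (hV r).intertwines h
      rw [this.1.comm, this.2]
    have h2 : star (V r) = star (V r) * pathProj ρ e t (word q r.1) := by
      conv_lhs => rw [← h1 r, star_mul, (h.pathProj_star_idem _).1]
    rw [h2, ← h1 s, mul_assoc, ← mul_assoc (pathProj ρ e t _), h.pathProj_orthogonal hp.isPeriod
      (by rw [length_word, length_word]) fun heq => hrs (Subtype.ext (word_injective hp.add_two_le
        r.2 s.2 heq)), zero_mul, mul_zero]
  · have h1 : ∀ r, star D * V r * star (star D * V r) =
        star D * pathProj ρ e t (word q r.1) * D := fun r => by
      rw [star_mul, star_star, mul_assoc, ← mul_assoc (V r), (hVV r).2, mul_assoc]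
    simp only [h1]
    rw [← Finset.sum_mul, ← Finset.mul_sum, h.sum_pathProj hp, mul_one, hD1]
  · have h1 := h.halfTwist_mul (n - 1) k (by have := k.2; omega)
    rw [show n - 1 - 1 - (k : ℕ) = n - 2 - k by omega, ← hD] at h1
    have h2 : ∀ m, (⇑ρ)^[m] (heckeGen e t) = t • 1 - (1 + t) • (⇑ρ)^[m] e := fun m => by
      rw [← coe_pow_starAlgHom, heckeGen, map_sub, map_smul, map_smul, map_one]
    rw [h2, h2, mul_sub, sub_mul, mul_smul_comm, mul_smul_comm, smul_mul_assoc, smul_mul_assoc,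
      mul_one, one_mul, sub_right_inj] at h1
    have h3 := smul_right_injective A h.t_ne h1
    have h4 : (⇑ρ)^[(k : ℕ)] e * star D = star D * (⇑ρ)^[n - 2 - k] e := by
      have h5 : D * (⇑ρ)^[(k : ℕ)] e = (⇑ρ)^[n - 2 - k] e * D := h3
      calc _ = star D * (D * (⇑ρ)^[(k : ℕ)] e) * star D := by
            rw [← mul_assoc, hD1, one_mul]
        _ = _ := by rw [h5, mul_assoc, mul_assoc, hD2, mul_one]
    rw [← mul_assoc, h4, mul_assoc, (hframe k r).1, Finset.mul_sum]
    exact Finset.sum_congr rfl fun r' _ => mul_smul_comm _ _ _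

end HeckeEndo

end HeckeEndomorphism

end LQP

end

/-! ### From a frame of partial isometries to a countable direct sum. -/

noncomputable section

namespace LQP

section HilbertSum

variable {H : Type*} [NormedAddCommGroup H] [InnerProductSpace ℂ H] [CompleteSpace H]

omit [CompleteSpace H] in
lemma exists_orthonormal_seq [TopologicalSpace.SeparableSpace H] (K : Submodule ℂ H)
    [CompleteSpace K] (hK : ¬ FiniteDimensional ℂ K) :
    ∃ b : ℕ → H, Orthonormal ℂ b ∧ (∀ i, b i ∈ K) ∧
      ∀ v ∈ K, (∀ i, inner ℂ (b i) v = 0) → v = 0 := by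
  obtain ⟨w, b, hb⟩ := exists_hilbertBasis ℂ K
  have : SecondCountableTopology H := UniformSpace.secondCountable_of_separable H
  have hcount : Countable w := by
    -- Distinct orthonormal vectors are at distance `√2 ≥ 1`, so in a separable space an orthonormal
    -- set is countable.
    have hd : DiscreteTopology w := by
      refine DiscreteTopology.of_forall_le_dist (r := 1) one_pos fun x y hxy => ?_
      have h1 := b.orthonormal.1 x
      have h2 := b.orthonormal.1 y
      have h3 := b.orthonormal.2 hxy
      rw [hb] at h1 h2 h3
      change 1 ≤ dist x y
      rw [Subtype.dist_eq, dist_eq_norm]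
      have h4 := norm_sub_sq (𝕜 := ℂ) (x : K) (y : K)
      rw [h1, h2, h3] at h4
      simp only [map_zero, mul_zero, sub_zero] at h4
      nlinarith [norm_nonneg ((x : K) - (y : K))]
    exact countable_of_Lindelof_of_discrete
  have hinf : Infinite w := by
    by_contra hfin
    rw [not_infinite_iff_finite] at hfin
    have := Fintype.ofFinite w
    exact hK b.toOrthonormalBasis.toBasis.finiteDimensional_of_finite
  obtain ⟨e⟩ : Nonempty (ℕ ≃ w) := by
    obtain ⟨h⟩ := nonempty_denumerable w
    exact ⟨(Denumerable.eqv w).symm⟩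
  refine ⟨fun i => (b (e i) : H), ?_, fun i => (b (e i)).2, fun v hv hv0 => ?_⟩
  · have h1 := (b.orthonormal.comp e e.injective).comp_linearIsometry K.subtypeₗᵢ
    exact h1
  · have h1 : b.repr ⟨v, hv⟩ = 0 := by
      ext j
      rw [b.repr_apply_apply]
      have h2 : inner ℂ ((b (e (e.symm j)) : K) : H) v = 0 := hv0 (e.symm j)
      rw [Equiv.apply_symm_apply] at h2
      exact h2
    have h2 := b.repr.map_eq_zero_iff.1 h1
    exact congrArg Subtype.val h2

variable {ι : Type*} [Fintype ι] [DecidableEq ι]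

lemma toEuclideanCLM_apply (E : Matrix ι ι ℂ) (x : EuclideanSpace ℂ ι) (r : ι) :
    (Matrix.toEuclideanCLM (𝕜 := ℂ) E x) r = ∑ s, E r s * x s := rfl

theorem exists_hilbertSum [TopologicalSpace.SeparableSpace H] (cls : ι → ι) (P V : ι → H →L[ℂ] H)
    (hP : ∀ r, star (P r) = P r ∧ P r * P r = P r)
    (hPinf : ∀ r, ¬ FiniteDimensional ℂ (LinearMap.range (P r : H →ₗ[ℂ] H)))
    (hV : ∀ r, star (V r) * V r = P (cls r)) (hV0 : ∀ r s, r ≠ s → star (V r) * V s = 0)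
    (hsum : ∑ r, V r * star (V r) = 1) :
    ∃ W : ℕ → EuclideanSpace ℂ ι →ₗᵢ[ℂ] H,
      IsHilbertSum ℂ (fun _ : ℕ => EuclideanSpace ℂ ι) W ∧
      ∀ (E : Matrix ι ι ℂ) (T : H →L[ℂ] H), (∀ r, T * V r = ∑ r', E r' r • V r') →
        (∀ r r', E r' r ≠ 0 → cls r' = cls r) →
        ∀ i x, T (W i x) = W i (Matrix.toEuclideanCLM (𝕜 := ℂ) E x) := by
  have hmem : ∀ r v, v ∈ LinearMap.range (P r : H →ₗ[ℂ] H) ↔ P r v = v := by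
    intro r v
    constructor
    · rintro ⟨u, rfl⟩
      exact congrArg (fun T : H →L[ℂ] H => T u) (hP r).2
    · intro h; exact ⟨v, h⟩
  have hclosed : ∀ r, IsClosed (LinearMap.range (P r : H →ₗ[ℂ] H) : Set H) := by
    intro r
    have : (LinearMap.range (P r : H →ₗ[ℂ] H) : Set H) = {v | P r v = v} := by
      ext v; exact hmem r v
    rw [this]
    exact isClosed_eq (P r).continuous continuous_id
  have hb : ∀ r, ∃ b : ℕ → H, Orthonormal ℂ b ∧
      (∀ i, b i ∈ LinearMap.range (P r : H →ₗ[ℂ] H)) ∧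
      ∀ v ∈ LinearMap.range (P r : H →ₗ[ℂ] H), (∀ i, inner ℂ (b i) v = 0) → v = 0 := by
    intro r
    have := (hclosed r).completeSpace_coe
    exact exists_orthonormal_seq _ (hPinf r)
  choose b hb1 hb2 hb3 using hb
  -- All `V r` of one class transport the same basis. An operator that only mixes indices of one
  -- class therefore preserves the label `i`, and each `i` gives one copy of the representation.
  set f : ℕ → ι → H := fun i r => V r (b (cls r) i) with hf
  have hadj : ∀ r s u v, inner ℂ (V r u) (V s v) = inner ℂ u ((star (V r) * V s) v) := by
    intro r s u v
    exact (ContinuousLinearMap.adjoint_inner_right (V r) u (V s v)).symm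
  have hff : ∀ i j r s, inner ℂ (f i r) (f j s) = if r = s then if i = j then (1 : ℂ) else 0 else 0 := by
    intro i j r s
    rw [hf, hadj]
    split_ifs with h1 h2
    · subst h1 h2
      rw [hV, (hmem _ _).1 (hb2 _ i), inner_self_eq_norm_sq_to_K, (hb1 _).1]; simp
    · subst h1
      rw [hV, (hmem _ _).1 (hb2 _ j)]
      exact (hb1 _).2 h2
    · rw [hV0 r s h1]; simp
  let L : ℕ → EuclideanSpace ℂ ι →ₗ[ℂ] H := fun i =>
    { toFun := fun x => ∑ r, x r • f i r
      map_add' := fun x y => by simp [add_smul, Finset.sum_add_distrib]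
      map_smul' := fun c x => by simp [Finset.smul_sum, mul_smul] }
  have hL : ∀ i x, L i x = ∑ r, x r • f i r := fun _ _ => rfl
  have hLL : ∀ i j x y, inner ℂ (L i x) (L j y) = if i = j then inner ℂ x y else (0 : ℂ) := by
    intro i j x y
    rw [hL, hL, sum_inner]
    simp only [inner_sum, inner_smul_left, inner_smul_right, hff]
    split_ifs with h
    · simp [PiLp.inner_apply, mul_comm]
    · simp
  let W : ℕ → EuclideanSpace ℂ ι →ₗᵢ[ℂ] H := fun i => (L i).isometryOfInner fun x y => by
    rw [hLL, if_pos rfl]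
  have hW : ∀ i x, W i x = ∑ r, x r • f i r := fun _ _ => rfl
  refine ⟨W, ?_, ?_⟩
  · refine IsHilbertSum.mk (fun i j hij x y => ?_) ?_
    · exact (hLL i j x y).trans (if_neg hij)
    · rw [top_le_iff, Submodule.topologicalClosure_eq_top_iff, eq_bot_iff]
      intro ψ hψ
      have h1 : ∀ i r, inner ℂ (f i r) ψ = 0 := by
        intro i r
        refine (Submodule.mem_orthogonal _ _).1 hψ _ ?_
        refine Submodule.mem_iSup_of_mem i ⟨EuclideanSpace.single r 1, ?_⟩
        change W i _ = _
        rw [hW, Finset.sum_eq_single r] <;> simp +contextual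
      -- `V_r⋆ ψ` lies in the range of `P (cls r)` and is orthogonal to its basis. When all of these
      -- vanish, `∑ V_r V_r⋆ = 1` gives `ψ = 0`.
      have h2 : ∀ r, star (V r) ψ = 0 := by
        intro r
        refine hb3 (cls r) _ ((hmem _ _).2 ?_) fun i => ?_
        · have h3 : V r * P (cls r) = V r := by
            have h4 : star (V r * (1 - P (cls r))) * (V r * (1 - P (cls r))) = 0 := by
              rw [star_mul, mul_assoc, ← mul_assoc (star (V r)), hV, mul_sub, mul_one, (hP _).2,
                sub_self, mul_zero]
            rw [CStarRing.star_mul_self_eq_zero_iff, mul_sub, mul_one, sub_eq_zero] at h4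
            exact h4.symm
          have h4 := congrArg star h3
          rw [star_mul, (hP _).1] at h4
          exact congrArg (fun T : H →L[ℂ] H => T ψ) h4
        · have h3 := ContinuousLinearMap.adjoint_inner_right (V r) (b (cls r) i) ψ
          exact h3.trans (h1 i r)
      have h3 := congrArg (fun T : H →L[ℂ] H => T ψ) hsum
      simp only [sum_apply, mul_apply_eq_comp, h2, map_zero,
        Finset.sum_const_zero, one_apply_eq_self] at h3
      exact h3.symm
  · intro E T hT hE i x
    rw [hW, hW, map_sum]
    have h1 : ∀ r, T (f i r) = ∑ r', E r' r • f i r' := by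
      intro r
      have h2 := congrArg (fun S : H →L[ℂ] H => S (b (cls r) i)) (hT r)
      simp only [mul_apply_eq_comp, sum_apply, smul_apply] at h2
      refine h2.trans (Finset.sum_congr rfl fun r' _ => ?_)
      by_cases h0 : E r' r = 0
      · rw [h0, zero_smul, zero_smul]
      · change _ = E r' r • V r' (b (cls r') i)
        rw [hE r r' h0]
    simp only [map_smul, h1, Finset.smul_sum, toEuclideanCLM_apply, Finset.sum_smul]
    rw [Finset.sum_comm]
    refine Finset.sum_congr rfl fun r _ => Finset.sum_congr rfl fun r' _ => ?_
    rw [smul_smul, mul_comm]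

end HilbertSum

/-! ### Representations of the braid groups. -/

section Braids

variable {n : ℕ}

lemma exists_braidHom {G : Type*} [Group G] (u : Fin (n - 1) → G)
    (h₁ : ∀ i j : Fin (n - 1), (j : ℕ) = i + 1 → u i * u j * u i = u j * u i * u j)
    (h₂ : ∀ i j : Fin (n - 1), (i : ℕ) + 2 ≤ j → u i * u j = u j * u i) :
    ∃ f : BraidGroup n →* G, ∀ k, f (braidGen n k) = u k := by
  refine ⟨PresentedGroup.toGroup (f := u) ?_, fun k => PresentedGroup.toGroup.of _⟩
  rintro r ⟨i, j, ⟨h, rfl⟩ | ⟨h, rfl⟩⟩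
  · simp only [map_mul, map_inv, FreeGroup.lift_apply_of]
    rw [h₁ i j h, mul_inv_cancel]
  · simp only [map_mul, map_inv, FreeGroup.lift_apply_of]
    rw [h₂ i j h, mul_inv_cancel]

lemma braidGroup_induction {p : BraidGroup n → Prop} (hgen : ∀ k, p (braidGen n k)) (hone : p 1)
    (hmul : ∀ a b, p a → p b → p (a * b)) (hinv : ∀ a, p a → p a⁻¹) (b : BraidGroup n) : p b := by
  have h1 : b ∈ Subgroup.closure (Set.range (PresentedGroup.of (rels := braidRelations n))) := by
    rw [PresentedGroup.closure_range_of]; trivial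
  induction h1 using Subgroup.closure_induction with
  | mem x hx => obtain ⟨k, rfl⟩ := hx; exact hgen k
  | one => exact hone
  | mul a b _ _ ha hb => exact hmul a b ha hb
  | inv a _ ha => exact hinv a ha

variable {H : Type*} [NormedAddCommGroup H] [InnerProductSpace ℂ H] [CompleteSpace H]
  {ι : Type*} [Fintype ι] [DecidableEq ι]

lemma isInfiniteMultiple_of_isHilbertSum {W : ℕ → EuclideanSpace ℂ ι →ₗᵢ[ℂ] H}
    (hW : IsHilbertSum ℂ (fun _ : ℕ => EuclideanSpace ℂ ι) W)
    (β : BraidGroup n →* unitary (H →L[ℂ] H)) (χ : BraidGroup n →* Circle)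
    (π : BraidGroup n →* Matrix.unitaryGroup ι ℂ)
    (h : ∀ k i x, (β (braidGen n k) : H →L[ℂ] H) (W i x) = (χ (braidGen n k) : ℂ) •
      W i (Matrix.toEuclideanCLM (𝕜 := ℂ) (π (braidGen n k) : Matrix ι ι ℂ) x)) :
    IsInfiniteMultiple (fun b => (β b : H →L[ℂ] H)) χ π := by
  set M : BraidGroup n → EuclideanSpace ℂ ι → EuclideanSpace ℂ ι := fun b x =>
    (χ b : ℂ) • Matrix.toEuclideanCLM (𝕜 := ℂ) (π b : Matrix ι ι ℂ) x with hM
  have hM1 : ∀ x, M 1 x = x := fun x => by simp [hM]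
  have hMmul : ∀ a b x, M (a * b) x = M a (M b x) := fun a b x => by
    simp [hM, map_smul, smul_smul]
  have hβ : ∀ b i x, (β b : H →L[ℂ] H) (W i x) = W i (M b x) := by
    intro b
    induction b using braidGroup_induction with
    | hgen k => intro i x; rw [h, hM, map_smul]
    | hone => intro i x; rw [hM1, map_one]; rfl
    | hmul a b ha hb => intro i x; rw [hMmul, ← ha, ← hb, map_mul]; rfl
    | hinv a ha =>
      intro i x
      have h1 : x = M a (M a⁻¹ x) := by rw [← hMmul, mul_inv_cancel, hM1]
      conv_lhs => rw [h1, ← ha]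
      have h2 : (β a⁻¹ : H →L[ℂ] H) * (β a : H →L[ℂ] H) = 1 := by
        rw [← Submonoid.coe_mul, ← map_mul, inv_mul_cancel, map_one]; rfl
      exact congrArg (fun T : H →L[ℂ] H => T (W i (M a⁻¹ x))) h2
  have hinner : ∀ b (u v : H), inner ℂ ((β b : H →L[ℂ] H) u) ((β b : H →L[ℂ] H) v) =
      inner ℂ u v := by
    intro b u v
    rw [← ContinuousLinearMap.adjoint_inner_right]
    exact congrArg (fun T : H →L[ℂ] H => inner ℂ u (T v)) (Unitary.mem_iff.1 (β b).2).1
  have hMinner : ∀ b x y, inner ℂ (M b⁻¹ x) y = inner ℂ x (M b y) := by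
    intro b x y
    rw [← (W 0).inner_map_map, ← (W 0).inner_map_map, ← hinner b, hβ, hβ, ← hMmul,
      mul_inv_cancel, hM1]
  have hcoord : ∀ ψ i x, inner ℂ x (hW.linearIsometryEquiv ψ i) = inner ℂ (W i x) ψ := by
    intro ψ i x
    rw [← hW.linearIsometryEquiv_symm_apply_single, ← hW.linearIsometryEquiv.inner_map_map,
      LinearIsometryEquiv.apply_symm_apply, lp.inner_single_left]
  refine ⟨hW.linearIsometryEquiv, fun b ψ i => ext_inner_left ℂ fun x => ?_⟩
  change _ = inner ℂ x (M b _)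
  rw [hcoord, ← hMinner, hcoord, ← hinner b (W i (M b⁻¹ x)) ψ, hβ, ← hMmul,
    mul_inv_cancel, hM1]

lemma mem_unitaryGroup_of_norm {X : Matrix ι ι ℂ}
    (h : ∀ x, ‖Matrix.toEuclideanCLM (𝕜 := ℂ) X x‖ = ‖x‖) : X ∈ Matrix.unitaryGroup ι ℂ := by
  rw [Matrix.mem_unitaryGroup_iff']
  have h1 := (ContinuousLinearMap.norm_map_iff_adjoint_comp_self _).1 h
  refine EquivLike.injective (Matrix.toEuclideanCLM (n := ι) (𝕜 := ℂ)) ?_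
  rw [map_mul, map_star, map_one]
  exact h1

/-- Wenzl's matrices inherit unitarity and the braid relations from the operators `u k` through the
isometry `W`, so no computation with matrix entries is needed. -/
theorem exists_isOcneanuWenzl {q d : ℕ∞} {t : ℂ} (W : EuclideanSpace ℂ (Tableau q d n) →ₗᵢ[ℂ] H)
    (u : Fin (n - 1) → unitary (H →L[ℂ] H))
    (h₁ : ∀ i j : Fin (n - 1), (j : ℕ) = i + 1 → u i * u j * u i = u j * u i * u j)
    (h₂ : ∀ i j : Fin (n - 1), (i : ℕ) + 2 ≤ j → u i * u j = u j * u i)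
    (hu : ∀ k x, (u k : H →L[ℂ] H) (W x) =
      W (Matrix.toEuclideanCLM (𝕜 := ℂ) (ocneanuWenzlGen q d t n k) x)) :
    ∃ π : BraidGroup n →* Matrix.unitaryGroup (Tableau q d n) ℂ, IsOcneanuWenzl q d t n π := by
  have hmem : ∀ k, ocneanuWenzlGen q d t n k ∈ Matrix.unitaryGroup (Tableau q d n) ℂ := by
    intro k
    refine mem_unitaryGroup_of_norm fun x => ?_
    rw [← W.norm_map, ← hu, ← W.norm_map x]
    have h1 := (ContinuousLinearMap.norm_map_iff_adjoint_comp_self (u k : H →L[ℂ] H)).2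
      (Unitary.mem_iff.1 (u k).2).1
    exact h1 _
  have hext : ∀ X Y : Matrix (Tableau q d n) (Tableau q d n) ℂ,
      (∀ x, W (Matrix.toEuclideanCLM (𝕜 := ℂ) X x) = W (Matrix.toEuclideanCLM (𝕜 := ℂ) Y x)) →
        X = Y := by
    intro X Y hXY
    refine EquivLike.injective (Matrix.toEuclideanCLM (𝕜 := ℂ)) (ContinuousLinearMap.ext fun x => ?_)
    exact W.injective (hXY x)
  let w : Fin (n - 1) → Matrix.unitaryGroup (Tableau q d n) ℂ := fun k => ⟨_, hmem k⟩
  have hw : ∀ k x, W (Matrix.toEuclideanCLM (𝕜 := ℂ) (ocneanuWenzlGen q d t n k) x) =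
      (u k : H →L[ℂ] H) (W x) := fun k x => (hu k x).symm
  obtain ⟨π, hπ⟩ : ∃ f : BraidGroup n →* Matrix.unitaryGroup (Tableau q d n) ℂ,
      ∀ k, f (braidGen n k) = w k := by
    apply exists_braidHom
    · intro i j hij
      refine Subtype.ext (hext _ _ fun x => ?_)
      simp only [w, Submonoid.coe_mul, map_mul, mul_apply_eq_comp, hw]
      exact congrArg (fun T : unitary (H →L[ℂ] H) => (T : H →L[ℂ] H) (W x)) (h₁ i j hij)
    · intro i j hij
      refine Subtype.ext (hext _ _ fun x => ?_)
      simp only [w, Submonoid.coe_mul, map_mul, mul_apply_eq_comp, hw]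
      exact congrArg (fun T : unitary (H →L[ℂ] H) => (T : H →L[ℂ] H) (W x)) (h₂ i j hij)
  exact ⟨π, fun k => by rw [hπ]⟩

end Braids

end LQP

end

/-! ### The braid group representations generated by `ρ` and the Markov trace. -/

noncomputable section

namespace LQP

section Assembly

variable {H : Type*} [NormedAddCommGroup H] [InnerProductSpace ℂ H] [CompleteSpace H]
  {A : StarSubalgebra ℂ (H →L[ℂ] H)} {ρ : A →⋆ₐ[ℂ] A} {φ : A →ₗ[ℂ] A} {e : A} {t c : ℂ} {η : ℝ}
  {q d : ℕ∞} {δ : ℝ} {n : ℕ}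

namespace HeckeEndo

lemma iterate_smul (k : ℕ) (c : ℂ) (x : A) : (⇑ρ)^[k] (c • x) = c • (⇑ρ)^[k] x := by
  rw [← coe_pow_starAlgHom, map_smul]

lemma unitary_iterate_smul (h : HeckeEndo A ρ φ e t η) (hc : ‖c‖ = 1) (k : ℕ) :
    (⇑ρ)^[k] (c • heckeGen e t) ∈ unitary A := by
  have hu := Unitary.mem_iff.1 (h.unitary_iterate k)
  have h1 : star c * c = 1 := by rw [Complex.star_def, Complex.conj_mul', hc]; simp
  rw [iterate_smul, Unitary.mem_iff, star_smul, smul_mul_smul_comm, smul_mul_smul_comm, hu.1, hu.2,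
    mul_comm c, h1, one_smul, and_self]

lemma iterate_heckeGen_braid (h : HeckeEndo A ρ φ e t η) (c : ℂ) (k : ℕ) :
    (⇑ρ)^[k] (c • heckeGen e t) * (⇑ρ)^[k + 1] (c • heckeGen e t) * (⇑ρ)^[k] (c • heckeGen e t) =
      (⇑ρ)^[k + 1] (c • heckeGen e t) * (⇑ρ)^[k] (c • heckeGen e t) *
        (⇑ρ)^[k + 1] (c • heckeGen e t) := by
  simp only [Function.iterate_succ_apply]
  rw [← iterate_map_mul, ← iterate_map_mul, ← iterate_map_mul, ← iterate_map_mul, map_smul]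
  simp only [smul_mul_smul_comm]
  rw [h.heckeGen_braid]

lemma iterate_heckeGen_comm (h : HeckeEndo A ρ φ e t η) (c : ℂ) {i j : ℕ} (hij : i + 2 ≤ j) :
    (⇑ρ)^[i] (c • heckeGen e t) * (⇑ρ)^[j] (c • heckeGen e t) =
      (⇑ρ)^[j] (c • heckeGen e t) * (⇑ρ)^[i] (c • heckeGen e t) := by
  obtain ⟨l, rfl⟩ := Nat.exists_eq_add_of_le hij
  rw [add_assoc, Function.iterate_add_apply, add_comm 2 l, Function.iterate_succ_apply',
    Function.iterate_succ_apply', ← iterate_map_mul, ← iterate_map_mul,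
    ((h.heckeGen_comm _).smul_left c).eq]

lemma exists_braidHom (h : HeckeEndo A ρ φ e t η) (hc : ‖c‖ = 1) (n : ℕ) :
    ∃ β : BraidGroup n →* unitary A,
      ∀ k, (β (braidGen n k) : A) = (⇑ρ)^[(k : ℕ)] (c • heckeGen e t) := by
  obtain ⟨β, hβ⟩ := LQP.exists_braidHom (n := n)
    (fun k => (⟨_, h.unitary_iterate_smul hc k⟩ : unitary A))
    (fun i j hij => Subtype.ext (by
      simp only [Submonoid.coe_mul, hij]; exact h.iterate_heckeGen_braid c i))
    (fun i j hij => Subtype.ext (h.iterate_heckeGen_comm c hij))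
  exact ⟨β, fun k => by rw [hβ]⟩

lemma mem_orbitAlg_of_braidHom (h : HeckeEndo A ρ φ e t η) {β : BraidGroup n →* unitary A}
    (hβ : ∀ k, (β (braidGen n k) : A) = (⇑ρ)^[(k : ℕ)] (c • heckeGen e t)) (b : BraidGroup n) :
    (β b : A) ∈ orbitAlg ρ (heckeGen e t) (n - 1) := by
  induction b using braidGroup_induction with
  | hgen k =>
    rw [hβ, iterate_smul]
    exact Subalgebra.smul_mem _ (iterate_mem_orbitAlg k.2) c
  | hone => rw [map_one]; exact one_mem _
  | hmul a b ha hb => rw [map_mul]; exact mul_mem ha hb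
  | hinv a ha => rw [map_inv]; exact h.star_mem_orbitAlg ha

theorem exists_isInfiniteMultiple [TopologicalSpace.SeparableSpace H] (h : HeckeEndo A ρ φ e t η)
    (hp : HasParameters ρ e t η q d δ) (hc : ‖c‖ = 1) {β : BraidGroup n →* unitary A}
    (hβ : ∀ k, (β (braidGen n k) : A) = (⇑ρ)^[(k : ℕ)] (c • heckeGen e t)) :
    ∃ (χ : BraidGroup n →* Circle) (π : BraidGroup n →* Matrix.unitaryGroup (Tableau q d n) ℂ),
      (∀ k : Fin (n - 1), (χ (braidGen n k) : ℂ) = c) ∧ IsOcneanuWenzl q d t n π ∧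
      IsInfiniteMultiple (fun b => ((β b : A) : H →L[ℂ] H)) χ π := by
  obtain ⟨cls, P, V, hP, hV, hV0, hsum, hE, hcls⟩ := h.exists_frame hp n
  obtain ⟨W, hW, hWE⟩ := exists_hilbertSum cls (fun r => (P r : H →L[ℂ] H))
    (fun r => (V r : H →L[ℂ] H))
    (fun r => ⟨congrArg Subtype.val (hP r).1, congrArg Subtype.val (hP r).2.1⟩)
    (fun r => h.infinite _ (hP r).2.2) (fun r => congrArg Subtype.val (hV r))
    (fun r s hrs => congrArg Subtype.val (hV0 r s hrs))
    (by simpa using congrArg A.subtype hsum)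
  have hWe : ∀ (k : Fin (n - 1)) i x, (((⇑ρ)^[(k : ℕ)] e : A) : H →L[ℂ] H) (W i x) =
      W i (Matrix.toEuclideanCLM (𝕜 := ℂ) (wenzlProjection q d n k) x) := by
    intro k
    refine hWE _ _ (fun r => ?_) fun r r' => hcls k r r'
    simpa using congrArg A.subtype (hE k r)
  have hWg : ∀ (k : Fin (n - 1)) i x,
      (((⇑ρ)^[(k : ℕ)] (heckeGen e t) : A) : H →L[ℂ] H) (W i x) =
        W i (Matrix.toEuclideanCLM (𝕜 := ℂ) (ocneanuWenzlGen q d t n k) x) := by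
    intro k i x
    have h1 : (⇑ρ)^[(k : ℕ)] (heckeGen e t) = t • 1 - (1 + t) • (⇑ρ)^[(k : ℕ)] e := by
      rw [heckeGen, ← coe_pow_starAlgHom, map_sub, map_smul, map_smul, map_one]
    rw [h1, ocneanuWenzlGen, map_sub, map_smul, map_smul, map_one]
    change t • W i x - (1 + t) • (((⇑ρ)^[(k : ℕ)] e : A) : H →L[ℂ] H) (W i x) = _
    rw [hWe, sub_apply, smul_apply, smul_apply, one_apply_eq_self, map_sub, map_smul, map_smul]
  have hmem : ∀ k : Fin (n - 1), (((⇑ρ)^[(k : ℕ)] (heckeGen e t) : A) : H →L[ℂ] H) ∈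
      unitary (H →L[ℂ] H) := by
    intro k
    have hu := Unitary.mem_iff.1 (h.unitary_iterate (k : ℕ))
    exact Unitary.mem_iff.2 ⟨congrArg Subtype.val hu.1, congrArg Subtype.val hu.2⟩
  obtain ⟨π, hπ⟩ := exists_isOcneanuWenzl (q := q) (d := d) (t := t) (W 0)
    (fun k => ⟨_, hmem k⟩)
    (fun i j hij => Subtype.ext (by
      have h1 := congrArg Subtype.val (h.iterate_heckeGen_braid 1 i)
      simp only [one_smul, ← hij] at h1
      exact h1))
    (fun i j hij => Subtype.ext (by
      have h1 := congrArg Subtype.val (h.iterate_heckeGen_comm 1 hij)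
      simp only [one_smul] at h1
      exact h1))
    (fun k x => hWg k 0 x)
  let c' : Circle := ⟨c, mem_sphere_zero_iff_norm.2 hc⟩
  obtain ⟨χ, hχ⟩ := LQP.exists_braidHom (n := n) (fun _ => c') (fun _ _ _ => rfl) fun _ _ _ => rfl
  have hχ' : ∀ k : Fin (n - 1), (χ (braidGen n k) : ℂ) = c := fun k => congrArg Subtype.val (hχ k)
  let B : BraidGroup n →* unitary (H →L[ℂ] H) :=
    { toFun := fun b => ⟨((β b : A) : H →L[ℂ] H), by
        have hu := Unitary.mem_iff.1 (β b).2
        exact Unitary.mem_iff.2 ⟨congrArg Subtype.val hu.1, congrArg Subtype.val hu.2⟩⟩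
      map_one' := by simp only [map_one]; rfl
      map_mul' := fun a b => by simp only [map_mul]; rfl }
  refine ⟨χ, π, hχ', hπ, isInfiniteMultiple_of_isHilbertSum hW B χ π fun k i x => ?_⟩
  rw [hχ', hπ k, ← hWg]
  change ((β (braidGen n k) : A) : H →L[ℂ] H) (W i x) = _
  rw [hβ, iterate_smul]
  rfl

lemma φ_iterate_mul_iterate (h : HeckeEndo A ρ φ e t η) (k : ℕ) (x y : A) :
    (⇑φ)^[k] (x * (⇑ρ)^[k] y) = (⇑φ)^[k] x * y := by
  induction k generalizing x with
  | zero => rfl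
  | succ k ih =>
    rw [Function.iterate_succ_apply' ρ, Function.iterate_succ_apply, h.φ_mul_ρ, ih,
      Function.iterate_succ_apply]

/-- The map `φ^k` already makes `x` scalar, and by the bimodule property it also strips `ρ^k` from
the last generator. One more `φ` produces the statistics parameter. -/
lemma φ_iterate_markov (h : HeckeEndo A ρ φ e t η) (c : ℂ) {k : ℕ} {a : ℂ} {x : A}
    (ha : (⇑φ)^[k] x = a • 1) :
    (⇑φ)^[k + 2] (x * (⇑ρ)^[k] (c • heckeGen e t)) =
      (c * (t - (1 + t) * η)) • (⇑φ)^[k + 1] x := by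
  rw [Function.iterate_succ_apply', Function.iterate_succ_apply', Function.iterate_succ_apply',
    h.φ_iterate_mul_iterate, ha, smul_mul_assoc, one_mul]
  simp only [map_smul, h.φ_one, h.φ_heckeGen, smul_smul]
  congr 1; ring

lemma φ_iterate_one (h : HeckeEndo A ρ φ e t η) (k : ℕ) : (⇑φ)^[k] 1 = 1 :=
  Function.iterate_fixed h.φ_one k

lemma φ_iterate_pos (h : HeckeEndo A ρ φ e t η) (k : ℕ) {x : A}
    (hx : (x : H →L[ℂ] H).IsPositive) : (((⇑φ)^[k] x : A) : H →L[ℂ] H).IsPositive := by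
  induction k generalizing x with
  | zero => exact hx
  | succ k ih => exact ih (h.φ_pos _ hx)

lemma smul_one_injective (h : HeckeEndo A ρ φ e t η) {a b : ℂ} (hab : a • (1 : A) = b • 1) :
    a = b := by
  have := h.nontriv
  exact smul_left_injective ℂ h.one_ne_zero' hab

open scoped ComplexOrder in
lemma coeff_of_isPositive (h : HeckeEndo A ρ φ e t η) {a : ℂ}
    (ha : ((a • 1 : A) : H →L[ℂ] H).IsPositive) : ∃ r : ℝ, 0 ≤ r ∧ (a : ℂ) = r := by
  have := h.nontriv
  obtain ⟨v, hv⟩ := exists_norm_eq H (zero_le_one (α := ℝ))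
  have h1 : 0 ≤ inner ℂ v (((a • 1 : A) : H →L[ℂ] H) v) := ha.inner_nonneg_right v
  have h2 : inner ℂ v (((a • 1 : A) : H →L[ℂ] H) v) = a := by
    change inner ℂ v (a • v) = a
    rw [inner_smul_right, inner_self_eq_norm_sq_to_K, hv]
    simp
  rw [h2] at h1
  obtain ⟨h3, h4⟩ := Complex.nonneg_iff.1 h1
  exact ⟨a.re, h3, Complex.ext rfl h4.symm⟩

theorem exists_markovTrace (h : HeckeEndo A ρ φ e t η) (β : ∀ n, BraidGroup n →* unitary A)
    (hβ : ∀ n k, (β n (braidGen n k) : A) = (⇑ρ)^[(k : ℕ)] (c • heckeGen e t)) :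
    ∃ tr : ∀ n : ℕ, BraidGroup n → ℂ, IsMarkovTrace (c * (t - (1 + t) * η)) tr ∧
      ∀ (n : ℕ) (b : BraidGroup n), (⇑φ)^[n] (β n b : A) = tr n b • 1 := by
  have hmem : ∀ n b, (β n b : A) ∈ orbitAlg ρ (heckeGen e t) (n - 1) := fun n b =>
    h.mem_orbitAlg_of_braidHom (hβ n) b
  have hmem' : ∀ n b, (β n b : A) ∈ orbitAlg ρ (heckeGen e t) n := fun n b =>
    orbitAlg_mono (n.sub_le 1) (hmem n b)
  choose tr htr using fun n b => h.exists_φ_iterate (k := n) _ (hmem' n b)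
  have hincl : ∀ n b, (β (n + 1) (braidInclusion n b) : A) = β n b := by
    intro n b
    induction b using braidGroup_induction with
    | hgen k =>
      have h1 : braidInclusion n (braidGen n k) =
        braidGen (n + 1) (Fin.castLE (by omega) k) := PresentedGroup.toGroup.of _
      rw [h1, hβ, hβ]; rfl
    | hone => simp only [map_one, OneMemClass.coe_one]
    | hmul a b ha hb => simp only [map_mul, Submonoid.coe_mul, ha, hb]
    | hinv a ha => simp only [map_inv]; exact congrArg star ha
  refine ⟨tr, ⟨fun n => ?_, fun n a b => ?_, fun n f => ?_, fun n b => ?_, fun n b => ?_⟩, htr⟩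
  · refine h.smul_one_injective ?_
    rw [← htr, map_one, one_smul]
    exact h.φ_iterate_one n
  · refine h.smul_one_injective ?_
    rw [← htr, ← htr, map_mul, map_mul]
    exact h.φ_iterate_mul_comm _ (hmem' n a) _ (hmem' n b)
  · let X : A := f.sum fun a x => x • (β n a : A)
    refine h.coeff_of_isPositive ?_
    -- The form is `φ^n(X⋆ X)` for `X = ∑ f(a) β(a)`.
    have h1 : (f.sum fun a x => f.sum fun b y => conj x * y * tr n (a⁻¹ * b)) • (1 : A) =
        (⇑φ)^[n] (star X * X) := by
      have hφ : ∀ x, (φ ^ n) x = (⇑φ)^[n] x := fun x => by rw [Module.End.pow_apply]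
      rw [← hφ]
      simp only [X, Finsupp.sum, star_sum, Finset.sum_mul, Finset.mul_sum, map_sum, star_smul,
        smul_mul_smul_comm, map_smul, Finset.sum_smul]
      rw [Finset.sum_comm]
      refine Finset.sum_congr rfl fun b _ => Finset.sum_congr rfl fun a _ => ?_
      rw [mul_smul, ← htr, map_mul, map_inv, hφ]
      rfl
    rw [h1]
    exact h.φ_iterate_pos n (ContinuousLinearMap.isPositive_adjoint_comp_self (X : H →L[ℂ] H))
  · refine h.smul_one_injective ?_
    rw [← htr, ← htr, hincl]
    obtain ⟨a, ha⟩ := h.exists_φ_iterate _ (hmem' n b)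
    rw [Function.iterate_succ_apply', ha, map_smul, h.φ_one]
  · refine h.smul_one_injective ?_
    rw [← htr, map_mul, Submonoid.coe_mul, hincl, hβ, mul_smul, ← htr]
    -- `B_{n+1}` has only `n` generators, so `φ^n` is already scalar on its image.
    obtain ⟨a, ha⟩ := h.exists_φ_iterate (k := n) _ (hmem (n + 1) b)
    exact h.φ_iterate_markov c ha

end HeckeEndo

end Assembly

end LQP

end

/-! ### The labelling of the eigenvalues and the main theorem. -/

noncomputable section

open scoped ComplexConjugate

namespace LQP

section Theorem

variable {s : ℕ} {H : Type*} [NormedAddCommGroup H] [InnerProductSpace ℂ H] [CompleteSpace H]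
  {N : HaagKastlerNet s H} {ρ : N.quasilocal →⋆ₐ[ℂ] N.quasilocal}
  {φ : N.quasilocal →ₗ[ℂ] N.quasilocal} {ε : N.quasilocal}

namespace HaagKastlerNet

lemma meetProjection_eq_zero {E : N.quasilocal} {m : ℕ} (hE : E * E = E)
    (h : ∀ ψ : H, (∀ i < m - 1, (((⇑ρ)^[i] E : N.quasilocal) : H →L[ℂ] H) ψ = ψ) → ψ = 0) :
    meetProjection ρ E m = 0 := by
  have h1 : (⨅ k : Fin (m - 1), LinearMap.range
      (((⇑ρ)^[(k : ℕ)] E : H →L[ℂ] H) : H →ₗ[ℂ] H)) = ⊥ := by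
    refine (Submodule.eq_bot_iff _).2 fun ψ hψ => h ψ fun i hi => ?_
    obtain ⟨v, rfl⟩ := (Submodule.mem_iInf _).1 hψ ⟨i, hi⟩
    have h2 : (⇑ρ)^[i] E * (⇑ρ)^[i] E = (⇑ρ)^[i] E := by rw [← iterate_map_mul, hE]
    exact congrArg (fun T : N.quasilocal => (T : H →L[ℂ] H) v) h2
  have h2 : (⨅ k : Fin (m - 1), LinearMap.range
      (((⇑ρ)^[(k : ℕ)] E : H →L[ℂ] H) : H →ₗ[ℂ] H)).topologicalClosure = ⊥ := by
    rw [h1]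
    have h2 : IsClosed ((⊥ : Submodule ℂ H) : Set H) := isClosed_singleton
    exact h2.submodule_topologicalClosure_eq
  ext ψ
  have h3 : meetProjection ρ E m ψ ∈ (⨅ k : Fin (m - 1), LinearMap.range
      (((⇑ρ)^[(k : ℕ)] E : H →L[ℂ] H) : H →ₗ[ℂ] H)).topologicalClosure :=
    Submodule.starProjection_apply_mem _ ψ
  rw [h2, Submodule.mem_bot] at h3
  exact h3

lemma hasEigenvalue_of_mul_eq_zero {l₁ l₂ : ℂ} (h : (ε - l₁ • 1) * (ε - l₂ • 1) = 0)
    (hε : ε ≠ l₂ • 1) : Module.End.HasEigenvalue (((ε : H →L[ℂ] H) : H →ₗ[ℂ] H)) l₁ := by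
  have h1 : ((ε - l₂ • 1 : N.quasilocal) : H →L[ℂ] H) ≠ 0 := fun h0 =>
    hε (sub_eq_zero.1 (Subtype.ext h0))
  obtain ⟨v, hv⟩ : ∃ v, ((ε - l₂ • 1 : N.quasilocal) : H →L[ℂ] H) v ≠ 0 := by
    by_contra! h2
    exact h1 (ContinuousLinearMap.ext h2)
  refine Module.End.hasEigenvalue_of_hasEigenvector (x := ((ε - l₂ • 1 : N.quasilocal) :
    H →L[ℂ] H) v) ⟨Module.End.mem_eigenspace_iff.2 (sub_eq_zero.1 ?_), hv⟩
  exact congrArg (fun T : N.quasilocal => (T : H →L[ℂ] H) v) h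

lemma eq_or_eq_of_hasEigenvalue {l₁ l₂ z : ℂ} (h : (ε - l₁ • 1) * (ε - l₂ • 1) = 0)
    (hz : Module.End.HasEigenvalue (((ε : H →L[ℂ] H) : H →ₗ[ℂ] H)) z) : z = l₁ ∨ z = l₂ := by
  obtain ⟨v, hv, hv0⟩ := hz.exists_hasEigenvector
  have hv : (ε : H →L[ℂ] H) v = z • v := Module.End.mem_eigenspace_iff.1 hv
  have hl : ∀ l : ℂ, ((ε - l • 1 : N.quasilocal) : H →L[ℂ] H) v = (z - l) • v := fun l => by
    rw [sub_smul, ← hv]; rfl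
  have h1 : (((ε - l₁ • 1) * (ε - l₂ • 1) : N.quasilocal) : H →L[ℂ] H) v =
      ((z - l₂) * (z - l₁)) • v := by
    change ((ε - l₁ • 1 : N.quasilocal) : H →L[ℂ] H)
      (((ε - l₂ • 1 : N.quasilocal) : H →L[ℂ] H) v) = _
    rw [hl, map_smul, hl, smul_smul]
  rw [h] at h1
  rcases mul_eq_zero.1 ((smul_eq_zero.1 h1.symm).resolve_right hv0) with h2 | h2
  · exact Or.inr (sub_eq_zero.1 h2)
  · exact Or.inl (sub_eq_zero.1 h2)

/-- Either labelling of the eigenvalues gives Hecke data, with values of `η` that add up to one. The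
labelling with `η ≤ 1/2` is chosen; for `t = 1` it makes the finite cutoff, if there is one, belong
to the projection for `l₂`. -/
theorem exists_heckeEndo_hasParameters (hρ : IsLocalizedEndomorphism ρ)
    (hirr : IsIrreducibleEndomorphism ρ) (htwo : HasTwoIrreducibleComponents (ρ.comp ρ))
    (hφ : IsLeftInverse ρ φ) (hε : IsStatisticsOperator ρ ε) :
    ∃ (l₁ l₂ : ℂ) (η : ℝ) (q d : ℕ∞) (δ : ℝ), l₁ ≠ l₂ ∧ (ε - l₁ • 1) * (ε - l₂ • 1) = 0 ∧
      (ε - l₂ • 1) * (ε - l₁ • 1) = 0 ∧ ‖l₂‖ = 1 ∧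
      ε = (-l₂) • heckeGen (eigenprojection ε l₂ l₁) (-(l₁ / l₂)) ∧
      HeckeEndo N.quasilocal ρ φ (eigenprojection ε l₂ l₁) (-(l₁ / l₂)) η ∧
      HeckeEndo.HasParameters ρ (eigenprojection ε l₂ l₁) (-(l₁ / l₂)) η q d δ := by
  obtain ⟨l₁, l₂, hl, h⟩ := exists_eigenvalues hρ hirr htwo hφ hε
  have h' : (ε - l₂ • 1) * (ε - l₁ • 1) = 0 := by
    rw [← h]; simp only [sub_mul, mul_sub, smul_mul_assoc, mul_smul_comm, one_mul, mul_one]; module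
  obtain ⟨-, n₂, hg, η, hη⟩ := heckeEndo_of_eigenvalues hρ hirr htwo hφ hε hl h
  obtain ⟨-, n₁, hg', η', hη'⟩ := heckeEndo_of_eigenvalues hρ hirr htwo hφ hε hl.symm h'
  have hadd : η + η' = 1 := by
    have h1 := hη'.φ_e
    rw [eigenprojection_add hl, map_sub, hη.φ_one, hη.φ_e] at h1
    have h2 : (1 - η : ℂ) = η' := hη.smul_one_injective (by rw [sub_smul, one_smul]; exact h1)
    have h3 : 1 - η = η' := by exact_mod_cast h2
    linarith
  by_cases hle : η ≤ 1 / 2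
  · obtain ⟨q, d, δ, hp⟩ := hη.exists_parameters fun _ => hle
    exact ⟨l₁, l₂, η, q, d, δ, hl, h, h', n₂, hg, hη, hp⟩
  · obtain ⟨q, d, δ, hp⟩ := hη'.exists_parameters fun _ => by linarith
    exact ⟨l₂, l₁, η', q, d, δ, hl.symm, h', h, n₁, hg', hη', hp⟩

end HaagKastlerNet

end Theorem

end LQP

end

open LQP HaagKastlerNet in
theorem mainTheorem1 {s : ℕ} {H : Type*} [NormedAddCommGroup H] [InnerProductSpace ℂ H]
    [CompleteSpace H] [TopologicalSpace.SeparableSpace H] (N : HaagKastlerNet s H)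
    (ρ : N.quasilocal →⋆ₐ[ℂ] N.quasilocal)
    (hloc : IsLocalizedEndomorphism ρ) (hirr : IsIrreducibleEndomorphism ρ)
    (htwo : HasTwoIrreducibleComponents (ρ.comp ρ))
    (φ : N.quasilocal →ₗ[ℂ] N.quasilocal) (hφ : IsLeftInverse ρ φ)
    (ε : N.quasilocal) (hε : IsStatisticsOperator ρ ε) :
    ∃ (l₁ l₂ : ℂ) (q d : ℕ∞) (δ : ℝ) (lam : ℂ)
      (β : ∀ n : ℕ, BraidGroup n →* unitary N.quasilocal) (tr : ∀ n : ℕ, BraidGroup n → ℂ),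
      -- the range of the parameters
      (4 ≤ q ∧ 2 ≤ d ∧ d + 2 ≤ q ∧ (δ = 1 ∨ δ = -1)) ∧
      -- the statistics operator has exactly two eigenvalues, with the given ratio
      (l₁ ≠ l₂ ∧ (ε - l₁ • 1) * (ε - l₂ • 1) = 0 ∧
        (∀ z : ℂ, Module.End.HasEigenvalue (((ε : H →L[ℂ] H) : H →ₗ[ℂ] H)) z ↔
          z = l₁ ∨ z = l₂) ∧
        l₁ / l₂ = -Complex.exp (δ * (2 * channelAngle q) * Complex.I)) ∧
      -- the statistics parameter and its modulus
      (φ ε = lam • 1 ∧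
        (q ≠ ⊤ → ‖lam‖ = Real.sin (channelAngle q) / Real.sin (d.toNat * channelAngle q)) ∧
        (q = ⊤ → d ≠ ⊤ → ‖lam‖ = 1 / (d.toNat : ℝ)) ∧
        (q = ⊤ → d = ⊤ → lam = 0)) ∧
      -- the braid group representations generated by `ρ^(k-1)(ε)`
      (∀ (n : ℕ) (k : Fin (n - 1)),
        (β n (braidGen n k) : N.quasilocal) = (⇑ρ)^[(k : ℕ)] ε) ∧
      (∀ n : ℕ, ∃ (χ : BraidGroup n →* Circle)
        (π : BraidGroup n →* Matrix.unitaryGroup (Tableau q d n) ℂ),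
        (∀ k : Fin (n - 1), (χ (braidGen n k) : ℂ) = -l₂) ∧
        IsOcneanuWenzl q d (-(l₁ / l₂)) n π ∧
        IsInfiniteMultiple (fun b => ((β n b : N.quasilocal) : H →L[ℂ] H)) χ π) ∧
      -- the cutoffs
      (∀ m : ℕ, d < (m : ℕ∞) → meetProjection ρ (eigenprojection ε l₂ l₁) m = 0) ∧
      (∀ m : ℕ, q < (m : ℕ∞) + d → meetProjection ρ (eigenprojection ε l₁ l₂) m = 0) ∧
      -- the Markov trace
      (IsMarkovTrace lam tr ∧
        ∀ (n : ℕ) (b : BraidGroup n), (⇑φ)^[n] (β n b : N.quasilocal) = tr n b • 1) := by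
  obtain ⟨l₁, l₂, η, q, d, δ, hl, h, h', n₂, hg, hη, hp⟩ :=
    exists_heckeEndo_hasParameters hloc hirr htwo hφ hε
  have hc : ‖-l₂‖ = 1 := by rw [norm_neg, n₂]
  have hg' : (-l₂) • heckeGen (eigenprojection ε l₂ l₁) (-(l₁ / l₂)) = ε := hg.symm
  choose β hβ using fun n => hη.exists_braidHom (ρ := ρ) hc n
  obtain ⟨tr, htr, hφtr⟩ := hη.exists_markovTrace β hβ
  have hne : ∀ c : ℂ, ε ≠ c • 1 := fun c => ne_smul_one hloc hirr htwo hφ hε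
  have hlam : ‖-l₂ * (-(l₁ / l₂) - (1 + -(l₁ / l₂)) * η)‖ =
      ‖-(l₁ / l₂) - (1 + -(l₁ / l₂)) * η‖ := by rw [norm_mul, hc, one_mul]
  refine ⟨l₁, l₂, q, d, δ, -l₂ * (-(l₁ / l₂) - (1 + -(l₁ / l₂)) * η), β, tr,
    ⟨hp.four_le, hp.two_le, hp.add_two_le, hp.sign⟩, ⟨hl, h, fun z => ⟨?_, ?_⟩, ?_⟩,
    ⟨?_, fun hq => ?_, fun hq hd => ?_, fun _ hd => ?_⟩, fun n k => ?_, fun n => ?_,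
    fun m hm => ?_, fun m hm => ?_, htr, hφtr⟩
  · exact eq_or_eq_of_hasEigenvalue h
  · rintro (rfl | rfl)
    · exact hasEigenvalue_of_mul_eq_zero h (hne _)
    · exact hasEigenvalue_of_mul_eq_zero h' (hne _)
  · rw [← hp.t_eq, neg_neg]
  · rw [← smul_smul, ← hη.φ_heckeGen, ← map_smul, hg']
  · rw [hlam, hp.norm_ν hq]
  · rw [hlam, hp.ν_eq hq hd, norm_div, norm_one, Complex.norm_natCast]
  · rw [hp.ν_top hd, mul_zero]
  · rw [hβ, hg']
  · exact hη.exists_isInfiniteMultiple hp hc (hβ n)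
  -- `E^(m)` is a meet of `m - 1` projections, so the bound `d < m` is used as `d ≤ m - 1`.
  · refine meetProjection_eq_zero hη.idem fun ψ hψ => hp.cutoff (m - 1) ψ ?_ hψ
    obtain ⟨k, hk⟩ := ENat.ne_top_iff_exists.1 (ne_top_of_lt hm)
    rw [← hk] at hm ⊢
    norm_cast at hm ⊢
    omega
  -- `m = 0` would give `q < d`; excluding it makes the truncated difference `m - 1` a true one.
  · have hm0 : 1 ≤ m := by
      by_contra! h0
      obtain rfl : m = 0 := by omega
      rw [Nat.cast_zero, zero_add] at hm
      exact absurd (hm.trans_le (le_self_add.trans hp.add_two_le)) (lt_irrefl _)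
    rw [eigenprojection_add hl]
    refine meetProjection_eq_zero hη.swap.idem fun ψ hψ => hp.cutoff' (m - 1) ψ ?_ fun i hi => ?_
    · rwa [Nat.sub_add_cancel hm0]
    · have h1 := HeckeEndo.iterate_one_sub_apply i ψ (hψ i hi)
      rwa [sub_sub_cancel] at h1
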